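/- Let $\omega\subset\mathbb{R}^2$ be a rectilinearly-convex obstacle: a closed and bounded region, bounded by a simple closed polygon all of whose edges are horizontal or vertical and no three of whose vertices are collinear, such that any two points of $\omega$ are joined by a shortest rectilinear path lying in $\omega$ (a rectilinear path consists of horizontal and vertical segments). The bounding box of a set is the smallest closed axis-parallel rectangle containing it; write $B(S)$ for the bounding box of $\bigcup S$. The extreme edges of $\omega$ are its four boundary edges lying on the sides of its bounding box. A skeleton for a region $R$ is a finite set $S$ of closed line segments contained in $R$ such that for all points $p,q$ outside the interior of $R$: if every shortest rectilinear path from $p$ to $q$ with at most one corner meets the interior of $R$, then each such path meets an element of $S$. A skeleton $S$ is connected if any two points of $\bigcup S$ are joined by a path in $\bigcup S$; a minimum connected skeleton is a connected skeleton with the smallest possible number of segments. A visibility edge is a line segment inside $\omega$ that cannot be extended to a longer line segment inside $\omega$. The horizontal (vertical) advancement of $s$ relative to a set $S$ of segments is the length of the part of the horizontal (vertical) projection of $s$ not covered by that of $\bigcup S$. Its advancement towards one of the directions left, right, down, up, relative to $S\neq\emptyset$, is the distance by which $s$ reaches beyond $\bigcup S$ in that direction, or $0$ if it does not. "Towards"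 an extreme edge $e$, seen from a set $A$, means in a direction for which some point of $e$ lies at or beyond some point of $A$ (so both directions are allowed if the projections of $A$ and $e$ overlap). Let $G$ be the set of all visibility edges of the following kinds. (1) Opposite extreme visibility edges, with endpoints on two parallel extreme edges; and maximum length adjacent extreme visibility edges, with endpoints on two orthogonal extreme edges and of maximum Euclidean length among the visibility edges joining these two extreme edges. (2) Maximal extreme visibility edges: for a horizontal extreme edge $e$, those which, among the visibility edges with an endpoint on $e$, have maximum vertical advancement relative to $\emptyset$ and, subject to this, reach as far as possible horizontally towards the other horizontal extreme edge (as seen from $e$); for a vertical extreme edge, the same with horizontal and vertical exchanged. (3) Non-auxiliary maximal frontier visibility edges. Let $S$ be a finite set of line segments that is a skeleton for $\omega\cap B(S)$. A frontier $f$ of $S$ is the closure of a connected component of $\partial B(S)\cap\operatorname{int}\omega$. Suppose $f$ is a line segment on a vertical side of $B(S)$, and let $e$ be the extreme edge of $\omega$ on the same (left or right) side. A maximal frontier visibility edge for $f$ is one which, among the visibility edges meeting $f$, has maximum horizontal advancement relative to $S$ and, subject to this, maximum vertical advancement towards $e$ (as seen from $f$) relative to $S$. For $f$ on a horizontal side,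 exchange horizontal and vertical. For an L-shaped $f$ (a horizontal and a vertical segment with a common endpoint), it is an edge satisfying one of these two conditions, for the side containing the corresponding leg of $f$. It is auxiliary if one of its endpoints lies on $f$. The set $G$ contains those maximal frontier visibility edges that, for some such $S$ and $f$, are not auxiliary. Then there exists a minimum connected skeleton $S^*$ for $\omega$ with $S^*\subseteq G$. -/

import Mathlib

namespace RectSkeleton

/-- The plane, in Cartesian coordinates. -/
abbrev Plane : Type := ℝ × ℝ

/-! ### Rectilinear paths -/

/-- The points `p` and `q` lie on a common horizontal or vertical line. -/
def AxisParallel (p q : Plane) : Prop := p.1 = q.1 ∨ p.2 = q.2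

/-- `l` lists the successive points of a rectilinear path from `p` to `q`: each point is joined
to the next one by a (possibly trivial) horizontal or vertical line segment. -/
def IsRectilinearPath (l : List Plane) (p q : Plane) : Prop :=
  l.head? = some p ∧ l.getLast? = some q ∧ l.IsChain AxisParallel

/-- The rectilinear length of a path. -/
def pathLength : List Plane → ℝ
  | [] => 0
  | [_] => 0
  | p :: q :: l => |p.1 - q.1| + |p.2 - q.2| + pathLength (q :: l)

/-- The set of points on a path. -/
def pathTrace : List Plane → Set Plane
  | [] => ∅
  | [p] => {p}
  | p :: q :: l => segment ℝ p q ∪ pathTrace (q :: l)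

/-- A rectilinear path from `p` to `q` of least possible length. -/
def IsShortestPath (l : List Plane) (p q : Plane) : Prop :=
  IsRectilinearPath l p q ∧ ∀ l', IsRectilinearPath l' p q → pathLength l ≤ pathLength l'

/-- The traces of the shortest rectilinear paths from `p` to `q` with at most one corner point. -/
def oneCornerPaths (p q : Plane) : Set (Set Plane) :=
  {π | ∃ c : Plane, IsShortestPath [p, c, q] p q ∧ π = pathTrace [p, c, q]}

/-! ### Directions -/

/-- The four axis directions. -/
inductive Dir
  | left
  | right
  | down
  | up

/-- The coordinate of a point measured in direction `d` (so larger means further in direction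
`d`). -/
def Dir.coord : Dir → Plane → ℝ
  | .left, p => -p.1
  | .right, p => p.1
  | .down, p => -p.2
  | .up, p => p.2

/-- The opposite direction. -/
def Dir.opp : Dir → Dir
  | .left => .right
  | .right => .left
  | .down => .up
  | .up => .down

/-- The directions `d` and `d'` are perpendicular. -/
def Dir.Perp : Dir → Dir → Prop
  | .left, d' => d' = .down ∨ d' = .up
  | .right, d' => d' = .down ∨ d' = .up
  | .down, d' => d' = .left ∨ d' = .right
  | .up, d' => d' = .left ∨ d' = .right

/-- How far the set `A` reaches in direction `d`. -/
noncomputable def reach (d : Dir) (A : Set Plane) : ℝ := sSup (d.coord '' A)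

/-- Seen from `A`, the set `E` lies in direction `d`.  If the projections of `A` and `E` in this
direction are disjoint, this holds for exactly one of `d` and `d.opp`; if they overlap, it holds
for both. -/
def LiesToward (d : Dir) (A E : Set Plane) : Prop :=
  ∃ p ∈ A, ∃ q ∈ E, d.coord p ≤ d.coord q

/-! ### Line segments and bounding boxes -/

/-- A closed (nondegenerate) line segment. -/
def IsLineSegment (s : Set Plane) : Prop := ∃ a b : Plane, a ≠ b ∧ s = segment ℝ a b

/-- `p` is an endpoint of the line segment `s`. -/
def IsEndpoint (p : Plane) (s : Set Plane) : Prop := ∃ q : Plane, s = segment ℝ p q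

/-- The bounding box of a set of line segments: the smallest closed axis-oriented rectangle that
contains all of them. -/
def boundingBox (S : Set (Set Plane)) : Set Plane :=
  ⋂₀ {R | ∃ a b : Plane, R = Set.Icc a b ∧ ⋃₀ S ⊆ R}

/-! ### Skeletons -/

/-- `S` is a skeleton for the region `ω`. -/
structure IsSkeleton (ω : Set Plane) (S : Set (Set Plane)) : Prop where
  finite : S.Finite
  isLineSegment : ∀ s ∈ S, IsLineSegment s
  inside : ∀ s ∈ S, s ⊆ ω
  blocks : ∀ p q : Plane, p ∉ interior ω → q ∉ interior ω →
    (∀ π ∈ oneCornerPaths p q, (π ∩ interior ω).Nonempty) →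
      ∀ π ∈ oneCornerPaths p q, ∃ s ∈ S, (π ∩ s).Nonempty

/-- A skeleton such that any two of its points are joined by a path in it. -/
def IsConnectedSkeleton (ω : Set Plane) (S : Set (Set Plane)) : Prop :=
  IsSkeleton ω S ∧ IsPathConnected (⋃₀ S)

/-- A connected skeleton with the smallest possible number of line segments. -/
def IsMinimumConnectedSkeleton (ω : Set Plane) (S : Set (Set Plane)) : Prop :=
  IsConnectedSkeleton ω S ∧ ∀ T, IsConnectedSkeleton ω T → S.ncard ≤ T.ncard

/-! ### Rectilinearly-convex obstacles -/

/-- A rectilinearly-convex obstacle: a closed and bounded region `region` whose boundary is a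
simple closed polygon with cyclically ordered vertices `vertex i`, no three of them collinear,
whose edges are all horizontal or vertical, and such that any two points of the region are joined
by a shortest rectilinear path inside the region. -/
structure Obstacle where
  n : ℕ
  three_le : 3 ≤ n
  vertex : ZMod n → Plane
  region : Set Plane
  isCompact : IsCompact region
  closure_interior : closure (interior region) = region
  frontier_eq : frontier region = ⋃ i, segment ℝ (vertex i) (vertex (i + 1))
  /-- Consecutive edges meet only in their common vertex. -/
  adjacent_edges : ∀ i, segment ℝ (vertex i) (vertex (i + 1)) ∩
    segment ℝ (vertex (i + 1)) (vertex (i + 1 + 1)) = {vertex (i + 1)}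
  /-- Edges that are not consecutive do not meet. -/
  nonadjacent_edges : ∀ i j, i ≠ j → i + 1 ≠ j → j + 1 ≠ i →
    Disjoint (segment ℝ (vertex i) (vertex (i + 1))) (segment ℝ (vertex j) (vertex (j + 1)))
  general_position : ∀ i j k, i ≠ j → j ≠ k → i ≠ k →
    ¬ Collinear ℝ {vertex i, vertex j, vertex k}
  rectilinear : ∀ i, AxisParallel (vertex i) (vertex (i + 1))
  convex : ∀ p ∈ region, ∀ q ∈ region, ∃ l, IsShortestPath l p q ∧ pathTrace l ⊆ region

namespace Obstacle

variable (Ω : Obstacle)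

/-- The `i`-th edge of the boundary. -/
def edge (i : ZMod Ω.n) : Set Plane := segment ℝ (Ω.vertex i) (Ω.vertex (i + 1))

/-- `e` is the extreme edge in direction `d`: the boundary edge that lies on the side in
direction `d` of the bounding box of the obstacle. -/
def IsExtremeEdge (d : Dir) (e : Set Plane) : Prop :=
  (∃ i, e = Ω.edge i) ∧ ∀ p ∈ e, d.coord p = reach d Ω.region

/-! ### Visibility edges -/

/-- A (maximum length) visibility edge: a line segment inside the obstacle that cannot be extended
to a longer line segment inside the obstacle. -/
def IsVisibilityEdge (s : Set Plane) : Prop :=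
  IsLineSegment s ∧ s ⊆ Ω.region ∧ ∀ t, IsLineSegment t → t ⊆ Ω.region → s ⊆ t → t = s

/-- A visibility edge with an endpoint on `e`. -/
def IsExtremeVisibilityEdge (e s : Set Plane) : Prop :=
  Ω.IsVisibilityEdge s ∧ ∃ p ∈ e, IsEndpoint p s

/-- A visibility edge with one endpoint on `e` and the other one on `e'`. -/
def IsVisibilityEdgeBetween (e e' s : Set Plane) : Prop :=
  Ω.IsVisibilityEdge s ∧ ∃ p ∈ e, ∃ q ∈ e', s = segment ℝ p q

/-- An opposite extreme visibility edge: its endpoints lie on parallel extreme edges.  (The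
diagonals, which join opposite extreme corners, are of this kind.) -/
def IsOppositeExtremeVisibilityEdge (s : Set Plane) : Prop :=
  ∃ (d : Dir) (e e' : Set Plane), Ω.IsExtremeEdge d e ∧ Ω.IsExtremeEdge d.opp e' ∧
    Ω.IsVisibilityEdgeBetween e e' s

/-- A maximum length adjacent extreme visibility edge: its endpoints lie on orthogonal extreme
edges, and its Euclidean length is maximal for this pair of extreme edges. -/
def IsMaximumAdjacentExtremeVisibilityEdge (s : Set Plane) : Prop :=
  ∃ (d d' : Dir) (e e' : Set Plane), d.Perp d' ∧ Ω.IsExtremeEdge d e ∧ Ω.IsExtremeEdge d' e' ∧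
    Ω.IsVisibilityEdge s ∧ ∃ p ∈ e, ∃ q ∈ e', s = segment ℝ p q ∧
      ∀ p' ∈ e, ∀ q' ∈ e', Ω.IsVisibilityEdge (segment ℝ p' q') →
        (p'.1 - q'.1) ^ 2 + (p'.2 - q'.2) ^ 2 ≤ (p.1 - q.1) ^ 2 + (p.2 - q.2) ^ 2

end Obstacle

/-! ### Advancement -/

/-- The advancement of `s` along the axis of `d` relative to `S`: the length of the part of the
projection of `s` that is not covered by the projection of `S`. -/
noncomputable def advancement (S : Set (Set Plane)) (d : Dir) (s : Set Plane) : ℝ :=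
  (MeasureTheory.volume (d.coord '' s \ d.coord '' ⋃₀ S)).toReal

/-- The advancement of `s` towards direction `d` relative to `S`: how far `s` reaches beyond `S`
in direction `d`. -/
noncomputable def advancementToward (S : Set (Set Plane)) (d : Dir) (s : Set Plane) : ℝ :=
  max 0 (reach d s - reach d (⋃₀ S))

/-- Among all sets with property `P`, the set `s` maximises `u` and, subject to this, `v`. -/
def IsLexMax (P : Set Plane → Prop) (u v : Set Plane → ℝ) (s : Set Plane) : Prop :=
  P s ∧ ∀ t, P t → u t ≤ u s ∧ (u t = u s → v t ≤ v s)

namespace Obstacle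

variable (Ω : Obstacle)

/-- A maximal extreme visibility edge.  For a horizontal extreme edge `e` it maximises its
vertical advancement and, subject to this, its horizontal advancement towards the other
horizontal extreme edge `e'`; for a vertical extreme edge the roles are exchanged.  Nothing is
covered beforehand, so the advancement is relative to the empty set, and the advancement towards
`e'` is measured by how far the edge reaches in the direction of `e'`. -/
def IsMaximalExtremeVisibilityEdge (s : Set Plane) : Prop :=
  ∃ (d d' : Dir) (e e' : Set Plane), Ω.IsExtremeEdge d e ∧ Ω.IsExtremeEdge d.opp e' ∧
    d.Perp d' ∧ LiesToward d' e e' ∧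
      IsLexMax (Ω.IsExtremeVisibilityEdge e) (advancement ∅ d) (reach d') s

/-! ### Frontiers -/

/-- `f` is a frontier of `S`: `S` is a skeleton for the part of the obstacle in the bounding box
of `S`, and `f` is the closure of a connected component of the intersection of the boundary of
the bounding box with the interior of the obstacle. -/
def IsFrontier (S : Set (Set Plane)) (f : Set Plane) : Prop :=
  IsSkeleton (Ω.region ∩ boundingBox S) S ∧
    ∃ x ∈ frontier (boundingBox S) ∩ interior Ω.region,
      f = closure (connectedComponentIn (frontier (boundingBox S) ∩ interior Ω.region) x)

end Obstacle

/-- `f` is either a single line segment on the side in direction `d` of the bounding box of `S`,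
or an L-shape with corner `a` consisting of such a line segment and of a line segment orthogonal
to it. -/
def HasLeg (S : Set (Set Plane)) (d : Dir) (f : Set Plane) : Prop :=
  ∃ a b : Plane, a ≠ b ∧ d.coord a = reach d (⋃₀ S) ∧ d.coord b = reach d (⋃₀ S) ∧
    (f = segment ℝ a b ∨
      ∃ c : Plane, a ≠ c ∧ (∀ d', d.Perp d' → d'.coord a = d'.coord c) ∧
        f = segment ℝ a b ∪ segment ℝ a c)

namespace Obstacle

variable (Ω : Obstacle)

/-- `s` is a maximal frontier visibility edge for the frontier `f` of `S`.  If `f` is a vertical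
line segment, then `s` meets `f`, maximises its horizontal advancement and, subject to this, its
vertical advancement towards the opposite vertical extreme edge `e`, that is, the one in the
direction in which `f` bounds the bounding box of `S`; if `f` is a horizontal line segment, the
roles are exchanged; if `f` is L-shaped, then one of the two applies. -/
def IsMaximalFrontierVisibilityEdge (S : Set (Set Plane)) (f s : Set Plane) : Prop :=
  Ω.IsFrontier S f ∧ ∃ (d d' : Dir) (e : Set Plane), HasLeg S d f ∧ Ω.IsExtremeEdge d e ∧
    d.Perp d' ∧ LiesToward d' f e ∧
      IsLexMax (fun t => Ω.IsVisibilityEdge t ∧ (t ∩ f).Nonempty)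
        (advancement S d) (advancementToward S d') s

/-- A maximal frontier visibility edge is auxiliary if it has an endpoint on its frontier.  This
is the property of being a maximal frontier visibility edge, for some frontier, that is not
auxiliary. -/
def IsNonAuxiliaryMaximalFrontierVisibilityEdge (s : Set Plane) : Prop :=
  ∃ (S : Set (Set Plane)) (f : Set Plane), Ω.IsMaximalFrontierVisibilityEdge S f s ∧
    ¬ ∃ p ∈ f, IsEndpoint p s

/-- The set of candidate edges that are not auxiliary: the maximal extreme visibility edges
(including opposite extreme visibility edges and maximum length adjacent extreme visibility
edges) and the maximal frontier visibility edges that are not auxiliary. -/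
def candidateSet : Set (Set Plane) :=
  {s | Ω.IsMaximalExtremeVisibilityEdge s ∨ Ω.IsOppositeExtremeVisibilityEdge s ∨
    Ω.IsMaximumAdjacentExtremeVisibilityEdge s ∨
      Ω.IsNonAuxiliaryMaximalFrontierVisibilityEdge s}

end Obstacle

end RectSkeleton

/-!
A finite connected family of segments in the obstacle is a skeleton exactly when its union touches
all four sides of the bounding box (`touches_of_isConnectedSkeleton`,
`isConnectedSkeleton_of_touches`). If it misses a side, a path just inside that side avoids it.
Conversely, a point outside the interior of the obstacle has an open quadrant free of points of the
obstacle (`exists_free`), so a one-corner path between two such points that meets the interior can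
be prolonged through empty quadrants to a curve that separates two parts of the family
(`elbow_inter_of_corner`, `elbow_inter_of_line`, `elbow_inter_nonempty`).

It therefore suffices to replace a connected family that touches all sides by at most as many
candidate edges which are again connected and touch all sides (`exists_subset_frontierEdges`). The
non-auxiliary maximal frontier visibility edges alone are enough
(`frontierEdges_subset_candidateSet`). They are supplied by windows: for a convex closed set `Q`,
take the pieces in `Q` of the boundary edges together with the segments in which the boundary of `Q`
crosses the obstacle. These segments form a skeleton of the part of the obstacle in their bounding
box, the crossing is a frontier, and a visibility edge that reaches furthest beyond the crossing is
a candidate (`isNonAuxiliary_of_window`). Half-planes and quarter-planes serve as windows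
(`isNonAuxiliary_halfPlane`, `isNonAuxiliary_quarterPlane`), and they show in particular that every
visibility edge which touches an extreme side without lying in it is a candidate
(`isNonAuxiliary_of_extreme`).

The replacement is carried out for an abstract `RectRegion` (`exists_built_of_spans`). If two
opposite sides can be joined by a full horizontal or vertical chord, that chord and few others
suffice (`exists_built_of_horizontal`, `exists_built_of_vertical`, `exists_built_four`). Otherwise,
up to symmetry, the obstacle is a corridor from the lower left to the upper right
(`exists_built_corridor`). There a shortest chain of the family is replaced greedily. From a
crosscut of the obstacle, take the line that reaches furthest (`Extremal`). Contacts with the upper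
and the lower boundary lock it (`KLine.exists_lowC_lt_highC`, `KLine.exists_highC_lt_lowC`), so it
lies on a candidate (`Cut.exists_mem`), and its last part, beyond the last contact, is the next
crosscut: no segment that starts at the old crosscut gets in front of the new one
(`Extremal.next_right`, `Extremal.next_up`, `Launch.exists_next`). By induction the candidates need
no more steps than the given chain (`chainClaim`).

Exchanging the coordinates (`RectRegion.swap`) and charts of two perpendicular directions
(`rectRegion`) reduce all orientations to this one.
-/


namespace RectSkeleton
open Set Filter Topology

/-! ### Segments in the plane -/

theorem mem_segment_iff {p q z : Plane} : z ∈ segment ℝ p q ↔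
    ∃ θ : ℝ, 0 ≤ θ ∧ θ ≤ 1 ∧ z.1 = p.1 + θ * (q.1 - p.1) ∧ z.2 = p.2 + θ * (q.2 - p.2) := by
  rw [segment_eq_image']
  constructor
  · rintro ⟨θ, ⟨h0, h1⟩, rfl⟩
    exact ⟨θ, h0, h1, by simp, by simp⟩
  · rintro ⟨θ, h0, h1, h2, h3⟩
    exact ⟨θ, ⟨h0, h1⟩, Prod.ext (by simp [h2]) (by simp [h3])⟩

/-- The point with abscissa `x` on the line of slope `α` and intercept `β`. -/
def pt (α β x : ℝ) : Plane := (x, α * x + β)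

@[simp] theorem pt_fst (α β x : ℝ) : (pt α β x).1 = x := rfl
@[simp] theorem pt_snd (α β x : ℝ) : (pt α β x).2 = α * x + β := rfl

theorem mem_segment_pt {α β x y : ℝ} (h : x ≤ y) {z : Plane} :
    z ∈ segment ℝ (pt α β x) (pt α β y) ↔ x ≤ z.1 ∧ z.1 ≤ y ∧ z.2 = α * z.1 + β := by
  rw [mem_segment_iff]
  simp only [pt_fst, pt_snd]
  constructor
  · rintro ⟨θ, h0, h1, h2, h3⟩
    refine ⟨?_, ?_, ?_⟩
    · nlinarith
    · nlinarith
    · rw [h3, h2]; ring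
  · rintro ⟨h1, h2, h3⟩
    rcases h.eq_or_lt with rfl | h
    · have : z.1 = x := le_antisymm h2 h1
      exact ⟨0, le_rfl, zero_le_one, by simp [this], by simp [h3, this]⟩
    · have hd : 0 < y - x := sub_pos.2 h
      refine ⟨(z.1 - x) / (y - x), div_nonneg (by linarith) hd.le,
        (div_le_one hd).2 (by linarith), ?_, ?_⟩
      · field_simp; ring
      · rw [h3]; field_simp; ring

theorem exists_line {p q : Plane} (h : p.1 ≠ q.1) :
    ∃ α β, p = pt α β p.1 ∧ q = pt α β q.1 := by
  have hd : q.1 - p.1 ≠ 0 := sub_ne_zero.2 h.symm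
  refine ⟨(q.2 - p.2) / (q.1 - p.1), p.2 - (q.2 - p.2) / (q.1 - p.1) * p.1, ?_, ?_⟩
  · exact Prod.ext rfl (by simp)
  · refine Prod.ext rfl ?_
    simp only [pt_snd]
    field_simp
    ring

theorem isCompact_segment (p q : Plane) : IsCompact (segment ℝ p q) := by
  rw [segment_eq_image_lineMap]
  exact isCompact_Icc.image (by fun_prop)

theorem segment_subset_iff {p q : Plane} {A : Set Plane} : segment ℝ p q ⊆ A ↔
    ∀ θ : ℝ, 0 ≤ θ → θ ≤ 1 → (p.1 + θ * (q.1 - p.1), p.2 + θ * (q.2 - p.2)) ∈ A := by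
  constructor
  · intro h θ h0 h1
    exact h (mem_segment_iff.2 ⟨θ, h0, h1, rfl, rfl⟩)
  · intro h z hz
    obtain ⟨θ, h0, h1, h2, h3⟩ := mem_segment_iff.1 hz
    have := h θ h0 h1
    rwa [← h2, ← h3] at this

theorem isClosed_segment_subset {A : Set Plane} (hA : IsClosed A) :
    IsClosed {pq : Plane × Plane | segment ℝ pq.1 pq.2 ⊆ A} := by
  simp only [segment_subset_iff, Set.ofPred_forall]
  refine isClosed_iInter fun θ => isClosed_iInter fun _ => isClosed_iInter fun _ => ?_
  exact hA.preimage (by fun_prop)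

theorem isClosed_mem_segment (a : Plane) :
    IsClosed {pq : Plane × Plane | a ∈ segment ℝ pq.1 pq.2} := by
  have : {pq : Plane × Plane | a ∈ segment ℝ pq.1 pq.2} = Prod.snd '' {x : (Icc (0:ℝ) 1) ×
      (Plane × Plane) | a.1 = x.2.1.1 + x.1 * (x.2.2.1 - x.2.1.1) ∧
        a.2 = x.2.1.2 + x.1 * (x.2.2.2 - x.2.1.2)} := by
    ext pq
    simp only [mem_ofPred_eq, mem_segment_iff, mem_image, Prod.exists, exists_eq_right]
    constructor
    · rintro ⟨θ, h0, h1, h2, h3⟩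
      exact ⟨⟨θ, h0, h1⟩, h2, h3⟩
    · rintro ⟨⟨θ, h0, h1⟩, h2, h3⟩
      exact ⟨θ, h0, h1, h2, h3⟩
  rw [this]
  apply isClosedMap_snd_of_compactSpace
  exact (isClosed_eq (by fun_prop) (by fun_prop)).inter (isClosed_eq (by fun_prop) (by fun_prop))

theorem segment_subset_segment {p q a b : Plane} (ha : a ∈ segment ℝ p q)
    (hb : b ∈ segment ℝ p q) : segment ℝ a b ⊆ segment ℝ p q :=
  (convex_segment p q).segment_subset ha hb

/-! ### Maximal segments -/

/-- A segment in `ω` that is not contained in a longer one. -/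
def MaxSeg (ω s : Set Plane) : Prop :=
  IsLineSegment s ∧ s ⊆ ω ∧ ∀ t, IsLineSegment t → t ⊆ ω → s ⊆ t → t = s

theorem exists_maxSeg {ω : Set Plane} (hω : IsCompact ω) {a b : Plane} (hab : a ≠ b)
    (h : segment ℝ a b ⊆ ω) : ∃ s, MaxSeg ω s ∧ segment ℝ a b ⊆ s := by
  let K : Set (Plane × Plane) := (ω ×ˢ ω) ∩ ({pq | segment ℝ pq.1 pq.2 ⊆ ω} ∩
    ({pq | a ∈ segment ℝ pq.1 pq.2} ∩ {pq | b ∈ segment ℝ pq.1 pq.2}))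
  have hK : IsCompact K := (hω.prod hω).inter_right ((isClosed_segment_subset hω.isClosed).inter
    ((isClosed_mem_segment a).inter (isClosed_mem_segment b)))
  obtain ⟨⟨p, q⟩, ⟨⟨hp, hq⟩, hpq, ha, hb⟩, hmax⟩ := hK.exists_isMaxOn
    ⟨(a, b), ⟨⟨h (left_mem_segment ℝ a b), h (right_mem_segment ℝ a b)⟩, h,
      left_mem_segment ℝ a b, right_mem_segment ℝ a b⟩⟩
    (f := fun pq => dist pq.1 pq.2) (by fun_prop)
  simp only [mem_ofPred_eq] at hpq ha hb
  have hne : p ≠ q := by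
    rintro rfl
    rw [segment_same, mem_singleton_iff] at ha hb
    exact hab (ha.trans hb.symm)
  refine ⟨segment ℝ p q, ⟨⟨p, q, hne, rfl⟩, hpq, ?_⟩, segment_subset_segment ha hb⟩
  rintro t ⟨c, d, hcd, rfl⟩ ht hs
  have hle : dist c d ≤ dist p q := hmax (a := (c, d))
    ⟨⟨ht (left_mem_segment ℝ c d), ht (right_mem_segment ℝ c d)⟩, ht, hs ha, hs hb⟩
  have hp' := hs (left_mem_segment ℝ p q)
  have hq' := hs (right_mem_segment ℝ p q)
  rw [segment_eq_image_lineMap] at hp' hq'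
  obtain ⟨θ, ⟨h0, h1⟩, rfl⟩ := hp'
  obtain ⟨η, ⟨k0, k1⟩, rfl⟩ := hq'
  rw [dist_lineMap_lineMap] at hle
  have hd : 0 < dist c d := dist_pos.2 hcd
  have h2 : 1 ≤ dist θ η := by
    by_contra h2
    push Not at h2
    nlinarith
  rw [Real.dist_eq] at h2
  rcases le_abs.1 h2 with h2 | h2
  · have e1 : θ = 1 := by linarith
    have e2 : η = 0 := by linarith
    subst e1 e2
    simp [segment_symm]
  · have e1 : θ = 0 := by linarith
    have e2 : η = 1 := by linarith
    subst e1 e2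
    simp

theorem IsLineSegment.isCompact {s : Set Plane} (h : IsLineSegment s) : IsCompact s := by
  obtain ⟨p, q, -, rfl⟩ := h
  exact isCompact_segment p q

theorem IsLineSegment.isPathConnected {s : Set Plane} (h : IsLineSegment s) :
    IsPathConnected s := by
  obtain ⟨p, q, -, rfl⟩ := h
  exact (convex_segment p q).isPathConnected ⟨p, left_mem_segment ℝ p q⟩

theorem IsLineSegment.convex {s : Set Plane} (h : IsLineSegment s) : Convex ℝ s := by
  obtain ⟨p, q, -, rfl⟩ := h
  exact convex_segment p q

theorem IsLineSegment.nonempty {s : Set Plane} (h : IsLineSegment s) : s.Nonempty := by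
  obtain ⟨p, q, -, rfl⟩ := h
  exact ⟨p, left_mem_segment ℝ p q⟩

theorem IsLineSegment.exists_ne {s : Set Plane} (h : IsLineSegment s) (z : Plane) :
    ∃ y ∈ s, y ≠ z := by
  obtain ⟨p, q, hpq, rfl⟩ := h
  by_cases hp : p = z
  · exact ⟨q, right_mem_segment ℝ p q, fun h => hpq (hp.trans h.symm)⟩
  · exact ⟨p, left_mem_segment ℝ p q, hp⟩

theorem exists_maxSeg_of_isLineSegment {ω : Set Plane} (hω : IsCompact ω) {t : Set Plane}
    (ht : IsLineSegment t) (h : t ⊆ ω) : ∃ s, MaxSeg ω s ∧ t ⊆ s := by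
  obtain ⟨a, b, hab, rfl⟩ := ht
  exact exists_maxSeg hω hab h

/-! ### The coordinate swap -/

/-- The reflection of a set in the diagonal. -/
def swapSet (A : Set Plane) : Set Plane := Prod.swap ⁻¹' A

@[simp] theorem mem_swapSet {A : Set Plane} {z : Plane} : z ∈ swapSet A ↔ z.swap ∈ A := Iff.rfl

@[simp] theorem swapSet_swapSet (A : Set Plane) : swapSet (swapSet A) = A := rfl

theorem swapSet_subset {A B : Set Plane} : swapSet A ⊆ swapSet B ↔ A ⊆ B :=
  ⟨fun h z hz => h (a := z.swap) (by simpa using hz), fun h _ hz => h hz⟩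

theorem swapSet_injective : Function.Injective swapSet := fun A B h => by
  have := congrArg swapSet h
  simpa using this

theorem swapSet_segment (p q : Plane) :
    swapSet (segment ℝ p q) = segment ℝ p.swap q.swap := by
  ext z
  rw [mem_swapSet, mem_segment_iff, mem_segment_iff]
  simp only [Prod.fst_swap, Prod.snd_swap]
  exact ⟨fun ⟨θ, h0, h1, h2, h3⟩ => ⟨θ, h0, h1, h3, h2⟩,
    fun ⟨θ, h0, h1, h2, h3⟩ => ⟨θ, h0, h1, h3, h2⟩⟩

theorem IsLineSegment.swap {s : Set Plane} (h : IsLineSegment s) : IsLineSegment (swapSet s) := by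
  obtain ⟨p, q, hpq, rfl⟩ := h
  exact ⟨p.swap, q.swap, fun h => hpq (Prod.swap_injective h), swapSet_segment p q⟩

theorem MaxSeg.swap {ω s : Set Plane} (h : MaxSeg ω s) : MaxSeg (swapSet ω) (swapSet s) := by
  refine ⟨h.1.swap, swapSet_subset.2 h.2.1, fun t ht hω hs => ?_⟩
  have := h.2.2 (swapSet t) ht.swap (swapSet_subset.1 hω) (swapSet_subset.1 hs)
  rw [← this, swapSet_swapSet]

theorem isCompact_swapSet {A : Set Plane} (h : IsCompact A) : IsCompact (swapSet A) := by
  have : swapSet A = Prod.swap '' A := by rw [image_swap_eq_preimage_swap]; rfl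
  rw [this]
  exact h.image continuous_swap

theorem isPathConnected_swapSet {A : Set Plane} (h : IsPathConnected A) :
    IsPathConnected (swapSet A) := by
  have : swapSet A = Prod.swap '' A := by rw [image_swap_eq_preimage_swap]; rfl
  rw [this]
  exact h.image continuous_swap

theorem swapSet_closure_interior {A : Set Plane} (h : closure (interior A) = A) :
    closure (interior (swapSet A)) = swapSet A := by
  have e := (Homeomorph.prodComm ℝ ℝ).preimage_interior A
  have e2 := (Homeomorph.prodComm ℝ ℝ).preimage_closure (interior A)
  rw [h] at e2
  calc closure (interior (swapSet A)) = closure ((Homeomorph.prodComm ℝ ℝ) ⁻¹' interior A) := by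
        rw [e]; rfl
    _ = swapSet A := by rw [← e2]; rfl

/-! ### Rectilinearly convex regions -/

/-- A compact region which, seen from a family `G` of its maximal segments and a finite set `F`
of exceptional coordinates, behaves like a rectilinearly convex obstacle with its candidate
edges.  Everything is formulated for the directions right and up, and is symmetric under
swapping the coordinates.

`hconn` and `vconn` record what is used of the monotone paths that join any two points. The fields
`top_of_left` to `left_of_upper` say that the steps of the upper left and of the lower right
boundary have their heights and abscissae in `F`; the fields `ext_*` say that the four sides of the
bounding box meet the region in more than one point. The remaining fields are sources of members of
`G`: `mem_left` to `mem_up` for segments that touch a side of the bounding box and are not contained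
in it, `mem_rightward` and `mem_upward` for segments that reach furthest beyond a straight frontier,
`mem_cornerRight` and `mem_cornerUp` for those that reach furthest beyond an L-shaped frontier with
corner `(c₁, c₂)`, respectively `(c₂, c₁)`. -/
structure RectRegion (ω : Set Plane) (G : Set (Set Plane)) (F : Set ℝ) : Prop where
  isCompact : IsCompact ω
  fat : closure (interior ω) = ω
  nonempty : ω.Nonempty
  hconn : ∀ p ∈ ω, ∀ q ∈ ω, ∀ x, p.1 ≤ x → x ≤ q.1 →
    ∃ y, (x, y) ∈ ω ∧ min p.2 q.2 ≤ y ∧ y ≤ max p.2 q.2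
  vconn : ∀ p ∈ ω, ∀ q ∈ ω, ∀ y, p.2 ≤ y → y ≤ q.2 →
    ∃ x, (x, y) ∈ ω ∧ min p.1 q.1 ≤ x ∧ x ≤ max p.1 q.1
  /-- No point cuts the region into a lower left and an upper right part. -/
  noPinch : ∀ z ∈ ω, (∀ g ∈ ω, g.1 ≤ z.1 ∧ g.2 ≤ z.2 ∨ z.1 ≤ g.1 ∧ z.2 ≤ g.2) →
    (∀ g ∈ ω, g.1 ≤ z.1 ∧ g.2 ≤ z.2) ∨ ∀ g ∈ ω, z.1 ≤ g.1 ∧ z.2 ≤ g.2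
  finite : F.Finite
  top_of_left : ∀ g ∈ ω, (∀ h ∈ ω, h.1 ≤ g.1 → h.2 ≤ g.2) → g.2 ∈ F
  right_of_lower : ∀ g ∈ ω, (∀ h ∈ ω, h.2 ≤ g.2 → h.1 ≤ g.1) → g.1 ∈ F
  bottom_of_right : ∀ g ∈ ω, (∀ h ∈ ω, g.1 ≤ h.1 → g.2 ≤ h.2) → g.2 ∈ F
  left_of_upper : ∀ g ∈ ω, (∀ h ∈ ω, g.2 ≤ h.2 → g.1 ≤ h.1) → g.1 ∈ F
  maxSeg : ∀ s ∈ G, MaxSeg ω s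
  ext_left : ∀ g ∈ ω, (∀ h ∈ ω, g.1 ≤ h.1) → ∃ y, y ≠ g.2 ∧ (g.1, y) ∈ ω
  ext_right : ∀ g ∈ ω, (∀ h ∈ ω, h.1 ≤ g.1) → ∃ y, y ≠ g.2 ∧ (g.1, y) ∈ ω
  ext_down : ∀ g ∈ ω, (∀ h ∈ ω, g.2 ≤ h.2) → ∃ x, x ≠ g.1 ∧ (x, g.2) ∈ ω
  ext_up : ∀ g ∈ ω, (∀ h ∈ ω, h.2 ≤ g.2) → ∃ x, x ≠ g.1 ∧ (x, g.2) ∈ ω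
  mem_left : ∀ s, MaxSeg ω s → (∃ g ∈ s, ∀ h ∈ ω, g.1 ≤ h.1) →
    (∃ g ∈ s, ∃ h ∈ ω, h.1 < g.1) → s ∈ G
  mem_right : ∀ s, MaxSeg ω s → (∃ g ∈ s, ∀ h ∈ ω, h.1 ≤ g.1) →
    (∃ g ∈ s, ∃ h ∈ ω, g.1 < h.1) → s ∈ G
  mem_down : ∀ s, MaxSeg ω s → (∃ g ∈ s, ∀ h ∈ ω, g.2 ≤ h.2) →
    (∃ g ∈ s, ∃ h ∈ ω, h.2 < g.2) → s ∈ G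
  mem_up : ∀ s, MaxSeg ω s → (∃ g ∈ s, ∀ h ∈ ω, h.2 ≤ g.2) →
    (∃ g ∈ s, ∃ h ∈ ω, g.2 < h.2) → s ∈ G
  mem_rightward : ∀ c ∉ F, (∃ z ∈ ω, ∃ z' ∈ ω, z.1 = c ∧ z'.1 = c ∧ z ≠ z') → ∀ s, MaxSeg ω s →
    (∃ g ∈ s, g.1 < c) → (∃ g ∈ s, c < g.1) →
    (∃ z ∈ s, z.1 = c ∧ ∃ g ∈ ω, (∀ h ∈ ω, h.1 ≤ g.1) ∧ z.2 ≤ g.2) →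
    ∀ e ∈ s, (∀ t, MaxSeg ω t → (∃ z ∈ t, z.1 = c) → (∀ g ∈ t, g.1 ≤ e.1) ∧
      ((∃ g ∈ t, g.1 = e.1) → ∀ g ∈ t, c ≤ g.1 → g.2 ≤ e.2 ∨ ∃ h ∈ ω, h.1 ≤ c ∧ g.2 ≤ h.2)) →
    s ∈ G
  mem_upward : ∀ c ∉ F, (∃ z ∈ ω, ∃ z' ∈ ω, z.2 = c ∧ z'.2 = c ∧ z ≠ z') → ∀ s, MaxSeg ω s →
    (∃ g ∈ s, g.2 < c) → (∃ g ∈ s, c < g.2) →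
    (∃ z ∈ s, z.2 = c ∧ ∃ g ∈ ω, (∀ h ∈ ω, h.2 ≤ g.2) ∧ z.1 ≤ g.1) →
    ∀ e ∈ s, (∀ t, MaxSeg ω t → (∃ z ∈ t, z.2 = c) → (∀ g ∈ t, g.2 ≤ e.2) ∧
      ((∃ g ∈ t, g.2 = e.2) → ∀ g ∈ t, c ≤ g.2 → g.1 ≤ e.1 ∨ ∃ h ∈ ω, h.2 ≤ c ∧ g.1 ≤ h.1)) →
    s ∈ G
  mem_cornerRight : ∀ c₁ ∉ F, ∀ c₂ ∉ F, (c₁, c₂) ∈ interior ω →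
    (∃ g ∈ ω, (∀ h ∈ ω, g.1 ≤ h.1) ∧ g.2 ≤ c₂) → (∃ g ∈ ω, (∀ h ∈ ω, h.1 ≤ g.1) ∧ c₂ ≤ g.2) →
    ∀ s, MaxSeg ω s → ∀ p ∈ s, p.1 < c₁ → p.2 < c₂ → ∀ e ∈ s, c₁ < e.1 → p.2 ≤ e.2 →
    (∀ t, MaxSeg ω t → (∃ z ∈ t, z.1 ≤ c₁ ∧ z.2 ≤ c₂ ∧ (z.1 = c₁ ∨ z.2 = c₂)) →
      (∀ g ∈ t, g.1 ≤ e.1) ∧ ((∃ g ∈ t, g.1 = e.1) → ∀ g ∈ t, g.2 ≤ e.2 ∨ g.2 ≤ c₂)) → s ∈ G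
  mem_cornerUp : ∀ c₁ ∉ F, ∀ c₂ ∉ F, (c₂, c₁) ∈ interior ω →
    (∃ g ∈ ω, (∀ h ∈ ω, g.2 ≤ h.2) ∧ g.1 ≤ c₂) → (∃ g ∈ ω, (∀ h ∈ ω, h.2 ≤ g.2) ∧ c₂ ≤ g.1) →
    ∀ s, MaxSeg ω s → ∀ p ∈ s, p.2 < c₁ → p.1 < c₂ → ∀ e ∈ s, c₁ < e.2 → p.1 ≤ e.1 →
    (∀ t, MaxSeg ω t → (∃ z ∈ t, z.2 ≤ c₁ ∧ z.1 ≤ c₂ ∧ (z.2 = c₁ ∨ z.1 = c₂)) →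
      (∀ g ∈ t, g.2 ≤ e.2) ∧ ((∃ g ∈ t, g.2 = e.2) → ∀ g ∈ t, g.1 ≤ e.1 ∨ g.1 ≤ c₂)) → s ∈ G

/-- The reflection of a family of sets in the diagonal. -/
def swapFam (G : Set (Set Plane)) : Set (Set Plane) := swapSet ⁻¹' G

theorem forall_swapSet {A : Set Plane} {P : Plane → Prop} :
    (∀ z ∈ swapSet A, P z) ↔ ∀ z ∈ A, P z.swap :=
  ⟨fun h z hz => h z.swap (by simpa using hz), fun h z hz => by simpa using h z.swap hz⟩

theorem exists_swapSet {A : Set Plane} {P : Plane → Prop} :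
    (∃ z ∈ swapSet A, P z) ↔ ∃ z ∈ A, P z.swap :=
  ⟨fun ⟨z, hz, h⟩ => ⟨z.swap, hz, by simpa using h⟩,
    fun ⟨z, hz, h⟩ => ⟨z.swap, by simpa using hz, h⟩⟩

theorem swap_maxSeg_iff {ω s : Set Plane} : MaxSeg (swapSet ω) s ↔ MaxSeg ω (swapSet s) :=
  ⟨fun h => by simpa using h.swap, fun h => by simpa using h.swap⟩

theorem swap_mem_interior {ω : Set Plane} {z : Plane} :
    z ∈ interior (swapSet ω) ↔ z.swap ∈ interior ω := by
  have e := (Homeomorph.prodComm ℝ ℝ).preimage_interior ω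
  have : interior (swapSet ω) = (Homeomorph.prodComm ℝ ℝ) ⁻¹' interior ω := by rw [e]; rfl
  rw [this]
  rfl

theorem RectRegion.swap {ω : Set Plane} {G : Set (Set Plane)} {F : Set ℝ} (R : RectRegion ω G F) :
    RectRegion (swapSet ω) (swapFam G) F where
  isCompact := isCompact_swapSet R.isCompact
  fat := swapSet_closure_interior R.fat
  nonempty := R.nonempty.imp (fun z hz => (by simpa using hz : z.swap.swap ∈ ω)) |> fun ⟨z, hz⟩ =>
    ⟨z.swap, hz⟩
  hconn p hp q hq x h1 h2 := R.vconn p.swap hp q.swap hq x h1 h2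
  vconn p hp q hq x h1 h2 := R.hconn p.swap hp q.swap hq x h1 h2
  noPinch z hz h := by
    simp only [forall_swapSet, Prod.fst_swap, Prod.snd_swap, and_comm] at h ⊢
    simpa [and_comm] using R.noPinch z.swap hz (by simpa [and_comm] using h)
  finite := R.finite
  top_of_left g hg h := R.right_of_lower g.swap hg fun z hz => h z.swap (by simpa using hz)
  right_of_lower g hg h := R.top_of_left g.swap hg fun z hz => h z.swap (by simpa using hz)
  bottom_of_right g hg h := R.left_of_upper g.swap hg fun z hz => h z.swap (by simpa using hz)
  left_of_upper g hg h := R.bottom_of_right g.swap hg fun z hz => h z.swap (by simpa using hz)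
  maxSeg s hs := swap_maxSeg_iff.2 (R.maxSeg _ hs)
  ext_left g hg h := R.ext_down g.swap hg (forall_swapSet.1 h)
  ext_right g hg h := R.ext_up g.swap hg (forall_swapSet.1 h)
  ext_down g hg h := R.ext_left g.swap hg (forall_swapSet.1 h)
  ext_up g hg h := R.ext_right g.swap hg (forall_swapSet.1 h)
  mem_left s hs h1 h2 := by
    refine R.mem_down _ (swap_maxSeg_iff.1 hs) ?_ ?_
    · simpa only [exists_swapSet, forall_swapSet, Prod.fst_swap, Prod.snd_swap] using h1
    · simpa only [exists_swapSet, forall_swapSet, Prod.fst_swap, Prod.snd_swap] using h2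
  mem_right s hs h1 h2 := by
    refine R.mem_up _ (swap_maxSeg_iff.1 hs) ?_ ?_
    · simpa only [exists_swapSet, forall_swapSet, Prod.fst_swap, Prod.snd_swap] using h1
    · simpa only [exists_swapSet, forall_swapSet, Prod.fst_swap, Prod.snd_swap] using h2
  mem_down s hs h1 h2 := by
    refine R.mem_left _ (swap_maxSeg_iff.1 hs) ?_ ?_
    · simpa only [exists_swapSet, forall_swapSet, Prod.fst_swap, Prod.snd_swap] using h1
    · simpa only [exists_swapSet, forall_swapSet, Prod.fst_swap, Prod.snd_swap] using h2
  mem_up s hs h1 h2 := by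
    refine R.mem_right _ (swap_maxSeg_iff.1 hs) ?_ ?_
    · simpa only [exists_swapSet, forall_swapSet, Prod.fst_swap, Prod.snd_swap] using h1
    · simpa only [exists_swapSet, forall_swapSet, Prod.fst_swap, Prod.snd_swap] using h2
  mem_rightward c hc h1 s hs h2 h3 h4 e he h5 := by
    refine R.mem_upward c hc ?_ _ (swap_maxSeg_iff.1 hs) ?_ ?_ ?_ e.swap (by simpa using he) ?_
    · obtain ⟨z, hz, z', hz', a, b, n⟩ := h1
      exact ⟨z.swap, hz, z'.swap, hz', a, b, fun h => n (Prod.swap_injective h)⟩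
    · simpa only [exists_swapSet, forall_swapSet, Prod.fst_swap, Prod.snd_swap] using h2
    · simpa only [exists_swapSet, forall_swapSet, Prod.fst_swap, Prod.snd_swap] using h3
    · simpa only [exists_swapSet, forall_swapSet, Prod.fst_swap, Prod.snd_swap] using h4
    · intro t ht h6
      have := h5 (swapSet t) ht.swap (by simpa only [exists_swapSet, Prod.fst_swap, Prod.snd_swap] using h6)
      simpa only [exists_swapSet, forall_swapSet, Prod.fst_swap, Prod.snd_swap] using this
  mem_upward c hc h1 s hs h2 h3 h4 e he h5 := by
    refine R.mem_rightward c hc ?_ _ (swap_maxSeg_iff.1 hs) ?_ ?_ ?_ e.swap (by simpa using he) ?_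
    · obtain ⟨z, hz, z', hz', a, b, n⟩ := h1
      exact ⟨z.swap, hz, z'.swap, hz', a, b, fun h => n (Prod.swap_injective h)⟩
    · simpa only [exists_swapSet, forall_swapSet, Prod.fst_swap, Prod.snd_swap] using h2
    · simpa only [exists_swapSet, forall_swapSet, Prod.fst_swap, Prod.snd_swap] using h3
    · simpa only [exists_swapSet, forall_swapSet, Prod.fst_swap, Prod.snd_swap] using h4
    · intro t ht h6
      have := h5 (swapSet t) ht.swap (by simpa only [exists_swapSet, Prod.fst_swap, Prod.snd_swap] using h6)
      simpa only [exists_swapSet, forall_swapSet, Prod.fst_swap, Prod.snd_swap] using this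
  mem_cornerRight c₁ hc₁ c₂ hc₂ hc h1 h2 s hs p hp hp1 hp2 e he he1 he2 h3 := by
    refine R.mem_cornerUp c₁ hc₁ c₂ hc₂ (swap_mem_interior.1 hc) ?_ ?_ _ (swap_maxSeg_iff.1 hs)
      p.swap (by simpa using hp) hp1 hp2 e.swap (by simpa using he) he1 he2 ?_
    · simpa only [exists_swapSet, forall_swapSet, Prod.fst_swap, Prod.snd_swap] using h1
    · simpa only [exists_swapSet, forall_swapSet, Prod.fst_swap, Prod.snd_swap] using h2
    · intro t ht h6
      have := h3 (swapSet t) ht.swap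
        (by simpa only [exists_swapSet, Prod.fst_swap, Prod.snd_swap] using h6)
      simpa only [exists_swapSet, forall_swapSet, Prod.fst_swap, Prod.snd_swap] using this
  mem_cornerUp c₁ hc₁ c₂ hc₂ hc h1 h2 s hs p hp hp1 hp2 e he he1 he2 h3 := by
    refine R.mem_cornerRight c₁ hc₁ c₂ hc₂ (swap_mem_interior.1 hc) ?_ ?_ _ (swap_maxSeg_iff.1 hs)
      p.swap (by simpa using hp) hp1 hp2 e.swap (by simpa using he) he1 he2 ?_
    · simpa only [exists_swapSet, forall_swapSet, Prod.fst_swap, Prod.snd_swap] using h1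
    · simpa only [exists_swapSet, forall_swapSet, Prod.fst_swap, Prod.snd_swap] using h2
    · intro t ht h6
      have := h3 (swapSet t) ht.swap
        (by simpa only [exists_swapSet, Prod.fst_swap, Prod.snd_swap] using h6)
      simpa only [exists_swapSet, forall_swapSet, Prod.fst_swap, Prod.snd_swap] using this

namespace RectRegion

variable {ω : Set Plane} {G : Set (Set Plane)} {F : Set ℝ} (R : RectRegion ω G F)
include R

/-- A point all of whose closed quadrants meet the region belongs to the region. -/
theorem mem_of_quadrants {z nw ne sw se : Plane} (h1 : nw ∈ ω) (h1x : nw.1 ≤ z.1)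
    (h1y : z.2 ≤ nw.2) (h2 : ne ∈ ω) (h2x : z.1 ≤ ne.1) (h2y : z.2 ≤ ne.2) (h3 : sw ∈ ω)
    (h3x : sw.1 ≤ z.1) (h3y : sw.2 ≤ z.2) (h4 : se ∈ ω) (h4x : z.1 ≤ se.1) (h4y : se.2 ≤ z.2) :
    z ∈ ω := by
  obtain ⟨y, hy, hy1, -⟩ := R.hconn nw h1 ne h2 z.1 h1x h2x
  obtain ⟨y', hy', -, hy2⟩ := R.hconn sw h3 se h4 z.1 h3x h4x
  obtain ⟨x, hx, hx1, hx2⟩ := R.vconn _ hy' _ hy z.2 (hy2.trans (max_le h3y h4y))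
    ((le_min h1y h2y).trans hy1)
  simp only [min_self, max_self] at hx1 hx2
  rwa [le_antisymm hx2 hx1] at hx

theorem mem_of_vertical {x y y1 y2 : ℝ} (h1 : (x, y1) ∈ ω) (h2 : (x, y2) ∈ ω) (hy1 : y1 ≤ y)
    (hy2 : y ≤ y2) : (x, y) ∈ ω :=
  R.mem_of_quadrants (z := (x, y)) h2 le_rfl hy2 h2 le_rfl hy2 h1 le_rfl hy1 h1 le_rfl hy1

theorem mem_of_horizontal {x y x1 x2 : ℝ} (h1 : (x1, y) ∈ ω) (h2 : (x2, y) ∈ ω) (hx1 : x1 ≤ x)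
    (hx2 : x ≤ x2) : (x, y) ∈ ω :=
  R.mem_of_quadrants (z := (x, y)) h1 hx1 le_rfl h2 hx2 le_rfl h1 hx1 le_rfl h2 hx2 le_rfl

/-- Every point of the region is a limit of interior points, so an open set that meets the region
meets it in two points that differ in both coordinates. -/
theorem exists_ne_of_isOpen {U : Set Plane} (hU : IsOpen U) {z : Plane} (hz : z ∈ ω)
    (hzU : z ∈ U) : ∃ g ∈ ω ∩ U, ∃ h ∈ ω ∩ U, g.1 < h.1 ∧ g.2 < h.2 := by
  rw [← R.fat] at hz
  obtain ⟨g, hgU, hg⟩ := mem_closure_iff.1 hz U hU hzU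
  have hopen : IsOpen (U ∩ interior ω) := hU.inter isOpen_interior
  obtain ⟨ε, hε, hball⟩ := Metric.isOpen_iff.1 hopen g ⟨hgU, hg⟩
  refine ⟨g, ⟨interior_subset hg, hgU⟩, (g.1 + ε / 2, g.2 + ε / 2), ?_, by simp [hε], by simp [hε]⟩
  have : (g.1 + ε / 2, g.2 + ε / 2) ∈ Metric.ball g ε := by
    rw [Metric.mem_ball, Prod.dist_eq, Real.dist_eq, Real.dist_eq]
    simp only [add_sub_cancel_left, max_self]
    rw [abs_of_pos (half_pos hε)]
    linarith
  exact ⟨interior_subset (hball this).2, (hball this).1⟩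

end RectRegion

/-! ### Steps of the boundary -/

namespace RectRegion

variable {ω : Set Plane} {G : Set (Set Plane)} {F : Set ℝ} (R : RectRegion ω G F)
include R

theorem exists_top_of_left {g : Plane} (hg : g ∈ ω) : ∃ h ∈ ω, h.1 ≤ g.1 ∧ g.2 ≤ h.2 ∧ h.2 ∈ F ∧
    ∀ k ∈ ω, k.1 ≤ g.1 → k.2 ≤ h.2 := by
  have hK : IsCompact (ω ∩ {k | k.1 ≤ g.1}) :=
    R.isCompact.inter_right (isClosed_le continuous_fst continuous_const)
  obtain ⟨h, ⟨hh, hh1⟩, hmax⟩ := hK.exists_isMaxOn ⟨g, hg, le_refl g.1⟩ continuous_snd.continuousOn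
  exact ⟨h, hh, hh1, hmax ⟨hg, le_refl g.1⟩,
    R.top_of_left h hh fun k hk hk1 => hmax ⟨hk, hk1.trans hh1⟩, fun k hk hk1 => hmax ⟨hk, hk1⟩⟩

theorem exists_bottom_of_right {g : Plane} (hg : g ∈ ω) : ∃ h ∈ ω, g.1 ≤ h.1 ∧ h.2 ≤ g.2 ∧
    h.2 ∈ F ∧ ∀ k ∈ ω, g.1 ≤ k.1 → h.2 ≤ k.2 := by
  have hK : IsCompact (ω ∩ {k | g.1 ≤ k.1}) :=
    R.isCompact.inter_right (isClosed_le continuous_const continuous_fst)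
  obtain ⟨h, ⟨hh, hh1⟩, hmin⟩ := hK.exists_isMinOn ⟨g, hg, le_refl g.1⟩ continuous_snd.continuousOn
  exact ⟨h, hh, hh1, hmin ⟨hg, le_refl g.1⟩,
    R.bottom_of_right h hh fun k hk hk1 => hmin ⟨hk, le_trans hh1 hk1⟩,
    fun k hk hk1 => hmin ⟨hk, hk1⟩⟩

/-- If nothing to the left of `b` is higher than `b`, then the same holds slightly to the right
of `b`. -/
theorem exists_step_up {b : Plane} (hb : ∀ g ∈ ω, g.1 ≤ b.1 → g.2 ≤ b.2) :
    ∃ δ > 0, ∀ g ∈ ω, g.1 < b.1 + δ → g.2 ≤ b.2 := by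
  -- By `top_of_left`, only the finitely many heights `f ∈ F` matter.
  have key : ∀ f ∈ F, ∀ᶠ δ in 𝓝[>] (0 : ℝ), b.2 < f → ∀ g ∈ ω, g.1 < b.1 + δ → g.2 < f := by
    intro f _
    by_cases hf : b.2 < f
    swap
    · exact Eventually.of_forall fun _ h => absurd h hf
    have hK : IsCompact (ω ∩ {k | f ≤ k.2}) :=
      R.isCompact.inter_right (isClosed_le continuous_const continuous_snd)
    rcases (ω ∩ {k | f ≤ k.2}).eq_empty_or_nonempty with h0 | h0
    · refine Eventually.of_forall fun δ _ g hg _ => ?_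
      by_contra hc
      have : g ∈ ω ∩ {k | f ≤ k.2} := ⟨hg, not_lt.1 hc⟩
      simp [h0] at this
    · obtain ⟨k, ⟨hk, hkf⟩, hmin⟩ := hK.exists_isMinOn h0 continuous_fst.continuousOn
      have hk1 : b.1 < k.1 := by
        by_contra hc
        have h2 := hb k hk (not_lt.1 hc)
        have h3 : f ≤ k.2 := hkf
        linarith
      filter_upwards [Ioo_mem_nhdsGT (sub_pos.2 hk1)] with δ hδ _ g hg hgδ
      by_contra hc
      have h4 : k.1 ≤ g.1 := hmin ⟨hg, not_lt.1 hc⟩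
      have := hδ.2
      linarith
  obtain ⟨δ, hδ, hpos⟩ := (((eventually_all_finite R.finite).2 key).and self_mem_nhdsWithin).exists
  refine ⟨δ, hpos, fun g hg hgδ => ?_⟩
  by_contra hc
  obtain ⟨h, hh, h1, h2, h3, -⟩ := R.exists_top_of_left hg
  exact lt_irrefl _ (hδ h.2 h3 ((not_le.1 hc).trans_le h2) h hh (h1.trans_lt hgδ))

/-- If everything to the right of `e` is higher than `e`, then it is higher by a definite
amount. -/
theorem exists_step_right {e : Plane} (he : ∀ g ∈ ω, e.1 < g.1 → e.2 < g.2) :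
    ∃ η > 0, ∀ g ∈ ω, e.1 < g.1 → e.2 + η ≤ g.2 := by
  have key : ∀ f ∈ F, ∀ᶠ η in 𝓝[>] (0 : ℝ), e.2 < f → e.2 + η ≤ f := by
    intro f _
    by_cases hf : e.2 < f
    · filter_upwards [Ioo_mem_nhdsGT (sub_pos.2 hf)] with η hη _
      have := hη.2
      linarith
    · exact Eventually.of_forall fun _ h => absurd h hf
  obtain ⟨η, hη, hpos⟩ := (((eventually_all_finite R.finite).2 key).and self_mem_nhdsWithin).exists
  refine ⟨η, hpos, fun g hg hge => ?_⟩
  obtain ⟨h, hh, h1, h2, h3, -⟩ := R.exists_bottom_of_right hg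
  exact (hη h.2 h3 (he h hh (hge.trans_le h1))).trans h2

theorem exists_lower_right {b : Plane} (hbω : b ∈ ω) (hb : ∀ g ∈ ω, g.1 ≤ b.1 → g.2 ≤ b.2)
    (h1 : ∃ h ∈ ω, b.1 < h.1) (h2 : ∃ k ∈ ω, k.1 < b.1 ∨ k.2 < b.2) :
    ∃ g ∈ ω, b.1 < g.1 ∧ g.2 < b.2 := by
  by_contra! hc
  have := R.noPinch b hbω fun g hg => by
    rcases le_or_gt g.1 b.1 with h | h
    · exact Or.inl ⟨h, hb g hg h⟩
    · exact Or.inr ⟨h.le, hc g hg h⟩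
  obtain ⟨h, hh, h1⟩ := h1
  obtain ⟨k, hk, h2⟩ := h2
  rcases this with h3 | h3
  · exact absurd h1 (not_lt.2 (h3 h hh).1)
  · rcases h2 with h2 | h2
    · exact absurd h2 (not_lt.2 (h3 k hk).1)
    · exact absurd h2 (not_lt.2 (h3 k hk).2)

end RectRegion

/-! ### Perturbation of lines -/

theorem eventually_line_lt {α β m₁ m₀ x u : ℝ} (h : α * x + β < u) :
    ∀ᶠ ε in 𝓝[>] (0 : ℝ), (α + ε * m₁) * x + (β + ε * m₀) < u := by
  have hc : Continuous fun ε : ℝ => (α + ε * m₁) * x + (β + ε * m₀) := by fun_prop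
  have : ∀ᶠ ε in 𝓝 (0 : ℝ), (α + ε * m₁) * x + (β + ε * m₀) < u :=
    hc.continuousAt.eventually_lt_const (by simpa using h)
  exact this.filter_mono nhdsWithin_le_nhds

theorem eventually_lt_line {α β m₁ m₀ x u : ℝ} (h : u < α * x + β) :
    ∀ᶠ ε in 𝓝[>] (0 : ℝ), u < (α + ε * m₁) * x + (β + ε * m₀) := by
  have hc : Continuous fun ε : ℝ => (α + ε * m₁) * x + (β + ε * m₀) := by fun_prop
  have : ∀ᶠ ε in 𝓝 (0 : ℝ), u < (α + ε * m₁) * x + (β + ε * m₀) :=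
    hc.continuousAt.eventually_const_lt (by simpa using h)
  exact this.filter_mono nhdsWithin_le_nhds

/-- A line that stays below a closed bound on a set stays below it at the supremum. -/
theorem line_sSup_le {A : Set ℝ} {α β u : ℝ} (h0 : A.Nonempty) (hA : BddAbove A)
    (h : ∀ x ∈ A, α * x + β ≤ u) : α * sSup A + β ≤ u := by
  have hcl : IsClosed {x : ℝ | α * x + β ≤ u} := isClosed_le (by fun_prop) continuous_const
  exact hcl.closure_subset_iff.2 h (csSup_mem_closure h0 hA)

theorem le_line_sInf {A : Set ℝ} {α β u : ℝ} (h0 : A.Nonempty) (hA : BddBelow A)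
    (h : ∀ x ∈ A, u ≤ α * x + β) : u ≤ α * sInf A + β := by
  have hcl : IsClosed {x : ℝ | u ≤ α * x + β} := isClosed_le continuous_const (by fun_prop)
  exact hcl.closure_subset_iff.2 h (csInf_mem_closure h0 hA)

namespace RectRegion

variable {ω : Set Plane} {G : Set (Set Plane)} {F : Set ℝ} (R : RectRegion ω G F)
include R

/-- Being below the upper left boundary of the region is a matter of finitely many corners, so it
survives a small change of an increasing line that does not raise it at the corners where the line
is tight. -/
theorem eventually_up {c X α β m₁ m₀ : ℝ}
    (hup : ∀ x, c ≤ x → x ≤ X → ∃ g ∈ ω, g.1 ≤ x ∧ α * x + β ≤ g.2)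
    (hcon : ∀ x, c ≤ x → x ≤ X → (∀ g ∈ ω, g.1 < x → g.2 ≤ α * x + β) →
      (x = c → ∀ g ∈ ω, g.1 ≤ c → g.2 ≤ α * c + β) → m₁ * x + m₀ ≤ 0)
    (hs : ∀ᶠ ε in 𝓝[>] (0 : ℝ), 0 ≤ α + ε * m₁) :
    ∀ᶠ ε in 𝓝[>] (0 : ℝ), ∀ x, c ≤ x → x ≤ X →
      ∃ g ∈ ω, g.1 ≤ x ∧ (α + ε * m₁) * x + (β + ε * m₀) ≤ g.2 := by
  have key : ∀ u ∈ F, ∀ᶠ ε in 𝓝[>] (0 : ℝ), ∀ x, c ≤ x → x ≤ X →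
      (∀ g ∈ ω, g.1 ≤ x → g.2 ≤ u) → (α + ε * m₁) * x + (β + ε * m₀) ≤ u := by
    intro u _
    let A : Set ℝ := {x | (c ≤ x ∧ x ≤ X) ∧ ∀ g ∈ ω, g.1 ≤ x → g.2 ≤ u}
    rcases A.eq_empty_or_nonempty with h0 | h0
    · refine Eventually.of_forall fun ε x h1 h2 h3 => ?_
      have : x ∈ A := ⟨⟨h1, h2⟩, h3⟩
      simp [h0] at this
    have hA : BddAbove A := ⟨X, fun x hx => hx.1.2⟩
    have hle : α * sSup A + β ≤ u := line_sSup_le h0 hA fun x hx => by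
      obtain ⟨g, hg, h1, h2⟩ := hup x hx.1.1 hx.1.2
      exact h2.trans (hx.2 g hg h1)
    have h1 : ∀ᶠ ε in 𝓝[>] (0 : ℝ), (α + ε * m₁) * sSup A + (β + ε * m₀) ≤ u := by
      rcases hle.lt_or_eq with hlt | heq
      · exact (eventually_line_lt hlt).mono fun ε h => h.le
      · obtain ⟨x1, hx1⟩ := h0
        have hc : c ≤ sSup A := hx1.1.1.trans (le_csSup hA hx1)
        have hm : m₁ * sSup A + m₀ ≤ 0 := by
          refine hcon _ hc (csSup_le ⟨x1, hx1⟩ fun x hx => hx.1.2) ?_ ?_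
          · intro g hg hlt
            obtain ⟨x, hx, hgx⟩ := exists_lt_of_lt_csSup ⟨x1, hx1⟩ hlt
            rw [heq]
            exact hx.2 g hg hgx.le
          · intro hsc g hg hgc
            rw [← hsc, heq]
            exact hx1.2 g hg (hgc.trans hx1.1.1)
        filter_upwards [self_mem_nhdsWithin] with ε hε
        have : ε * (m₁ * sSup A + m₀) ≤ 0 := mul_nonpos_of_nonneg_of_nonpos (le_of_lt hε) hm
        linarith
    filter_upwards [h1, hs] with ε h1 hs x hcx hxX hx
    have : x ≤ sSup A := le_csSup hA ⟨⟨hcx, hxX⟩, hx⟩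
    have := mul_le_mul_of_nonneg_left this hs
    linarith
  filter_upwards [(eventually_all_finite R.finite).2 key] with ε h x hcx hxX
  obtain ⟨g, hg, hgx, -⟩ := hup x hcx hxX
  have hK : IsCompact (ω ∩ {k | k.1 ≤ x}) :=
    R.isCompact.inter_right (isClosed_le continuous_fst continuous_const)
  obtain ⟨k, ⟨hk, hk1⟩, hmax⟩ := hK.exists_isMaxOn ⟨g, hg, hgx⟩ continuous_snd.continuousOn
  exact ⟨k, hk, hk1, h k.2 (R.top_of_left k hk fun h hh hh1 => hmax ⟨hh, hh1.trans hk1⟩) x hcx hxX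
    fun h hh hh1 => hmax ⟨hh, hh1⟩⟩

/-- The counterpart of `eventually_up` for the lower right boundary. -/
theorem eventually_lo {c X α β m₁ m₀ : ℝ}
    (hlo : ∀ x, c ≤ x → x ≤ X → ∃ g ∈ ω, x ≤ g.1 ∧ g.2 ≤ α * x + β)
    (hcon : ∀ x, c ≤ x → x ≤ X → (∀ g ∈ ω, x < g.1 → α * x + β ≤ g.2) → 0 ≤ m₁ * x + m₀)
    (hs : ∀ᶠ ε in 𝓝[>] (0 : ℝ), 0 ≤ α + ε * m₁) :
    ∀ᶠ ε in 𝓝[>] (0 : ℝ), ∀ x, c ≤ x → x ≤ X →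
      ∃ g ∈ ω, x ≤ g.1 ∧ g.2 ≤ (α + ε * m₁) * x + (β + ε * m₀) := by
  have key : ∀ u ∈ F, ∀ᶠ ε in 𝓝[>] (0 : ℝ), ∀ x, c ≤ x → x ≤ X →
      (∀ g ∈ ω, x ≤ g.1 → u ≤ g.2) → u ≤ (α + ε * m₁) * x + (β + ε * m₀) := by
    intro u _
    let A : Set ℝ := {x | (c ≤ x ∧ x ≤ X) ∧ ∀ g ∈ ω, x ≤ g.1 → u ≤ g.2}
    rcases A.eq_empty_or_nonempty with h0 | h0
    · refine Eventually.of_forall fun ε x h1 h2 h3 => ?_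
      have : x ∈ A := ⟨⟨h1, h2⟩, h3⟩
      simp [h0] at this
    have hA : BddBelow A := ⟨c, fun x hx => hx.1.1⟩
    have hle : u ≤ α * sInf A + β := le_line_sInf h0 hA fun x hx => by
      obtain ⟨g, hg, h1, h2⟩ := hlo x hx.1.1 hx.1.2
      exact (hx.2 g hg h1).trans h2
    have h1 : ∀ᶠ ε in 𝓝[>] (0 : ℝ), u ≤ (α + ε * m₁) * sInf A + (β + ε * m₀) := by
      rcases hle.lt_or_eq with hlt | heq
      · exact (eventually_lt_line hlt).mono fun ε h => h.le
      · obtain ⟨x1, hx1⟩ := h0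
        have hm : 0 ≤ m₁ * sInf A + m₀ := by
          refine hcon _ (le_csInf ⟨x1, hx1⟩ fun x hx => hx.1.1) ((csInf_le hA hx1).trans hx1.1.2) ?_
          intro g hg hlt
          obtain ⟨x, hx, hgx⟩ := exists_lt_of_csInf_lt ⟨x1, hx1⟩ hlt
          rw [← heq]
          exact hx.2 g hg hgx.le
        filter_upwards [self_mem_nhdsWithin] with ε hε
        have : 0 ≤ ε * (m₁ * sInf A + m₀) := mul_nonneg (le_of_lt hε) hm
        linarith
    filter_upwards [h1, hs] with ε h1 hs x hcx hxX hx
    have : sInf A ≤ x := csInf_le hA ⟨⟨hcx, hxX⟩, hx⟩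
    have := mul_le_mul_of_nonneg_left this hs
    linarith
  filter_upwards [(eventually_all_finite R.finite).2 key] with ε h x hcx hxX
  obtain ⟨g, hg, hgx, -⟩ := hlo x hcx hxX
  have hK : IsCompact (ω ∩ {k | x ≤ k.1}) :=
    R.isCompact.inter_right (isClosed_le continuous_const continuous_fst)
  obtain ⟨k, ⟨hk, hk1⟩, hmin⟩ := hK.exists_isMinOn ⟨g, hg, hgx⟩ continuous_snd.continuousOn
  exact ⟨k, hk, hk1, h k.2 (R.bottom_of_right k hk fun h hh hh1 => hmin ⟨hh, le_trans hk1 hh1⟩)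
    x hcx hxX fun h hh hh1 => hmin ⟨hh, hh1⟩⟩

end RectRegion

/-! ### Lines that start from a crosscut -/

/-- A segment `[a, b]` of the region from which further segments start to the right and upwards.
It may degenerate to the lower left corner of the bounding box.  The field `conv` says that a line
along which one can leave the segment passes between the two endpoints. -/
structure Source (ω : Set Plane) (a b : Plane) : Prop where
  subset : segment ℝ a b ⊆ ω
  le : a.2 ≤ b.2
  nw : (∀ g ∈ ω, g.1 ≤ b.1 → g.2 ≤ b.2) ∨ b.1 ≤ a.1 ∧ ∀ g ∈ ω, b.1 ≤ g.1
  flat : a.2 < b.2 ∨ a = b ∧ (∀ g ∈ ω, a.2 ≤ g.2) ∧ ∃ g ∈ ω, g.1 ≤ b.1 ∧ b.2 < g.2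
  rise : ∀ g ∈ ω, a.1 < g.1 → b.1 < g.1 → ∃ h ∈ ω, g.1 ≤ h.1 ∧ a.2 ≤ h.2
  conv : ∀ p ∈ segment ℝ a b, ∀ α β X, 0 ≤ α → a.1 < X → b.1 < X → p = pt α β p.1 →
    segment ℝ p (pt α β X) ⊆ ω → a.2 ≤ α * a.1 + β ∧ α * b.1 + β ≤ b.2

/-- The conditions on a line of nonnegative slope that make it lead from the crosscut `[a, b]` to
the abscissa `X` inside the region: it passes between `a` and `b`, below the upper left boundary
and above the lower right boundary. -/
structure KLine (ω : Set Plane) (a b : Plane) (X α β : ℝ) : Prop where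
  slope : 0 ≤ α
  low : a.2 ≤ α * a.1 + β
  high : α * b.1 + β ≤ b.2
  up : ∀ x, b.1 ≤ x → x ≤ X → ∃ g ∈ ω, g.1 ≤ x ∧ α * x + β ≤ g.2
  lo : ∀ x, a.1 ≤ x → x ≤ X → ∃ g ∈ ω, x ≤ g.1 ∧ g.2 ≤ α * x + β
  top : ∃ g ∈ ω, X ≤ g.1 ∧ α * X + β ≤ g.2

/-- The line is tight at the abscissa `x` against `b`, the upper left boundary or the height of
the region beyond `X`. -/
def HighC (ω : Set Plane) (b : Plane) (X α β x : ℝ) : Prop :=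
  b.1 ≤ x ∧ x ≤ X ∧ ((x = b.1 ∧ α * b.1 + β = b.2) ∨
    (b.1 < x ∧ ∀ g ∈ ω, g.1 < x → g.2 ≤ α * x + β) ∨
      (x = X ∧ ∀ g ∈ ω, X ≤ g.1 → g.2 ≤ α * X + β))

/-- The line is tight at the abscissa `x` against `a` or the lower right boundary. -/
def LowC (ω : Set Plane) (a : Plane) (X α β x : ℝ) : Prop :=
  a.1 ≤ x ∧ x ≤ X ∧ ((x = a.1 ∧ α * a.1 + β = a.2) ∨ ∀ g ∈ ω, x < g.1 → α * x + β ≤ g.2)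

theorem Source.left_mem {ω : Set Plane} {a b : Plane} (S : Source ω a b) : a ∈ ω :=
  S.subset (left_mem_segment ℝ a b)

theorem Source.right_mem {ω : Set Plane} {a b : Plane} (S : Source ω a b) : b ∈ ω :=
  S.subset (right_mem_segment ℝ a b)

/-- The point of a segment that divides the abscissae in a given way. -/
theorem exists_mem_segment_fst {p q : Plane} {x : ℝ} (h : p.1 < q.1) (h1 : p.1 ≤ x)
    (h2 : x ≤ q.1) : ∃ μ, 0 ≤ μ ∧ μ ≤ 1 ∧ x = p.1 + μ * (q.1 - p.1) ∧
      (x, p.2 + μ * (q.2 - p.2)) ∈ segment ℝ p q := by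
  have hd : 0 < q.1 - p.1 := sub_pos.2 h
  refine ⟨(x - p.1) / (q.1 - p.1), div_nonneg (by linarith) hd.le,
    (div_le_one hd).2 (by linarith), by field_simp; ring, ?_⟩
  exact mem_segment_iff.2 ⟨(x - p.1) / (q.1 - p.1), div_nonneg (by linarith) hd.le,
    (div_le_one hd).2 (by linarith), by simp only; field_simp; ring, rfl⟩

theorem snd_mem_of_segment {a b p : Plane} (h : a.2 ≤ b.2) (hp : p ∈ segment ℝ a b) :
    a.2 ≤ p.2 ∧ p.2 ≤ b.2 := by
  obtain ⟨θ, h0, h1, -, h3⟩ := mem_segment_iff.1 hp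
  constructor <;> nlinarith

theorem fst_le_of_segment {a b p : Plane} {X : ℝ} (ha : a.1 ≤ X) (hb : b.1 ≤ X)
    (hp : p ∈ segment ℝ a b) : p.1 ≤ X := by
  obtain ⟨θ, h0, h1, h2, -⟩ := mem_segment_iff.1 hp
  nlinarith

theorem fst_lt_of_segment {a b p : Plane} {X : ℝ} (ha : a.1 < X) (hb : b.1 < X)
    (hp : p ∈ segment ℝ a b) : p.1 < X :=
  (fst_le_of_segment (le_max_left a.1 b.1) (le_max_right a.1 b.1) hp).trans_lt (max_lt ha hb)

section KLine

variable {ω : Set Plane} {a b : Plane} {X α β : ℝ}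

theorem Source.kLine (S : Source ω a b) {p : Plane} (hp : p ∈ segment ℝ a b) (hα : 0 ≤ α)
    (haX : a.1 < X) (hbX : b.1 < X) (hpL : p = pt α β p.1) (h : segment ℝ p (pt α β X) ⊆ ω) :
    KLine ω a b X α β := by
  obtain ⟨hlow, hhigh⟩ := S.conv p hp α β X hα haX hbX hpL h
  have hpX : p.1 < X := fst_lt_of_segment haX hbX hp
  have hp2 : p.2 = α * p.1 + β := congrArg Prod.snd hpL
  have hmem : ∀ x, p.1 ≤ x → x ≤ X → pt α β x ∈ ω := fun x h1 h2 => by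
    apply h
    rw [hpL, mem_segment_pt hpX.le]
    exact ⟨h1, h2, rfl⟩
  obtain ⟨hpa, hpb⟩ := snd_mem_of_segment S.le hp
  refine ⟨hα, hlow, hhigh, fun x h1 h2 => ?_, fun x h1 h2 => ?_, ⟨_, hmem X hpX.le le_rfl, le_rfl,
    le_rfl⟩⟩
  · rcases le_or_gt p.1 x with h3 | h3
    · exact ⟨_, hmem x h3 h2, le_rfl, le_rfl⟩
    · exact ⟨b, S.right_mem, h1, by nlinarith⟩
  · rcases le_or_gt p.1 x with h3 | h3
    · exact ⟨_, hmem x h3 h2, le_rfl, le_rfl⟩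
    · obtain ⟨μ, h0, h1', hx, hm⟩ := exists_mem_segment_fst (h1.trans_lt h3) h1 h3.le
      refine ⟨_, S.subset (segment_subset_segment (left_mem_segment ℝ a b) hp hm), le_rfl, ?_⟩
      simp only
      rw [hp2, hx]
      nlinarith

/-- A line satisfying the conditions of `KLine` does start on the crosscut and stays inside the
region; it starts in the lower end whenever it passes through it. -/
theorem KLine.exists_start {G : Set (Set Plane)} {F : Set ℝ} (R : RectRegion ω G F)
    (S : Source ω a b) (K : KLine ω a b X α β) (haX : a.1 < X) (hbX : b.1 < X) :
    ∃ p ∈ segment ℝ a b, p = pt α β p.1 ∧ p.1 < X ∧ (α * a.1 + β = a.2 → p = a) ∧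
      segment ℝ p (pt α β X) ⊆ ω := by
  set f0 := α * a.1 + β - a.2 with hf0
  set f1 := α * b.1 + β - b.2 with hf1
  have h0 : 0 ≤ f0 := by have := K.low; linarith
  have h1 : f1 ≤ 0 := by have := K.high; linarith
  obtain ⟨θ, hθ0, hθ1, hθ, hθa⟩ : ∃ θ : ℝ, 0 ≤ θ ∧ θ ≤ 1 ∧ f0 + θ * (f1 - f0) = 0 ∧
      (f0 = 0 → θ = 0) := by
    rcases h0.eq_or_lt with h0 | h0
    · exact ⟨0, le_rfl, zero_le_one, by rw [← h0]; ring, fun _ => rfl⟩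
    · have hd : 0 < f0 - f1 := by linarith
      exact ⟨f0 / (f0 - f1), by positivity, (div_le_one hd).2 (by linarith),
        by field_simp; ring, fun h => absurd h h0.ne'⟩
  have hp : ((a.1 + θ * (b.1 - a.1), a.2 + θ * (b.2 - a.2)) : Plane) ∈ segment ℝ a b :=
    mem_segment_iff.2 ⟨θ, hθ0, hθ1, rfl, rfl⟩
  set p : Plane := (a.1 + θ * (b.1 - a.1), a.2 + θ * (b.2 - a.2)) with hpdef
  have hp2 : p.2 = α * p.1 + β := by
    simp only [hpdef]
    linear_combination -hθ
  have hpL : p = pt α β p.1 := Prod.ext rfl hp2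
  have hpX : p.1 < X := fst_lt_of_segment haX hbX hp
  refine ⟨p, hp, hpL, hpX, fun h => ?_, fun z hz => ?_⟩
  · rw [hpdef, hθa (by rw [hf0]; linarith)]
    exact Prod.ext (by simp) (by simp)
  rw [hpL, mem_segment_pt hpX.le] at hz
  obtain ⟨hz1, hz2, hz3⟩ := hz
  obtain ⟨g, hg, hg1, hg2⟩ := K.top
  have hup : ∃ g ∈ ω, g.1 ≤ z.1 ∧ z.2 ≤ g.2 := by
    rw [hz3]
    rcases le_or_gt b.1 z.1 with h3 | h3
    · exact K.up z.1 h3 hz2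
    · obtain ⟨μ, h0, h1', hx, hm⟩ := exists_mem_segment_fst (hz1.trans_lt h3) hz1 h3.le
      refine ⟨_, S.subset (segment_subset_segment hp (right_mem_segment ℝ a b) hm), le_rfl, ?_⟩
      simp only
      rw [hp2, hx]
      have := K.high
      nlinarith
  have hlo : ∃ g ∈ ω, z.1 ≤ g.1 ∧ g.2 ≤ z.2 := by
    rw [hz3]
    rcases le_or_gt a.1 z.1 with h3 | h3
    · exact K.lo z.1 h3 hz2
    · obtain ⟨μ, h0, h1', hx, hm⟩ := exists_mem_segment_fst (hz1.trans_lt h3) hz1 h3.le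
      refine ⟨_, S.subset (segment_subset_segment hp (left_mem_segment ℝ a b) hm), le_rfl, ?_⟩
      simp only
      rw [hp2, hx]
      have := K.low
      nlinarith
  obtain ⟨n, hn, hn1, hn2⟩ := hup
  obtain ⟨s, hs, hs1, hs2⟩ := hlo
  have hα := K.slope
  exact R.mem_of_quadrants hn hn1 hn2 hg (hz2.trans hg1) (by rw [hz3]; nlinarith) (S.subset hp) hz1
    (by rw [hz3, hp2]; nlinarith) hs hs1 hs2

/-- Admissibility of a line survives a small change that does not raise it at its contacts from
above and does not lower it at its contacts from below. -/
theorem KLine.eventually {G : Set (Set Plane)} {F : Set ℝ} (R : RectRegion ω G F)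
    (S : Source ω a b) (K : KLine ω a b X α β) (hbX : b.1 < X) {m₁ m₀ : ℝ}
    (hH : ∀ x, HighC ω b X α β x → m₁ * x + m₀ ≤ 0)
    (hL : ∀ x, LowC ω a X α β x → 0 ≤ m₁ * x + m₀)
    (haX : a.1 < X) (hs : ∀ᶠ ε in 𝓝[>] (0 : ℝ), 0 ≤ α + ε * m₁) :
    ∀ᶠ ε in 𝓝[>] (0 : ℝ), KLine ω a b X (α + ε * m₁) (β + ε * m₀) := by
  have hpos : ∀ᶠ ε in 𝓝[>] (0 : ℝ), 0 < ε := self_mem_nhdsWithin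
  have h1 : ∀ᶠ ε in 𝓝[>] (0 : ℝ), a.2 ≤ (α + ε * m₁) * a.1 + (β + ε * m₀) := by
    rcases K.low.lt_or_eq with h | h
    · exact (eventually_lt_line h).mono fun ε h => h.le
    · have := hL a.1 ⟨le_rfl, haX.le, Or.inl ⟨rfl, h.symm⟩⟩
      filter_upwards [hpos] with ε hε
      nlinarith
  have h2 : ∀ᶠ ε in 𝓝[>] (0 : ℝ), (α + ε * m₁) * b.1 + (β + ε * m₀) ≤ b.2 := by
    rcases K.high.lt_or_eq with h | h
    · exact (eventually_line_lt h).mono fun ε h => h.le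
    · have := hH b.1 ⟨le_rfl, hbX.le, Or.inl ⟨rfl, h⟩⟩
      filter_upwards [hpos] with ε hε
      nlinarith
  have h3 := R.eventually_up (m₁ := m₁) (m₀ := m₀) K.up (fun x hx hxX hg hx0 => by
    refine hH x ⟨hx, hxX, ?_⟩
    rcases hx.eq_or_lt with rfl | hx
    · exact Or.inl ⟨rfl, le_antisymm K.high (hx0 rfl b S.right_mem le_rfl)⟩
    · exact Or.inr (Or.inl ⟨hx, hg⟩)) hs
  have h4 := R.eventually_lo (m₁ := m₁) (m₀ := m₀) K.lo (fun x hx hxX hg =>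
    hL x ⟨hx, hxX, Or.inr hg⟩) hs
  have h5 : ∀ᶠ ε in 𝓝[>] (0 : ℝ), ∃ g ∈ ω, X ≤ g.1 ∧ (α + ε * m₁) * X + (β + ε * m₀) ≤ g.2 := by
    by_cases h : ∃ g ∈ ω, X ≤ g.1 ∧ α * X + β < g.2
    · obtain ⟨g, hg, hg1, hg2⟩ := h
      exact (eventually_line_lt hg2).mono fun ε h => ⟨g, hg, hg1, h.le⟩
    · push Not at h
      have := hH X ⟨hbX.le, le_rfl, Or.inr (Or.inr ⟨rfl, h⟩)⟩
      obtain ⟨g, hg, hg1, hg2⟩ := K.top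
      filter_upwards [hpos] with ε hε
      exact ⟨g, hg, hg1, by nlinarith⟩
  filter_upwards [h1, h2, h3, h4, h5, hs] with ε h1 h2 h3 h4 h5 h6
  exact ⟨h6, h1, h2, h3, h4, h5⟩

/-- A line that ends as high as possible at `X` and is as steep as possible under this condition
cannot be turned counterclockwise: it is tight from below before it is tight from above. -/
theorem KLine.exists_lowC_lt_highC {G : Set (Set Plane)} {F : Set ℝ} (R : RectRegion ω G F)
    (S : Source ω a b) (K : KLine ω a b X α β) (haX : a.1 < X) (hbX : b.1 < X)
    (hmax : ∀ α' β', KLine ω a b X α' β' → α' * X + β' ≤ α * X + β ∧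
      (α' * X + β' = α * X + β → α' ≤ α)) :
    ∃ xC xV, LowC ω a X α β xC ∧ HighC ω b X α β xV ∧ xC < xV := by
  by_contra! hc
  -- Otherwise some `x0` separates the contacts from above, on its left, from the contacts from
  -- below. Turning the line counterclockwise about `x0` makes it steeper and does not lower its
  -- end.
  obtain ⟨x0, hx0, hH, hL⟩ : ∃ x0 ≤ X, (∀ x, HighC ω b X α β x → x ≤ x0) ∧
      ∀ x, LowC ω a X α β x → x0 ≤ x := by
    by_cases h : ∃ x, HighC ω b X α β x
    · obtain ⟨x, hx⟩ := h
      have hbdd : BddAbove {x | HighC ω b X α β x} := ⟨X, fun x hx => hx.2.1⟩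
      exact ⟨sSup {x | HighC ω b X α β x}, csSup_le ⟨x, hx⟩ fun y hy => hy.2.1,
        fun y hy => le_csSup hbdd hy, fun y hy => csSup_le ⟨x, hx⟩ fun z hz => hc y z hy hz⟩
    · exact ⟨a.1, haX.le, fun x hx => absurd ⟨x, hx⟩ h, fun x hx => hx.1⟩
  have hs : ∀ᶠ ε in 𝓝[>] (0 : ℝ), 0 ≤ α + ε * 1 := by
    filter_upwards [self_mem_nhdsWithin] with ε hε
    have := K.slope
    have : 0 < ε := hε
    linarith
  obtain ⟨ε, hK, hε⟩ := ((K.eventually R S hbX (m₁ := 1) (m₀ := -x0)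
    (fun x hx => by have := hH x hx; linarith) (fun x hx => by have := hL x hx; linarith) haX
    hs).and self_mem_nhdsWithin).exists
  have hε : 0 < ε := hε
  obtain ⟨h1, h2⟩ := hmax _ _ hK
  have : α + ε * 1 ≤ α := h2 (le_antisymm h1 (by nlinarith))
  linarith

/-- A line of positive slope that ends as low as possible at `X`, where it is not tight from
below, is tight from above before it is tight from below. -/
theorem KLine.exists_highC_lt_lowC {G : Set (Set Plane)} {F : Set ℝ} (R : RectRegion ω G F)
    (S : Source ω a b) (K : KLine ω a b X α β) (haX : a.1 < X) (hbX : b.1 < X) (hα : 0 < α)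
    (hmin : ∀ α' β', KLine ω a b X α' β' → α * X + β ≤ α' * X + β')
    (hX : ∃ g ∈ ω, X < g.1 ∧ g.2 < α * X + β) :
    ∃ xV xC, HighC ω b X α β xV ∧ LowC ω a X α β xC ∧ xV < xC ∧ xC < X := by
  obtain ⟨g, hg, hgX, hg2⟩ := hX
  -- The lower boundary goes down to `g.2` beyond `X`, so an increasing line cannot touch it where
  -- the line is higher than `g.2`.
  obtain ⟨x1, hx1, hLx⟩ : ∃ x1 < X, ∀ x, LowC ω a X α β x → x ≤ x1 := by
    refine ⟨max a.1 ((g.2 - β) / α), max_lt haX ((div_lt_iff₀ hα).2 (by linarith)), ?_⟩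
    rintro x ⟨-, hxX, ⟨rfl, -⟩ | h⟩
    · exact le_max_left _ _
    · have := h g hg (hxX.trans_lt hgX)
      exact ((le_div_iff₀ hα).2 (by linarith)).trans (le_max_right _ _)
  by_contra! hc
  have hc' : ∀ xV xC, HighC ω b X α β xV → LowC ω a X α β xC → xC ≤ xV := by
    intro xV xC h1 h2
    by_contra h3
    exact absurd (hc xV xC h1 h2 (not_le.1 h3)) (not_le.2 ((hLx xC h2).trans_lt hx1))
  -- Turning the line clockwise about a pivot `x0 < X` that separates the contacts lowers its end.
  obtain ⟨x0, hx0, hH, hL⟩ : ∃ x0 < X, (∀ x, HighC ω b X α β x → x0 ≤ x) ∧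
      ∀ x, LowC ω a X α β x → x ≤ x0 := by
    by_cases h : ∃ x, LowC ω a X α β x
    · obtain ⟨x, hx⟩ := h
      have hbdd : BddAbove {x | LowC ω a X α β x} := ⟨x1, hLx⟩
      exact ⟨sSup {x | LowC ω a X α β x}, (csSup_le ⟨x, hx⟩ hLx).trans_lt hx1,
        fun y hy => csSup_le ⟨x, hx⟩ fun z hz => hc' y z hy hz, fun y hy => le_csSup hbdd hy⟩
    · exact ⟨b.1, hbX, fun x hx => hx.1, fun x hx => absurd ⟨x, hx⟩ h⟩
  have hs : ∀ᶠ ε in 𝓝[>] (0 : ℝ), 0 ≤ α + ε * (-1) := by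
    filter_upwards [Ioo_mem_nhdsGT hα] with ε hε
    have := hε.2
    linarith
  obtain ⟨ε, hK, hε⟩ := ((K.eventually R S hbX (m₁ := -1) (m₀ := x0)
    (fun x hx => by have := hH x hx; linarith) (fun x hx => by have := hL x hx; linarith) haX
    hs).and self_mem_nhdsWithin).exists
  have hε : 0 < ε := hε
  have := hmin _ _ hK
  nlinarith

end KLine

/-! ### Lines of furthest reach -/

section KLine

variable {ω : Set Plane} {G : Set (Set Plane)} {F : Set ℝ} {a b : Plane} {X α β : ℝ}

theorem line_le_of_forall_lt {α β x₁ x₂ u : ℝ} (h : x₁ < x₂)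
    (hu : ∀ x, x₁ < x → x < x₂ → α * x + β ≤ u) : α * x₂ + β ≤ u := by
  have hc : Tendsto (fun x => α * x + β) (𝓝[<] x₂) (𝓝 (α * x₂ + β)) :=
    (Continuous.tendsto (by fun_prop) x₂).mono_left nhdsWithin_le_nhds
  exact le_of_tendsto hc (by filter_upwards [Ioo_mem_nhdsLT h] with x hx using hu x hx.1 hx.2)

theorem le_line_of_forall_gt {α β x₁ x₂ u : ℝ} (h : x₁ < x₂)
    (hu : ∀ x, x₁ < x → x < x₂ → u ≤ α * x + β) : u ≤ α * x₁ + β := by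
  have hc : Tendsto (fun x => α * x + β) (𝓝[>] x₁) (𝓝 (α * x₁ + β)) :=
    (Continuous.tendsto (by fun_prop) x₁).mono_left nhdsWithin_le_nhds
  exact ge_of_tendsto hc (by filter_upwards [Ioo_mem_nhdsGT h] with x hx using hu x hx.1 hx.2)

/-- A line that leads from the crosscut to its furthest possible abscissa, ends there as high as
possible, and is as steep as possible under these conditions. -/
structure Extremal (ω : Set Plane) (a b : Plane) (X α β : ℝ) : Prop where
  left_lt : a.1 < X
  right_lt : b.1 < X
  kLine : KLine ω a b X α β
  far : ∀ X' α' β', a.1 < X' → b.1 < X' → KLine ω a b X' α' β' → X' ≤ X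
  best : ∀ α' β', KLine ω a b X α' β' → α' * X + β' ≤ α * X + β ∧
    (α' * X + β' = α * X + β → α' ≤ α)

/-- The segments that start on the crosscut and do not descend. -/
def risingFrom (ω : Set Plane) (a b : Plane) : Set (Plane × Plane) :=
  (segment ℝ a b ×ˢ ω) ∩ {pq | segment ℝ pq.1 pq.2 ⊆ ω} ∩ {pq | pq.1.2 ≤ pq.2.2}

theorem isCompact_risingFrom (hω : IsCompact ω) : IsCompact (risingFrom ω a b) :=
  ((((isCompact_segment a b).prod hω).inter_right (isClosed_segment_subset hω.isClosed))).inter_right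
    (isClosed_le (by fun_prop) (by fun_prop))

theorem KLine.exists_risingFrom (R : RectRegion ω G F) (S : Source ω a b)
    (K : KLine ω a b X α β) (haX : a.1 < X) (hbX : b.1 < X) :
    ∃ p, p = pt α β p.1 ∧ (p, pt α β X) ∈ risingFrom ω a b := by
  obtain ⟨p, hp, hpL, hpX, -, h⟩ := K.exists_start R S haX hbX
  refine ⟨p, hpL, ⟨⟨hp, h (right_mem_segment ℝ _ _)⟩, h⟩, ?_⟩
  have hp2 : p.2 = α * p.1 + β := congrArg Prod.snd hpL
  have := mul_le_mul_of_nonneg_left hpX.le K.slope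
  simp only [mem_ofPred_eq, pt_snd]
  linarith

theorem Source.exists_kLine_of_risingFrom (S : Source ω a b) {p q : Plane}
    (h : (p, q) ∈ risingFrom ω a b) (haq : a.1 < q.1) (hbq : b.1 < q.1) :
    KLine ω a b q.1 ((q.2 - p.2) / (q.1 - p.1)) (q.2 - (q.2 - p.2) / (q.1 - p.1) * q.1) := by
  obtain ⟨⟨⟨hp, -⟩, hs⟩, hle⟩ := h
  have hpq : p.1 < q.1 := fst_lt_of_segment haq hbq hp
  have hd : 0 < q.1 - p.1 := sub_pos.2 hpq
  have hle : p.2 ≤ q.2 := hle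
  have e : pt ((q.2 - p.2) / (q.1 - p.1)) (q.2 - (q.2 - p.2) / (q.1 - p.1) * q.1) q.1 = q :=
    Prod.ext rfl (by simp)
  refine S.kLine hp (div_nonneg (by linarith) hd.le) haq hbq (Prod.ext rfl ?_) (by rw [e]; exact hs)
  simp only [pt_snd]
  field_simp
  ring

/-- Successive maximisation over the compact set `risingFrom` of segments that leave the crosscut:
first the abscissa of the end, then its height, then the slope. A line with the lowest end at the
same abscissa exists as well. -/
theorem Source.exists_extremal (R : RectRegion ω G F) (S : Source ω a b)
    (h0 : ∃ X α β, a.1 < X ∧ b.1 < X ∧ KLine ω a b X α β) :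
    ∃ X α β, Extremal ω a b X α β ∧
      ∃ α₀ β₀, KLine ω a b X α₀ β₀ ∧ ∀ α' β', KLine ω a b X α' β' → α₀ * X + β₀ ≤ α' * X + β' := by
  have hN := isCompact_risingFrom (a := a) (b := b) R.isCompact
  obtain ⟨X1, α1, β1, ha1, hb1, K1⟩ := h0
  obtain ⟨p1, -, h1⟩ := K1.exists_risingFrom R S ha1 hb1
  obtain ⟨⟨p2, q2⟩, h2, hmax⟩ := hN.exists_isMaxOn ⟨_, h1⟩ (f := fun pq => pq.2.1) (by fun_prop)
  have hX1 : X1 ≤ q2.1 := hmax h1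
  set X := q2.1
  have haX : a.1 < X := ha1.trans_le hX1
  have hbX : b.1 < X := hb1.trans_le hX1
  have hN2 : IsCompact (risingFrom ω a b ∩ {pq | pq.2.1 = X}) :=
    hN.inter_right (isClosed_eq (by fun_prop) (by fun_prop))
  have far : ∀ X' α' β', a.1 < X' → b.1 < X' → KLine ω a b X' α' β' → X' ≤ X := by
    intro X' α' β' ha' hb' K'
    obtain ⟨p', -, h'⟩ := K'.exists_risingFrom R S ha' hb'
    exact hmax h'
  obtain ⟨⟨p3, q3⟩, h3, hmax3⟩ := hN2.exists_isMaxOn ⟨(p2, q2), h2, rfl⟩ (f := fun pq => pq.2.2)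
    (by fun_prop)
  obtain ⟨⟨p5, q5⟩, h5, hmin5⟩ := hN2.exists_isMinOn ⟨(p2, q2), h2, rfl⟩ (f := fun pq => pq.2.2)
    (by fun_prop)
  have hN3 : IsCompact (risingFrom ω a b ∩ {pq | pq.2.1 = X} ∩ {pq | pq.2.2 = q3.2}) :=
    hN2.inter_right (isClosed_eq (by fun_prop) (by fun_prop))
  obtain ⟨⟨p4, q4⟩, ⟨⟨h4, h4X⟩, h4y⟩, hmax4⟩ := hN3.exists_isMaxOn ⟨(p3, q3), h3, rfl⟩
    (f := fun pq => (pq.2.2 - pq.1.2) / (pq.2.1 - pq.1.1)) (by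
      refine ContinuousOn.div (by fun_prop) (by fun_prop) ?_
      rintro ⟨p, q⟩ ⟨⟨⟨⟨⟨hp, -⟩, -⟩, -⟩, hq⟩, -⟩
      have : p.1 < X := fst_lt_of_segment haX hbX hp
      have hq : q.1 = X := hq
      simp only
      linarith)
  have h4X : q4.1 = X := h4X
  have h4y : q4.2 = q3.2 := h4y
  have h5X : q5.1 = X := h5.2
  have K4 := S.exists_kLine_of_risingFrom h4 (by rw [h4X]; exact haX) (by rw [h4X]; exact hbX)
  have K5 := S.exists_kLine_of_risingFrom h5.1 (by rw [h5X]; exact haX) (by rw [h5X]; exact hbX)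
  rw [h4X, h4y] at K4
  rw [h5X] at K5
  refine ⟨X, _, _, ⟨haX, hbX, K4, far, fun α' β' K' => ?_⟩, _, _, K5, fun α' β' K' => ?_⟩
  · obtain ⟨p', hp', h'⟩ := K'.exists_risingFrom R S haX hbX
    have hle : α' * X + β' ≤ q3.2 := hmax3 (a := (p', pt α' β' X)) ⟨h', rfl⟩
    refine ⟨by linarith, fun heq => ?_⟩
    have hsl := hmax4 (a := (p', pt α' β' X)) ⟨⟨h', rfl⟩, by
      simp only [mem_ofPred_eq, pt_snd]; linarith⟩
    simp only [mem_ofPred_eq, pt_snd, pt_fst] at hsl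
    have hp'X : p'.1 < X := fst_lt_of_segment haX hbX h'.1.1.1
    have hp2 : p'.2 = α' * p'.1 + β' := congrArg Prod.snd hp'
    rw [h4X, h4y] at hsl
    rwa [hp2, show α' * X + β' - (α' * p'.1 + β') = α' * (X - p'.1) by ring,
      mul_div_cancel_right₀ _ (sub_pos.2 hp'X).ne'] at hsl
  · obtain ⟨p', hp', h'⟩ := K'.exists_risingFrom R S haX hbX
    have hle : q5.2 ≤ α' * X + β' := hmin5 (a := (p', pt α' β' X)) ⟨h', rfl⟩
    linarith

/-- A point to the right of the crosscut that is not higher than it is reached horizontally. -/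
theorem Source.kLine_horizontal (S : Source ω a b) {q : Plane}
    (hq : q ∈ ω) (haq : a.1 < q.1) (hbq : b.1 < q.1) (hqb : q.2 ≤ b.2) :
    KLine ω a b q.1 0 (max q.2 a.2) := by
  have hab := S.le
  refine ⟨le_rfl, ?_, ?_, fun x h1 h2 => ⟨b, S.right_mem, h1, ?_⟩, fun x h1 h2 =>
    ⟨q, hq, h2, ?_⟩, ?_⟩
  · simp
  · simp [hqb, hab]
  · simp [hqb, hab]
  · simp
  · rcases le_total a.2 q.2 with h | h
    · exact ⟨q, hq, le_rfl, by simp [h]⟩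
    · obtain ⟨r, hr, hr1, hr2⟩ := S.rise q hq haq hbq
      exact ⟨r, hr, hr1, by simp [h, hr2]⟩

/-- Whatever is reached from the crosscut by a segment is reached by a segment that does not
descend. -/
theorem Source.exists_kLine (S : Source ω a b) {p q : Plane}
    (hp : p ∈ segment ℝ a b) (hpq : segment ℝ p q ⊆ ω) (haq : a.1 < q.1) (hbq : b.1 < q.1) :
    ∃ α β, KLine ω a b q.1 α β ∧ α * q.1 + β = max q.2 a.2 := by
  have hq : q ∈ ω := hpq (right_mem_segment ℝ p q)
  obtain ⟨hpa, hpb⟩ := snd_mem_of_segment S.le hp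
  rcases le_total p.2 q.2 with h | h
  · refine ⟨_, _, S.exists_kLine_of_risingFrom (p := p) (q := q) ⟨⟨⟨hp, hq⟩, hpq⟩, h⟩ haq hbq, ?_⟩
    rw [max_eq_left (hpa.trans h)]
    ring
  · exact ⟨_, _, S.kLine_horizontal hq haq hbq (h.trans hpb), by simp⟩

theorem KLine.pt_mem (R : RectRegion ω G F) (S : Source ω a b) (K : KLine ω a b X α β)
    (haX : a.1 < X) (hbX : b.1 < X) : pt α β X ∈ ω := by
  obtain ⟨p, -, -, -, -, h⟩ := K.exists_start R S haX hbX
  exact h (right_mem_segment ℝ _ _)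

/-- The lines that lead to the same abscissa form a convex set. -/
theorem KLine.combo {α' β' c d : ℝ} (K : KLine ω a b X α β) (K' : KLine ω a b X α' β')
    (hc : 0 ≤ c) (hd : 0 ≤ d) (hcd : c + d = 1) :
    KLine ω a b X (c * α + d * α') (c * β + d * β') := by
  have e : ∀ x, (c * α + d * α') * x + (c * β + d * β') = c * (α * x + β) + d * (α' * x + β') :=
    fun x => by ring
  have hle : ∀ {u v w : ℝ}, u ≤ w → v ≤ w → c * u + d * v ≤ w := fun hu hv => by
    calc _ ≤ c * _ + d * _ := add_le_add (mul_le_mul_of_nonneg_left hu hc)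
          (mul_le_mul_of_nonneg_left hv hd)
      _ = _ := by rw [← add_mul, hcd, one_mul]
  have hge : ∀ {u v w : ℝ}, w ≤ u → w ≤ v → w ≤ c * u + d * v := fun hu hv => by
    calc _ = c * _ + d * _ := by rw [← add_mul, hcd, one_mul]
      _ ≤ _ := add_le_add (mul_le_mul_of_nonneg_left hu hc) (mul_le_mul_of_nonneg_left hv hd)
  refine ⟨add_nonneg (mul_nonneg hc K.slope) (mul_nonneg hd K'.slope), ?_, ?_, fun x h1 h2 => ?_,
    fun x h1 h2 => ?_, ?_⟩
  · rw [e]; exact hge K.low K'.low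
  · rw [e]; exact hle K.high K'.high
  · rw [e]
    obtain ⟨g, hg, hg1, hg2⟩ := K.up x h1 h2
    obtain ⟨h, hh, hh1, hh2⟩ := K'.up x h1 h2
    rcases le_total g.2 h.2 with hgh | hgh
    · exact ⟨h, hh, hh1, hle (hg2.trans hgh) hh2⟩
    · exact ⟨g, hg, hg1, hle hg2 (hh2.trans hgh)⟩
  · rw [e]
    obtain ⟨g, hg, hg1, hg2⟩ := K.lo x h1 h2
    obtain ⟨h, hh, hh1, hh2⟩ := K'.lo x h1 h2
    rcases le_total g.2 h.2 with hgh | hgh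
    · exact ⟨g, hg, hg1, hge hg2 (hgh.trans hh2)⟩
    · exact ⟨h, hh, hh1, hge (hgh.trans hg2) hh2⟩
  · rw [e]
    obtain ⟨g, hg, hg1, hg2⟩ := K.top
    obtain ⟨h, hh, hh1, hh2⟩ := K'.top
    rcases le_total g.2 h.2 with hgh | hgh
    · exact ⟨h, hh, hh1, hle (hg2.trans hgh) hh2⟩
    · exact ⟨g, hg, hg1, hle hg2 (hh2.trans hgh)⟩

/-- What stops a line at the furthest possible abscissa: the upper boundary to the left, the lower
boundary to the right, or the upper boundary to the right. -/
theorem KLine.stopped (K : KLine ω a b X α β) (haX : a.1 < X) (hbX : b.1 < X)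
    (far : ∀ X' α' β', a.1 < X' → b.1 < X' → KLine ω a b X' α' β' → X' ≤ X) :
    (∀ g ∈ ω, g.1 ≤ X → g.2 ≤ α * X + β) ∨ (∀ g ∈ ω, X < g.1 → α * X + β < g.2) ∨
      ∀ g ∈ ω, X < g.1 → g.2 ≤ α * X + β := by
  by_contra! hc
  -- Otherwise the same line leads slightly further.
  obtain ⟨⟨n, hn, hn1, hn2⟩, ⟨s, hs, hs1, hs2⟩, ⟨t, ht, ht1, ht2⟩⟩ := hc
  have hcont : Tendsto (fun x => α * x + β) (𝓝[>] X) (𝓝 (α * X + β)) :=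
    (Continuous.tendsto (by fun_prop) X).mono_left nhdsWithin_le_nhds
  have hev : ∀ᶠ x in 𝓝[>] X, (α * x + β < n.2 ∧ α * x + β < t.2) ∧ x ∈ Ioo X s.1 ∧
      x ∈ Ioo X t.1 := by
    filter_upwards [hcont.eventually_lt_const hn2, hcont.eventually_lt_const ht2,
      Ioo_mem_nhdsGT hs1, Ioo_mem_nhdsGT ht1] with x h1 h2 h3 h4
    exact ⟨⟨h1, h2⟩, h3, h4⟩
  obtain ⟨X', ⟨h1, h2⟩, h3, h4⟩ := hev.exists
  have hXX : X < X' := h3.1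
  have hα := K.slope
  refine absurd (far X' α β (haX.trans hXX) (hbX.trans hXX) ⟨hα, K.low, K.high, fun x hx hx' => ?_,
    fun x hx hx' => ?_, t, ht, h4.2.le, h2.le⟩) (not_le.2 hXX)
  · rcases le_or_gt x X with h | h
    · exact K.up x hx h
    · exact ⟨n, hn, hn1.trans h.le, by nlinarith⟩
  · rcases le_or_gt x X with h | h
    · exact K.lo x hx h
    · exact ⟨s, hs, hx'.trans h3.2.le, by nlinarith⟩

theorem HighC.nw {x : ℝ} (S : Source ω a b) (h : HighC ω b X α β x) (hx : x < X) :
    ∀ g ∈ ω, g.1 < x → g.2 ≤ α * x + β := by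
  obtain ⟨-, -, ⟨rfl, h⟩ | ⟨-, h⟩ | ⟨rfl, -⟩⟩ := h
  · rw [h]
    intro g hg hgx
    rcases S.nw with h1 | h1
    · exact h1 g hg hgx.le
    · exact absurd hgx (not_lt.2 (h1.2 g hg))
  · exact h
  · exact absurd hx (lt_irrefl _)

theorem LowC.se {x : ℝ} (h : LowC ω a X α β x) (ha : a.1 < x ∨ ∀ g ∈ ω, a.1 < g.1 → a.2 ≤ g.2) :
    ∀ g ∈ ω, x < g.1 → α * x + β ≤ g.2 := by
  obtain ⟨-, -, ⟨rfl, h⟩ | h⟩ := h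
  · rw [h]
    exact ha.resolve_left (lt_irrefl _)
  · exact h

/-- Every line from the crosscut passes below a point where another one is tight from above. -/
theorem KLine.le_of_highC {X' α' β' x : ℝ} (K' : KLine ω a b X' α' β') (h : HighC ω b X α β x)
    (hx : x < X) (hx' : x ≤ X') : α' * x + β' ≤ α * x + β := by
  obtain ⟨-, -, ⟨rfl, h⟩ | ⟨hbx, h⟩ | ⟨rfl, -⟩⟩ := h
  · rw [h]
    exact K'.high
  · refine line_le_of_forall_lt hbx fun y hy1 hy2 => ?_
    obtain ⟨g, hg, hg1, hg2⟩ := K'.up y hy1.le (hy2.le.trans hx')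
    exact hg2.trans (h g hg (hg1.trans_lt hy2))
  · exact absurd hx (lt_irrefl _)

/-- Every line from the crosscut passes above a point where another one is tight from below. -/
theorem KLine.ge_of_lowC {X' α' β' x : ℝ} (K' : KLine ω a b X' α' β') (h : LowC ω a X α β x)
    (hx : x < X') : α * x + β ≤ α' * x + β' := by
  obtain ⟨hax, -, ⟨rfl, h⟩ | h⟩ := h
  · rw [h]
    exact K'.low
  · refine le_line_of_forall_gt hx fun y hy1 hy2 => ?_
    obtain ⟨g, hg, hg1, hg2⟩ := K'.lo y (hax.trans hy1.le) hy2.le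
    exact (h g hg (hy1.trans_le hg1)).trans hg2

/-- The region beyond an abscissa has a lowest height, which is attained there, since only finitely
many values are possible. -/
theorem exists_bottom_value (R : RectRegion ω G F) (h : ∃ g ∈ ω, X < g.1) :
    ∃ m, (∀ g ∈ ω, X < g.1 → m ≤ g.2) ∧ ∃ g ∈ ω, X < g.1 ∧ g.2 = m := by
  have hV : {f ∈ F | ∃ g ∈ ω, X < g.1 ∧ g.2 = f}.Finite := R.finite.subset (sep_subset _ _)
  obtain ⟨g, hg, hgX⟩ := h
  obtain ⟨k, hk, hk1, hk2, hkF, -⟩ := R.exists_bottom_of_right hg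
  obtain ⟨m, ⟨-, hm⟩, hmin⟩ := hV.exists_minimalFor id _ ⟨k.2, hkF, k, hk, hgX.trans_le hk1, rfl⟩
  refine ⟨m, fun g hg hgX => ?_, hm⟩
  obtain ⟨k, hk, hk1, hk2, hkF, -⟩ := R.exists_bottom_of_right hg
  have hkV : k.2 ∈ {f ∈ F | ∃ g ∈ ω, X < g.1 ∧ g.2 = f} := ⟨hkF, k, hk, hgX.trans_le hk1, rfl⟩
  rcases le_total m k.2 with h | h
  · exact h.trans hk2
  · exact (hmin hkV h).trans hk2

/-- If the lower boundary to the right does not stop the highest line, then it does not even touch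
the lowest one. -/
theorem Extremal.exists_lower (R : RectRegion ω G F) (S : Source ω a b)
    (E : Extremal ω a b X α β) {α₀ β₀ : ℝ} (K₀ : KLine ω a b X α₀ β₀)
    (hns : ∃ g ∈ ω, X < g.1 ∧ g.2 ≤ α * X + β) : ∃ g ∈ ω, X < g.1 ∧ g.2 < α₀ * X + β₀ := by
  by_contra! hc
  obtain ⟨g₁, hg₁, hg₁X, hg₁y⟩ := hns
  obtain ⟨m, hm, g, hg, hgX, rfl⟩ := exists_bottom_value R ⟨g₁, hg₁, hg₁X⟩
  have h0 : α₀ * X + β₀ ≤ g.2 := hc g hg hgX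
  have h1 : g.2 ≤ α * X + β := (hm g₁ hg₁ hg₁X).trans hg₁y
  -- A convex combination of the two lines ends exactly at the height of the lowest point beyond
  -- `X`. Nothing stops this line at `X`.
  obtain ⟨c, d, hc0, hd0, hcd, hval⟩ : ∃ c d : ℝ, 0 ≤ c ∧ 0 ≤ d ∧ c + d = 1 ∧
      c * (α₀ * X + β₀) + d * (α * X + β) = g.2 := by
    have : g.2 ∈ segment ℝ (α₀ * X + β₀) (α * X + β) := by
      rw [segment_eq_Icc (h0.trans h1)]
      exact ⟨h0, h1⟩
    obtain ⟨c, d, h1, h2, h3, h4⟩ := this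
    exact ⟨c, d, h1, h2, h3, by simpa using h4⟩
  have K := K₀.combo E.kLine hc0 hd0 hcd
  have hv : (c * α₀ + d * α) * X + (c * β₀ + d * β) = g.2 := by rw [← hval]; ring
  have hmem := K.pt_mem R S E.left_lt E.right_lt
  rcases K.stopped E.left_lt E.right_lt E.far with h | h | h
  · obtain ⟨k, hk, hk1, hk2⟩ := R.exists_lower_right hmem h ⟨g, hg, hgX⟩
      ⟨a, S.left_mem, Or.inl E.left_lt⟩
    have := hm k hk hk1
    rw [pt_snd, hv] at hk2
    linarith
  · have := h g hg hgX
    linarith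
  · have hopen : IsOpen {z : Plane | X < z.1} := isOpen_lt continuous_const continuous_fst
    obtain ⟨k, ⟨hk, hk1⟩, k', ⟨hk', hk1'⟩, -, hlt⟩ := R.exists_ne_of_isOpen hopen hg hgX
    have h3 := hm k hk hk1
    have h4 := h k' hk' hk1'
    linarith

/-- If the lower boundary to the right stops the extremal line, then the line is increasing and
tight from below before it is tight from above, strictly before its end. -/
theorem Extremal.lowC_lt_highC (R : RectRegion ω G F) (S : Source ω a b)
    (E : Extremal ω a b X α β) (hse : ∀ g ∈ ω, X < g.1 → α * X + β < g.2)
    (hX : ∃ g ∈ ω, X < g.1) :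
    ∃ xC xV, LowC ω a X α β xC ∧ HighC ω b X α β xV ∧ xC < xV ∧ xV < X ∧ 0 < α := by
  obtain ⟨xC, xV, hC, hV, hlt⟩ := E.kLine.exists_lowC_lt_highC R S E.left_lt E.right_lt E.best
  obtain ⟨h, hh, hhX⟩ := hX
  have hmem := E.kLine.pt_mem R S E.left_lt E.right_lt
  -- If the line were tight from above at its end, the region would be contained in the vertical
  -- line through `X` just above that end.
  have hVX : xV < X := by
    refine hV.2.1.lt_of_ne fun hEq => ?_
    rcases hV.2.2 with ⟨hb, -⟩ | ⟨-, hnw⟩ | ⟨-, htop⟩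
    · exact E.right_lt.ne (hb.symm.trans hEq)
    · rw [hEq] at hnw
      obtain ⟨η, hη, hstep⟩ := R.exists_step_right (e := pt α β X) hse
      have hopen : IsOpen {z : Plane | α * X + β < z.2 ∧ z.2 < α * X + β + η} :=
        (isOpen_lt continuous_const continuous_snd).inter (isOpen_lt continuous_snd continuous_const)
      obtain ⟨x, hx, -⟩ := R.vconn _ hmem h hh (α * X + β + η / 2) (by simp; linarith)
        (by have := hstep h hh hhX; simp only [pt_snd] at this; linarith)
      have hline : ∀ k ∈ ω, α * X + β < k.2 → k.2 < α * X + β + η → k.1 = X := by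
        intro k hk h1 h2
        rcases lt_trichotomy k.1 X with h3 | h3 | h3
        · have := hnw k hk h3
          linarith
        · exact h3
        · have := hstep k hk h3
          simp only [pt_snd] at this
          linarith
      obtain ⟨k, ⟨hk, hk1⟩, k', ⟨hk', hk1'⟩, hne, -⟩ := R.exists_ne_of_isOpen hopen hx
        ⟨by simp only; linarith, by simp only; linarith⟩
      rw [hline k hk hk1.1 hk1.2, hline k' hk' hk1'.1 hk1'.2] at hne
      exact lt_irrefl _ hne
    · exact absurd (htop h hh hhX.le) (not_le.2 (hse h hh hhX))
  -- If the line were horizontal, the region would be contained in it between `xC` and `xV`.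
  refine ⟨xC, xV, hC, hV, hlt, hVX, E.kLine.slope.lt_of_ne fun hα => ?_⟩
  have hnw := hV.nw S hVX
  simp only [← hα, zero_mul, zero_add] at hnw hC hV
  have hse' : ∀ g ∈ ω, xC < g.1 → β ≤ g.2 := by
    rcases hC.2.2 with ⟨h1, h2⟩ | h1
    · exfalso
      rw [zero_mul, zero_add] at h2
      rcases hV.2.2 with ⟨h4, h3⟩ | ⟨h3, -⟩ | ⟨h3, -⟩
      · rw [zero_mul, zero_add] at h3
        rcases S.flat with h5 | ⟨rfl, -⟩
        · linarith
        · linarith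
      · rcases S.flat with h5 | ⟨rfl, -, g, hg, hg1, hg2⟩
        · have := hnw b S.right_mem h3
          linarith
        · have := hnw g hg (hg1.trans_lt h3)
          linarith
      · linarith
    · simpa using h1
  obtain ⟨y, hy, -⟩ := R.hconn a S.left_mem h hh ((xC + xV) / 2)
    (by have := hC.1; linarith) (by linarith)
  have hopen : IsOpen {z : Plane | xC < z.1 ∧ z.1 < xV} :=
    (isOpen_lt continuous_const continuous_fst).inter (isOpen_lt continuous_fst continuous_const)
  obtain ⟨k, ⟨hk, hk1⟩, k', ⟨hk', hk1'⟩, -, hne⟩ := R.exists_ne_of_isOpen hopen hy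
    ⟨by simp only; linarith, by simp only; linarith⟩
  have h1 := hnw k' hk' hk1'.2
  have h2 := hse' k hk hk1.1
  linarith

/-- The lowest line to the furthest abscissa is increasing unless it ends at the height of `a`. -/
theorem KLine.slope_pos_of_lowest (K : KLine ω a b X α β)
    (hmin : ∀ α' β', KLine ω a b X α' β' → α * X + β ≤ α' * X + β')
    (hX : ∃ g ∈ ω, X < g.1 ∧ g.2 < α * X + β) : 0 < α ∨ (α = 0 ∧ β = a.2) := by
  refine K.slope.lt_or_eq.imp_right fun hα => ?_
  refine ⟨hα.symm, ?_⟩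
  subst hα
  have hlow := K.low
  have hhigh := K.high
  simp only [zero_mul, zero_add] at hlow hhigh hX hmin
  refine hlow.antisymm' (le_of_not_gt fun hlt => ?_)
  obtain ⟨g, hg, hgX, hgβ⟩ := hX
  -- A horizontal line above `a` and above the lower boundary could be lowered.
  have hm : max g.2 a.2 < β := max_lt hgβ hlt
  have K' : KLine ω a b X 0 (max g.2 a.2) := by
    refine ⟨le_rfl, by simp, by simpa using ⟨hgβ.le.trans hhigh, hlow.trans hhigh⟩,
      fun x h1 h2 => ?_, fun x h1 h2 => ⟨g, hg, h2.trans hgX.le, by simp⟩, ?_⟩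
    · obtain ⟨k, hk, hk1, hk2⟩ := K.up x h1 h2
      refine ⟨k, hk, hk1, ?_⟩
      simp only [zero_mul, zero_add] at hk2 ⊢
      exact hm.le.trans hk2
    · obtain ⟨k, hk, hk1, hk2⟩ := K.top
      refine ⟨k, hk, hk1, ?_⟩
      simp only [zero_mul, zero_add] at hk2 ⊢
      exact hm.le.trans hk2
  have := hmin _ _ K'
  simp only [zero_mul, zero_add] at this
  linarith

end KLine

/-! ### Crosscuts and the candidate segments that leave them -/

/-- If two lines cross between `x₁` and `x₂`, the order beyond `x₂` is that at `x₂`. -/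
theorem line_le_of_cross {α β α' β' x₁ x₂ x₃ : ℝ} (h12 : x₁ < x₂) (h23 : x₂ ≤ x₃)
    (h1 : α * x₁ + β ≤ α' * x₁ + β') (h2 : α' * x₂ + β' ≤ α * x₂ + β) :
    α' * x₃ + β' ≤ α * x₃ + β := by
  have h : (α' - α) * (x₂ - x₁) ≤ 0 := by linarith
  have h3 : α' - α ≤ 0 := by
    by_contra hc
    exact absurd h (not_le.2 (mul_pos (not_le.1 hc) (sub_pos.2 h12)))
  nlinarith [mul_nonneg_of_nonpos_of_nonpos h3 (sub_nonpos.2 h23)]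

theorem IsLineSegment.exists_line {s : Set Plane} (hs : IsLineSegment s) {z g : Plane}
    (hz : z ∈ s) (hg : g ∈ s) (h : z.1 ≠ g.1) : ∃ α β, ∀ k ∈ s, k = pt α β k.1 := by
  obtain ⟨c, d, -, rfl⟩ := hs
  have hcd : c.1 ≠ d.1 := by
    intro hcd
    obtain ⟨θ, -, -, h1, -⟩ := mem_segment_iff.1 hz
    obtain ⟨η, -, -, h2, -⟩ := mem_segment_iff.1 hg
    apply h
    rw [h1, h2, hcd]
    ring
  obtain ⟨α, β, hc, hd⟩ := RectSkeleton.exists_line hcd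
  refine ⟨α, β, fun k hk => Prod.ext rfl ?_⟩
  obtain ⟨θ, -, -, h1, h2⟩ := mem_segment_iff.1 hk
  have hc2 : c.2 = α * c.1 + β := congrArg Prod.snd hc
  have hd2 : d.2 = α * d.1 + β := congrArg Prod.snd hd
  rw [pt_snd, h1, h2, hc2, hd2]
  ring

theorem eventually_left_notMem {F : Set ℝ} (hF : F.Finite) (c : ℝ) : ∀ᶠ x in 𝓝[<] c, x ∉ F := by
  have : ∀ᶠ x in 𝓝[<] c, ∀ f ∈ F, x ≠ f := by
    refine (eventually_all_finite hF).2 fun f _ => ?_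
    rcases lt_or_ge f c with h | h
    · filter_upwards [Ioo_mem_nhdsLT h] with x hx using hx.1.ne'
    · filter_upwards [self_mem_nhdsWithin] with x hx using ((show x < c from hx).trans_le h).ne
  filter_upwards [this] with x hx hxF using hx x hxF rfl

namespace RectRegion

variable {ω : Set Plane} {G : Set (Set Plane)} {F : Set ℝ} (R : RectRegion ω G F)
include R

theorem exists_rightmost : ∃ g ∈ ω, ∀ h ∈ ω, h.1 ≤ g.1 := by
  obtain ⟨g, hg, hmax⟩ := R.isCompact.exists_isMaxOn R.nonempty continuous_fst.continuousOn
  exact ⟨g, hg, fun h hh => hmax hh⟩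

/-- A maximal segment along an extremal line belongs to the candidates if, among all segments
that cross a vertical chord, it reaches furthest to the right and, subject to this, highest. -/
theorem mem_of_bound {α β x₀ x₀₀ X : ℝ} {s : Set Plane} (hx₀ : x₀ ∉ F) (hs : MaxSeg ω s)
    (hx : x₀₀ < x₀) (h00 : pt α β x₀₀ ∈ s) (hX : pt α β X ∈ s) (hxX : x₀ < X)
    (hne : ∃ z ∈ ω, z.1 = x₀ ∧ z ≠ pt α β x₀)
    (hext : ∃ g ∈ ω, (∀ h ∈ ω, h.1 ≤ g.1) ∧ α * x₀ + β ≤ g.2)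
    (bound : ∀ α' β' X', X ≤ X' → (∀ x, x₀ ≤ x → x ≤ X' → pt α' β' x ∈ ω) →
      X' ≤ X ∧ (0 < α' → α' * X + β' ≤ α * X + β)) : s ∈ G := by
  have h0 : pt α β x₀ ∈ s :=
    hs.1.convex.segment_subset h00 hX
      ((mem_segment_pt (hx.trans hxX).le).2 ⟨hx.le, hxX.le, rfl⟩)
  obtain ⟨z, hz, hz1, hz2⟩ := hne
  refine R.mem_rightward x₀ hx₀ ⟨z, hz, _, hs.2.1 h0, hz1, rfl, hz2⟩ s hs ⟨_, h00, hx⟩ ⟨_, hX, hxX⟩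
    ⟨_, h0, rfl, hext⟩ _ hX fun t ht ⟨z', hz', hz'0⟩ => ?_
  have hline : ∀ {α' β' X'}, (∀ k ∈ t, k = pt α' β' k.1) → pt α' β' X' ∈ t → x₀ ≤ X' →
      ∀ x, x₀ ≤ x → x ≤ X' → pt α' β' x ∈ ω := fun hk hX' hle x h1 h2 => by
    have hz'' := hk z' hz'
    rw [hz'0] at hz''
    exact ht.2.1 (ht.1.convex.segment_subset (hz'' ▸ hz') hX' ((mem_segment_pt hle).2 ⟨h1, h2, rfl⟩))
  have hreach : ∀ g ∈ t, g.1 ≤ X := by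
    intro g hg
    by_contra! hc
    obtain ⟨α', β', hk⟩ := ht.1.exists_line hz' hg (by rw [hz'0]; exact (hxX.trans hc).ne)
    exact absurd (bound α' β' g.1 hc.le (hline hk (hk g hg ▸ hg) (hxX.trans hc).le)).1 (not_le.2 hc)
  refine ⟨hreach, fun ⟨g, hg, hgX⟩ k hk hxk => ?_⟩
  simp only [pt_fst, pt_snd] at hgX ⊢
  obtain ⟨α', β', hl⟩ := ht.1.exists_line hz' hg (by rw [hz'0, hgX]; exact hxX.ne)
  have hk2 : k.2 = α' * k.1 + β' := congrArg Prod.snd (hl k hk)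
  have hz2 : z'.2 = α' * z'.1 + β' := congrArg Prod.snd (hl z' hz')
  rcases lt_or_ge 0 α' with hα | hα
  · left
    have h1 := (bound α' β' X le_rfl (hline hl (hgX ▸ hl g hg ▸ hg) hxX.le)).2 hα
    have h2 := hreach k hk
    nlinarith
  · right
    exact ⟨z', ht.2.1 hz', hz'0.le, by rw [hk2, hz2, hz'0]; nlinarith⟩

end RectRegion

/-- A rising segment of the region whose lower end touches the lower right boundary, whose upper
end lies under the upper left boundary, and which can be extended beyond its lower end. -/
structure Cut (ω : Set Plane) (a b : Plane) : Prop where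
  fst_lt : a.1 < b.1
  snd_lt : a.2 < b.2
  nw : ∀ g ∈ ω, g.1 ≤ b.1 → g.2 ≤ b.2
  se : ∀ g ∈ ω, a.1 < g.1 → a.2 ≤ g.2
  extend : ∃ a', a'.1 < a.1 ∧ segment ℝ a' b ⊆ ω ∧ a ∈ segment ℝ a' b

section Cut

variable {ω : Set Plane} {G : Set (Set Plane)} {F : Set ℝ} {a b p : Plane} {X α β : ℝ}

theorem Cut.exists_line (C : Cut ω a b) : ∃ σ τ x, 0 < σ ∧ a = pt σ τ a.1 ∧ b = pt σ τ b.1 ∧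
    x < a.1 ∧ (∀ y, x ≤ y → y ≤ b.1 → pt σ τ y ∈ ω) ∧
    ∀ p ∈ segment ℝ a b, p = pt σ τ p.1 ∧ a.1 ≤ p.1 ∧ p.1 ≤ b.1 := by
  obtain ⟨a', ha', hsub, ha⟩ := C.extend
  have h1 := C.fst_lt
  have h2 := C.snd_lt
  obtain ⟨σ, τ, hl⟩ := (show IsLineSegment (segment ℝ a' b) from
    ⟨a', b, fun h => (ha'.trans h1).ne (congrArg Prod.fst h), rfl⟩).exists_line
    (left_mem_segment ℝ a' b) (right_mem_segment ℝ a' b) (ha'.trans h1).ne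
  have ea := hl a ha
  have eb := hl b (right_mem_segment ℝ a' b)
  have ea' := hl a' (left_mem_segment ℝ a' b)
  refine ⟨σ, τ, a'.1, ?_, ea, eb, ha', fun y hy1 hy2 => hsub ?_, fun p hp => ?_⟩
  · have ea2 : a.2 = σ * a.1 + τ := congrArg Prod.snd ea
    have eb2 : b.2 = σ * b.1 + τ := congrArg Prod.snd eb
    by_contra hc
    nlinarith
  · rw [ea', eb]
    exact (mem_segment_pt (ha'.trans h1).le).2 ⟨hy1, hy2, rfl⟩
  · have hp' := hp
    rw [ea, eb, mem_segment_pt h1.le] at hp'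
    exact ⟨Prod.ext rfl hp'.2.2, hp'.1, hp'.2.1⟩

theorem Cut.source (R : RectRegion ω G F) (C : Cut ω a b) : Source ω a b := by
  obtain ⟨a', ha', hsub, ha⟩ := C.extend
  refine ⟨(segment_subset_segment ha (right_mem_segment ℝ a' b)).trans hsub, C.snd_lt.le,
    Or.inl C.nw, Or.inl C.snd_lt,
    fun g hg h1 _ => ⟨g, hg, le_rfl, C.se g hg h1⟩, fun p hp α β X hα haX hbX hpL h => ?_⟩
  obtain ⟨σ, τ, x, hσ, ea, eb, hx, hmem, hline⟩ := C.exists_line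
  obtain ⟨ep, hp1, hp2⟩ := hline p hp
  have ea2 : a.2 = σ * a.1 + τ := congrArg Prod.snd ea
  have eb2 : b.2 = σ * b.1 + τ := congrArg Prod.snd eb
  have ep2 : p.2 = σ * p.1 + τ := congrArg Prod.snd ep
  have epL : p.2 = α * p.1 + β := congrArg Prod.snd hpL
  rcases le_or_gt α σ with hασ | hασ
  · constructor <;> nlinarith
  · exfalso
    -- A steeper line would be higher than `b` just to the right of `b`.
    obtain ⟨δ, hδ, hstep⟩ := R.exists_step_up C.nw
    obtain ⟨x, hx1, hx2⟩ := exists_between (lt_min hbX (lt_add_of_pos_right b.1 hδ))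
    have hpX : p.1 ≤ X := (hp2.trans hbX.le)
    have := hstep (pt α β x) (h (by
      rw [hpL, mem_segment_pt hpX]
      exact ⟨by simpa using (hp2.trans hx1.le), (hx2.trans_le (min_le_left _ _)).le, rfl⟩))
      (hx2.trans_le (min_le_right _ _))
    rw [pt_snd] at this
    have h3 : α * x + β = p.2 + α * (x - p.1) := by rw [epL]; ring
    have h4 : b.2 = p.2 + σ * (b.1 - p.1) := by rw [eb2, ep2]; ring
    nlinarith

/-- A line that leaves a crosscut to the right is less steep than it. -/
theorem Cut.slope_lt (R : RectRegion ω G F) (C : Cut ω a b) (K : KLine ω a b X α β)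
    (hbX : b.1 < X) {σ τ : ℝ} (hσ : 0 < σ) (ea : a = pt σ τ a.1) (eb : b = pt σ τ b.1) : α < σ := by
  by_contra! hc
  have ea2 : a.2 = σ * a.1 + τ := congrArg Prod.snd ea
  have eb2 : b.2 = σ * b.1 + τ := congrArg Prod.snd eb
  have h1 := K.low
  have h2 := K.high
  have hab := C.fst_lt
  obtain ⟨δ, hδ, hstep⟩ := R.exists_step_up C.nw
  obtain ⟨x, hx1, hx2⟩ := exists_between (lt_min hbX (lt_add_of_pos_right b.1 hδ))
  obtain ⟨g, hg, hg1, hg2⟩ := K.up x hx1.le (hx2.trans_le (min_le_left _ _)).le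
  have h3 := hstep g hg (hg1.trans_lt (hx2.trans_le (min_le_right _ _)))
  have h4 : α * b.1 + β = b.2 := le_antisymm h2 (by nlinarith)
  nlinarith

/-- A line that leaves the crosscut from `p` is not tight from below before `p`. -/
theorem Cut.start_le (R : RectRegion ω G F) (C : Cut ω a b) (K : KLine ω a b X α β)
    (hbX : b.1 < X) (hp : p ∈ segment ℝ a b) (hpL : p = pt α β p.1)
    (hpa : α * a.1 + β = a.2 → p = a) {x : ℝ} (hx : LowC ω a X α β x) : p.1 ≤ x := by
  obtain ⟨σ, τ, x', hσ, ea, eb, hx', hmem, hline⟩ := C.exists_line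
  obtain ⟨ep, hp1, hp2⟩ := hline p hp
  have hlt := C.slope_lt R K hbX hσ ea eb
  have ep2 : p.2 = σ * p.1 + τ := congrArg Prod.snd ep
  have epL : p.2 = α * p.1 + β := congrArg Prod.snd hpL
  by_contra! hc
  obtain ⟨hax, -, ⟨rfl, h⟩ | h⟩ := hx
  · rw [hpa h] at hc
    exact lt_irrefl _ hc
  · have := le_line_of_forall_gt (α := σ) (β := τ) (u := α * x + β) hc fun y hy1 hy2 =>
      h (pt σ τ y) (hmem y (hx'.le.trans (hax.trans hy1.le)) (hy2.le.trans hp2)) hy1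
    nlinarith

/-- The rightmost points of the region that are not reached from the crosscut lie above it. -/
theorem Extremal.exists_rightmost (R : RectRegion ω G F) (S : Source ω a b)
    (E : Extremal ω a b X α β) (hX : ∃ h ∈ ω, X < h.1) :
    ∃ g ∈ ω, (∀ h ∈ ω, h.1 ≤ g.1) ∧ b.2 < g.2 ∧ X < g.1 := by
  obtain ⟨g, hg, hmax⟩ := R.exists_rightmost
  obtain ⟨h, hh, hhX⟩ := hX
  have hgX : X < g.1 := hhX.trans_le (hmax h hh)
  refine ⟨g, hg, hmax, ?_, hgX⟩
  by_contra! hc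
  exact absurd (E.far _ _ _ (E.left_lt.trans hgX) (E.right_lt.trans hgX)
    (S.kLine_horizontal hg (E.left_lt.trans hgX) (E.right_lt.trans hgX) hc)) (not_le.2 hgX)

theorem exists_mem_of_rightmost (R : RectRegion ω G F) (hpX : p.1 < X)
    (hseg : segment ℝ p (pt α β X) ⊆ ω) (hX : ∀ h ∈ ω, h.1 ≤ X) :
    ∃ s ∈ G, segment ℝ p (pt α β X) ⊆ s := by
  obtain ⟨s, hs, hsub⟩ := exists_maxSeg R.isCompact
    (fun h => hpX.ne (congrArg Prod.fst h) : p ≠ pt α β X) hseg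
  exact ⟨s, R.mem_right s hs ⟨_, hsub (right_mem_segment ℝ _ _), hX⟩
    ⟨p, hsub (left_mem_segment ℝ _ _), _, hseg (right_mem_segment ℝ _ _), hpX⟩, hsub⟩

/-- Just to the left of its start on a crosscut, a line that leaves the crosscut is still in the
region, and differs from the crosscut. -/
theorem Cut.eventually_left (R : RectRegion ω G F) (C : Cut ω a b) (K : KLine ω a b X α β)
    (hbX : b.1 < X) (hp : p ∈ segment ℝ a b) (hpL : p = pt α β p.1) :
    ∀ᶠ x in 𝓝[<] p.1, pt α β x ∈ ω ∧ ∃ z ∈ ω, z.1 = x ∧ z ≠ pt α β x := by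
  obtain ⟨σ, τ, x', hσ, ea, eb, hx', hmem, hline⟩ := C.exists_line
  obtain ⟨ep, hp1, hp2⟩ := hline p hp
  have hlt := C.slope_lt R K hbX hσ ea eb
  have ep2 : p.2 = σ * p.1 + τ := congrArg Prod.snd ep
  have epL : p.2 = α * p.1 + β := congrArg Prod.snd hpL
  have hlim : Tendsto (fun x => σ * x + τ) (𝓝[<] p.1) (𝓝 p.2) := by
    rw [ep2]
    exact (Continuous.tendsto (by fun_prop) p.1).mono_left nhdsWithin_le_nhds
  -- The heights of the upper left boundary are finite in number, so they cannot increase to `p.2`.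
  have hF : ∀ᶠ x in 𝓝[<] p.1, ∀ f ∈ F, f < p.2 → f < σ * x + τ := by
    refine (eventually_all_finite R.finite).2 fun f _ => ?_
    by_cases hf : f < p.2
    · exact (hlim.eventually_const_lt hf).mono fun x h _ => h
    · exact Eventually.of_forall fun x h => absurd h hf
  filter_upwards [hF, Ioo_mem_nhdsLT (hx'.trans_le hp1)] with x hxF hx
  have hw := hmem x hx.1.le (hx.2.le.trans hp2)
  have hαx := mul_le_mul_of_nonneg_left hx.2.le K.slope
  have hwx : σ * x + τ < α * x + β := by nlinarith [hx.2]
  refine ⟨?_, pt σ τ x, hw, rfl, fun h => hwx.ne (congrArg Prod.snd h)⟩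
  obtain ⟨g, hg, hg1, hg2, hgF, -⟩ := R.exists_top_of_left hw
  have hgp : p.2 ≤ g.2 := by
    by_contra! hc
    exact absurd hg2 (not_le.2 (hxF g.2 hgF hc))
  exact R.mem_of_quadrants (z := pt α β x) hg hg1 (by rw [pt_snd]; linarith)
    (C.source R |>.subset hp) hx.2.le (by rw [pt_snd]; linarith) hw le_rfl hwx.le hw le_rfl hwx.le

/-- The extremal line from a crosscut lies on a candidate segment. -/
theorem Cut.exists_mem (R : RectRegion ω G F) (C : Cut ω a b) (E : Extremal ω a b X α β)
    {α₀ β₀ : ℝ} (K₀ : KLine ω a b X α₀ β₀)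
    (hmin : ∀ α' β', KLine ω a b X α' β' → α₀ * X + β₀ ≤ α' * X + β')
    (hp : p ∈ segment ℝ a b) (hpL : p = pt α β p.1)
    (hpa : α * a.1 + β = a.2 → p = a) (hseg : segment ℝ p (pt α β X) ⊆ ω) :
    ∃ s ∈ G, segment ℝ p (pt α β X) ⊆ s := by
  have S := C.source R
  have K := E.kLine
  have hpX : p.1 < X := fst_lt_of_segment E.left_lt E.right_lt hp
  have hpb : p.1 ≤ b.1 := fst_le_of_segment C.fst_lt.le le_rfl hp
  by_cases hX : ∀ h ∈ ω, h.1 ≤ X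
  · exact exists_mem_of_rightmost R hpX hseg hX
  push Not at hX
  obtain ⟨g, hg, hgmax, hgb, hgX⟩ := E.exists_rightmost R S hX
  -- The frontier is the vertical chord at an abscissa `x₀` just to the left of `p`. Segments that
  -- cross it are subject to all contacts of lines that leave the crosscut.
  obtain ⟨x₁, hx₁, hgood⟩ := (mem_nhdsLT_iff_exists_Ioo_subset' (sub_one_lt p.1)).1
    ((C.eventually_left R K E.right_lt hp hpL).and (eventually_left_notMem R.finite p.1))
  obtain ⟨x₀, h10, h0p⟩ := exists_between (show x₁ < p.1 from hx₁)
  obtain ⟨x₀₀, h100, h000⟩ := exists_between h10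
  have hpts : ∀ x, x₀₀ ≤ x → x ≤ X → pt α β x ∈ ω := fun x h1 h2 => by
    rcases lt_or_ge x p.1 with h | h
    · exact (hgood (show x ∈ Ioo x₁ p.1 from ⟨h100.trans_le h1, h⟩)).1.1
    · refine hseg ?_
      rw [hpL]
      exact (mem_segment_pt hpX.le).2 ⟨h, h2, rfl⟩
  have hx₀X : x₀ < X := h0p.trans hpX
  have hx00X : x₀₀ < X := h000.trans hx₀X
  obtain ⟨s, hs, hsub⟩ := exists_maxSeg R.isCompact
    (fun h => hx00X.ne (congrArg Prod.fst h) : pt α β x₀₀ ≠ pt α β X) (fun z hz => by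
      rw [mem_segment_pt hx00X.le] at hz
      have := hpts z.1 hz.1 hz.2.1
      rwa [show pt α β z.1 = z from Prod.ext rfl hz.2.2.symm] at this)
  obtain ⟨⟨-, hne⟩, hx₀F⟩ := hgood (show x₀ ∈ Ioo x₁ p.1 from ⟨h10, h0p⟩)
  have hp2 : p.2 = α * p.1 + β := congrArg Prod.snd hpL
  have hαx := mul_le_mul_of_nonneg_left h0p.le K.slope
  have hpb2 := (snd_mem_of_segment C.snd_lt.le hp).2
  refine ⟨s, R.mem_of_bound hx₀F hs h000 (hsub (left_mem_segment ℝ _ _))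
    (hsub (right_mem_segment ℝ _ _)) hx₀X hne ⟨g, hg, hgmax, by linarith⟩ ?_,
    (segment_subset_segment (by
      rw [hpL]; exact (mem_segment_pt hx00X.le).2 ⟨(h000.trans h0p).le, hpX.le, rfl⟩)
      (right_mem_segment ℝ _ _)).trans hsub⟩
  intro α' β' X' hXX' hpts'
  have hlow : ∀ {γ δ xC x₂}, LowC ω a X γ δ xC → x₀ ≤ xC → xC < x₂ → x₂ ≤ X' →
      γ * xC + δ ≤ α' * xC + β' := fun hC h1 h2 h3 =>
    le_line_of_forall_gt h2 fun y hy1 hy2 =>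
      hC.se (Or.inr C.se) _ (hpts' y (h1.trans hy1.le) (hy2.le.trans h3)) hy1
  have hhigh : ∀ {γ δ xV}, (∀ g ∈ ω, g.1 < xV → g.2 ≤ γ * xV + δ) → x₀ < xV → xV ≤ X' →
      α' * xV + β' ≤ γ * xV + δ := fun hV h1 h2 =>
    line_le_of_forall_lt h1 fun y hy1 hy2 => hV _ (hpts' y hy1.le (hy2.le.trans h2)) hy2
  have hpC : ∀ {xC}, LowC ω a X α β xC → x₀ < xC := fun hC =>
    h0p.trans_le (C.start_le R K E.right_lt hp hpL hpa hC)
  by_cases hse : ∀ g ∈ ω, X < g.1 → α * X + β < g.2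
  -- Stopped by the lower boundary: the contacts `xC < xV` keep every competitor below the end of
  -- the extremal line at `X`, so the lower boundary stops it there too.
  · obtain ⟨xC, xV, hC, hV, hCV, hVX, hα⟩ := E.lowC_lt_highC R S hse hX
    have hle : α' * X + β' ≤ α * X + β := line_le_of_cross hCV hVX.le
      (hlow hC (hpC hC).le hCV (hVX.le.trans hXX'))
      (hhigh (hV.nw S hVX) ((hpC hC).trans hCV) (hVX.le.trans hXX'))
    refine ⟨?_, fun _ => hle⟩
    by_contra! hlt
    obtain ⟨η, hη, hstep⟩ := R.exists_step_right (e := pt α β X) hse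
    have := le_line_of_forall_gt (u := α * X + β + η) hlt fun y hy1 hy2 =>
      hstep _ (hpts' y (hx₀X.le.trans hy1.le) hy2.le) hy1
    linarith
  -- Otherwise the contacts `xV < xC` of the lowest line keep every competitor above its end at `X`,
  -- where the upper boundary or the height of the region beyond stops them.
  · push Not at hse
    obtain ⟨g₀, hg₀, hg₀X, hg₀y⟩ := E.exists_lower R S K₀ hse
    have hα₀ : 0 < α₀ := by
      rcases K₀.slope_pos_of_lowest hmin ⟨g₀, hg₀, hg₀X, hg₀y⟩ with h | ⟨rfl, rfl⟩
      · exact h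
      · have := C.se g₀ hg₀ (E.left_lt.trans hg₀X)
        linarith
    obtain ⟨xV, xC, hV, hC, hVC, hCX⟩ := K₀.exists_highC_lt_lowC R S E.left_lt E.right_lt hα₀ hmin
      ⟨g₀, hg₀, hg₀X, hg₀y⟩
    have hxV : x₀ < xV := h0p.trans_le (hpb.trans hV.1)
    obtain ⟨δ, hδ, hstep⟩ : ∃ δ > 0, ∀ g ∈ ω, X < g.1 → g.1 < X + δ → g.2 ≤ α₀ * X + β₀ := by
      rcases K₀.stopped E.left_lt E.right_lt E.far with h | h | h
      · obtain ⟨δ, hδ, h⟩ := R.exists_step_up (b := pt α₀ β₀ X) h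
        exact ⟨δ, hδ, fun g hg _ hgδ => h g hg hgδ⟩
      · exact absurd (h g₀ hg₀ hg₀X) (not_lt.2 hg₀y.le)
      · exact ⟨1, one_pos, fun g hg hgX _ => h g hg hgX⟩
    constructor
    · by_contra! hlt
      obtain ⟨x, hx1, hx2⟩ := exists_between (lt_min hlt (lt_add_of_pos_right X hδ))
      have h1 : α' * x + β' ≤ α₀ * X + β₀ := hstep _ (hpts' x (hx₀X.le.trans hx1.le)
        (hx2.le.trans (min_le_left _ _))) hx1 (hx2.trans_le (min_le_right _ _))
      have h2 := line_le_of_cross (x₃ := x) hVC (hCX.le.trans hx1.le)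
        (hhigh (hV.nw S (hVC.trans hCX)) hxV ((hVC.trans hCX).le.trans hXX'))
        (hlow hC (hxV.trans hVC).le hCX hXX')
      nlinarith
    · intro _
      rcases K.stopped E.left_lt E.right_lt E.far with h | h | h
      · exact h _ (hpts' X hx₀X.le hXX') le_rfl
      · exact absurd hse (by push Not; exact h)
      · obtain ⟨xC, xV, hC, hV, hCV⟩ := K.exists_lowC_lt_highC R S E.left_lt E.right_lt E.best
        have hxV := (hpC hC).trans hCV
        have key : (∀ g ∈ ω, g.1 < xV → g.2 ≤ α * xV + β) → α' * X + β' ≤ α * X + β := fun hnw =>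
          line_le_of_cross hCV hV.2.1 (hlow hC (hpC hC).le hCV (hV.2.1.trans hXX'))
            (hhigh hnw hxV (hV.2.1.trans hXX'))
        rcases hV.2.2 with ⟨rfl, h⟩ | ⟨-, h⟩ | ⟨rfl, h⟩
        · exact key fun g hg hgx => by rw [h]; exact C.nw g hg hgx.le
        · exact key h
        · exact h _ (hpts' xV hx₀X.le hXX') le_rfl

end Cut

/-! ### The next crosscut -/

/-- The part of the plane in front of the segment `[a, b]`: to the right of it, or above it. -/
def front (a b : Plane) : Set Plane :=
  {g | a.2 ≤ g.2 ∧ (b.2 < g.2 ∨ (g.2 - a.2) * (b.1 - a.1) < (b.2 - a.2) * (g.1 - a.1))}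

section Next

variable {ω : Set Plane} {G : Set (Set Plane)} {F : Set ℝ} {a b p : Plane} {X α β : ℝ}

/-- If the lower boundary stops the extremal line, the end of the line after its last contact with
the upper boundary is a crosscut for going upwards, and nothing reached from the old crosscut is
in front of it. -/
theorem Extremal.next_right (R : RectRegion ω G F) (S : Source ω a b)
    (E : Extremal ω a b X α β) (hp : p ∈ segment ℝ a b) (hpL : p = pt α β p.1)
    (hseg : segment ℝ p (pt α β X) ⊆ ω) (hpC : ∀ x, LowC ω a X α β x → p.1 ≤ x)
    (hse : ∀ g ∈ ω, X < g.1 → α * X + β < g.2) (hX : ∃ g ∈ ω, X < g.1) :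
    ∃ v, Cut (swapSet ω) v.swap (pt α β X).swap ∧
      segment ℝ v (pt α β X) ⊆ segment ℝ p (pt α β X) ∧
      ∀ p' ∈ segment ℝ a b, ∀ q, segment ℝ p' q ⊆ ω → q.swap ∉ front v.swap (pt α β X).swap := by
  obtain ⟨xC, xV, hC, hV, hCV, hVX, hα⟩ := E.lowC_lt_highC R S hse hX
  have hpX : p.1 < X := fst_lt_of_segment E.left_lt E.right_lt hp
  have hpV : p.1 < xV := (hpC xC hC).trans_lt hCV
  have hvmem : pt α β xV ∈ segment ℝ p (pt α β X) := by
    rw [hpL]; exact (mem_segment_pt hpX.le).2 ⟨hpV.le, hVX.le, rfl⟩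
  have hp2 : p.2 = α * p.1 + β := congrArg Prod.snd hpL
  have hnw := hV.nw S hVX
  refine ⟨pt α β xV, ⟨?_, hVX, fun g hg h => ?_, fun g hg h => ?_, p.swap, ?_, ?_, ?_⟩,
    segment_subset_segment hvmem (right_mem_segment ℝ _ _), fun p' hp' q hq hfront => ?_⟩
  · simp only [Prod.fst_swap, pt_snd]
    nlinarith
  · by_contra! hc
    exact absurd h (not_le.2 (hse g.swap hg hc))
  · by_contra! hc
    exact absurd h (not_lt.2 (hnw g.swap hg hc))
  · simp only [Prod.fst_swap, pt_snd, hp2]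
    nlinarith
  · rw [← swapSet_segment]
    exact swapSet_subset.2 hseg
  · rw [← swapSet_segment]
    simpa using hvmem
  · simp only [front, mem_ofPred_eq, Prod.fst_swap, Prod.snd_swap, pt_fst, pt_snd] at hfront
    obtain ⟨hq1, hq2⟩ := hfront
    have haq : a.1 < q.1 := (hC.1.trans_lt hCV).trans_le hq1
    have hbq : b.1 < q.1 := by
      rcases S.nw with hnw' | hba
      swap
      · exact hba.1.trans_lt haq
      refine (hV.1.trans hq1).lt_of_ne fun hEq => ?_
      have hqb := hnw' q (hq (right_mem_segment ℝ p' q)) hEq.ge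
      rcases hV.2.2 with ⟨h1, h2⟩ | ⟨h1, -⟩ | ⟨h1, -⟩
      · rcases hq2 with hq2 | hq2
        · exact absurd (hEq ▸ E.right_lt) (not_lt.2 hq2.le)
        · rw [h1, h2, ← hEq] at hq2
          nlinarith [E.right_lt]
      · exact absurd (hEq ▸ h1) (not_lt.2 hq1)
      · exact absurd (hEq ▸ E.right_lt) (not_lt.2 (h1 ▸ hq1))
    obtain ⟨α', β', K', hval⟩ := S.exists_kLine hp' hq haq hbq
    have hqX := E.far _ _ _ haq hbq K'
    have hlt : α * q.1 + β < q.2 := by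
      rcases hq2 with hq2 | hq2
      · exact absurd hqX (not_le.2 hq2)
      · by_contra! hc
        nlinarith
    -- The line to `q` passes above the contact `xC` and below `xV`, so it is below the extremal
    -- line at `q`.
    have := line_le_of_cross (x₃ := q.1) hCV hq1 (K'.ge_of_lowC hC (hCV.trans_le hq1))
      (K'.le_of_highC hV hVX hq1)
    rw [hval] at this
    exact absurd ((le_max_left _ _).trans this) (not_le.2 hlt)

/-- If the upper boundary stops the extremal line, the end of the line after its last contact with
the lower boundary is a crosscut for going right, and nothing reached from the old crosscut is in
front of it. -/
theorem Extremal.next_up (R : RectRegion ω G F) (S : Source ω a b)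
    (E : Extremal ω a b X α β) (hmin : ∀ α' β', KLine ω a b X α' β' → α * X + β ≤ α' * X + β')
    (ha : a.1 ≤ b.1 ∨ ∀ g ∈ ω, a.1 < g.1 → a.2 ≤ g.2)
    (hp : p ∈ segment ℝ a b) (hpL : p = pt α β p.1) (hseg : segment ℝ p (pt α β X) ⊆ ω)
    (hnw : ∀ g ∈ ω, g.1 ≤ X → g.2 ≤ α * X + β) (hX : ∃ g ∈ ω, X < g.1 ∧ g.2 < α * X + β) :
    ∃ c, Cut ω c (pt α β X) ∧ segment ℝ c (pt α β X) ⊆ segment ℝ p (pt α β X) ∧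
      ∀ p' ∈ segment ℝ a b, ∀ q, segment ℝ p' q ⊆ ω → q ∉ front c (pt α β X) := by
  have K := E.kLine
  have hbX2 := hnw b S.right_mem E.right_lt.le
  have hpb2 := (snd_mem_of_segment S.le hp).2
  have hpX : p.1 < X := fst_lt_of_segment E.left_lt E.right_lt hp
  have hp2 : p.2 = α * p.1 + β := congrArg Prod.snd hpL
  have hα : 0 < α := by
    rcases K.slope_pos_of_lowest hmin hX with h | ⟨rfl, rfl⟩
    · exact h
    · rcases S.flat with h | ⟨-, h, -⟩
      · linarith
      · obtain ⟨g, hg, -, hg2⟩ := hX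
        have := h g hg
        linarith
  obtain ⟨xV, xC, hV, hC, hVC, hCX⟩ := K.exists_highC_lt_lowC R S E.left_lt E.right_lt hα hmin hX
  have hVX := hVC.trans hCX
  have hpC : p.1 < xC := by
    by_contra! hc
    have h1 : p.1 ≤ a.1 := by
      by_contra! h
      exact lt_irrefl _ (fst_lt_of_segment h (hV.1.trans_lt (hVC.trans_le hc)) hp)
    have h2 : α * xV + β < b.2 := by nlinarith [hC.1]
    rcases hV.2.2 with ⟨h3, h4⟩ | ⟨h3, h4⟩ | ⟨h3, -⟩
    · rw [h3, h4] at h2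
      exact lt_irrefl _ h2
    · exact absurd (h4 b S.right_mem h3) (not_le.2 h2)
    · exact hVX.ne h3
  have hse := hC.se (ha.imp_left fun h => h.trans_lt (hV.1.trans_lt hVC))
  have hcmem : pt α β xC ∈ segment ℝ p (pt α β X) := by
    rw [hpL]; exact (mem_segment_pt hpX.le).2 ⟨hpC.le, hCX.le, rfl⟩
  refine ⟨pt α β xC, ⟨hCX, ?_, hnw, hse, p, hpC, hseg, hcmem⟩,
    segment_subset_segment hcmem (right_mem_segment ℝ _ _), fun p' hp' q hq hfront => ?_⟩
  · simp only [pt_snd]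
    nlinarith
  · simp only [front, mem_ofPred_eq, pt_fst, pt_snd] at hfront
    obtain ⟨hq1, hq2⟩ := hfront
    have hxq : xC < q.1 := by
      rcases hq2 with hq2 | hq2
      · refine hCX.trans (not_le.1 fun hc => ?_)
        exact absurd (hnw q (hq (right_mem_segment ℝ p' q)) hc) (not_le.2 hq2)
      · by_contra! hc
        have h1 : 0 ≤ (q.2 - (α * xC + β)) * (X - xC) :=
          mul_nonneg (by linarith) (by linarith)
        have h2 : 0 ≤ α * (X - xC) * (xC - q.1) :=
          mul_nonneg (mul_nonneg hα.le (by linarith)) (by linarith)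
        linarith
    have haq : a.1 < q.1 := hC.1.trans_lt hxq
    have hbq : b.1 < q.1 := hV.1.trans_lt (hVC.trans hxq)
    obtain ⟨α', β', K', hval⟩ := S.exists_kLine hp' hq haq hbq
    have hqX := E.far _ _ _ haq hbq K'
    have hlt : q.2 < α * q.1 + β := by
      rcases hq2 with hq2 | hq2
      · exact absurd hqX (not_le.2 (not_le.1 fun hc =>
          absurd (hnw q (hq (right_mem_segment ℝ p' q)) hc) (not_le.2 hq2)))
      · by_contra! hc
        nlinarith
    -- The line to `q` passes below the contact `xV` and above `xC`, so it is above the extremal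
    -- line at `q`.
    have := line_le_of_cross (x₃ := q.1) hVC hxq.le (K'.le_of_highC hV hVX (hVC.trans hxq).le)
      (K'.ge_of_lowC hC hxq)
    rw [hval] at this
    have haC : a.2 ≤ q.2 := by
      have h1 := K.low
      have h2 := mul_le_mul_of_nonneg_left hC.1 hα.le
      linarith
    rw [max_eq_left haC] at this
    linarith

/-- If a segment from the crosscut reaches an upwards closed set `Θ`, so does the extremal line,
provided that from every point outside `Θ` the region continues to the upper right. -/
theorem Extremal.end_mem (S : Source ω a b)
    (E : Extremal ω a b X α β) (hXω : pt α β X ∈ ω) {Θ : Set Plane}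
    (hup : ∀ g h : Plane, g ∈ Θ → g.1 ≤ h.1 → g.2 ≤ h.2 → h ∈ Θ)
    (hne : ∀ g ∈ ω, g ∉ Θ → ∃ h ∈ ω, g.1 < h.1 ∧ g.2 < h.2) {q : Plane}
    (hp : p ∈ segment ℝ a b) (hpq : segment ℝ p q ⊆ ω) (hq : q ∈ Θ) (haq : a.1 < q.1)
    (hbq : b.1 < q.1) : pt α β X ∈ Θ := by
  by_contra hc
  obtain ⟨h, hh, hhX, hhy⟩ := hne _ hXω hc
  simp only [pt_fst, pt_snd] at hhX hhy
  have K := E.kLine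
  obtain ⟨α', β', K', hval⟩ := S.exists_kLine hp hpq haq hbq
  have hqX := E.far _ _ _ haq hbq K'
  have hya : a.2 ≤ α * X + β := by
    have h1 := K.low
    have h2 := mul_le_mul_of_nonneg_left E.left_lt.le K.slope
    linarith
  have hqy : α * X + β < q.2 := by
    by_contra! hle
    exact hc (hup q _ hq hqX hle)
  rw [max_eq_left (hya.trans hqy.le)] at hval
  have hα' := K'.slope
  have hα := K.slope
  have hX' : q.2 ≤ α' * X + β' := by nlinarith
  -- The combination of the extremal line and the line to `q` that has height `m` at `X` would end
  -- higher than the extremal line.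
  set m := min q.2 h.2
  have hm : α * X + β < m := lt_min hqy hhy
  have hm' : m ≤ α' * X + β' := (min_le_left _ _).trans hX'
  have hd : 0 < α' * X + β' - (α * X + β) := by linarith
  set l := (m - (α * X + β)) / (α' * X + β' - (α * X + β)) with hl
  have hl0 : 0 < l := div_pos (by linarith) hd
  have hl1 : l ≤ 1 := (div_le_one hd).2 (by linarith)
  have e : ∀ x, ((1 - l) * α + l * α') * x + ((1 - l) * β + l * β') =
      (1 - l) * (α * x + β) + l * (α' * x + β') := fun x => by ring
  have eX : ((1 - l) * α + l * α') * X + ((1 - l) * β + l * β') = m := by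
    rw [e]
    have : l * (α' * X + β' - (α * X + β)) = m - (α * X + β) := div_mul_cancel₀ _ hd.ne'
    linarith
  have hs : 0 ≤ (1 - l) * α + l * α' :=
    add_nonneg (mul_nonneg (by linarith) hα) (mul_nonneg hl0.le hα')
  have hcombo : KLine ω a b q.1 ((1 - l) * α + l * α') ((1 - l) * β + l * β') := by
    refine KLine.combo ⟨hα, K.low, K.high, fun x h1 h2 => K.up x h1 (h2.trans hqX),
      fun x h1 h2 => K.lo x h1 (h2.trans hqX), q, hpq (right_mem_segment ℝ p q), le_rfl, ?_⟩ K'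
      (by linarith) hl0.le (by ring)
    nlinarith
  have hK : KLine ω a b X ((1 - l) * α + l * α') ((1 - l) * β + l * β') := by
    refine ⟨hs, hcombo.low, hcombo.high, fun x h1 h2 => ?_, fun x h1 h2 => ?_, h, hh, hhX.le, ?_⟩
    · rcases le_or_gt x q.1 with hx | hx
      · exact hcombo.up x h1 hx
      · refine ⟨q, hpq (right_mem_segment ℝ p q), hx.le, ?_⟩
        have := mul_le_mul_of_nonneg_left h2 hs
        have := min_le_left q.2 h.2
        linarith
    · rcases le_or_gt x q.1 with hx | hx
      · exact hcombo.lo x h1 hx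
      · obtain ⟨g, hg, hg1, hg2⟩ := K.lo x h1 h2
        refine ⟨g, hg, hg1, hg2.trans ?_⟩
        rw [e]
        have h3 : α * x + β ≤ α' * x + β' := by nlinarith
        nlinarith
    · rw [eX]
      exact min_le_right _ _
  have := (E.best _ _ hK).1
  rw [eX] at this
  linarith

end Next

/-! ### Steps from a crosscut -/

section Launch

variable {ω : Set Plane} {G : Set (Set Plane)} {F : Set ℝ} {a b p : Plane} {X α β : ℝ}

/-- A crosscut whose extremal lines lie on candidate segments. -/
structure Launch (ω : Set Plane) (G : Set (Set Plane)) (a b : Plane) : Prop where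
  source : Source ω a b
  side : a.1 ≤ b.1 ∨ ∀ g ∈ ω, a.1 < g.1 → a.2 ≤ g.2
  start_le : ∀ {X α β p}, Extremal ω a b X α β → p ∈ segment ℝ a b → p = pt α β p.1 →
    (α * a.1 + β = a.2 → p = a) → ∀ x, LowC ω a X α β x → p.1 ≤ x
  mem : ∀ {X α β α₀ β₀ p}, Extremal ω a b X α β → KLine ω a b X α₀ β₀ →
    (∀ α' β', KLine ω a b X α' β' → α₀ * X + β₀ ≤ α' * X + β') → p ∈ segment ℝ a b →
    p = pt α β p.1 → (α * a.1 + β = a.2 → p = a) → segment ℝ p (pt α β X) ⊆ ω →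
    ∃ s ∈ G, segment ℝ p (pt α β X) ⊆ s

theorem Cut.launch (R : RectRegion ω G F) (C : Cut ω a b) : Launch ω G a b where
  source := C.source R
  side := Or.inr C.se
  start_le E hp hpL hpa _ hx := C.start_le R E.kLine E.right_lt hp hpL hpa hx
  mem E K₀ hmin hp hpL hpa hseg := C.exists_mem R E K₀ hmin hp hpL hpa hseg

/-- The left side of the region as a crosscut. -/
structure SideCut (ω : Set Plane) (a b : Plane) : Prop where
  subset : segment ℝ a b ⊆ ω
  fst_eq : a.1 = b.1
  snd_lt : a.2 < b.2
  left : ∀ g ∈ ω, b.1 ≤ g.1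
  nw : ∀ g ∈ ω, g.1 ≤ b.1 → g.2 ≤ b.2
  rise : ∃ h ∈ ω, (∀ g ∈ ω, g.1 ≤ h.1) ∧ a.2 ≤ h.2

theorem fst_mem_of_segment (hp : p ∈ segment ℝ a b) : p.1 ≤ max a.1 b.1 ∧ min a.1 b.1 ≤ p.1 := by
  obtain ⟨θ, h0, h1, h2, -⟩ := mem_segment_iff.1 hp
  constructor
  · exact fst_le_of_segment (le_max_left _ _) (le_max_right _ _) hp
  · have ha := min_le_left a.1 b.1
    have hb := min_le_right a.1 b.1
    nlinarith

theorem SideCut.launch (R : RectRegion ω G F) (C : SideCut ω a b) : Launch ω G a b where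
  source := by
    refine ⟨C.subset, C.snd_lt.le, Or.inl C.nw, Or.inl C.snd_lt, fun g hg _ _ => ?_,
      fun p hp α β X hα _ _ hpL _ => ?_⟩
    · obtain ⟨h, hh, hmax, hle⟩ := C.rise
      exact ⟨h, hh, hmax g hg, hle⟩
    · have h1 := fst_mem_of_segment hp
      rw [C.fst_eq, max_self, min_self] at h1
      have h2 : p.1 = b.1 := le_antisymm h1.1 h1.2
      have hp2 : p.2 = α * p.1 + β := congrArg Prod.snd hpL
      rw [C.fst_eq, ← h2, ← hp2]
      exact snd_mem_of_segment C.snd_lt.le hp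
  side := Or.inl C.fst_eq.le
  start_le {X α β p} _ hp _ _ x hx := by
    have h1 := (fst_mem_of_segment hp).1
    rw [← C.fst_eq, max_self] at h1
    exact h1.trans hx.1
  mem {X α β α₀ β₀ p} E _ _ hp _ _ hseg := by
    have hpX : p.1 < X := fst_lt_of_segment E.left_lt E.right_lt hp
    obtain ⟨s, hs, hsub⟩ := exists_maxSeg R.isCompact
      (fun h => hpX.ne (congrArg Prod.fst h) : p ≠ pt α β X) hseg
    have h1 := (fst_mem_of_segment hp).1
    rw [C.fst_eq, max_self] at h1
    exact ⟨s, R.mem_left s hs ⟨p, hsub (left_mem_segment ℝ _ _), fun g hg => h1.trans (C.left g hg)⟩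
      ⟨_, hsub (right_mem_segment ℝ _ _), p, C.subset hp, hpX⟩, hsub⟩

/-- The segment from the right end `a` of the bottom side of the region to the upper end `b` of the
left side, as a crosscut. -/
structure CornerCut (ω : Set Plane) (a b : Plane) : Prop where
  subset : segment ℝ a b ⊆ ω
  fst_lt : b.1 < a.1
  snd_lt : a.2 < b.2
  left : ∀ g ∈ ω, b.1 ≤ g.1
  down : ∀ g ∈ ω, a.2 ≤ g.2
  nw : ∀ g ∈ ω, g.1 ≤ b.1 → g.2 ≤ b.2
  se : ∀ g ∈ ω, g.2 ≤ a.2 → g.1 ≤ a.1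
  corner : (a.1, b.2) ∈ ω

theorem CornerCut.swap (C : CornerCut ω a b) : CornerCut (swapSet ω) b.swap a.swap where
  subset := by
    rw [← swapSet_segment, segment_symm]
    exact swapSet_subset.2 C.subset
  fst_lt := C.snd_lt
  snd_lt := C.fst_lt
  left g hg := C.down g.swap hg
  down g hg := C.left g.swap hg
  nw g hg h := C.se g.swap hg h
  se g hg h := C.nw g.swap hg h
  corner := C.corner

theorem CornerCut.source (C : CornerCut ω a b) : Source ω a b := by
  refine ⟨C.subset, C.snd_lt.le, Or.inl C.nw, Or.inl C.snd_lt,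
    fun g hg _ _ => ⟨g, hg, le_rfl, C.down g hg⟩, fun p hp α β X hα _ _ hpL _ => ?_⟩
  have h1 := fst_mem_of_segment hp
  rw [max_eq_left C.fst_lt.le, min_eq_right C.fst_lt.le] at h1
  obtain ⟨h2, h3⟩ := snd_mem_of_segment C.snd_lt.le hp
  have hp2 : p.2 = α * p.1 + β := congrArg Prod.snd hpL
  constructor <;> nlinarith

theorem exists_between_notMem {F : Set ℝ} (hF : F.Finite) {x y : ℝ} (h : x < y) :
    ∃ c, x < c ∧ c < y ∧ c ∉ F := by
  obtain ⟨c, hc, hcF⟩ := ((Ioo_infinite h).sdiff hF).nonempty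
  exact ⟨c, hc.1, hc.2, hcF⟩

/-- The extremal line from a segment across the lower left corner lies on a candidate. -/
theorem CornerCut.exists_mem (R : RectRegion ω G F) (C : CornerCut ω a b)
    (E : Extremal ω a b X α β) {α₀ β₀ : ℝ} (K₀ : KLine ω a b X α₀ β₀)
    (hmin : ∀ α' β', KLine ω a b X α' β' → α₀ * X + β₀ ≤ α' * X + β')
    (hp : p ∈ segment ℝ a b) (hpL : p = pt α β p.1) (hseg : segment ℝ p (pt α β X) ⊆ ω) :
    ∃ s ∈ G, segment ℝ p (pt α β X) ⊆ s := by
  have S := C.source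
  have K := E.kLine
  have hpX : p.1 < X := fst_lt_of_segment E.left_lt E.right_lt hp
  have hp2 : p.2 = α * p.1 + β := congrArg Prod.snd hpL
  have hpy : p.2 ≤ α * X + β := by
    have := mul_le_mul_of_nonneg_left hpX.le K.slope
    linarith
  have heω : pt α β X ∈ ω := hseg (right_mem_segment ℝ _ _)
  by_cases hX : ∀ h ∈ ω, h.1 ≤ X
  · exact exists_mem_of_rightmost R hpX hseg hX
  push Not at hX
  obtain ⟨s, hs, hsub⟩ := exists_maxSeg R.isCompact
    (fun h => hpX.ne (congrArg Prod.fst h) : p ≠ pt α β X) hseg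
  refine ⟨s, ?_, hsub⟩
  have hps : p ∈ s := hsub (left_mem_segment ℝ _ _)
  have hes : pt α β X ∈ s := hsub (right_mem_segment ℝ _ _)
  obtain ⟨θ, h0, h1, hθ1, hθ2⟩ := mem_segment_iff.1 hp
  have hab1 := C.fst_lt
  have hab2 := C.snd_lt
  -- If `p` is an end of the crosscut, then it lies on the bottom or on the left side.
  rcases h0.eq_or_lt with rfl | h0
  · have hpa : p.2 = a.2 := by rw [hθ2]; ring
    refine R.mem_down s hs ⟨p, hps, fun h hh => hpa.trans_le (C.down h hh)⟩
      ⟨_, hes, a, S.left_mem, ?_⟩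
    by_contra! hc
    exact absurd E.left_lt (not_lt.2 (C.se _ heω hc))
  rcases h1.eq_or_lt with rfl | h1
  · have hpb : p.1 = b.1 := by rw [hθ1]; ring
    exact R.mem_left s hs ⟨p, hps, fun h hh => hpb.trans_le (C.left h hh)⟩
      ⟨_, hes, p, C.subset hp, hpX⟩
  have hpa1 : p.1 < a.1 := by nlinarith
  have hpb1 : b.1 < p.1 := by nlinarith
  have hpa2 : a.2 < p.2 := by nlinarith
  have hpb2 : p.2 < b.2 := by nlinarith
  obtain ⟨y, hy, hyω⟩ := R.ext_left b S.right_mem C.left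
  have hyb : y < b.2 := (C.nw _ hyω le_rfl).lt_of_ne hy
  obtain ⟨g, hg, hgmax, hgb, hgX⟩ := E.exists_rightmost R S hX
  -- The frontier is L-shaped, with a corner between `p` and `(a.1, b.2)`. The corner is chosen
  -- above a point of the left side, so that the region behind the frontier touches this side.
  obtain ⟨c₁, hpc₁, hc₁a, hc₁F⟩ := exists_between_notMem R.finite hpa1
  obtain ⟨c₂, hc₂, hc₂b, hc₂F⟩ := exists_between_notMem R.finite (max_lt hpb2 hyb)
  obtain ⟨hpc₂, hyc₂⟩ := max_lt_iff.1 hc₂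
  have hint : (c₁, c₂) ∈ interior ω := by
    refine mem_interior.2 ⟨Ioo p.1 a.1 ×ˢ Ioo p.2 b.2, fun z hz => ?_, isOpen_Ioo.prod isOpen_Ioo,
      ⟨hpc₁, hc₁a⟩, hpc₂, hc₂b⟩
    exact R.mem_of_quadrants S.right_mem (hpb1.trans hz.1.1).le hz.2.2.le C.corner hz.1.2.le
      hz.2.2.le (C.subset hp) hz.1.1.le hz.2.1.le S.left_mem hz.1.2.le (hpa2.trans hz.2.1).le
  refine R.mem_cornerRight c₁ hc₁F c₂ hc₂F hint ⟨_, hyω, C.left, hyc₂.le⟩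
    ⟨g, hg, hgmax, (hc₂b.trans hgb).le⟩ s hs p hps hpc₁ hpc₂ _ hes (hc₁a.trans E.left_lt) hpy
    fun t ht ⟨z, hz, hz1, hz2, _⟩ => ?_
  simp only [pt_fst, pt_snd]
  have hzX : z.1 < X := (hz1.trans_lt hc₁a).trans E.left_lt
  -- A rising segment that meets the frontier comes from the crosscut.
  have hrise : ∀ {α' β' X'}, 0 ≤ α' → (∀ k ∈ t, k = pt α' β' k.1) → pt α' β' X' ∈ t → X ≤ X' →
      KLine ω a b X' α' β' := by
    intro α' β' X' hα' hl hX' hXX'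
    have hz' := hl z hz
    have hz2' : z.2 = α' * z.1 + β' := congrArg Prod.snd hz'
    have hpts : ∀ x, z.1 ≤ x → x ≤ X' → pt α' β' x ∈ ω := fun x h1 h2 =>
      ht.2.1 (ht.1.convex.segment_subset (hz' ▸ hz) hX'
        ((mem_segment_pt (hzX.le.trans hXX')).2 ⟨h1, h2, rfl⟩))
    have hza : z.1 ≤ a.1 := hz1.trans hc₁a.le
    have hlow : ∀ x, x ≤ z.1 → α' * x + β' ≤ b.2 := fun x hx => by
      have := mul_le_mul_of_nonneg_left hx hα'
      linarith
    refine ⟨hα', C.down _ (hpts a.1 hza (E.left_lt.le.trans hXX')),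
      hlow _ (C.left z (ht.2.1 hz)), fun x hx1 hx2 => ?_, fun x hx1 hx2 =>
        ⟨_, hpts x (hza.trans hx1) hx2, le_rfl, le_rfl⟩,
      ⟨_, hpts X' (hzX.le.trans hXX') le_rfl, le_rfl, le_rfl⟩⟩
    rcases le_total z.1 x with h | h
    · exact ⟨_, hpts x h hx2, le_rfl, le_rfl⟩
    · exact ⟨b, S.right_mem, hx1, hlow x h⟩
  have hreach : ∀ k ∈ t, k.1 ≤ X := by
    intro k hk
    by_contra! hkX
    obtain ⟨α', β', hl⟩ := ht.1.exists_line hz hk (hzX.trans hkX).ne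
    refine absurd hkX (not_lt.2 ?_)
    rcases le_or_gt 0 α' with hα' | hα'
    · exact E.far _ _ _ (E.left_lt.trans hkX) (E.right_lt.trans hkX)
        (hrise hα' hl (hl k hk ▸ hk) hkX.le)
    · have hz2' : z.2 = α' * z.1 + β' := congrArg Prod.snd (hl z hz)
      have hk2' : k.2 = α' * k.1 + β' := congrArg Prod.snd (hl k hk)
      exact E.far _ _ _ (E.left_lt.trans hkX) (E.right_lt.trans hkX) (S.kLine_horizontal
        (ht.2.1 hk) (E.left_lt.trans hkX) (E.right_lt.trans hkX) (by nlinarith))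
  refine ⟨hreach, fun ⟨k, hk, hkX⟩ q hq => ?_⟩
  obtain ⟨α', β', hl⟩ := ht.1.exists_line hz hk (by rw [hkX]; exact hzX.ne)
  have hz2' : z.2 = α' * z.1 + β' := congrArg Prod.snd (hl z hz)
  have hk2' : k.2 = α' * k.1 + β' := congrArg Prod.snd (hl k hk)
  have hq2' : q.2 = α' * q.1 + β' := congrArg Prod.snd (hl q hq)
  rcases le_or_gt 0 α' with hα' | hα'
  · left
    have h1 := (E.best _ _ (hrise hα' hl (hkX ▸ hl k hk ▸ hk) le_rfl)).1
    have h2 := mul_le_mul_of_nonneg_left (hreach q hq) hα'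
    linarith
  rcases le_or_gt z.1 q.1 with hzq | hqz
  · right
    nlinarith
  left
  rcases K.stopped E.left_lt E.right_lt E.far with h | h | h
  · exact h q (ht.2.1 hq) (hreach q hq)
  · obtain ⟨xC, xV, hC, hV, hCV, hVX, hα⟩ := E.lowC_lt_highC R S h hX
    have := hV.nw S hVX q (ht.2.1 hq) (by have := hC.1; linarith)
    nlinarith
  · exfalso
    have hkb : k.2 < b.2 := by nlinarith
    have hkX' : a.1 < k.1 ∧ b.1 < k.1 := by rw [hkX]; exact ⟨E.left_lt, E.right_lt⟩
    have Kh := S.kLine_horizontal (ht.2.1 hk) hkX'.1 hkX'.2 hkb.le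
    rw [hkX] at Kh
    have hy₀ : α₀ * X + β₀ < b.2 := by
      have := hmin _ _ Kh
      rw [zero_mul, zero_add] at this
      exact this.trans_lt (max_lt hkb C.snd_lt)
    obtain ⟨g₀, hg₀, hg₀X, hg₀y⟩ := E.exists_lower R S K₀ ⟨g, hg, hgX, h g hg hgX⟩
    rcases K₀.stopped E.left_lt E.right_lt E.far with h | h | h
    · exact absurd (h b S.right_mem E.right_lt.le) (not_le.2 hy₀)
    · exact absurd (h g₀ hg₀ hg₀X) (not_lt.2 hg₀y.le)
    · exact absurd (h g hg hgX) (not_le.2 (hy₀.trans hgb))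

theorem CornerCut.launch (R : RectRegion ω G F) (C : CornerCut ω a b) : Launch ω G a b where
  source := C.source
  side := Or.inr fun g hg _ => C.down g hg
  start_le {X α β p} _ hp _ _ x hx := by
    have h1 := (fst_mem_of_segment hp).1
    rw [max_eq_left C.fst_lt.le] at h1
    exact h1.trans hx.1
  mem E K₀ hmin hp hpL _ hseg := C.exists_mem R E K₀ hmin hp hpL hseg

/-- The lower left corner of the bounding box as a degenerate crosscut. -/
structure PointCut (ω : Set Plane) (o : Plane) : Prop where
  mem : o ∈ ω
  left : ∀ g ∈ ω, o.1 ≤ g.1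
  down : ∀ g ∈ ω, o.2 ≤ g.2

theorem PointCut.launch (R : RectRegion ω G F) {o : Plane} (C : PointCut ω o) :
    Launch ω G o o where
  source := by
    obtain ⟨y, hy, hyω⟩ := R.ext_left o C.mem C.left
    refine ⟨by simpa using C.mem, le_rfl, Or.inr ⟨le_rfl, C.left⟩, Or.inr ⟨rfl, C.down, _, hyω,
      le_rfl, (C.down _ hyω).lt_of_ne hy.symm⟩, fun g hg _ _ => ⟨g, hg, le_rfl, C.down g hg⟩,
      fun p hp α β X hα _ _ hpL _ => ?_⟩
    rw [segment_same, mem_singleton_iff] at hp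
    subst hp
    have hp2 : p.2 = α * p.1 + β := congrArg Prod.snd hpL
    exact ⟨hp2.le, hp2.ge⟩
  side := Or.inl le_rfl
  start_le {X α β p} _ hp _ _ x hx := by
    rw [segment_same, mem_singleton_iff] at hp
    rw [hp]
    exact hx.1
  mem {X α β α₀ β₀ p} E _ _ hp _ _ hseg := by
    have hpX : p.1 < X := fst_lt_of_segment E.left_lt E.right_lt hp
    obtain ⟨s, hs, hsub⟩ := exists_maxSeg R.isCompact
      (fun h => hpX.ne (congrArg Prod.fst h) : p ≠ pt α β X) hseg
    rw [segment_same, mem_singleton_iff] at hp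
    exact ⟨s, R.mem_left s hs ⟨p, hsub (left_mem_segment ℝ _ _), hp ▸ C.left⟩
      ⟨_, hsub (right_mem_segment ℝ _ _), p, hp ▸ C.mem, hpX⟩, hsub⟩

/-! ### Goals -/

/-- A goal for a sequence of segments that moves to the upper right: `Goal` says that a segment
touches certain sides of the region, `Θ` is the part of the plane from which the segment `k`, which
has reached the goal, can no longer be avoided. -/
structure Target (ω : Set Plane) (G : Set (Set Plane)) (Θ k : Set Plane)
    (Goal : Set Plane → Prop) : Prop where
  up : ∀ g h : Plane, g ∈ Θ → g.1 ≤ h.1 → g.2 ≤ h.2 → h ∈ Θ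
  ne : ∀ g ∈ ω, g ∉ Θ → ∃ h ∈ ω, g.1 < h.1 ∧ g.2 < h.2
  mem : k ∈ G
  goal : Goal k
  meets : ∀ s, IsLineSegment s → s ⊆ ω → (∃ g ∈ s, g ∈ Θ) → (∃ g ∈ s, g ∉ Θ) → (s ∩ k).Nonempty
  mono : ∀ s t, s ⊆ t → Goal s → Goal t
  hits : ∀ s ⊆ ω, Goal s → ∃ g ∈ s, g ∈ Θ
  mem_of_goal : ∀ s, MaxSeg ω s → Goal s → (∃ g ∈ s, g ∉ Θ) → s ∈ G

variable {Θ k : Set Plane} {Goal : Set Plane → Prop}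

theorem Target.swap (T : Target ω G Θ k Goal) :
    Target (swapSet ω) (swapFam G) (swapSet Θ) (swapSet k) (fun s => Goal (swapSet s)) where
  up g h hg h1 h2 := T.up g.swap h.swap hg h2 h1
  ne g hg hgΘ := by
    obtain ⟨h, hh, h1, h2⟩ := T.ne g.swap hg hgΘ
    exact ⟨h.swap, by simpa using hh, h2, h1⟩
  mem := T.mem
  goal := T.goal
  meets s hs hsω h1 h2 := by
    obtain ⟨g, hg, hgk⟩ := T.meets (swapSet s) hs.swap (swapSet_subset.1 hsω)
      (exists_swapSet.2 h1) (exists_swapSet.2 h2)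
    exact ⟨g.swap, hg, by simpa using hgk⟩
  mono s t hst := T.mono _ _ (swapSet_subset.2 hst)
  hits s hs hg := by
    obtain ⟨g, hg, hgΘ⟩ := T.hits (swapSet s) (swapSet_subset.1 hs) hg
    exact ⟨g.swap, hg, by simpa using hgΘ⟩
  mem_of_goal s hs hg h := T.mem_of_goal _ (swap_maxSeg_iff.1 hs) hg (exists_swapSet.2 h)

/-- If the goal is within reach of a segment from the crosscut, some candidate segment leads from
the crosscut to `Θ`. -/
theorem Launch.exists_final (R : RectRegion ω G F) (L : Launch ω G a b)
    (T : Target ω G Θ k Goal) {p q : Plane} (hp : p ∈ segment ℝ a b) (hpq : segment ℝ p q ⊆ ω)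
    (hq : q ∈ Θ) (haq : a.1 < q.1) (hbq : b.1 < q.1) :
    ∃ s ∈ G, (s ∩ segment ℝ a b).Nonempty ∧ (s ∩ Θ).Nonempty := by
  obtain ⟨α₁, β₁, K₁, -⟩ := L.source.exists_kLine hp hpq haq hbq
  obtain ⟨X, α, β, E, α₀, β₀, K₀, hmin⟩ :=
    L.source.exists_extremal R ⟨_, _, _, haq, hbq, K₁⟩
  obtain ⟨p', hp', hpL, hpX, hpa, hseg⟩ := E.kLine.exists_start R L.source E.left_lt E.right_lt
  obtain ⟨s, hs, hsub⟩ := L.mem E K₀ hmin hp' hpL hpa hseg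
  exact ⟨s, hs, ⟨p', hsub (left_mem_segment ℝ _ _), hp'⟩, _, hsub (right_mem_segment ℝ _ _),
    E.end_mem L.source (hseg (right_mem_segment ℝ _ _)) T.up T.ne hp hpq hq haq hbq⟩

/-- If the goal is not within reach, some candidate segment leads from the crosscut to a new
crosscut, and nothing reached from the old one is in front of the new one. -/
theorem Launch.exists_next (R : RectRegion ω G F) (L : Launch ω G a b)
    (T : Target ω G Θ k Goal) (h0 : ∃ X α β, a.1 < X ∧ b.1 < X ∧ KLine ω a b X α β)
    (hΘ : ∀ p ∈ segment ℝ a b, ∀ q, segment ℝ p q ⊆ ω → q ∉ Θ) :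
    ∃ s ∈ G, (s ∩ segment ℝ a b).Nonempty ∧ ∃ a' b', segment ℝ a' b' ⊆ s ∧ b' ∉ Θ ∧
      ((Cut ω a' b' ∧ ∀ p ∈ segment ℝ a b, ∀ q, segment ℝ p q ⊆ ω → q ∉ front a' b') ∨
        (Cut (swapSet ω) a'.swap b'.swap ∧
          ∀ p ∈ segment ℝ a b, ∀ q, segment ℝ p q ⊆ ω → q.swap ∉ front a'.swap b'.swap)) := by
  have S := L.source
  obtain ⟨X, α, β, E, α₀, β₀, K₀, hmin⟩ := S.exists_extremal R h0
  obtain ⟨p, hp, hpL, hpX, hpa, hseg⟩ := E.kLine.exists_start R S E.left_lt E.right_lt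
  obtain ⟨s, hs, hsub⟩ := L.mem E K₀ hmin hp hpL hpa hseg
  have he := hΘ p hp _ hseg
  have heω : pt α β X ∈ ω := hseg (right_mem_segment ℝ _ _)
  obtain ⟨h, hh, hhX, hhy⟩ := T.ne _ heω he
  refine ⟨s, hs, ⟨p, hsub (left_mem_segment ℝ _ _), hp⟩, ?_⟩
  by_cases hse : ∀ g ∈ ω, X < g.1 → α * X + β < g.2
  · obtain ⟨v, hv, hvs, hfr⟩ := E.next_right R S hp hpL hseg (L.start_le E hp hpL hpa) hse
      ⟨h, hh, hhX⟩
    exact ⟨v, _, hvs.trans hsub, he, Or.inr ⟨hv, hfr⟩⟩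
  push Not at hse
  obtain ⟨g, hg, hgX, hgy⟩ := E.exists_lower R S K₀ hse
  have hnw : ∀ g ∈ ω, g.1 ≤ X → g.2 ≤ α * X + β := by
    rcases E.kLine.stopped E.left_lt E.right_lt E.far with h1 | h1 | h1
    · exact h1
    · obtain ⟨k, hk, hkX, hky⟩ := hse
      exact absurd (h1 k hk hkX) (not_lt.2 hky)
    · exact absurd (h1 h hh hhX) (not_le.2 hhy)
  -- The upper boundary stops the lowest line as well, so both end in the same point.
  have heq : α₀ * X + β₀ = α * X + β := by
    obtain ⟨p₀, hp₀, hp₀L, hp₀X, -, hseg₀⟩ := K₀.exists_start R S E.left_lt E.right_lt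
    obtain ⟨h', hh', hhX', hhy'⟩ := T.ne _ (hseg₀ (right_mem_segment ℝ _ _)) (hΘ p₀ hp₀ _ hseg₀)
    refine le_antisymm (hmin _ _ E.kLine) ?_
    rcases K₀.stopped E.left_lt E.right_lt E.far with h1 | h1 | h1
    · exact h1 _ heω le_rfl
    · exact absurd (h1 g hg hgX) (not_lt.2 hgy.le)
    · exact absurd (h1 h' hh' hhX') (not_le.2 hhy')
  rw [heq] at hmin hgy
  obtain ⟨c, hc, hcs, hfr⟩ := E.next_up R S hmin L.side hp hpL hseg hnw ⟨g, hg, hgX, hgy⟩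
  exact ⟨c, _, hcs.trans hsub, he, Or.inl ⟨hc, hfr⟩⟩

end Launch

/-! ### Replacing a chain of segments by candidates -/

/-- `Linked ω Goal n y`: the segment `y` is the first of `n` segments in `ω`, each of which meets
the next one and the last of which has the property `Goal`. -/
inductive Linked (ω : Set Plane) (Goal : Set Plane → Prop) : ℕ → Set Plane → Prop
  | last {y} : IsLineSegment y → y ⊆ ω → Goal y → Linked ω Goal 1 y
  | cons {n y y'} : IsLineSegment y → y ⊆ ω → (y ∩ y').Nonempty → Linked ω Goal n y' →
      Linked ω Goal (n + 1) y

/-- At most `n` candidates form a connected set that meets `w` and contains a segment with the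
property `Goal`. -/
def Joins (G : Set (Set Plane)) (Goal : Set Plane → Prop) (n : ℕ) (w : Set Plane) : Prop :=
  ∃ S ⊆ G, S.Finite ∧ S.ncard ≤ n ∧ IsPathConnected (⋃₀ S) ∧ (⋃₀ S ∩ w).Nonempty ∧ ∃ s ∈ S, Goal s

section Chain

variable {ω : Set Plane} {G : Set (Set Plane)} {F : Set ℝ} {a b p : Plane} {Θ k y : Set Plane}
  {Goal : Set Plane → Prop} {n : ℕ}

theorem Linked.isLineSegment (h : Linked ω Goal n y) : IsLineSegment y := by
  cases h <;> assumption

theorem Linked.subset (h : Linked ω Goal n y) : y ⊆ ω := by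
  cases h <;> assumption

theorem Linked.pos (h : Linked ω Goal n y) : 1 ≤ n := by
  cases h <;> omega

theorem Linked.swap (h : Linked ω Goal n y) :
    Linked (swapSet ω) (fun s => Goal (swapSet s)) n (swapSet y) := by
  induction h with
  | last h1 h2 h3 => exact .last h1.swap (swapSet_subset.2 h2) h3
  | cons h1 h2 h3 _ ih =>
    obtain ⟨g, hg, hg'⟩ := h3
    exact .cons h1.swap (swapSet_subset.2 h2) ⟨g.swap, by simpa using hg, by simpa using hg'⟩ ih

theorem Joins.mono {m : ℕ} {w : Set Plane} (h : Joins G Goal n w) (hnm : n ≤ m) :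
    Joins G Goal m w := by
  obtain ⟨S, h1, h2, h3, h4⟩ := h
  exact ⟨S, h1, h2, h3.trans hnm, h4⟩

theorem sUnion_swapSet_image (S : Set (Set Plane)) : ⋃₀ (swapSet '' S) = swapSet (⋃₀ S) := by
  ext z
  simp [swapSet]

theorem Joins.of_swap {w : Set Plane}
    (h : Joins (swapFam G) (fun s => Goal (swapSet s)) n (swapSet w)) : Joins G Goal n w := by
  obtain ⟨S, h1, h2, h3, h4, ⟨z, hz, hzw⟩, s, hs, hg⟩ := h
  refine ⟨swapSet '' S, ?_, h2.image _, ?_, ?_, ⟨z.swap, ?_, hzw⟩, _, mem_image_of_mem _ hs, hg⟩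
  · rintro _ ⟨s, hs, rfl⟩
    exact h1 hs
  · rwa [ncard_image_of_injective S swapSet_injective]
  · rw [sUnion_swapSet_image]
    exact isPathConnected_swapSet h4
  · rw [sUnion_swapSet_image]
    simpa using hz

theorem Joins.cons {s w w' : Set Plane} (hs : s ∈ G) (hseg : IsLineSegment s) (hw' : w' ⊆ s)
    (hw : (s ∩ w).Nonempty) (h : Joins G Goal n w') : Joins G Goal (n + 1) w := by
  obtain ⟨S, h1, h2, h3, h4, ⟨z, hz, hzw⟩, t, ht, hg⟩ := h
  refine ⟨insert s S, insert_subset hs h1, h2.insert s, (ncard_insert_le s S).trans (by omega), ?_,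
    ?_, t, mem_insert_of_mem s ht, hg⟩
  · rw [sUnion_insert]
    exact hseg.isPathConnected.union h4 ⟨z, hw' hzw, hz⟩
  · rw [sUnion_insert]
    exact hw.mono (inter_subset_inter_left _ subset_union_left)

/-- A segment that meets `w` and reaches the goal can be replaced by a maximal extension. -/
theorem joins_of_goal (R : RectRegion ω G F) (T : Target ω G Θ k Goal) {w : Set Plane}
    (hw : ∀ p ∈ w, p ∉ Θ) (hy : IsLineSegment y) (hyω : y ⊆ ω) (hg : Goal y)
    (hyw : (y ∩ w).Nonempty) : Joins G Goal 1 w := by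
  obtain ⟨s, hs, hys⟩ := exists_maxSeg_of_isLineSegment R.isCompact hy hyω
  obtain ⟨p, hpy, hpw⟩ := hyw
  have hgs := T.mono y s hys hg
  refine ⟨{s}, singleton_subset_iff.2 (T.mem_of_goal s hs hgs ⟨p, hys hpy, hw p hpw⟩),
    finite_singleton s, (ncard_singleton s).le, ?_, ?_, s, rfl, hgs⟩
  · rw [sUnion_singleton]
    exact hs.1.isPathConnected
  · rw [sUnion_singleton]
    exact ⟨p, hys hpy, hpw⟩

/-- If `Θ` is within reach, two candidates suffice: one that leads from the crosscut to `Θ`, and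
`k`. -/
theorem Launch.joins_final (R : RectRegion ω G F) (L : Launch ω G a b) (T : Target ω G Θ k Goal)
    (hw : ∀ p ∈ segment ℝ a b, p ∉ Θ) {q : Plane} (hp : p ∈ segment ℝ a b)
    (hpq : segment ℝ p q ⊆ ω) (hq : q ∈ Θ) (haq : a.1 < q.1) (hbq : b.1 < q.1) :
    Joins G Goal 2 (segment ℝ a b) := by
  obtain ⟨s, hs, ⟨z, hzs, hzw⟩, ⟨u, hus, huΘ⟩⟩ := L.exists_final R T hp hpq hq haq hbq
  have hsm := R.maxSeg s hs
  have hkm := R.maxSeg k T.mem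
  refine ⟨{s, k}, insert_subset hs (singleton_subset_iff.2 T.mem), toFinite _,
    (ncard_insert_le s {k}).trans (by rw [ncard_singleton]), ?_, ?_, k, mem_insert_of_mem s rfl,
    T.goal⟩
  · rw [sUnion_pair]
    exact hsm.1.isPathConnected.union hkm.1.isPathConnected
      (T.meets s hsm.1 hsm.2.1 ⟨u, hus, huΘ⟩ ⟨z, hzs, hw z hzw⟩)
  · rw [sUnion_pair]
    exact ⟨z, Or.inl hzs, hzw⟩

/-- A connected set that meets two closed sets covering it meets them in a common point. -/
theorem front_inter_nonempty_of_cover {A B T w : Set Plane} (hT : IsPreconnected T)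
    (hA : IsClosed A) (hB : IsClosed B) (hcov : T ⊆ A ∪ B) (h1 : (T ∩ A).Nonempty)
    (h2 : (T ∩ B).Nonempty) (hAB : ∀ g ∈ T, g ∈ A → g ∈ B → g ∈ w) : (T ∩ w).Nonempty := by
  obtain ⟨g, hg, hgA, hgB⟩ := isPreconnected_closed_iff.1 hT A B hA hB hcov h1 h2
  exact ⟨g, hg, hAB g hg hgA hgB⟩

theorem mem_segment_of_cross {g : Plane} (hab : a.2 < b.2) (h1 : a.2 ≤ g.2) (h2 : g.2 ≤ b.2)
    (h : (g.2 - a.2) * (b.1 - a.1) = (b.2 - a.2) * (g.1 - a.1)) : g ∈ segment ℝ a b := by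
  have hd : 0 < b.2 - a.2 := sub_pos.2 hab
  refine mem_segment_iff.2 ⟨(g.2 - a.2) / (b.2 - a.2), div_nonneg (by linarith) hd.le,
    (div_le_one hd).2 (by linarith), ?_, ?_⟩
  · field_simp
    linarith
  · field_simp
    ring

/-- A connected set can pass to the front of a crosscut only through the crosscut. -/
theorem Cut.inter_nonempty (C : Cut ω a b) {T : Set Plane} (hT : IsPreconnected T) (hTω : T ⊆ ω)
    (h1 : ∃ g ∈ T, g ∉ front a b) (h2 : ∃ g ∈ T, g ∈ front a b) :
    (T ∩ segment ℝ a b).Nonempty := by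
  have hab1 := C.fst_lt
  have hab2 := C.snd_lt
  -- The closures of the parts of the region behind and in front of the crosscut.
  refine front_inter_nonempty_of_cover hT
    (A := {g | g.2 ≤ a.2 ∧ g.1 ≤ a.1} ∪
      {g | (a.2 ≤ g.2 ∧ g.2 ≤ b.2) ∧ (b.2 - a.2) * (g.1 - a.1) ≤ (g.2 - a.2) * (b.1 - a.1)})
    (B := {g | b.2 ≤ g.2 ∧ b.1 ≤ g.1} ∪
      {g | (a.2 ≤ g.2 ∧ g.2 ≤ b.2) ∧ (g.2 - a.2) * (b.1 - a.1) ≤ (b.2 - a.2) * (g.1 - a.1)})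
    ?_ ?_ ?_ ?_ ?_ ?_
  · refine IsClosed.union (IsClosed.and ?_ ?_) (IsClosed.and (IsClosed.and ?_ ?_) ?_) <;>
      exact isClosed_le (by fun_prop) (by fun_prop)
  · refine IsClosed.union (IsClosed.and ?_ ?_) (IsClosed.and (IsClosed.and ?_ ?_) ?_) <;>
      exact isClosed_le (by fun_prop) (by fun_prop)
  · intro g hg
    rcases lt_or_ge g.2 a.2 with h3 | h3
    · exact Or.inl (Or.inl ⟨h3.le, not_lt.1 fun h4 => not_le.2 h3 (C.se g (hTω hg) h4)⟩)
    rcases lt_or_ge b.2 g.2 with h4 | h4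
    · exact Or.inr (Or.inl ⟨h4.le, not_lt.1 fun h5 => not_le.2 h4 (C.nw g (hTω hg) h5.le)⟩)
    rcases le_total ((b.2 - a.2) * (g.1 - a.1)) ((g.2 - a.2) * (b.1 - a.1)) with h5 | h5
    · exact Or.inl (Or.inr ⟨⟨h3, h4⟩, h5⟩)
    · exact Or.inr (Or.inr ⟨⟨h3, h4⟩, h5⟩)
  · obtain ⟨g, hg, hgf⟩ := h1
    refine ⟨g, hg, ?_⟩
    rcases lt_or_ge g.2 a.2 with h3 | h3
    · exact Or.inl ⟨h3.le, not_lt.1 fun h4 => not_le.2 h3 (C.se g (hTω hg) h4)⟩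
    · right
      by_contra hc
      apply hgf
      refine ⟨h3, ?_⟩
      by_contra! h4
      exact hc ⟨⟨h3, h4.1⟩, h4.2⟩
  · obtain ⟨g, hg, h3, h4⟩ := h2
    refine ⟨g, hg, ?_⟩
    rcases lt_or_ge b.2 g.2 with h5 | h5
    · exact Or.inl ⟨h5.le, not_lt.1 fun h6 => not_le.2 h5 (C.nw g (hTω hg) h6.le)⟩
    · exact Or.inr ⟨⟨h3, h5⟩, (h4.resolve_left (not_lt.2 h5)).le⟩
  · rintro g - (⟨h1, h2⟩ | ⟨⟨h1, h2⟩, h3⟩) (⟨h4, h5⟩ | ⟨⟨h4, h5⟩, h6⟩)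
    · linarith
    · have h7 : g.2 = a.2 := le_antisymm h1 h4
      refine mem_segment_of_cross hab2 h4 h5 (le_antisymm h6 ?_)
      rw [h7]
      nlinarith
    · have h7 : g.2 = b.2 := le_antisymm h2 h4
      refine mem_segment_of_cross hab2 h1 h2 (le_antisymm ?_ h3)
      rw [h7]
      nlinarith
    · exact mem_segment_of_cross hab2 h1 h2 (le_antisymm h6 h3)

/-- A connected set can pass to the front of the segment across the lower left corner only through
this segment, since nothing of the region lies to the left of it or below it. -/
theorem CornerCut.inter_nonempty (C : CornerCut ω a b) {T : Set Plane} (hT : IsPreconnected T)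
    (hTω : T ⊆ ω) (h1 : ∃ g ∈ T, g ∉ front a b) (h2 : ∃ g ∈ T, g ∈ front a b) :
    (T ∩ segment ℝ a b).Nonempty := by
  have hab1 := C.fst_lt
  have hab2 := C.snd_lt
  refine front_inter_nonempty_of_cover hT
    (A := {g | (b.2 - a.2) * (g.1 - a.1) ≤ (g.2 - a.2) * (b.1 - a.1)})
    (B := {g | (g.2 - a.2) * (b.1 - a.1) ≤ (b.2 - a.2) * (g.1 - a.1)})
    (isClosed_le (by fun_prop) (by fun_prop)) (isClosed_le (by fun_prop) (by fun_prop))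
    (fun g _ => le_total ((b.2 - a.2) * (g.1 - a.1)) ((g.2 - a.2) * (b.1 - a.1))) ?_ ?_ ?_
  · obtain ⟨g, hg, hgf⟩ := h1
    refine ⟨g, hg, ?_⟩
    by_contra hc
    exact hgf ⟨C.down g (hTω hg), Or.inr (not_le.1 hc)⟩
  · obtain ⟨g, hg, h3, h4⟩ := h2
    refine ⟨g, hg, ?_⟩
    rcases h4 with h4 | h4
    · have := C.left g (hTω hg)
      simp only [mem_ofPred_eq]
      nlinarith
    · exact h4.le
  · intro g hg h3 h4
    have h5 := C.left g (hTω hg)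
    have h6 := C.down g (hTω hg)
    have h7 : (g.2 - a.2) * (b.1 - a.1) = (b.2 - a.2) * (g.1 - a.1) := le_antisymm h4 h3
    refine mem_segment_of_cross hab2 h6 ?_ h7
    by_contra! hc
    nlinarith

/-- The statement that a chain of `n` segments which starts behind a crosscut can be replaced by
candidates. -/
def ChainClaim (n : ℕ) : Prop :=
  ∀ {ω : Set Plane} {G : Set (Set Plane)} {F : Set ℝ} {a b : Plane} {Θ k y : Set Plane}
    {Goal : Set Plane → Prop}, RectRegion ω G F → Target ω G Θ k Goal → Cut ω a b → b ∉ Θ →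
    Linked ω Goal n y → (∃ g ∈ y, g ∉ front a b) → Joins G Goal n (segment ℝ a b)

/-- If `Θ` is out of reach, the candidate that leads to the next crosscut replaces the first segment
`y` of the chain: since `y` starts at the old crosscut, the rest of the chain starts behind the new
one. -/
theorem Launch.joins_next (R : RectRegion ω G F) (L : Launch ω G a b) (T : Target ω G Θ k Goal)
    (hn : ChainClaim n) (h0 : ∃ X α β, a.1 < X ∧ b.1 < X ∧ KLine ω a b X α β)
    (hΘ : ∀ p ∈ segment ℝ a b, ∀ q, segment ℝ p q ⊆ ω → q ∉ Θ) {y' : Set Plane}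
    (hy : IsLineSegment y) (hyω : y ⊆ ω) (hyw : (y ∩ segment ℝ a b).Nonempty)
    (hyy' : (y ∩ y').Nonempty) (hl : Linked ω Goal n y') :
    Joins G Goal (n + 1) (segment ℝ a b) := by
  obtain ⟨s, hs, hsw, a', b', hsub, hb', h⟩ := L.exists_next R T h0 hΘ
  obtain ⟨p, hpy, hpw⟩ := hyw
  obtain ⟨g, hgy, hgy'⟩ := hyy'
  have hpg : segment ℝ p g ⊆ ω := (hy.convex.segment_subset hpy hgy).trans hyω
  refine Joins.cons hs (R.maxSeg s hs).1 hsub hsw ?_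
  rcases h with ⟨C, hfr⟩ | ⟨C, hfr⟩
  · exact hn R T C hb' hl ⟨g, hgy', hfr p hpw g hpg⟩
  · have := hn R.swap T.swap C (by simpa using hb') hl.swap
      ⟨g.swap, by simpa using hgy', hfr p hpw g hpg⟩
    rw [← swapSet_segment] at this
    exact this.of_swap

theorem Cut.notMem_of_mem (T : Target ω G Θ k Goal) (C : Cut ω a b) (hb : b ∉ Θ) :
    ∀ p ∈ segment ℝ a b, p ∉ Θ := fun p hp h =>
  hb (T.up p b h (fst_le_of_segment C.fst_lt.le le_rfl hp) (snd_mem_of_segment C.snd_lt.le hp).2)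

/-- All points of the region in `Θ` are in front of a crosscut whose upper end is not in `Θ`. -/
theorem Cut.mem_front (T : Target ω G Θ k Goal) (C : Cut ω a b) (hb : b ∉ Θ) {g : Plane}
    (hg : g ∈ ω) (hgΘ : g ∈ Θ) : g ∈ front a b := by
  have hab1 := C.fst_lt
  have hab2 := C.snd_lt
  refine ⟨?_, ?_⟩
  · by_contra! hc
    refine hb (T.up g b hgΘ ?_ (hc.trans hab2).le)
    by_contra! h
    exact absurd (C.se g hg (hab1.trans h)) (not_le.2 hc)
  · by_contra! hc
    refine hb (T.up g b hgΘ ?_ hc.1)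
    by_contra! h
    nlinarith [hc.1, hc.2]

/-- The step of the replacement for a crosscut that a segment of the chain meets. -/
theorem Launch.joins_of_meets (R : RectRegion ω G F) (L : Launch ω G a b)
    (T : Target ω G Θ k Goal) (hn : ∀ m < n, ChainClaim m)
    (hw : ∀ p ∈ segment ℝ a b, p ∉ Θ)
    (hfar : ∀ p ∈ segment ℝ a b, ∀ q ∈ Θ, segment ℝ p q ⊆ ω → a.1 < q.1 ∧ b.1 < q.1)
    (h0 : ∃ X α β, a.1 < X ∧ b.1 < X ∧ KLine ω a b X α β)
    (hl : Linked ω Goal n y) (hyw : (y ∩ segment ℝ a b).Nonempty) :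
    Joins G Goal n (segment ℝ a b) := by
  by_cases hg : Goal y
  · exact (joins_of_goal R T hw hl.isLineSegment hl.subset hg hyw).mono hl.pos
  cases hl with
  | last h1 h2 h3 => exact absurd h3 hg
  | @cons m _ y' h1 h2 h3 h4 =>
    by_cases hΘ : ∃ p ∈ segment ℝ a b, ∃ q ∈ Θ, segment ℝ p q ⊆ ω
    · obtain ⟨p, hp, q, hq, hpq⟩ := hΘ
      obtain ⟨haq, hbq⟩ := hfar p hp q hq hpq
      exact (L.joins_final R T hw hp hpq hq haq hbq).mono (by have := h4.pos; omega)
    · push Not at hΘ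
      exact L.joins_next R T (hn m (Nat.lt_succ_self m)) h0
        (fun p hp q hpq hq => hΘ p hp q hq hpq) h1 h2 hyw h3 h4

/-- Induction on the length of the chain. A first segment that does not meet the crosscut stays
behind it and is dropped; otherwise a step from the crosscut replaces it. -/
theorem chainClaim (n : ℕ) : ChainClaim n := by
  induction n using Nat.strong_induction_on with
  | _ n ih =>
  intro ω G F a b Θ k y Goal R T C hb hl hy
  have hw := C.notMem_of_mem T hb
  by_cases hyw : (y ∩ segment ℝ a b).Nonempty
  · obtain ⟨h, hh, hh1, -⟩ := T.ne b (C.source R).right_mem hb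
    obtain ⟨g, hg, hg1, hg2⟩ := R.exists_lower_right (C.source R).right_mem C.nw ⟨h, hh, hh1⟩
      ⟨a, (C.source R).left_mem, Or.inl C.fst_lt⟩
    refine (C.launch R).joins_of_meets R T ih hw (fun p hp q hq hpq => ?_)
      ⟨_, _, _, C.fst_lt.trans hg1, hg1, (C.source R).kLine_horizontal hg (C.fst_lt.trans hg1) hg1
        hg2.le⟩ hl hyw
    have : b.1 < q.1 := by
      by_contra! hc
      exact hb (T.up q b hq hc (C.nw q (hpq (right_mem_segment ℝ p q)) hc))
    exact ⟨C.fst_lt.trans this, this⟩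
  · have hback : ∀ g ∈ y, g ∉ front a b := fun g hg hgf => hyw
      (C.inter_nonempty hl.isLineSegment.convex.isPreconnected hl.subset hy ⟨g, hg, hgf⟩)
    cases hl with
    | last h1 h2 h3 =>
      obtain ⟨g, hg, hgΘ⟩ := T.hits y h2 h3
      exact absurd (C.mem_front T hb (h2 hg) hgΘ) (hback g hg)
    | cons h1 h2 h3 h4 =>
      obtain ⟨g, hg, hg'⟩ := h3
      exact (ih _ (Nat.lt_succ_self _) R T C hb h4 ⟨g, hg', hback g hg⟩).mono (Nat.le_succ _)

/-- The replacement for a chain that starts on the left side of the region. -/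
theorem SideCut.joins (R : RectRegion ω G F) (T : Target ω G Θ k Goal) (C : SideCut ω a b)
    (hb : b ∉ Θ) (hl : Linked ω Goal n y) (hyw : (y ∩ segment ℝ a b).Nonempty) :
    Joins G Goal n (segment ℝ a b) := by
  have S := (C.launch R).source
  obtain ⟨h, hh, hh1, -⟩ := T.ne b S.right_mem hb
  obtain ⟨g, hg, hg1, hg2⟩ := R.exists_lower_right S.right_mem C.nw ⟨h, hh, hh1⟩
    ⟨a, S.left_mem, Or.inr C.snd_lt⟩
  have hg1' : a.1 < g.1 := by rw [C.fst_eq]; exact hg1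
  refine (C.launch R).joins_of_meets R T (fun m _ => chainClaim m) (fun p hp h => hb (T.up p b h
    (fst_le_of_segment C.fst_eq.le le_rfl hp) (snd_mem_of_segment C.snd_lt.le hp).2))
    (fun p hp q hq hpq => ?_) ⟨_, _, _, hg1', hg1, S.kLine_horizontal hg hg1' hg1 hg2.le⟩ hl hyw
  have : b.1 < q.1 := by
    by_contra! hc
    exact hb (T.up q b hq hc (C.nw q (hpq (right_mem_segment ℝ p q)) hc))
  exact ⟨by rw [C.fst_eq]; exact this, this⟩

/-- The replacement for a chain that starts in the lower left corner of the bounding box. -/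
theorem PointCut.joins (R : RectRegion ω G F) (T : Target ω G Θ k Goal) {o : Plane}
    (C : PointCut ω o) (ho : ∀ g ∈ ω, g.1 ≤ o.1 → g ∉ Θ) (hl : Linked ω Goal n y)
    (hy : o ∈ y) : Joins G Goal n {o} := by
  obtain ⟨x, hx, hxω⟩ := R.ext_down o C.mem C.down
  have hox : o.1 < x := (C.left _ hxω).lt_of_ne hx.symm
  have := (C.launch R).joins_of_meets R T (fun m _ => chainClaim m) (fun p hp h => ?_)
    (fun p hp q hq hpq => ?_) ⟨_, _, _, hox, hox, (C.launch R).source.kLine_horizontal hxω hox hox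
      le_rfl⟩ hl ⟨o, hy, left_mem_segment ℝ o o⟩
  · rwa [segment_same] at this
  · rw [segment_same, mem_singleton_iff] at hp
    exact ho p (hp ▸ C.mem) (hp ▸ le_rfl) h
  · have : o.1 < q.1 := not_le.1 fun hc => ho q (hpq (right_mem_segment ℝ p q)) hc hq
    exact ⟨this, this⟩

/-- Behind the segment across the lower left corner, nothing lies beyond the corner `(a.1, b.2)`. -/
theorem CornerCut.le_corner (C : CornerCut ω a b) {g : Plane} (hg : g ∈ ω)
    (h : g ∉ front a b) : g.1 ≤ a.1 ∧ g.2 ≤ b.2 := by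
  have h1 := C.fst_lt
  have h2 := C.snd_lt
  have h3 := C.left g hg
  have h4 := C.down g hg
  have h5 : ¬ (b.2 < g.2 ∨ (g.2 - a.2) * (b.1 - a.1) < (b.2 - a.2) * (g.1 - a.1)) :=
    fun h5 => h ⟨h4, h5⟩
  push Not at h5
  refine ⟨?_, h5.1⟩
  by_contra! hc
  nlinarith [h5.2]

/-- The replacement for a chain that starts behind the segment across the lower left corner. -/
theorem CornerCut.joins (R : RectRegion ω G F) (T : Target ω G Θ k Goal) (C : CornerCut ω a b)
    (hc : (a.1, b.2) ∉ Θ) (hl : Linked ω Goal n y) (hy : ∃ g ∈ y, g ∉ front a b) :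
    Joins G Goal n (segment ℝ a b) := by
  induction hl with
  | @last y h1 h2 h3 =>
    obtain ⟨g, hg, hgΘ⟩ := T.hits y h2 h3
    have hgf : g ∈ front a b := by
      by_contra hgf
      obtain ⟨h4, h5⟩ := C.le_corner (h2 hg) hgf
      exact hc (T.up g _ hgΘ h4 h5)
    refine joins_of_goal R T (fun p hp h => hc (T.up p _ h ?_ ?_)) h1 h2 h3
      (C.inter_nonempty h1.convex.isPreconnected h2 hy ⟨g, hg, hgf⟩)
    · exact fst_le_of_segment (X := a.1) (a := a) le_rfl C.fst_lt.le hp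
    · exact (snd_mem_of_segment C.snd_lt.le hp).2
  | @cons m y y' h1 h2 h3 h4 ih =>
    by_cases hyw : (y ∩ segment ℝ a b).Nonempty
    swap
    · obtain ⟨g, hg, hg'⟩ := h3
      refine (ih ⟨g, hg', fun hgf => hyw ?_⟩).mono (Nat.le_succ m)
      exact C.inter_nonempty h1.convex.isPreconnected h2 hy ⟨g, hg, hgf⟩
    have hw : ∀ p ∈ segment ℝ a b, p ∉ Θ := fun p hp h => hc (T.up p _ h
      (fst_le_of_segment (X := a.1) (a := a) le_rfl C.fst_lt.le hp)
      (snd_mem_of_segment C.snd_lt.le hp).2)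
    have hsw : swapSet (segment ℝ a b) = segment ℝ b.swap a.swap := by
      rw [swapSet_segment, segment_symm]
    by_cases hΘ : ∃ p ∈ segment ℝ a b, ∃ q ∈ Θ, segment ℝ p q ⊆ ω
    · obtain ⟨p, hp, q, hq, hpq⟩ := hΘ
      have h2m : 2 ≤ m + 1 := by have := h4.pos; omega
      by_cases haq : a.1 < q.1
      · exact ((C.launch R).joins_final R T hw hp hpq hq haq (C.fst_lt.trans haq)).mono h2m
      · have hbq : b.2 < q.2 := by
          by_contra! h
          exact hc (T.up q _ hq (not_lt.1 haq) h)
        have := (C.swap.launch R.swap).joins_final R.swap T.swap (p := p.swap) (q := q.swap)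
          (fun p hp => hw p.swap (by rw [← hsw] at hp; exact hp))
          (by rw [← hsw]; simpa using hp)
          (by rw [← swapSet_segment]; exact swapSet_subset.2 hpq) (by simpa using hq) hbq
          (C.snd_lt.trans hbq)
        rw [← hsw] at this
        exact this.of_swap.mono h2m
    push Not at hΘ
    by_cases hr : ∃ g ∈ ω, a.1 < g.1 ∧ g.2 ≤ b.2
    · obtain ⟨g, hg, hg1, hg2⟩ := hr
      have hbg := C.fst_lt.trans hg1
      exact (C.launch R).joins_next R T (chainClaim m)
        ⟨_, _, _, hg1, hbg, C.source.kLine_horizontal hg hg1 hbg hg2⟩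
        (fun p hp q hpq hq => hΘ p hp q hq hpq) h1 h2 hyw h3 h4
    -- Otherwise the region continues above the crosscut, since it does not end at the corner.
    obtain ⟨g, hg, hg1, hg2⟩ : ∃ g ∈ ω, b.2 < g.2 ∧ g.1 ≤ a.1 := by
      by_contra! hu
      push Not at hr
      obtain ⟨h, hh, hh1, -⟩ := T.ne _ C.corner hc
      obtain ⟨g, hg, hg1, hg2⟩ := R.exists_lower_right C.corner
        (fun g hg hga => not_lt.1 fun hbg => not_lt.2 hga (hu g hg hbg)) ⟨h, hh, hh1⟩
        ⟨a, C.source.left_mem, Or.inr C.snd_lt⟩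
      exact absurd (hr g hg hg1) (not_lt.2 hg2.le)
    have hag := C.snd_lt.trans hg1
    obtain ⟨z, hz, hzw⟩ := hyw
    obtain ⟨u, hu, hu'⟩ := h3
    have := (C.swap.launch R.swap).joins_next R.swap T.swap (chainClaim m)
      ⟨_, _, _, hg1, hag, C.swap.source.kLine_horizontal (q := g.swap) (by simpa using hg) hg1 hag
        hg2⟩
      (fun p hp q hpq hq => hΘ p.swap (by rw [← hsw] at hp; exact hp) q.swap hq (by
        rw [← swapSet_segment]
        exact swapSet_subset.1 (by simpa using hpq))) h1.swap (swapSet_subset.2 h2)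
      ⟨z.swap, by simpa using hz, by rw [← hsw]; simpa using hzw⟩
      ⟨u.swap, by simpa using hu, by simpa using hu'⟩ h4.swap
    rw [← hsw] at this
    exact this.of_swap

end Chain

/-! ### Full horizontal and vertical chords -/

/-- `g` is a leftmost point of `ω`. -/
def Leftmost (ω : Set Plane) (g : Plane) : Prop := g ∈ ω ∧ ∀ h ∈ ω, g.1 ≤ h.1
/-- `g` is a rightmost point of `ω`. -/
def Rightmost (ω : Set Plane) (g : Plane) : Prop := g ∈ ω ∧ ∀ h ∈ ω, h.1 ≤ g.1
/-- `g` is a lowest point of `ω`. -/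
def Lowest (ω : Set Plane) (g : Plane) : Prop := g ∈ ω ∧ ∀ h ∈ ω, g.2 ≤ h.2
/-- `g` is a highest point of `ω`. -/
def Highest (ω : Set Plane) (g : Plane) : Prop := g ∈ ω ∧ ∀ h ∈ ω, h.2 ≤ g.2

/-- The points of `ω` at height `y`. -/
def hSlice (ω : Set Plane) (y : ℝ) : Set Plane := {g | g ∈ ω ∧ g.2 = y}
/-- The points of `ω` with abscissa `x`. -/
def vSlice (ω : Set Plane) (x : ℝ) : Set Plane := {g | g ∈ ω ∧ g.1 = x}

section Swap

variable {ω : Set Plane} {g : Plane}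

theorem Lowest.swap (h : Lowest ω g) : Leftmost (swapSet ω) g.swap :=
  ⟨by simpa using h.1, fun z hz => h.2 z.swap hz⟩
theorem Rightmost.swap (h : Rightmost ω g) : Highest (swapSet ω) g.swap :=
  ⟨by simpa using h.1, fun z hz => h.2 z.swap hz⟩
theorem Highest.swap (h : Highest ω g) : Rightmost (swapSet ω) g.swap :=
  ⟨by simpa using h.1, fun z hz => h.2 z.swap hz⟩

end Swap

theorem exists_mem_hSlice {ω T : Set Plane} (hT : IsPreconnected T) (hTω : T ⊆ ω) {g h : Plane}
    (hg : g ∈ T) (hh : h ∈ T) {y : ℝ} (h1 : g.2 ≤ y) (h2 : y ≤ h.2) :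
    (T ∩ hSlice ω y).Nonempty := by
  obtain ⟨z, hz, hzy⟩ := hT.intermediate_value hg hh continuous_snd.continuousOn ⟨h1, h2⟩
  exact ⟨z, hz, hTω hz, hzy⟩

theorem exists_mem_vSlice {ω T : Set Plane} (hT : IsPreconnected T) (hTω : T ⊆ ω) {g h : Plane}
    (hg : g ∈ T) (hh : h ∈ T) {x : ℝ} (h1 : g.1 ≤ x) (h2 : x ≤ h.1) :
    (T ∩ vSlice ω x).Nonempty := by
  obtain ⟨z, hz, hzy⟩ := hT.intermediate_value hg hh continuous_fst.continuousOn ⟨h1, h2⟩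
  exact ⟨z, hz, hTω hz, hzy⟩

namespace RectRegion

variable {ω : Set Plane} {G : Set (Set Plane)} {F : Set ℝ}

/-- A nondegenerate full horizontal chord is a maximal segment. -/
theorem maxSeg_hSlice (R : RectRegion ω G F) {g h : Plane} (hg : g ∈ ω) (hh : h ∈ ω)
    (hgh : g.2 = h.2) (hne : g.1 < h.1) : MaxSeg ω (hSlice ω g.2) := by
  have hc : IsCompact (hSlice ω g.2) :=
    R.isCompact.inter_right (isClosed_eq continuous_snd continuous_const)
  obtain ⟨p, hp, hpmin⟩ := hc.exists_isMinOn ⟨g, hg, rfl⟩ continuous_fst.continuousOn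
  obtain ⟨q, hq, hqmax⟩ := hc.exists_isMaxOn ⟨g, hg, rfl⟩ continuous_fst.continuousOn
  have hpq : p.1 < q.1 := (hpmin ⟨hg, rfl⟩).trans_lt (hne.trans_le (hqmax ⟨hh, hgh.symm⟩))
  have hp' : p = pt 0 g.2 p.1 := Prod.ext rfl (by simpa using hp.2)
  have hq' : q = pt 0 g.2 q.1 := Prod.ext rfl (by simpa using hq.2)
  have hseg : hSlice ω g.2 = segment ℝ p q := by
    ext z
    rw [hp', hq', mem_segment_pt hpq.le]
    constructor
    · intro hz
      exact ⟨hpmin hz, hqmax hz, by simpa using hz.2⟩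
    · rintro ⟨h1, h2, h3⟩
      have hz2 : z.2 = g.2 := by simpa using h3
      refine ⟨?_, hz2⟩
      have := R.mem_of_horizontal (x := z.1) (y := g.2) (x1 := p.1) (x2 := q.1)
        (by rw [← hp.2]; exact hp.1) (by rw [← hq.2]; exact hq.1) h1 h2
      rwa [← hz2] at this
  refine ⟨⟨p, q, fun h => hpq.ne (by rw [h]), hseg⟩, fun z hz => hz.1, fun t ht htω hsub => ?_⟩
  refine subset_antisymm (fun z hz => ⟨htω hz, ?_⟩) hsub
  obtain ⟨α, β, hl⟩ := ht.exists_line (hsub hp) (hsub hq) hpq.ne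
  have h1 : p.2 = α * p.1 + β := congrArg Prod.snd (hl p (hsub hp))
  have h2 : q.2 = α * q.1 + β := congrArg Prod.snd (hl q (hsub hq))
  have h3 : z.2 = α * z.1 + β := congrArg Prod.snd (hl z hz)
  have hα : α = 0 := by
    have : α * (q.1 - p.1) = 0 := by linarith [hp.2, hq.2]
    exact (mul_eq_zero.1 this).resolve_right (sub_ne_zero.2 hpq.ne')
  rw [hα] at h1 h3
  linarith [hp.2]

/-- The horizontal chord through a point of the left side is not degenerate. -/
theorem exists_hSlice_of_leftmost (R : RectRegion ω G F) {l : Plane} (hl : Leftmost ω l) :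
    ∃ h ∈ ω, l.2 = h.2 ∧ l.1 < h.1 := by
  have hfat : ∀ z ∈ ω, ∀ U : Set Plane, IsOpen U → z ∈ U → ∃ h ∈ ω, h ∈ U ∧ l.1 < h.1 := by
    intro z hz U hU hzU
    obtain ⟨g, hg, h, hh, h1, -⟩ := R.exists_ne_of_isOpen hU hz hzU
    exact ⟨h, hh.1, hh.2, (hl.2 g hg.1).trans_lt h1⟩
  by_cases hlow : Lowest ω l
  · obtain ⟨x, hx, hxω⟩ := R.ext_down l hl.1 hlow.2
    exact ⟨_, hxω, rfl, (hl.2 _ hxω).lt_of_ne hx.symm⟩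
  by_cases hhigh : Highest ω l
  · obtain ⟨x, hx, hxω⟩ := R.ext_up l hl.1 hhigh.2
    exact ⟨_, hxω, rfl, (hl.2 _ hxω).lt_of_ne hx.symm⟩
  simp only [Lowest, Highest, hl.1, true_and] at hlow hhigh
  push Not at hlow hhigh
  obtain ⟨u, hu, hul⟩ := hlow
  obtain ⟨v, hv, hvl⟩ := hhigh
  obtain ⟨u', hu', hul', hu1⟩ := hfat u hu {z | z.2 < l.2} (isOpen_lt continuous_snd
    continuous_const) hul
  obtain ⟨v', hv', hvl', hv1⟩ := hfat v hv {z | l.2 < z.2} (isOpen_lt continuous_const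
    continuous_snd) hvl
  refine ⟨(min u'.1 v'.1, l.2), ?_, rfl, lt_min hu1 hv1⟩
  exact R.mem_of_quadrants hl.1 (lt_min hu1 hv1).le le_rfl hv' (min_le_right _ _)
    (le_of_lt hvl') hl.1 (lt_min hu1 hv1).le le_rfl hu'
    (min_le_left _ _) (le_of_lt hul')

theorem exists_hSlice_of_rightmost (R : RectRegion ω G F) {r : Plane} (hr : Rightmost ω r) :
    ∃ h ∈ ω, h.2 = r.2 ∧ h.1 < r.1 := by
  have hfat : ∀ z ∈ ω, ∀ U : Set Plane, IsOpen U → z ∈ U → ∃ h ∈ ω, h ∈ U ∧ h.1 < r.1 := by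
    intro z hz U hU hzU
    obtain ⟨g, hg, h, hh, h1, -⟩ := R.exists_ne_of_isOpen hU hz hzU
    exact ⟨g, hg.1, hg.2, h1.trans_le (hr.2 h hh.1)⟩
  by_cases hlow : Lowest ω r
  · obtain ⟨x, hx, hxω⟩ := R.ext_down r hr.1 hlow.2
    exact ⟨_, hxω, rfl, (hr.2 _ hxω).lt_of_ne hx⟩
  by_cases hhigh : Highest ω r
  · obtain ⟨x, hx, hxω⟩ := R.ext_up r hr.1 hhigh.2
    exact ⟨_, hxω, rfl, (hr.2 _ hxω).lt_of_ne hx⟩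
  simp only [Lowest, Highest, hr.1, true_and] at hlow hhigh
  push Not at hlow hhigh
  obtain ⟨u, hu, hul⟩ := hlow
  obtain ⟨v, hv, hvl⟩ := hhigh
  obtain ⟨u', hu', hul', hu1⟩ := hfat u hu {z | z.2 < r.2} (isOpen_lt continuous_snd
    continuous_const) hul
  obtain ⟨v', hv', hvl', hv1⟩ := hfat v hv {z | r.2 < z.2} (isOpen_lt continuous_const
    continuous_snd) hvl
  refine ⟨(max u'.1 v'.1, r.2), ?_, rfl, max_lt hu1 hv1⟩
  exact R.mem_of_quadrants hv' (le_max_right _ _) (le_of_lt hvl') hr.1 (max_lt hu1 hv1).le le_rfl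
    hu' (le_max_left _ _) (le_of_lt hul') hr.1 (max_lt hu1 hv1).le le_rfl

theorem hSlice_mem_of_leftmost (R : RectRegion ω G F) {l : Plane} (hl : Leftmost ω l) :
    hSlice ω l.2 ∈ G := by
  obtain ⟨h, hh, h2, h1⟩ := R.exists_hSlice_of_leftmost hl
  exact R.mem_left _ (R.maxSeg_hSlice hl.1 hh h2 h1) ⟨l, ⟨hl.1, rfl⟩, hl.2⟩
    ⟨h, ⟨hh, h2.symm⟩, l, hl.1, h1⟩

theorem hSlice_mem_of_rightmost (R : RectRegion ω G F) {r : Plane} (hr : Rightmost ω r) :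
    hSlice ω r.2 ∈ G := by
  obtain ⟨h, hh, h2, h1⟩ := R.exists_hSlice_of_rightmost hr
  exact R.mem_right _ (h2 ▸ R.maxSeg_hSlice hh hr.1 h2 h1) ⟨r, ⟨hr.1, rfl⟩, hr.2⟩
    ⟨h, ⟨hh, h2⟩, r, hr.1, h1⟩

theorem vSlice_mem_of_lowest (R : RectRegion ω G F) {b : Plane} (hb : Lowest ω b) :
    vSlice ω b.1 ∈ G := R.swap.hSlice_mem_of_leftmost hb.swap

theorem vSlice_mem_of_highest (R : RectRegion ω G F) {t : Plane} (ht : Highest ω t) :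
    vSlice ω t.1 ∈ G := R.swap.hSlice_mem_of_rightmost ht.swap

theorem fst_lt_of_leftmost (R : RectRegion ω G F) {l r : Plane} (hl : Leftmost ω l)
    (hr : Rightmost ω r) : l.1 < r.1 := by
  obtain ⟨h, hh, -, h1⟩ := R.exists_hSlice_of_leftmost hl
  exact h1.trans_le (hr.2 h hh)

theorem snd_lt_of_lowest (R : RectRegion ω G F) {b t : Plane} (hb : Lowest ω b)
    (ht : Highest ω t) : b.2 < t.2 := R.swap.fst_lt_of_leftmost hb.swap ht.swap

/-- A maximal segment that touches two sides of the bounding box is a candidate. -/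
theorem mem_of_left_down (R : RectRegion ω G F) {s : Set Plane} (hs : MaxSeg ω s) {l b : Plane}
    (hl : Leftmost ω l) (hb : Lowest ω b) (hls : l ∈ s) (hbs : b ∈ s) : s ∈ G := by
  by_cases h1 : ∃ g ∈ s, ∃ h ∈ ω, h.1 < g.1
  · exact R.mem_left s hs ⟨l, hls, hl.2⟩ h1
  refine R.mem_down s hs ⟨b, hbs, hb.2⟩ ?_
  push Not at h1
  obtain ⟨z, hz, hzb⟩ := hs.1.exists_ne b
  refine ⟨z, hz, b, hb.1, (hb.2 z (hs.2.1 hz)).lt_of_ne fun h => hzb (Prod.ext ?_ h.symm)⟩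
  exact le_antisymm (h1 z hz b hb.1) (h1 b hbs z (hs.2.1 hz))

theorem mem_of_left_up (R : RectRegion ω G F) {s : Set Plane} (hs : MaxSeg ω s) {l b : Plane}
    (hl : Leftmost ω l) (hb : Highest ω b) (hls : l ∈ s) (hbs : b ∈ s) : s ∈ G := by
  by_cases h1 : ∃ g ∈ s, ∃ h ∈ ω, h.1 < g.1
  · exact R.mem_left s hs ⟨l, hls, hl.2⟩ h1
  refine R.mem_up s hs ⟨b, hbs, hb.2⟩ ?_
  push Not at h1
  obtain ⟨z, hz, hzb⟩ := hs.1.exists_ne b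
  refine ⟨z, hz, b, hb.1, (hb.2 z (hs.2.1 hz)).lt_of_ne fun h => hzb (Prod.ext ?_ h)⟩
  exact le_antisymm (h1 z hz b hb.1) (h1 b hbs z (hs.2.1 hz))

theorem mem_of_right_up (R : RectRegion ω G F) {s : Set Plane} (hs : MaxSeg ω s) {l b : Plane}
    (hl : Rightmost ω l) (hb : Highest ω b) (hls : l ∈ s) (hbs : b ∈ s) : s ∈ G := by
  by_cases h1 : ∃ g ∈ s, ∃ h ∈ ω, g.1 < h.1
  · exact R.mem_right s hs ⟨l, hls, hl.2⟩ h1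
  refine R.mem_up s hs ⟨b, hbs, hb.2⟩ ?_
  push Not at h1
  obtain ⟨z, hz, hzb⟩ := hs.1.exists_ne b
  refine ⟨z, hz, b, hb.1, (hb.2 z (hs.2.1 hz)).lt_of_ne fun h => hzb (Prod.ext ?_ h)⟩
  exact le_antisymm (h1 b hbs z (hs.2.1 hz)) (h1 z hz b hb.1)

theorem mem_of_right_down (R : RectRegion ω G F) {s : Set Plane} (hs : MaxSeg ω s) {l b : Plane}
    (hl : Rightmost ω l) (hb : Lowest ω b) (hls : l ∈ s) (hbs : b ∈ s) : s ∈ G :=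
  R.swap.mem_of_left_up (s := swapSet s) hs.swap hb.swap hl.swap (by simpa using hbs)
    (by simpa using hls)

theorem mem_of_left_right (R : RectRegion ω G F) {s : Set Plane} (hs : MaxSeg ω s) {l r : Plane}
    (hl : Leftmost ω l) (hr : Rightmost ω r) (hls : l ∈ s) (hrs : r ∈ s) : s ∈ G :=
  R.mem_left s hs ⟨l, hls, hl.2⟩ ⟨r, hrs, l, hl.1, R.fst_lt_of_leftmost hl hr⟩

theorem mem_of_down_up (R : RectRegion ω G F) {s : Set Plane} (hs : MaxSeg ω s) {b t : Plane}
    (hb : Lowest ω b) (ht : Highest ω t) (hbs : b ∈ s) (hts : t ∈ s) : s ∈ G :=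
  R.mem_down s hs ⟨b, hbs, hb.2⟩ ⟨t, hts, b, hb.1, R.snd_lt_of_lowest hb ht⟩

end RectRegion

/-! ### Families that touch all four sides -/

/-- `A` is the union of at most `n` members of `G`, and path connected. -/
def Built (G : Set (Set Plane)) (n : ℕ) (A : Set Plane) : Prop :=
  IsPathConnected A ∧ ∃ S ⊆ G, S.Finite ∧ S.ncard ≤ n ∧ ⋃₀ S = A

/-- `A` touches all four sides of the bounding box of `ω`. -/
structure Spans (ω A : Set Plane) : Prop where
  left : ∃ g ∈ A, Leftmost ω g
  right : ∃ g ∈ A, Rightmost ω g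
  down : ∃ g ∈ A, Lowest ω g
  up : ∃ g ∈ A, Highest ω g

section Built

variable {ω : Set Plane} {G : Set (Set Plane)} {F : Set ℝ} {A s : Set Plane} {n : ℕ}
  {l r b t : Plane}

theorem Spans.mono {B : Set Plane} (h : Spans ω A) (hAB : A ⊆ B) : Spans ω B where
  left := h.left.imp fun _ hg => ⟨hAB hg.1, hg.2⟩
  right := h.right.imp fun _ hg => ⟨hAB hg.1, hg.2⟩
  down := h.down.imp fun _ hg => ⟨hAB hg.1, hg.2⟩
  up := h.up.imp fun _ hg => ⟨hAB hg.1, hg.2⟩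

theorem spans_of_mem (hl : Leftmost ω l) (hr : Rightmost ω r) (hb : Lowest ω b)
    (ht : Highest ω t) (h1 : l ∈ A) (h2 : r ∈ A) (h3 : b ∈ A) (h4 : t ∈ A) : Spans ω A :=
  ⟨⟨l, h1, hl⟩, ⟨r, h2, hr⟩, ⟨b, h3, hb⟩, t, h4, ht⟩

theorem Built.mono {m : ℕ} (h : Built G n A) (hnm : n ≤ m) : Built G m A := by
  obtain ⟨h1, S, h2, h3, h4, h5⟩ := h
  exact ⟨h1, S, h2, h3, h4.trans hnm, h5⟩

theorem Built.subset (R : RectRegion ω G F) (h : Built G n A) : A ⊆ ω := by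
  obtain ⟨-, S, hS, -, -, rfl⟩ := h
  exact sUnion_subset fun s hs => (R.maxSeg s (hS hs)).2.1

theorem Built.isPreconnected (h : Built G n A) : IsPreconnected A :=
  h.1.isConnected.isPreconnected

theorem built_single (R : RectRegion ω G F) (hs : s ∈ G) : Built G 1 s :=
  ⟨(R.maxSeg s hs).1.isPathConnected, {s}, singleton_subset_iff.2 hs, finite_singleton s,
    (ncard_singleton s).le, sUnion_singleton s⟩

theorem Built.union (R : RectRegion ω G F) (h : Built G n A) (hs : s ∈ G)
    (hne : (A ∩ s).Nonempty) : Built G (n + 1) (A ∪ s) := by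
  obtain ⟨h1, S, h2, h3, h4, rfl⟩ := h
  refine ⟨h1.union (R.maxSeg s hs).1.isPathConnected hne, insert s S, insert_subset hs h2,
    h3.insert s, (ncard_insert_le s S).trans (by omega), ?_⟩
  rw [sUnion_insert, union_comm]

/-- The horizontal chord through a point of the left side can be added to a connected set that has
points at or above and at or below its height. -/
theorem Built.union_left (R : RectRegion ω G F) (h : Built G n A) (hl : Leftmost ω l) {g k : Plane}
    (hg : g ∈ A) (hk : k ∈ A) (h1 : g.2 ≤ l.2) (h2 : l.2 ≤ k.2) :
    ∃ B, Built G (n + 1) B ∧ A ⊆ B ∧ l ∈ B :=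
  ⟨_, h.union R (R.hSlice_mem_of_leftmost hl)
    (exists_mem_hSlice h.isPreconnected (h.subset R) hg hk h1 h2), subset_union_left,
    Or.inr ⟨hl.1, rfl⟩⟩

theorem Built.union_right (R : RectRegion ω G F) (h : Built G n A) (hl : Rightmost ω r)
    {g k : Plane} (hg : g ∈ A) (hk : k ∈ A) (h1 : g.2 ≤ r.2) (h2 : r.2 ≤ k.2) :
    ∃ B, Built G (n + 1) B ∧ A ⊆ B ∧ r ∈ B :=
  ⟨_, h.union R (R.hSlice_mem_of_rightmost hl)
    (exists_mem_hSlice h.isPreconnected (h.subset R) hg hk h1 h2), subset_union_left,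
    Or.inr ⟨hl.1, rfl⟩⟩

theorem Built.union_down (R : RectRegion ω G F) (h : Built G n A) (hl : Lowest ω b)
    {g k : Plane} (hg : g ∈ A) (hk : k ∈ A) (h1 : g.1 ≤ b.1) (h2 : b.1 ≤ k.1) :
    ∃ B, Built G (n + 1) B ∧ A ⊆ B ∧ b ∈ B :=
  ⟨_, h.union R (R.vSlice_mem_of_lowest hl)
    (exists_mem_vSlice h.isPreconnected (h.subset R) hg hk h1 h2), subset_union_left,
    Or.inr ⟨hl.1, rfl⟩⟩

theorem Built.union_up (R : RectRegion ω G F) (h : Built G n A) (hl : Highest ω t)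
    {g k : Plane} (hg : g ∈ A) (hk : k ∈ A) (h1 : g.1 ≤ t.1) (h2 : t.1 ≤ k.1) :
    ∃ B, Built G (n + 1) B ∧ A ⊆ B ∧ t ∈ B :=
  ⟨_, h.union R (R.vSlice_mem_of_highest hl)
    (exists_mem_vSlice h.isPreconnected (h.subset R) hg hk h1 h2), subset_union_left,
    Or.inr ⟨hl.1, rfl⟩⟩

/-- A connected set from the left to the right side is completed by the vertical chords. -/
theorem Built.complete_of_left_right (R : RectRegion ω G F) (h : Built G n A) (hl : Leftmost ω l)
    (hr : Rightmost ω r) (hb : Lowest ω b) (ht : Highest ω t) (hlA : l ∈ A) (hrA : r ∈ A) :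
    ∃ B, Built G (n + 2) B ∧ Spans ω B := by
  obtain ⟨B, hB, hAB, hbB⟩ := h.union_down R hb hlA hrA (hl.2 b hb.1) (hr.2 b hb.1)
  obtain ⟨C, hC, hBC, htC⟩ := hB.union_up R ht (hAB hlA) (hAB hrA) (hl.2 t ht.1) (hr.2 t ht.1)
  exact ⟨C, hC, spans_of_mem hl hr hb ht (hBC (hAB hlA)) (hBC (hAB hrA)) (hBC hbB) htC⟩

/-- A connected set from the bottom to the top side is completed by the horizontal chords. -/
theorem Built.complete_of_down_up (R : RectRegion ω G F) (h : Built G n A) (hl : Leftmost ω l)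
    (hr : Rightmost ω r) (hb : Lowest ω b) (ht : Highest ω t) (hbA : b ∈ A) (htA : t ∈ A) :
    ∃ B, Built G (n + 2) B ∧ Spans ω B := by
  obtain ⟨B, hB, hAB, hlB⟩ := h.union_left R hl hbA htA (hb.2 l hl.1) (ht.2 l hl.1)
  obtain ⟨C, hC, hBC, hrC⟩ := hB.union_right R hr (hAB hbA) (hAB htA) (hb.2 r hr.1) (ht.2 r hr.1)
  exact ⟨C, hC, spans_of_mem hl hr hb ht (hBC hlB) hrC (hBC (hAB hbA)) (hBC (hAB htA))⟩

/-- A segment that touches two sides is completed by two chords, unless the two sides are the left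
and the bottom one or the right and the top one. -/
theorem exists_built_of_touches (R : RectRegion ω G F) (hs : MaxSeg ω s) (hl : Leftmost ω l)
    (hr : Rightmost ω r) (hb : Lowest ω b) (ht : Highest ω t) (hlr : l.2 ≤ r.2)
    (h : (l ∈ s ∨ b ∈ s) ∧ (r ∈ s ∨ t ∈ s)) : ∃ B, Built G 3 B ∧ Spans ω B := by
  rcases h with ⟨h1 | h1, h2 | h2⟩
  · exact (built_single R (R.mem_of_left_right hs hl hr h1 h2)).complete_of_left_right R hl hr hb ht
      h1 h2
  · obtain ⟨B, hB, hAB, hrB⟩ := (built_single R (R.mem_of_left_up hs hl ht h1 h2)).union_right R hr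
      h1 h2 hlr (ht.2 r hr.1)
    obtain ⟨C, hC, hBC, hbC⟩ := hB.union_down R hb (hAB h1) hrB (hl.2 b hb.1) (hr.2 b hb.1)
    exact ⟨C, hC, spans_of_mem hl hr hb ht (hBC (hAB h1)) (hBC hrB) hbC (hBC (hAB h2))⟩
  · obtain ⟨B, hB, hAB, hlB⟩ := (built_single R (R.mem_of_right_down hs hr hb h2 h1)).union_left R
      hl h1 h2 (hb.2 l hl.1) hlr
    obtain ⟨C, hC, hBC, htC⟩ := hB.union_up R ht hlB (hAB h2) (hl.2 t ht.1) (hr.2 t ht.1)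
    exact ⟨C, hC, spans_of_mem hl hr hb ht (hBC hlB) (hBC (hAB h2)) (hBC (hAB h1)) htC⟩
  · exact (built_single R (R.mem_of_down_up hs hb ht h1 h2)).complete_of_down_up R hl hr hb ht h1 h2

/-- If the top side starts to the left of the bottom side, a segment from the left to the bottom
side is completed by two chords. -/
theorem exists_built_of_left_down (R : RectRegion ω G F) (hs : MaxSeg ω s) (hl : Leftmost ω l)
    (hr : Rightmost ω r) (hb : Lowest ω b) (ht : Highest ω t) (htb : t.1 ≤ b.1)
    (h1 : l ∈ s) (h2 : b ∈ s) : ∃ B, Built G 3 B ∧ Spans ω B := by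
  obtain ⟨B, hB, hAB, htB⟩ := (built_single R (R.mem_of_left_down hs hl hb h1 h2)).union_up R ht
    h1 h2 (hl.2 t ht.1) htb
  obtain ⟨C, hC, hBC, hrC⟩ := hB.union_right R hr (hAB h2) htB (hb.2 r hr.1) (ht.2 r hr.1)
  exact ⟨C, hC, spans_of_mem hl hr hb ht (hBC (hAB h1)) hrC (hBC (hAB h2)) (hBC htB)⟩

/-- If the top side starts to the left of the bottom side, a segment from the right to the top side
is completed by two chords. -/
theorem exists_built_of_right_up (R : RectRegion ω G F) (hs : MaxSeg ω s) (hl : Leftmost ω l)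
    (hr : Rightmost ω r) (hb : Lowest ω b) (ht : Highest ω t) (htb : t.1 ≤ b.1)
    (h1 : r ∈ s) (h2 : t ∈ s) : ∃ B, Built G 3 B ∧ Spans ω B := by
  obtain ⟨B, hB, hAB, hbB⟩ := (built_single R (R.mem_of_right_up hs hr ht h1 h2)).union_down R hb
    h2 h1 htb (hr.2 b hb.1)
  obtain ⟨C, hC, hBC, hlC⟩ := hB.union_left R hl hbB (hAB h2) (hb.2 l hl.1) (ht.2 l hl.1)
  exact ⟨C, hC, spans_of_mem hl hr hb ht hlC (hBC (hAB h1)) (hBC hbB) (hBC (hAB h2))⟩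

/-- If the top side starts to the left of the bottom side and the left side below the right side,
four chords form a connected set. -/
theorem exists_built_four (R : RectRegion ω G F) (hl : Leftmost ω l)
    (hr : Rightmost ω r) (hb : Lowest ω b) (ht : Highest ω t) (hlr : l.2 ≤ r.2)
    (htb : t.1 ≤ b.1) : ∃ B, Built G 4 B ∧ Spans ω B := by
  have hc : (t.1, l.2) ∈ ω := R.mem_of_quadrants hl.1 (hl.2 t ht.1) le_rfl ht.1 le_rfl (ht.2 l hl.1)
    hl.1 (hl.2 t ht.1) le_rfl hb.1 htb (hb.2 l hl.1)
  have h2 := (built_single R (R.hSlice_mem_of_leftmost hl)).union R (R.vSlice_mem_of_highest ht)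
    ⟨(t.1, l.2), ⟨hc, rfl⟩, hc, rfl⟩
  have hlB : l ∈ hSlice ω l.2 ∪ vSlice ω t.1 := Or.inl ⟨hl.1, rfl⟩
  have htB : t ∈ hSlice ω l.2 ∪ vSlice ω t.1 := Or.inr ⟨ht.1, rfl⟩
  obtain ⟨B, hB, hAB, hrB⟩ := h2.union_right R hr hlB htB hlr (ht.2 r hr.1)
  obtain ⟨C, hC, hBC, hbC⟩ := hB.union_down R hb (hAB hlB) hrB (hl.2 b hb.1) (hr.2 b hb.1)
  exact ⟨C, hC, spans_of_mem hl hr hb ht (hBC (hAB hlB)) (hBC hrB) hbC (hBC (hAB htB))⟩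

/-- If the bottom and the top side are joined by a vertical chord, two horizontal chords complete
it. -/
theorem exists_built_of_vertical (R : RectRegion ω G F) (hl : Leftmost ω l)
    (hr : Rightmost ω r) (hb : Lowest ω b) (ht : Highest ω t) (htb : t.1 = b.1) :
    ∃ B, Built G 3 B ∧ Spans ω B :=
  (built_single R (R.vSlice_mem_of_lowest hb)).complete_of_down_up R hl hr hb ht ⟨hb.1, rfl⟩
    ⟨ht.1, htb⟩

/-- If the left and the right side are joined by a horizontal chord, two vertical chords complete
it. -/
theorem exists_built_of_horizontal (R : RectRegion ω G F) (hl : Leftmost ω l)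
    (hr : Rightmost ω r) (hb : Lowest ω b) (ht : Highest ω t) (hlr : l.2 = r.2) :
    ∃ B, Built G 3 B ∧ Spans ω B :=
  (built_single R (R.hSlice_mem_of_leftmost hl)).complete_of_left_right R hl hr hb ht ⟨hl.1, rfl⟩
    ⟨hr.1, hlr.symm⟩

theorem RectRegion.mem_of_spans (R : RectRegion ω G F) (hs : MaxSeg ω s) (h : Spans ω s) :
    s ∈ G := by
  obtain ⟨⟨l, hls, hl⟩, ⟨r, hrs, hr⟩, -, -⟩ := h
  exact R.mem_of_left_right hs hl hr hls hrs

/-- A maximal segment that is no candidate touches no side, or it lies within a single side.  In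
either case the rest of the family touches all sides touched by the segment. -/
theorem RectRegion.spans_of_notMem (R : RectRegion ω G F) {x y : Set Plane} (hs : MaxSeg ω s)
    (hsG : s ∉ G) (hxs : x ⊆ s) (hxy : (x ∩ y).Nonempty) (h : Spans ω (x ∪ y)) : Spans ω y := by
  obtain ⟨z, hzx, hzy⟩ := hxy
  have hzω := hs.2.1 (hxs hzx)
  obtain ⟨⟨l, hlx, hl⟩, ⟨r, hrx, hr⟩, ⟨b, hbx, hb⟩, ⟨t, htx, ht⟩⟩ := h
  refine ⟨?_, ?_, ?_, ?_⟩
  · refine hlx.elim (fun hlx => ⟨z, hzy, hzω, fun h hh => ?_⟩) fun hly => ⟨l, hly, hl⟩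
    by_contra! hc
    exact hsG (R.mem_left s hs ⟨l, hxs hlx, hl.2⟩ ⟨z, hxs hzx, h, hh, hc⟩)
  · refine hrx.elim (fun hlx => ⟨z, hzy, hzω, fun h hh => ?_⟩) fun hly => ⟨r, hly, hr⟩
    by_contra! hc
    exact hsG (R.mem_right s hs ⟨r, hxs hlx, hr.2⟩ ⟨z, hxs hzx, h, hh, hc⟩)
  · refine hbx.elim (fun hlx => ⟨z, hzy, hzω, fun h hh => ?_⟩) fun hly => ⟨b, hly, hb⟩
    by_contra! hc
    exact hsG (R.mem_down s hs ⟨b, hxs hlx, hb.2⟩ ⟨z, hxs hzx, h, hh, hc⟩)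
  · refine htx.elim (fun hlx => ⟨z, hzy, hzω, fun h hh => ?_⟩) fun hly => ⟨t, hly, ht⟩
    by_contra! hc
    exact hsG (R.mem_up s hs ⟨t, hxs hlx, ht.2⟩ ⟨z, hxs hzx, h, hh, hc⟩)

theorem IsLineSegment.isClosed (hs : IsLineSegment s) : IsClosed s := hs.isCompact.isClosed

/-- A family of one or two segments is replaced by the maximal extensions of its members, of which
those that are no candidates can be left out. -/
theorem exists_built_pair (R : RectRegion ω G F) {x y : Set Plane} (hx : IsLineSegment x)
    (hxω : x ⊆ ω) (hy : IsLineSegment y) (hyω : y ⊆ ω) (hc : IsPreconnected (x ∪ y))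
    (h : Spans ω (x ∪ y)) : ∃ n A, n ≤ ({x, y} : Set (Set Plane)).ncard ∧ Built G n A ∧
      Spans ω A := by
  obtain ⟨x', hx', hxx'⟩ := exists_maxSeg_of_isLineSegment R.isCompact hx hxω
  obtain ⟨y', hy', hyy'⟩ := exists_maxSeg_of_isLineSegment R.isCompact hy hyω
  have hxy : (x ∩ y).Nonempty := by
    obtain ⟨z, -, hz⟩ := isPreconnected_closed_iff.1 hc x y hx.isClosed hy.isClosed subset_rfl
      (hx.nonempty.imp fun _ h => ⟨Or.inl h, h⟩) (hy.nonempty.imp fun _ h => ⟨Or.inr h, h⟩)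
    exact ⟨z, hz⟩
  have h1 : 1 ≤ ({x, y} : Set (Set Plane)).ncard :=
    (ncard_pos (toFinite _)).2 ⟨x, mem_insert x {y}⟩
  by_cases hxG : x' ∈ G
  swap
  · have := (R.spans_of_notMem hx' hxG hxx' hxy h).mono hyy'
    exact ⟨1, y', h1, built_single R (R.mem_of_spans hy' this), this⟩
  by_cases hyG : y' ∈ G
  swap
  · rw [union_comm] at h
    rw [inter_comm] at hxy
    have := (R.spans_of_notMem hy' hyG hyy' hxy h).mono hxx'
    exact ⟨1, x', h1, built_single R (R.mem_of_spans hx' this), this⟩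
  by_cases hne : x = y
  · subst hne
    rw [union_self] at h
    exact ⟨1, x', h1, built_single R hxG, h.mono hxx'⟩
  · exact ⟨2, x' ∪ y', (ncard_pair hne).ge, (built_single R hxG).union R hyG
      (hxy.mono (inter_subset_inter hxx' hyy')), h.mono (union_subset_union hxx' hyy')⟩

end Built

/-! ### Shortest chains in a connected family -/

/-- `Chain Z Goal n y`: a chain of `n` members of `Z`, each of which meets the next one, leads from
`y` to a member with the property `Goal`. -/
inductive Chain (Z : Set (Set Plane)) (Goal : Set Plane → Prop) : ℕ → Set Plane → Prop
  | last {y} : y ∈ Z → Goal y → Chain Z Goal 1 y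
  | cons {n y y'} : y ∈ Z → (y ∩ y').Nonempty → Chain Z Goal n y' → Chain Z Goal (n + 1) y

section Chain

variable {Z : Set (Set Plane)} {Goal : Set Plane → Prop} {n : ℕ} {y : Set Plane}

theorem Chain.mem (h : Chain Z Goal n y) : y ∈ Z := by
  cases h <;> assumption

theorem Chain.pos (h : Chain Z Goal n y) : 1 ≤ n := by
  cases h <;> omega

theorem Chain.linked {ω : Set Plane} (hZ : ∀ z ∈ Z, IsLineSegment z ∧ z ⊆ ω)
    (h : Chain Z Goal n y) : Linked ω Goal n y := by
  induction h with
  | last h1 h2 => exact .last (hZ _ h1).1 (hZ _ h1).2 h2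
  | cons h1 h2 _ ih => exact .cons (hZ _ h1).1 (hZ _ h1).2 h2 ih

/-- A shortest chain consists of distinct members, only the last of which has the property
`Goal`. -/
theorem Chain.exists_members (h : Chain Z Goal n y) (hmin : ∀ m < n, ¬ Chain Z Goal m y) :
    ∃ C ⊆ Z, C.Finite ∧ C.ncard = n ∧ y ∈ C ∧ (∀ c ∈ C, c ≠ y → ∃ m < n, Chain Z Goal m c) ∧
      ∃ z ∈ C, Goal z ∧ Chain Z (· = z) n y ∧ ∀ c ∈ C, Goal c → c = z := by
  induction h with
  | @last y h1 h2 =>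
    exact ⟨{y}, singleton_subset_iff.2 h1, finite_singleton y, ncard_singleton y, rfl,
      fun c hc hcy => absurd hc hcy, y, rfl, h2, .last h1 rfl, fun c hc _ => hc⟩
  | @cons n y y' h1 h2 h3 ih =>
    obtain ⟨C, hC, hfin, hcard, hy', hless, z, hz, hgz, hch, huniq⟩ := ih fun m hm hm' =>
      hmin (m + 1) (by omega) (.cons h1 h2 hm')
    have hle : ∀ c ∈ C, ∃ m < n + 1, Chain Z Goal m c := fun c hc => by
      by_cases hcy : c = y'
      · exact ⟨n, by omega, hcy ▸ h3⟩
      · obtain ⟨m, hm, h⟩ := hless c hc hcy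
        exact ⟨m, by omega, h⟩
    have hyC : y ∉ C := fun hyC => by
      obtain ⟨m, hm, h⟩ := hle y hyC
      exact hmin m hm h
    refine ⟨insert y C, insert_subset h1 hC, hfin.insert y, by
      rw [ncard_insert_of_notMem hyC hfin, hcard], mem_insert y C, ?_, z, mem_insert_of_mem y hz,
      hgz, .cons h1 h2 hch, ?_⟩
    · rintro c (rfl | hc) hcy
      · exact absurd rfl hcy
      · exact hle c hc
    · rintro c (rfl | hc) hgc
      · exact absurd (.last h1 hgc) (hmin 1 (by have := h3.pos; omega))
      · exact huniq c hc hgc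

/-- In a finite family of closed sets with connected union, chains lead from each nonempty member
to any property that some nonempty member has. -/
theorem exists_chain (hfin : Z.Finite) (hZ : ∀ z ∈ Z, IsClosed z ∧ z.Nonempty)
    (hc : IsPreconnected (⋃₀ Z)) (hg : ∃ z ∈ Z, Goal z) (hy : y ∈ Z) : ∃ n, Chain Z Goal n y := by
  by_contra hn
  obtain ⟨z, hz, hgz⟩ := hg
  -- The members with and without a chain form two disjoint closed sets.
  set A := {c | c ∈ Z ∧ ∃ n, Chain Z Goal n c}
  set B := {c | c ∈ Z ∧ ¬ ∃ n, Chain Z Goal n c}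
  have hA : A ⊆ Z := fun c hc => hc.1
  have hB : B ⊆ Z := fun c hc => hc.1
  obtain ⟨g, -, ⟨c, hcA, hgc⟩, d, hdB, hgd⟩ := isPreconnected_closed_iff.1 hc (⋃₀ A) (⋃₀ B)
    (sUnion_eq_biUnion ▸ (hfin.subset hA).isClosed_biUnion fun c hc => (hZ c hc.1).1)
    (sUnion_eq_biUnion ▸ (hfin.subset hB).isClosed_biUnion fun c hc => (hZ c hc.1).1)
    (by
      rintro g ⟨c, hcZ, hgc⟩
      by_cases h : ∃ n, Chain Z Goal n c
      · exact Or.inl ⟨c, ⟨hcZ, h⟩, hgc⟩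
      · exact Or.inr ⟨c, ⟨hcZ, h⟩, hgc⟩)
    (by
      obtain ⟨g, hg⟩ := (hZ z hz).2
      exact ⟨g, ⟨z, hz, hg⟩, z, ⟨hz, 1, .last hz hgz⟩, hg⟩)
    (by
      obtain ⟨g, hg⟩ := (hZ y hy).2
      exact ⟨g, ⟨y, hy, hg⟩, y, ⟨hy, hn⟩, hg⟩)
  obtain ⟨n, hn⟩ := hcA.2
  exact hdB.2 ⟨n + 1, .cons hdB.1 ⟨g, hgd, hgc⟩ hn⟩

end Chain

/-! ### The top side, the right side, or both as goals -/

section Targets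

variable {ω : Set Plane} {G : Set (Set Plane)} {F : Set ℝ}

/-- The leftmost highest point. -/
theorem RectRegion.exists_highest_leftmost (R : RectRegion ω G F) :
    ∃ t, Highest ω t ∧ ∀ g, Highest ω g → t.1 ≤ g.1 := by
  obtain ⟨p, hp, hmax⟩ := R.isCompact.exists_isMaxOn R.nonempty continuous_snd.continuousOn
  have hc : IsCompact (hSlice ω p.2) :=
    R.isCompact.inter_right (isClosed_eq continuous_snd continuous_const)
  obtain ⟨t, ht, htmin⟩ := hc.exists_isMinOn ⟨p, hp, rfl⟩ continuous_fst.continuousOn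
  refine ⟨t, ⟨ht.1, fun h hh => (hmax hh).trans ht.2.ge⟩, fun g hg => htmin ⟨hg.1, ?_⟩⟩
  exact le_antisymm (hmax hg.1) (hg.2 p hp)

theorem RectRegion.exists_rightmost_lowest (R : RectRegion ω G F) :
    ∃ r, Rightmost ω r ∧ ∀ g, Rightmost ω g → r.2 ≤ g.2 := by
  obtain ⟨t, ht, h⟩ := R.swap.exists_highest_leftmost
  exact ⟨t.swap, ⟨ht.1, fun g hg => ht.2 g.swap (by simpa using hg)⟩, fun g hg => h g.swap hg.swap⟩

/-- The goal of touching the top side. Every segment that passes beyond the left end `t` of the top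
side crosses the vertical chord through `t`. -/
theorem topTarget (R : RectRegion ω G F) {t : Plane} (ht : Highest ω t)
    (htl : ∀ g, Highest ω g → t.1 ≤ g.1) :
    Target ω G {g | t.1 ≤ g.1} (vSlice ω t.1) (fun s => ∃ g ∈ s, Highest ω g) where
  up g h hg h1 _ := le_trans (α := ℝ) hg h1
  ne g hg hgΘ := by
    refine ⟨t, ht.1, not_le.1 hgΘ, (ht.2 g hg).lt_of_ne fun h => hgΘ (htl g ⟨hg, fun k hk => ?_⟩)⟩
    exact h ▸ ht.2 k hk
  mem := R.vSlice_mem_of_highest ht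
  goal := ⟨t, ⟨ht.1, rfl⟩, ht⟩
  meets s hs hsω h1 h2 := by
    obtain ⟨g, hg, hg1⟩ := h1
    obtain ⟨k, hk, hk1⟩ := h2
    exact exists_mem_vSlice hs.convex.isPreconnected hsω hk hg (not_le.1 hk1).le hg1
  mono s t hst := fun ⟨g, hg, h⟩ => ⟨g, hst hg, h⟩
  hits s hs := fun ⟨g, hg, h⟩ => ⟨g, hg, htl g h⟩
  mem_of_goal s hs := fun ⟨g, hg, h⟩ ⟨k, hk, hkΘ⟩ => by
    refine R.mem_up s hs ⟨g, hg, h.2⟩ ⟨k, hk, t, ht.1, ?_⟩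
    refine (ht.2 k (hs.2.1 hk)).lt_of_ne fun h => hkΘ (htl k ⟨hs.2.1 hk, fun j hj => ?_⟩)
    exact h ▸ ht.2 j hj

/-- The goal of touching the right side. -/
theorem rightTarget (R : RectRegion ω G F) {r : Plane} (hr : Rightmost ω r)
    (hrl : ∀ g, Rightmost ω g → r.2 ≤ g.2) :
    Target ω G {g | r.2 ≤ g.2} (hSlice ω r.2) (fun s => ∃ g ∈ s, Rightmost ω g) := by
  have := (topTarget R.swap hr.swap fun g hg => hrl g.swap hg.swap).swap
  have h2 : (fun s => ∃ g ∈ swapSet s, Highest (swapSet ω) g) =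
      (fun s => ∃ g ∈ s, Rightmost ω g) := by
    funext s
    exact propext ⟨fun ⟨g, hg, h⟩ => ⟨g.swap, hg, h.swap⟩,
      fun ⟨g, hg, h⟩ => ⟨g.swap, by simpa using hg, h.swap⟩⟩
  rw [h2] at this
  exact this

/-- If some segment joins the top and the right side, so does the segment between the left end of
the top side and the lower end of the right side. -/
theorem cornerTarget (R : RectRegion ω G F) {t r q q' o : Plane} (ht : Highest ω t)
    (htl : ∀ g, Highest ω g → t.1 ≤ g.1) (hr : Rightmost ω r)
    (hrl : ∀ g, Rightmost ω g → r.2 ≤ g.2) (hq : Highest ω q) (hq' : Rightmost ω q')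
    (hqq' : segment ℝ q q' ⊆ ω) (ho : o ∈ ω) (hot : o.1 ≤ t.1) (hor : o.2 ≤ r.2) :
    ∃ k, Target ω G {g | (r.1 - t.1) * (t.2 - r.2) ≤
      (r.1 - t.1) * (g.2 - r.2) + (t.2 - r.2) * (g.1 - t.1)} k
      (fun s => (∃ g ∈ s, Highest ω g) ∧ ∃ g ∈ s, Rightmost ω g) := by
  obtain ⟨x, hx, hxω⟩ := R.ext_up t ht.1 ht.2
  obtain ⟨y, hy, hyω⟩ := R.ext_right r hr.1 hr.2
  have htr : t.1 < r.1 := ((htl _ ⟨hxω, ht.2⟩).lt_of_ne hx.symm).trans_le (hr.2 _ hxω)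
  have hrt : r.2 < t.2 := ((hrl _ ⟨hyω, hr.2⟩).lt_of_ne hy.symm).trans_le (ht.2 _ hyω)
  have hseg : segment ℝ t r ⊆ ω := by
    intro p hp
    obtain ⟨θ, h0, h1, hp1, hp2⟩ := mem_segment_iff.1 hp
    have hu : (q.1 + θ * (q'.1 - q.1), q.2 + θ * (q'.2 - q.2)) ∈ ω :=
      segment_subset_iff.1 hqq' θ h0 h1
    have e1 := htl q hq
    have e2 := hrl q' hq'
    have e3 := ht.2 q hq.1
    have e4 := hq.2 t ht.1
    have e5 := hr.2 q' hq'.1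
    have e6 := hq'.2 r hr.1
    refine R.mem_of_quadrants ht.1 (by nlinarith) (by nlinarith) hu (show p.1 ≤ _ by
      simp only; nlinarith) (show p.2 ≤ _ by simp only; nlinarith) ho (by nlinarith) (by nlinarith)
      hr.1 (by nlinarith) (by nlinarith)
  obtain ⟨k, hk, htk⟩ := exists_maxSeg R.isCompact (fun h => htr.ne (by rw [h])) hseg
  have htk' := htk (left_mem_segment ℝ t r)
  have hrk' := htk (right_mem_segment ℝ t r)
  have hd1 := sub_pos.2 htr
  have hd2 := sub_pos.2 hrt
  refine ⟨k, fun g h hg h1 h2 => ?_, fun g hg hgΘ => ?_, R.mem_of_right_up hk hr ht hrk' htk',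
    ⟨⟨t, htk', ht⟩, r, hrk', hr⟩, fun s hs hsω h1 h2 => ?_,
    fun s s' hss ⟨⟨g, hg, h1⟩, g', hg', h2⟩ => ⟨⟨g, hss hg, h1⟩, g', hss hg', h2⟩,
    fun s hs ⟨⟨g, hg, h1⟩, _⟩ => ⟨g, hg, ?_⟩,
    fun s hs ⟨⟨g, hg, h1⟩, g', hg', h2⟩ _ => R.mem_of_right_up hs h2 h1 hg' hg⟩
  · simp only [mem_ofPred_eq] at hg ⊢
    nlinarith
  · simp only [mem_ofPred_eq, not_le] at hgΘ
    rcases lt_or_ge g.1 t.1 with h1 | h1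
    · refine ⟨t, ht.1, h1, (ht.2 g hg).lt_of_ne fun h => not_le.2 h1 (htl g ⟨hg, fun k hk => ?_⟩)⟩
      exact h ▸ ht.2 k hk
    rcases lt_or_ge g.2 r.2 with h2 | h2
    · refine ⟨r, hr.1, (hr.2 g hg).lt_of_ne fun h => not_le.2 h2 (hrl g ⟨hg, fun k hk => ?_⟩), h2⟩
      exact h ▸ hr.2 k hk
    -- The segment from `t` to `r` has points to the upper right of `g`.
    have hlt : (g.1 - t.1) / (r.1 - t.1) < (t.2 - g.2) / (t.2 - r.2) := by
      rw [div_lt_div_iff₀ hd1 hd2]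
      nlinarith
    obtain ⟨θ, hθ1, hθ2⟩ := exists_between hlt
    have h3 := (div_lt_iff₀ hd1).1 hθ1
    have h4 := (lt_div_iff₀ hd2).1 hθ2
    have hθ0 : 0 ≤ θ := (div_nonneg (by linarith) hd1.le).trans hθ1.le
    have hθ3 : θ ≤ 1 := hθ2.le.trans ((div_le_one hd2).2 (by linarith))
    refine ⟨_, segment_subset_iff.1 hseg θ hθ0 hθ3, ?_, ?_⟩ <;> simp only <;> nlinarith
  · obtain ⟨g, hg, hgΘ⟩ := h1
    obtain ⟨g', hg', hgΘ'⟩ := h2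
    simp only [mem_ofPred_eq, not_le] at hgΘ hgΘ'
    obtain ⟨z, hz, hzΘ⟩ := hs.convex.isPreconnected.intermediate_value hg' hg
      (f := fun g : Plane => (r.1 - t.1) * (g.2 - r.2) + (t.2 - r.2) * (g.1 - t.1))
      (by fun_prop) ⟨hgΘ'.le, hgΘ⟩
    have h1 := hr.2 z (hsω hz)
    have h2 := ht.2 z (hsω hz)
    simp only at hzΘ
    refine ⟨z, hz, htk (mem_segment_iff.2 ⟨(z.1 - t.1) / (r.1 - t.1), div_nonneg ?_ hd1.le,
      (div_le_one hd1).2 (by linarith), by field_simp; ring, ?_⟩)⟩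
    · nlinarith
    · field_simp
      nlinarith
  · have h2 := htl g h1
    have h3 := h1.2 t ht.1
    simp only [mem_ofPred_eq]
    nlinarith

end Targets

/-! ### The corridor from the lower left to the upper right -/

section Corridor

variable {ω : Set Plane} {G : Set (Set Plane)} {F : Set ℝ} {Θ k x : Set Plane}
  {Goal : Set Plane → Prop} {n : ℕ}

/-- The uppermost leftmost point. -/
theorem RectRegion.exists_leftmost_highest (R : RectRegion ω G F) :
    ∃ l, Leftmost ω l ∧ ∀ g, Leftmost ω g → g.2 ≤ l.2 := by
  obtain ⟨p, hp, hmin⟩ := R.isCompact.exists_isMinOn R.nonempty continuous_fst.continuousOn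
  have hc : IsCompact (vSlice ω p.1) :=
    R.isCompact.inter_right (isClosed_eq continuous_fst continuous_const)
  obtain ⟨t, ht, htmax⟩ := hc.exists_isMaxOn ⟨p, hp, rfl⟩ continuous_snd.continuousOn
  refine ⟨t, ⟨ht.1, fun h hh => ht.2.le.trans (hmin hh)⟩, fun g hg => htmax ⟨hg.1, ?_⟩⟩
  exact le_antisymm (hg.2 p hp) (hmin hg.1)

theorem RectRegion.exists_leftmost_lowest (R : RectRegion ω G F) :
    ∃ l, Leftmost ω l ∧ ∀ g, Leftmost ω g → l.2 ≤ g.2 := by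
  obtain ⟨p, hp, hmin⟩ := R.isCompact.exists_isMinOn R.nonempty continuous_fst.continuousOn
  have hc : IsCompact (vSlice ω p.1) :=
    R.isCompact.inter_right (isClosed_eq continuous_fst continuous_const)
  obtain ⟨t, ht, htmin⟩ := hc.exists_isMinOn ⟨p, hp, rfl⟩ continuous_snd.continuousOn
  refine ⟨t, ⟨ht.1, fun h hh => ht.2.le.trans (hmin hh)⟩, fun g hg => htmin ⟨hg.1, ?_⟩⟩
  exact le_antisymm (hg.2 p hp) (hmin hg.1)

theorem RectRegion.exists_lowest_rightmost (R : RectRegion ω G F) :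
    ∃ b, Lowest ω b ∧ ∀ g, Lowest ω g → g.1 ≤ b.1 := by
  obtain ⟨t, ht, h⟩ := R.swap.exists_leftmost_highest
  exact ⟨t.swap, ⟨ht.1, fun g hg => ht.2 g.swap (by simpa using hg)⟩, fun g hg => h g.swap hg.swap⟩

theorem Joins.built {w : Set Plane} (h : Joins G Goal n w) :
    ∃ A, Built G n A ∧ (A ∩ w).Nonempty ∧ ∃ s ⊆ A, Goal s := by
  obtain ⟨S, h1, h2, h3, h4, h5, s, hs, hg⟩ := h
  exact ⟨⋃₀ S, ⟨h4, S, h1, h2, h3, rfl⟩, h5, s, subset_sUnion_of_mem hs, hg⟩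

/-- The replacement for a chain that starts with a segment touching the left side. -/
theorem exists_built_of_left (R : RectRegion ω G F) (T : Target ω G Θ k Goal) {l₂ r : Plane}
    (hl₂ : Leftmost ω l₂) (hmax : ∀ g, Leftmost ω g → g.2 ≤ l₂.2) (hr : Rightmost ω r)
    (hlr : l₂.2 ≤ r.2) (hΘ : l₂ ∉ Θ) (hch : Linked ω Goal n x) {l : Plane} (hl : Leftmost ω l)
    (hlx : l ∈ x) : ∃ A, Built G n A ∧ (∃ g ∈ A, Leftmost ω g) ∧ ∃ s ⊆ A, Goal s := by
  obtain ⟨l₁, hl₁, hmin⟩ := R.exists_leftmost_lowest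
  obtain ⟨y, hy, hyω⟩ := R.ext_left l₂ hl₂.1 hl₂.2
  have h12 : l₁.2 < l₂.2 :=
    (hmin _ ⟨hyω, hl₂.2⟩).trans_lt ((hmax _ ⟨hyω, hl₂.2⟩).lt_of_ne hy)
  have e1 : l₁.1 = l₂.1 := le_antisymm (hl₁.2 _ hl₂.1) (hl₂.2 _ hl₁.1)
  have el : l.1 = l₂.1 := le_antisymm (hl.2 _ hl₂.1) (hl₂.2 _ hl.1)
  have hside : ∀ p ∈ segment ℝ l₁ l₂, Leftmost ω p := by
    intro p hp
    obtain ⟨θ, h0, h1, hp1, -⟩ := mem_segment_iff.1 hp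
    obtain ⟨h2, h3⟩ := snd_mem_of_segment h12.le hp
    have hp1' : p.1 = l₂.1 := by rw [hp1, e1]; ring
    have : (l₂.1, p.2) ∈ ω := R.mem_of_vertical (y1 := l₁.2) (y2 := l₂.2)
      (by rw [← e1]; exact hl₁.1) hl₂.1 h2 h3
    rw [← hp1'] at this
    exact ⟨this, hp1' ▸ hl₂.2⟩
  have C : SideCut ω l₁ l₂ := ⟨fun p hp => (hside p hp).1, e1, h12, hl₂.2,
    fun g hg h => hmax g ⟨hg, fun z hz => h.trans (hl₂.2 z hz)⟩, r, hr.1, hr.2, h12.le.trans hlr⟩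
  have hlmem : l ∈ segment ℝ l₁ l₂ := by
    have hd := sub_pos.2 h12
    refine mem_segment_iff.2 ⟨(l.2 - l₁.2) / (l₂.2 - l₁.2), div_nonneg ?_ hd.le,
      (div_le_one hd).2 ?_, by rw [e1, el]; ring, by field_simp; ring⟩
    · linarith [hmin l hl]
    · linarith [hmax l hl]
  obtain ⟨A, hA, ⟨g, hgA, hg⟩, hs⟩ := (C.joins R T hΘ hch ⟨l, hlx, hlmem⟩).built
  exact ⟨A, hA, ⟨g, hgA, hside g hg⟩, hs⟩

/-- The replacement for a chain that starts with a segment touching the left and the bottom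
side. -/
theorem exists_built_of_corner (R : RectRegion ω G F) (T : Target ω G Θ k Goal) {l₂ b₂ : Plane}
    (hl₂ : Leftmost ω l₂) (hmax : ∀ g, Leftmost ω g → g.2 ≤ l₂.2) (hb₂ : Lowest ω b₂)
    (hbmax : ∀ g, Lowest ω g → g.1 ≤ b₂.1) (hcor : (b₂.1, l₂.2) ∈ ω) (hΘ : (b₂.1, l₂.2) ∉ Θ)
    (hn : n ≠ 1) (hch : Linked ω Goal n x) {l b : Plane} (hl : Leftmost ω l)
    (hb : Lowest ω b) (hlx : l ∈ x) (hbx : b ∈ x) :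
    ∃ A, Built G n A ∧ (∃ g ∈ A, Leftmost ω g) ∧ (∃ g ∈ A, Lowest ω g) ∧ ∃ s ⊆ A, Goal s := by
  have el : l.1 = l₂.1 := le_antisymm (hl.2 _ hl₂.1) (hl₂.2 _ hl.1)
  have eb : b.2 = b₂.2 := le_antisymm (hb.2 _ hb₂.1) (hb₂.2 _ hb.1)
  by_cases ho : (l₂.1, b₂.2) ∈ x
  · have hoω := hch.subset ho
    have C : PointCut ω (l₂.1, b₂.2) := ⟨hoω, hl₂.2, hb₂.2⟩
    obtain ⟨A, hA, ⟨g, hgA, hg⟩, hs⟩ := (C.joins R T (fun g hg h hgΘ => hΘ (T.up g _ hgΘ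
      (h.trans (hl₂.2 _ hcor)) (hmax g ⟨hg, fun z hz => h.trans (hl₂.2 z hz)⟩))) hch ho).built
    rw [mem_singleton_iff] at hg
    subst hg
    exact ⟨A, hA, ⟨_, hgA, hoω, hl₂.2⟩, ⟨_, hgA, hoω, hb₂.2⟩, hs⟩
  -- Otherwise the first segment descends from the left to the bottom side.
  have h1 : l₂.1 < b.1 := by
    refine (hl₂.2 b hb.1).lt_of_ne fun h => ho ?_
    rw [h, ← eb]
    exact hbx
  have h2 : b₂.2 < l.2 := by
    refine (hb₂.2 l hl.1).lt_of_ne fun h => ho ?_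
    rw [h, ← el]
    exact hlx
  have hbb := hbmax b hb
  have hll := hmax l hl
  have hbl : segment ℝ b l ⊆ ω := (hch.isLineSegment.convex.segment_subset hbx hlx).trans hch.subset
  have hsub : segment ℝ b₂ l₂ ⊆ ω := by
    intro p hp
    obtain ⟨θ, h0, h1, hp1, hp2⟩ := mem_segment_iff.1 hp
    have hu : (b.1 + θ * (l.1 - b.1), b.2 + θ * (l.2 - b.2)) ∈ ω := segment_subset_iff.1 hbl θ h0 h1
    have e1 := hl₂.2 b hb.1
    have e2 := hb₂.2 l hl.1
    refine R.mem_of_quadrants hl₂.1 (by nlinarith) (by nlinarith) hcor (by simp only; nlinarith)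
      (by simp only; nlinarith) hu (by simp only; nlinarith) (by simp only; nlinarith) hb₂.1
      (by nlinarith) (by nlinarith)
  have C : CornerCut ω b₂ l₂ := ⟨hsub, h1.trans_le hbb, h2.trans_le hll, hl₂.2, hb₂.2,
    fun g hg h => hmax g ⟨hg, fun z hz => h.trans (hl₂.2 z hz)⟩,
    fun g hg h => hbmax g ⟨hg, fun z hz => h.trans (hb₂.2 z hz)⟩, hcor⟩
  -- It lies on or below the segment from `b₂` to `l₂`.
  have hback : ∀ g ∈ x, g ∉ front b₂ l₂ := by
    intro g hg hgf
    have hgω := hch.subset hg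
    obtain ⟨α, β, hline⟩ := hch.isLineSegment.exists_line hlx hbx (by rw [el]; exact h1.ne)
    have e1 : l.2 = α * l.1 + β := congrArg Prod.snd (hline l hlx)
    have e2 : b.2 = α * b.1 + β := congrArg Prod.snd (hline b hbx)
    have e3 : g.2 = α * g.1 + β := congrArg Prod.snd (hline g hg)
    have e4 := hl₂.2 g hgω
    have e5 := hb₂.2 g hgω
    rw [el] at e1
    have hα : α < 0 := by nlinarith
    have e6 : g.1 ≤ b.1 := by nlinarith
    obtain ⟨-, h | h⟩ := hgf
    · nlinarith
    · have e7 : (g.2 - b₂.2) * (b.1 - l₂.1) = (l.2 - b₂.2) * (b.1 - g.1) := by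
        have e8 : g.2 - b₂.2 = α * (g.1 - b.1) := by linarith
        have e9 : l.2 - b₂.2 = α * (l₂.1 - b.1) := by linarith
        rw [e8, e9]
        ring
      have e10 : (g.2 - b₂.2) * (b₂.1 - l₂.1) ≤ (l₂.2 - b₂.2) * (b₂.1 - g.1) := by
        have hd : 0 < b.1 - l₂.1 := sub_pos.2 h1
        have hx : (l.2 - b₂.2) * ((b.1 - g.1) * (b₂.1 - l₂.1)) ≤
            (l₂.2 - b₂.2) * ((b₂.1 - g.1) * (b.1 - l₂.1)) := by
          have e11 : (b.1 - g.1) * (b₂.1 - l₂.1) ≤ (b₂.1 - g.1) * (b.1 - l₂.1) := by nlinarith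
          have e12 : 0 ≤ (b.1 - g.1) * (b₂.1 - l₂.1) := mul_nonneg (by linarith) (by linarith)
          nlinarith
        refine le_of_mul_le_mul_right ?_ hd
        calc (g.2 - b₂.2) * (b₂.1 - l₂.1) * (b.1 - l₂.1)
            = (g.2 - b₂.2) * (b.1 - l₂.1) * (b₂.1 - l₂.1) := by ring
          _ = (l.2 - b₂.2) * ((b.1 - g.1) * (b₂.1 - l₂.1)) := by rw [e7]; ring
          _ ≤ _ := hx
          _ = _ := by ring
      linarith
  cases hch with
  | last _ _ _ => exact absurd rfl hn
  | @cons m _ y _ _ h3 h4 =>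
    obtain ⟨g, hgx, hgy⟩ := h3
    obtain ⟨A, hA, ⟨z, hzA, hz⟩, s, hsA, hs⟩ := (C.joins R T hΘ h4 ⟨g, hgy, hback g hgx⟩).built
    obtain ⟨c, hc, hsc⟩ := exists_maxSeg R.isCompact
      (fun h => (h1.trans_le hbb).ne (by rw [h])) hsub
    have hlc := hsc (right_mem_segment ℝ b₂ l₂)
    have hbc := hsc (left_mem_segment ℝ b₂ l₂)
    exact ⟨A ∪ c, hA.union R (R.mem_of_left_down hc hl₂ hb₂ hlc hbc) ⟨z, hzA, hsc hz⟩,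
      ⟨l₂, Or.inr hlc, hl₂⟩, ⟨b₂, Or.inr hbc, hb₂⟩, s, hsA.trans subset_union_left, hs⟩

theorem Built.swap {A : Set Plane} (h : Built (swapFam G) n A) : Built G n (swapSet A) := by
  obtain ⟨h1, S, h2, h3, h4, rfl⟩ := h
  refine ⟨isPathConnected_swapSet h1, swapSet '' S, ?_, h3.image _, ?_, sUnion_swapSet_image S⟩
  · rintro _ ⟨s, hs, rfl⟩
    exact h2 hs
  · rwa [ncard_image_of_injective S swapSet_injective]

/-- The replacement for a chain that starts at the left or the bottom side. -/
theorem exists_built_of_chain (R : RectRegion ω G F) (T : Target ω G Θ k Goal)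
    (hΘ : ∃ l₂ b₂, Leftmost ω l₂ ∧ (∀ g, Leftmost ω g → g.2 ≤ l₂.2) ∧ Lowest ω b₂ ∧
      (∀ g, Lowest ω g → g.1 ≤ b₂.1) ∧ (b₂.1, l₂.2) ∈ ω ∧ (b₂.1, l₂.2) ∉ Θ ∧
      (∃ r, Rightmost ω r ∧ l₂.2 ≤ r.2) ∧ ∃ t, Highest ω t ∧ b₂.1 ≤ t.1)
    (hn : n ≠ 1) (hch : Linked ω Goal n x)
    (hx : (∃ g ∈ x, Leftmost ω g) ∨ ∃ g ∈ x, Lowest ω g) :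
    ∃ A, Built G n A ∧ ((∃ g ∈ A, Leftmost ω g) ∨ ∃ g ∈ A, Lowest ω g) ∧
      ((∃ g ∈ x, Leftmost ω g) → (∃ g ∈ x, Lowest ω g) →
        (∃ g ∈ A, Leftmost ω g) ∧ ∃ g ∈ A, Lowest ω g) ∧ ∃ s ⊆ A, Goal s := by
  obtain ⟨l₂, b₂, hl₂, hmax, hb₂, hbmax, hcor, hΘ, ⟨r, hr, hlr⟩, t, ht, hbt⟩ := hΘ
  by_cases h1 : ∃ g ∈ x, Leftmost ω g
  · obtain ⟨l, hlx, hl⟩ := h1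
    by_cases h2 : ∃ g ∈ x, Lowest ω g
    · obtain ⟨b, hbx, hb⟩ := h2
      obtain ⟨A, hA, h3, h4, h5⟩ := exists_built_of_corner R T hl₂ hmax hb₂ hbmax hcor hΘ hn hch
        hl hb hlx hbx
      exact ⟨A, hA, Or.inl h3, fun _ _ => ⟨h3, h4⟩, h5⟩
    · obtain ⟨A, hA, h3, h4⟩ := exists_built_of_left R T hl₂ hmax hr hlr (fun h => hΘ
        (T.up _ _ h (hl₂.2 _ hcor) le_rfl)) hch hl hlx
      exact ⟨A, hA, Or.inl h3, fun _ h => absurd h h2, h4⟩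
  · obtain ⟨b, hbx, hb⟩ := hx.resolve_left h1
    obtain ⟨A, hA, ⟨g, hgA, hg⟩, s, hsA, hs⟩ := exists_built_of_left R.swap T.swap hb₂.swap
      (fun g hg => hbmax g.swap ⟨hg.1, fun z hz => hg.2 z.swap (by simpa using hz)⟩) ht.swap hbt
      (fun h => hΘ (T.up _ _ h le_rfl (hb₂.2 _ hcor))) hch.swap hb.swap (by simpa using hbx)
    exact ⟨swapSet A, hA.swap, Or.inr ⟨g.swap, by simpa using hgA, hg.1, fun z hz => hg.2 z.swap
      (by simpa using hz)⟩, fun h => absurd h h1, swapSet s, swapSet_subset.2 hsA, hs⟩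

/-- In the corridor, one chord adds the missing one of the left and the bottom side to a connected
set that touches one of them. -/
theorem Built.complete_left_down (R : RectRegion ω G F) {A : Set Plane} {l r b t : Plane}
    (h : Built G n A) (hl : Leftmost ω l) (hr : Rightmost ω r) (hb : Lowest ω b)
    (ht : Highest ω t) (hlr : l.2 ≤ r.2) (hbt : b.1 ≤ t.1) (h1 : l ∈ A ∨ b ∈ A)
    (h2 : r ∈ A ∨ t ∈ A) : ∃ B, Built G (n + 1) B ∧ A ⊆ B ∧ l ∈ B ∧ b ∈ B := by
  rcases h1 with h1 | h1
  · obtain ⟨B, hB, hAB, hbB⟩ : ∃ B, Built G (n + 1) B ∧ A ⊆ B ∧ b ∈ B := by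
      rcases h2 with h2 | h2
      · exact h.union_down R hb h1 h2 (hl.2 b hb.1) (hr.2 b hb.1)
      · exact h.union_down R hb h1 h2 (hl.2 b hb.1) hbt
    exact ⟨B, hB, hAB, hAB h1, hbB⟩
  · obtain ⟨B, hB, hAB, hbB⟩ : ∃ B, Built G (n + 1) B ∧ A ⊆ B ∧ l ∈ B := by
      rcases h2 with h2 | h2
      · exact h.union_left R hl h1 h2 (hb.2 l hl.1) hlr
      · exact h.union_left R hl h1 h2 (hb.2 l hl.1) (ht.2 l hl.1)
    exact ⟨B, hB, hAB, hbB, hAB h1⟩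

/-- In the corridor, one chord adds the missing one of the right and the top side to a connected set
that touches one of them. -/
theorem Built.complete_right_up (R : RectRegion ω G F) {A : Set Plane} {l r b t : Plane}
    (h : Built G n A) (hl : Leftmost ω l) (hr : Rightmost ω r) (hb : Lowest ω b)
    (ht : Highest ω t) (hlr : l.2 ≤ r.2) (hbt : b.1 ≤ t.1) (h1 : l ∈ A ∨ b ∈ A)
    (h2 : r ∈ A ∨ t ∈ A) : ∃ B, Built G (n + 1) B ∧ A ⊆ B ∧ r ∈ B ∧ t ∈ B := by
  rcases h2 with h2 | h2
  · obtain ⟨B, hB, hAB, hbB⟩ : ∃ B, Built G (n + 1) B ∧ A ⊆ B ∧ t ∈ B := by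
      rcases h1 with h1 | h1
      · exact h.union_up R ht h1 h2 (hl.2 t ht.1) (hr.2 t ht.1)
      · exact h.union_up R ht h1 h2 hbt (hr.2 t ht.1)
    exact ⟨B, hB, hAB, hAB h2, hbB⟩
  · obtain ⟨B, hB, hAB, hbB⟩ : ∃ B, Built G (n + 1) B ∧ A ⊆ B ∧ r ∈ B := by
      rcases h1 with h1 | h1
      · exact h.union_right R hr h1 h2 hlr (ht.2 r hr.1)
      · exact h.union_right R hr h1 h2 (hb.2 r hr.1) (ht.2 r hr.1)
    exact ⟨B, hB, hAB, hbB, hAB h2⟩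

/-- A chain of `n ≠ 1` segments from the left or bottom side to the right or top side can be
replaced by `n` candidates, which touch the same sides at both ends. -/
theorem exists_built_of_chain_between (R : RectRegion ω G F)
    (hlr : ∀ l r, Leftmost ω l → Rightmost ω r → l.2 < r.2)
    (hbt : ∀ b t, Lowest ω b → Highest ω t → b.1 < t.1) {z : Set Plane} (hz : IsLineSegment z)
    (hzω : z ⊆ ω) (hn : n ≠ 1) (hch : Linked ω (· = z) n x)
    (hx : (∃ g ∈ x, Leftmost ω g) ∨ ∃ g ∈ x, Lowest ω g)
    (hzg : (∃ g ∈ z, Rightmost ω g) ∨ ∃ g ∈ z, Highest ω g) :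
    ∃ A, Built G n A ∧ ((∃ g ∈ A, Leftmost ω g) ∨ ∃ g ∈ A, Lowest ω g) ∧
      ((∃ g ∈ x, Leftmost ω g) → (∃ g ∈ x, Lowest ω g) →
        (∃ g ∈ A, Leftmost ω g) ∧ ∃ g ∈ A, Lowest ω g) ∧
      ((∃ g ∈ A, Rightmost ω g) ∨ ∃ g ∈ A, Highest ω g) ∧
      ((∃ g ∈ z, Rightmost ω g) → (∃ g ∈ z, Highest ω g) →
        (∃ g ∈ A, Rightmost ω g) ∧ ∃ g ∈ A, Highest ω g) := by
  obtain ⟨l₂, hl₂, hmax⟩ := R.exists_leftmost_highest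
  obtain ⟨b₂, hb₂, hbmax⟩ := R.exists_lowest_rightmost
  obtain ⟨t, ht, htl⟩ := R.exists_highest_leftmost
  obtain ⟨r, hr, hrl⟩ := R.exists_rightmost_lowest
  have h1 := hlr l₂ r hl₂ hr
  have h2 := hbt b₂ t hb₂ ht
  have e1 := hl₂.2 b₂ hb₂.1
  have e2 := hb₂.2 l₂ hl₂.1
  have e3 := ht.2 l₂ hl₂.1
  -- The right end of the bottom side and the upper end of the left side determine a corner that none
  -- of the goal sets contains.
  have hcor : (b₂.1, l₂.2) ∈ ω := R.mem_of_quadrants (z := (b₂.1, l₂.2)) hl₂.1 e1 le_rfl ht.1 h2.le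
    e3 hl₂.1 e1 le_rfl hb₂.1 le_rfl e2
  have hmono : ∀ {P : Plane → Prop} {s A : Set Plane}, s ⊆ A → (∃ g ∈ s, P g) → ∃ g ∈ A, P g :=
    fun h ⟨g, hg, hP⟩ => ⟨g, h hg, hP⟩
  have hlink : ∀ {Goal' : Set Plane → Prop}, Goal' z → Linked ω Goal' n x := by
    intro Goal' hg
    clear hx hn
    generalize hG : (· = z) = Goal₀ at hch
    induction hch with
    | last h1 h2 h3 =>
      subst hG
      subst h3
      exact .last h1 h2 hg
    | cons h1 h2 h3 _ ih => exact .cons h1 h2 h3 ih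
  by_cases hzr : ∃ g ∈ z, Rightmost ω g
  · by_cases hzt : ∃ g ∈ z, Highest ω g
    · obtain ⟨q', hqz', hq'⟩ := hzr
      obtain ⟨q, hqz, hq⟩ := hzt
      obtain ⟨k, T⟩ := cornerTarget R ht htl hr hrl hq hq'
        ((hz.convex.segment_subset hqz hqz').trans hzω) hcor h2.le h1.le
      obtain ⟨y, hy, hyω⟩ := R.ext_up t ht.1 ht.2
      obtain ⟨y', hy', hyω'⟩ := R.ext_right r hr.1 hr.2
      have e1 : t.1 < r.1 := ((htl _ ⟨hyω, ht.2⟩).lt_of_ne hy.symm).trans_le (hr.2 _ hyω)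
      have e2 : r.2 < t.2 := ((hrl _ ⟨hyω', hr.2⟩).lt_of_ne hy'.symm).trans_le (ht.2 _ hyω')
      have e3 := mul_pos (sub_pos.2 e1) (sub_pos.2 e2)
      have e4 := mul_pos (sub_pos.2 e1) (sub_pos.2 h1)
      have e5 := mul_pos (sub_pos.2 e2) (sub_pos.2 h2)
      obtain ⟨A, hA, h3, h4, s, hsA, h5, h6⟩ := exists_built_of_chain R T ⟨l₂, b₂, hl₂, hmax, hb₂,
        hbmax, hcor, fun h => by simp only [mem_ofPred_eq] at h; linarith, ⟨r, hr, h1.le⟩, t, ht,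
        h2.le⟩ hn (hlink ⟨⟨q, hqz, hq⟩, q', hqz', hq'⟩) hx
      exact ⟨A, hA, h3, h4, Or.inl (hmono hsA h6), fun _ _ => ⟨hmono hsA h6, hmono hsA h5⟩⟩
    · obtain ⟨A, hA, h3, h4, s, hsA, h5⟩ := exists_built_of_chain R (rightTarget R hr hrl)
        ⟨l₂, b₂, hl₂, hmax, hb₂, hbmax, hcor, not_le.2 h1, ⟨r, hr, h1.le⟩, t, ht, h2.le⟩ hn
        (hlink hzr) hx
      exact ⟨A, hA, h3, h4, Or.inl (hmono hsA h5), fun _ h => absurd h hzt⟩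
  · obtain ⟨A, hA, h3, h4, s, hsA, h5⟩ := exists_built_of_chain R (topTarget R ht htl)
      ⟨l₂, b₂, hl₂, hmax, hb₂, hbmax, hcor, not_le.2 h2, ⟨r, hr, h1.le⟩, t, ht, h2.le⟩ hn
      (hlink (hzg.resolve_left hzr)) hx
    exact ⟨A, hA, h3, h4, Or.inr (hmono hsA h5), fun h => absurd h hzr⟩

/-- In the corridor, a shortest chain from the left or bottom side to the right or top side is
replaced. Each side not touched by its ends is touched by a further member of the family, which pays
for the chord that adds this side. -/
theorem exists_built_corridor (R : RectRegion ω G F)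
    (hlr : ∀ l r, Leftmost ω l → Rightmost ω r → l.2 < r.2)
    (hbt : ∀ b t, Lowest ω b → Highest ω t → b.1 < t.1) {Z : Set (Set Plane)} (hfin : Z.Finite)
    (hZ : ∀ z ∈ Z, IsLineSegment z ∧ z ⊆ ω) (hc : IsPreconnected (⋃₀ Z)) (hs : Spans ω (⋃₀ Z))
    (h3 : 3 ≤ Z.ncard) : ∃ A, Built G Z.ncard A ∧ Spans ω A := by
  obtain ⟨⟨l, ⟨zl, hzl, hlz⟩, hl⟩, ⟨r, ⟨zr, hzr, hrz⟩, hr⟩, ⟨b, ⟨zb, hzb, hbz⟩, hb⟩,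
    ⟨t, ⟨zt, hzt, htz⟩, ht⟩⟩ := hs
  set P : Set Plane → Prop := fun s => (∃ g ∈ s, Leftmost ω g) ∨ ∃ g ∈ s, Lowest ω g with hP
  set Q : Set Plane → Prop := fun s => (∃ g ∈ s, Rightmost ω g) ∨ ∃ g ∈ s, Highest ω g with hQ
  have hex : ∃ n, ∃ x, P x ∧ Chain Z Q n x := by
    obtain ⟨n, hn⟩ := exists_chain hfin (fun z hz => ⟨(hZ z hz).1.isClosed, (hZ z hz).1.nonempty⟩)
      hc (Goal := Q) ⟨zr, hzr, Or.inl ⟨r, hrz, hr⟩⟩ hzl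
    exact ⟨n, zl, Or.inl ⟨l, hlz, hl⟩, hn⟩
  classical
  obtain ⟨x, hxP, hx⟩ := Nat.find_spec hex
  have hmin : ∀ m < Nat.find hex, ∀ y, P y → ¬ Chain Z Q m y := fun m hm y hy h =>
    Nat.find_min hex hm ⟨y, hy, h⟩
  set n := Nat.find hex
  have hxZ := hZ x hx.mem
  obtain ⟨C, hCZ, hCfin, hCn, hxC, hless, z, hzC, hzQ, hch, huniq⟩ :=
    hx.exists_members fun m hm => hmin m hm x hxP
  by_cases hn : n = 1
  · rw [hn] at hch hCn
    obtain ⟨u, hu⟩ := ncard_eq_one.1 hCn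
    have hxz : x = z := by
      rw [hu] at hxC hzC
      exact hxC.trans hzC.symm
    subst hxz
    obtain ⟨x', hx', hxx'⟩ := exists_maxSeg_of_isLineSegment R.isCompact hxZ.1 hxZ.2
    obtain ⟨l', b', hl', hb', h1⟩ : ∃ l' b', Leftmost ω l' ∧ Lowest ω b' ∧ (l' ∈ x' ∨ b' ∈ x') :=
      hxP.elim (fun ⟨g, hg, h⟩ => ⟨g, b, h, hb, Or.inl (hxx' hg)⟩)
        fun ⟨g, hg, h⟩ => ⟨l, g, hl, h, Or.inr (hxx' hg)⟩
    obtain ⟨r', t', hr', ht', h2⟩ : ∃ l' b', Rightmost ω l' ∧ Highest ω b' ∧ (l' ∈ x' ∨ b' ∈ x') :=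
      hzQ.elim (fun ⟨g, hg, h⟩ => ⟨g, t, h, ht, Or.inl (hxx' hg)⟩)
        fun ⟨g, hg, h⟩ => ⟨r, g, hr, h, Or.inr (hxx' hg)⟩
    obtain ⟨B, hB, hsp⟩ := exists_built_of_touches R hx' hl' hr' hb' ht' (hlr _ _ hl' hr').le
      ⟨h1, h2⟩
    exact ⟨B, hB.mono h3, hsp⟩
  have hzZ := hZ z (hCZ hzC)
  obtain ⟨A, hA, hA1, hA2, hA3, hA4⟩ := exists_built_of_chain_between R hlr hbt hzZ.1 hzZ.2 hn
    (hch.linked hZ) hxP hzQ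
  -- Sides that the ends of a shortest chain do not touch are touched by further members.
  have hlow : ((∃ g ∈ x, Leftmost ω g) ∧ ∃ g ∈ x, Lowest ω g) ∨ ∃ e ∈ Z, e ∉ C ∧ P e := by
    have key : ∀ e ∈ Z, P e → e ≠ x → e ∉ C := fun e _ hPe hex heC => by
      obtain ⟨m, hm, h⟩ := hless e heC hex
      exact hmin m hm e hPe h
    by_cases h1 : ∃ g ∈ x, Leftmost ω g
    · by_cases h2 : ∃ g ∈ x, Lowest ω g
      · exact Or.inl ⟨h1, h2⟩
      · have hPe : P zb := Or.inr ⟨b, hbz, hb⟩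
        exact Or.inr ⟨zb, hzb, key zb hzb hPe fun h => h2 (h ▸ ⟨b, hbz, hb⟩), hPe⟩
    · have hPe : P zl := Or.inl ⟨l, hlz, hl⟩
      exact Or.inr ⟨zl, hzl, key zl hzl hPe fun h => h1 (h ▸ ⟨l, hlz, hl⟩), hPe⟩
  have hhigh : ((∃ g ∈ z, Rightmost ω g) ∧ ∃ g ∈ z, Highest ω g) ∨ ∃ e ∈ Z, e ∉ C ∧ Q e := by
    have key : ∀ e ∈ Z, Q e → e ≠ z → e ∉ C := fun e _ hQe hez heC => hez (huniq e heC hQe)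
    by_cases h1 : ∃ g ∈ z, Rightmost ω g
    · by_cases h2 : ∃ g ∈ z, Highest ω g
      · exact Or.inl ⟨h1, h2⟩
      · have hQe : Q zt := Or.inr ⟨t, htz, ht⟩
        exact Or.inr ⟨zt, hzt, key zt hzt hQe fun h => h2 (h ▸ ⟨t, htz, ht⟩), hQe⟩
    · have hQe : Q zr := Or.inl ⟨r, hrz, hr⟩
      exact Or.inr ⟨zr, hzr, key zr hzr hQe fun h => h1 (h ▸ ⟨r, hrz, hr⟩), hQe⟩
  have hn1 : 1 < n := lt_of_le_of_ne hx.pos (Ne.symm hn)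
  have hcard1 : ∀ e ∈ Z, e ∉ C → n + 1 ≤ Z.ncard := fun e he heC => by
    rw [← hCn, ← ncard_insert_of_notMem heC hCfin]
    exact ncard_le_ncard (insert_subset he hCZ) hfin
  obtain ⟨l', b', hl', hb', h1⟩ : ∃ l' b', Leftmost ω l' ∧ Lowest ω b' ∧ (l' ∈ A ∨ b' ∈ A) :=
    hA1.elim (fun ⟨g, hg, h⟩ => ⟨g, b, h, hb, Or.inl hg⟩) fun ⟨g, hg, h⟩ => ⟨l, g, hl, h, Or.inr hg⟩
  obtain ⟨r', t', hr', ht', h2⟩ : ∃ l' b', Rightmost ω l' ∧ Highest ω b' ∧ (l' ∈ A ∨ b' ∈ A) :=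
    hA3.elim (fun ⟨g, hg, h⟩ => ⟨g, t, h, ht, Or.inl hg⟩) fun ⟨g, hg, h⟩ => ⟨r, g, hr, h, Or.inr hg⟩
  have e1 := (hlr _ _ hl' hr').le
  have e2 := (hbt _ _ hb' ht').le
  rcases hlow with ⟨hx1, hx2⟩ | ⟨e, heZ, heC, hPe⟩
  · obtain ⟨hl, hb⟩ := hA2 hx1 hx2
    rcases hhigh with ⟨hz1, hz2⟩ | ⟨e, heZ, heC, hQe⟩
    · obtain ⟨hr, ht⟩ := hA4 hz1 hz2
      exact ⟨A, hA.mono (hCn ▸ ncard_le_ncard hCZ hfin), hl, hr, hb, ht⟩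
    · obtain ⟨B, hB, hAB, hrB, htB⟩ := hA.complete_right_up R hl' hr' hb' ht' e1 e2 h1 h2
      exact ⟨B, hB.mono (hcard1 e heZ heC), hl.imp fun _ h => ⟨hAB h.1, h.2⟩, ⟨r', hrB, hr'⟩,
        hb.imp fun _ h => ⟨hAB h.1, h.2⟩, t', htB, ht'⟩
  · obtain ⟨B, hB, hAB, hlB, hbB⟩ := hA.complete_left_down R hl' hr' hb' ht' e1 e2 h1 h2
    rcases hhigh with ⟨hz1, hz2⟩ | ⟨e', heZ', heC', hQe⟩
    · obtain ⟨hr, ht⟩ := hA4 hz1 hz2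
      exact ⟨B, hB.mono (hcard1 e heZ heC), ⟨l', hlB, hl'⟩, hr.imp fun _ h => ⟨hAB h.1, h.2⟩,
        ⟨b', hbB, hb'⟩, ht.imp fun _ h => ⟨hAB h.1, h.2⟩⟩
    · obtain ⟨D, hD, hBD, hrD, htD⟩ := hB.complete_right_up R hl' hr' hb' ht' e1 e2 (Or.inl hlB)
        (h2.imp (fun h => hAB h) fun h => hAB h)
      refine ⟨D, hD.mono ?_, ⟨l', hBD hlB, hl'⟩, ⟨r', hrD, hr'⟩, ⟨b', hBD hbB, hb'⟩, t', htD, ht'⟩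
      have hee : e ≠ e' := fun h => hmin 1 hn1 e hPe (.last heZ (h ▸ hQe))
      have h4 : e ∉ insert e' C := by simp [hee, heC]
      have h5 : (insert e (insert e' C)).ncard = n + 1 + 1 := by
        rw [ncard_insert_of_notMem h4 (hCfin.insert e'), ncard_insert_of_notMem heC' hCfin, hCn]
      rw [← h5]
      exact ncard_le_ncard (insert_subset heZ (insert_subset heZ' hCZ)) hfin

/-! ### Replacing a connected family that touches all sides -/

/-- The heights of the points of the left and of the right side form intervals, which overlap or are
strictly ordered. -/
theorem exists_lt_or_exists_eq (R : RectRegion ω G F) {l₀ r₀ : Plane} (hl₀ : Leftmost ω l₀)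
    (hr₀ : Rightmost ω r₀) (h : l₀.2 ≤ r₀.2) :
    (∃ l r, Leftmost ω l ∧ Rightmost ω r ∧ l.2 = r.2) ∨
      ∀ l r, Leftmost ω l → Rightmost ω r → l.2 < r.2 := by
  by_contra! hc
  obtain ⟨hne, l, r, hl, hr, hrl⟩ := hc
  have el : l.1 = l₀.1 := le_antisymm (hl.2 _ hl₀.1) (hl₀.2 _ hl.1)
  have er : r.1 = r₀.1 := le_antisymm (hr₀.2 _ hr.1) (hr.2 _ hr₀.1)
  rcases le_total r₀.2 l.2 with h1 | h1
  · have : (l.1, r₀.2) ∈ ω := R.mem_of_vertical (y1 := l₀.2) (y2 := l.2) (by rw [el]; exact hl₀.1)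
      hl.1 h h1
    exact hne (l.1, r₀.2) r₀ ⟨this, hl.2⟩ hr₀ rfl
  · have : (r.1, l.2) ∈ ω := R.mem_of_vertical (y1 := r.2) (y2 := r₀.2) hr.1
      (by rw [er]; exact hr₀.1) hrl h1
    exact hne l (r.1, l.2) hl ⟨this, hr.2⟩ rfl

/-- A finite connected family of segments that touches all four sides of the bounding box can be
replaced by at most as many candidates, provided that the left side does not lie above the right
side. -/
theorem exists_built_of_spans (R : RectRegion ω G F) {l₀ r₀ : Plane} (hl₀ : Leftmost ω l₀)
    (hr₀ : Rightmost ω r₀) (h₀ : l₀.2 ≤ r₀.2) {Z : Set (Set Plane)} (hfin : Z.Finite)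
    (hZ : ∀ z ∈ Z, IsLineSegment z ∧ z ⊆ ω) (hc : IsPreconnected (⋃₀ Z)) (hs : Spans ω (⋃₀ Z)) :
    ∃ A, Built G Z.ncard A ∧ Spans ω A := by
  rcases lt_or_ge Z.ncard 3 with h3 | h3
  · obtain ⟨-, ⟨z, hz, -⟩, -⟩ := hs.left
    obtain ⟨x, y, rfl⟩ : ∃ x y, Z = {x, y} := by
      have : 0 < Z.ncard := (ncard_pos hfin).2 ⟨z, hz⟩
      interval_cases h : Z.ncard
      · obtain ⟨x, hx⟩ := ncard_eq_one.1 h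
        exact ⟨x, x, by simp [hx]⟩
      · obtain ⟨x, y, -, hxy⟩ := ncard_eq_two.1 h
        exact ⟨x, y, hxy⟩
    rw [sUnion_pair] at hc hs
    obtain ⟨hx, hxω⟩ := hZ x (mem_insert x {y})
    obtain ⟨hy, hyω⟩ := hZ y (mem_insert_of_mem x rfl)
    obtain ⟨n, A, hn, hA, hAs⟩ := exists_built_pair R hx hxω hy hyω hc hs
    exact ⟨A, hA.mono hn, hAs⟩
  obtain ⟨⟨l, ⟨zl, hzl, hlz⟩, hl⟩, ⟨r, ⟨zr, hzr, hrz⟩, hr⟩, ⟨b, ⟨zb, hzb, hbz⟩, hb⟩,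
    ⟨t, ⟨zt, hzt, htz⟩, ht⟩⟩ := id hs
  have h3' : ∀ {B : Set Plane}, Built G 3 B → Built G Z.ncard B := fun h => h.mono h3
  rcases exists_lt_or_exists_eq R hl₀ hr₀ h₀ with ⟨l', r', hl', hr', hlr⟩ | hlr
  · obtain ⟨B, hB, hsp⟩ := exists_built_of_horizontal R hl' hr' hb ht hlr
    exact ⟨B, h3' hB, hsp⟩
  have hv : ∀ {t' b'}, Highest ω t' → Lowest ω b' → t'.1 = b'.1 →
      ∃ A, Built G Z.ncard A ∧ Spans ω A := fun ht' hb' h => by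
    obtain ⟨B, hB, hsp⟩ := exists_built_of_vertical R hl hr hb' ht' h
    exact ⟨B, h3' hB, hsp⟩
  by_cases hov : ∃ t' b', Highest ω t' ∧ Lowest ω b' ∧ t'.1 = b'.1
  · obtain ⟨t', b', ht', hb', h⟩ := hov
    exact hv ht' hb' h
  rcases le_total b.1 t.1 with hbt | htb
  · rcases exists_lt_or_exists_eq R.swap hb.swap ht.swap hbt with ⟨b', t', hb', ht', h⟩ | h
    · exact absurd ⟨t'.swap, b'.swap, ⟨ht'.1, fun z hz => ht'.2 z.swap (by simpa using hz)⟩,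
        ⟨hb'.1, fun z hz => hb'.2 z.swap (by simpa using hz)⟩, h.symm⟩ hov
    · exact exists_built_corridor R hlr (fun b t hb ht => h b.swap t.swap hb.swap ht.swap) hfin hZ hc
        hs h3
  have hlr' := (hlr l r hl hr).le
  -- Two sides touched by the same member, or four members.
  have htwo : ∀ z ∈ Z, ∃ z', MaxSeg ω z' ∧ z ⊆ z' := fun z hz =>
    exists_maxSeg_of_isLineSegment R.isCompact (hZ z hz).1 (hZ z hz).2
  have hcross : ∀ z ∈ Z, (l ∈ z ∨ b ∈ z) → (r ∈ z ∨ t ∈ z) →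
      ∃ A, Built G Z.ncard A ∧ Spans ω A := fun z hz h1 h2 => by
    obtain ⟨z', hz', hsub⟩ := htwo z hz
    obtain ⟨B, hB, hsp⟩ := exists_built_of_touches R hz' hl hr hb ht hlr'
      ⟨h1.imp (fun h => hsub h) fun h => hsub h, h2.imp (fun h => hsub h) fun h => hsub h⟩
    exact ⟨B, h3' hB, hsp⟩
  by_cases h1 : zl = zr
  · exact hcross zl hzl (Or.inl hlz) (Or.inl (h1 ▸ hrz))
  by_cases h2 : zl = zt
  · exact hcross zl hzl (Or.inl hlz) (Or.inr (h2 ▸ htz))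
  by_cases h4 : zb = zr
  · exact hcross zb hzb (Or.inr hbz) (Or.inl (h4 ▸ hrz))
  by_cases h5 : zb = zt
  · exact hcross zb hzb (Or.inr hbz) (Or.inr (h5 ▸ htz))
  by_cases h6 : zl = zb
  · obtain ⟨z', hz', hsub⟩ := htwo zl hzl
    obtain ⟨B, hB, hsp⟩ := exists_built_of_left_down R hz' hl hr hb ht htb (hsub hlz)
      (hsub (h6 ▸ hbz))
    exact ⟨B, h3' hB, hsp⟩
  by_cases h7 : zr = zt
  · obtain ⟨z', hz', hsub⟩ := htwo zr hzr
    obtain ⟨B, hB, hsp⟩ := exists_built_of_right_up R hz' hl hr hb ht htb (hsub hrz)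
      (hsub (h7 ▸ htz))
    exact ⟨B, h3' hB, hsp⟩
  obtain ⟨B, hB, hsp⟩ := exists_built_four R hl hr hb ht hlr' htb
  refine ⟨B, hB.mono ?_, hsp⟩
  have : ({zl, zb, zr, zt} : Set (Set Plane)).ncard = 4 := by
    rw [ncard_insert_of_notMem (by simp [h1, h2, h6]) (toFinite _),
      ncard_insert_of_notMem (by simp [h4, h5]) (toFinite _), ncard_pair h7]
  rw [← this]
  refine ncard_le_ncard ?_ hfin
  rintro z (rfl | rfl | rfl | rfl) <;> assumption

end Corridor

/-! ### Directions -/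

namespace Dir

variable {d d' δ : Dir} {p q : Plane}

/-- The unit vector in direction `d`. -/
def vec : Dir → Plane
  | .left => (-1, 0)
  | .right => (1, 0)
  | .down => (0, -1)
  | .up => (0, 1)

@[simp] theorem coord_opp (d : Dir) (p : Plane) : d.opp.coord p = -d.coord p := by
  cases d <;> simp [opp, coord]

theorem continuous_coord (d : Dir) : Continuous d.coord := by
  cases d
  exacts [continuous_fst.neg, continuous_fst, continuous_snd.neg, continuous_snd]

theorem coord_add_vec (d : Dir) (p : Plane) (ε : ℝ) : d.coord (p + ε • d.vec) = d.coord p + ε := by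
  cases d <;> simp [coord, vec, add_comm]

theorem Perp.symm (h : d.Perp d') : d'.Perp d := by
  cases d <;> cases d' <;> simp_all [Perp]

theorem Perp.opp_left (h : d.Perp d') : d.opp.Perp d' := by
  cases d <;> cases d' <;> simp_all [Perp, opp]

theorem Perp.opp_right (h : d.Perp d') : d.Perp d'.opp := h.symm.opp_left.symm

theorem exists_perp (d : Dir) : ∃ d', d.Perp d' := by
  cases d <;> simp [Perp]

theorem coord_add_vec_perp (h : d.Perp d') (p : Plane) (ε : ℝ) :
    d'.coord (p + ε • d.vec) = d'.coord p := by
  cases d <;> cases d' <;> simp_all [coord, vec, Perp]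

theorem Perp.ext (h : d.Perp d') (h1 : d.coord p = d.coord q) (h2 : d'.coord p = d'.coord q) :
    p = q := by
  cases d <;> cases d' <;> simp_all [coord, Perp, Prod.ext_iff]

theorem Perp.exists_coord (h : d.Perp d') (x y : ℝ) : ∃ p, d.coord p = x ∧ d'.coord p = y := by
  refine ⟨x • d.vec + y • d'.vec, ?_, ?_⟩ <;>
    cases d <;> cases d' <;> simp_all [coord, vec, Perp]

theorem Perp.eq_or (h : d.Perp d') (δ : Dir) : δ = d ∨ δ = d.opp ∨ δ = d' ∨ δ = d'.opp := by
  cases d <;> cases d' <;> cases δ <;> simp_all [Perp, opp]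

theorem coord_lineMap (d : Dir) (p q : Plane) (θ : ℝ) :
    d.coord (p.1 + θ * (q.1 - p.1), p.2 + θ * (q.2 - p.2)) =
      d.coord p + θ * (d.coord q - d.coord p) := by
  cases d <;> simp only [coord] <;> ring

theorem coord_of_mem_segment (d : Dir) {z : Plane} (hz : z ∈ segment ℝ p q) :
    min (d.coord p) (d.coord q) ≤ d.coord z ∧ d.coord z ≤ max (d.coord p) (d.coord q) := by
  obtain ⟨θ, h0, h1, h2, h3⟩ := mem_segment_iff.1 hz
  have : z = (p.1 + θ * (q.1 - p.1), p.2 + θ * (q.2 - p.2)) := Prod.ext h2 h3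
  rw [this, coord_lineMap]
  constructor
  · have := min_le_left (d.coord p) (d.coord q)
    have := min_le_right (d.coord p) (d.coord q)
    nlinarith
  · have := le_max_left (d.coord p) (d.coord q)
    have := le_max_right (d.coord p) (d.coord q)
    nlinarith

/-- An open set contains, with each point, a point further in direction `d`. -/
theorem exists_move (d : Dir) {U : Set Plane} (hU : IsOpen U) (hp : p ∈ U) :
    ∃ q ∈ U, d.coord p < d.coord q ∧ ∀ d', d.Perp d' → d'.coord q = d'.coord p := by
  have h : Tendsto (fun ε : ℝ => p + ε • d.vec) (𝓝[>] 0) (𝓝 p) := by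
    have : Tendsto (fun ε : ℝ => p + ε • d.vec) (𝓝 0) (𝓝 (p + (0 : ℝ) • d.vec)) :=
      Continuous.tendsto (by fun_prop) 0
    rw [zero_smul, add_zero] at this
    exact this.mono_left nhdsWithin_le_nhds
  obtain ⟨ε, h1, h2⟩ := ((h.eventually (hU.mem_nhds hp)).and self_mem_nhdsWithin).exists
  refine ⟨_, h1, ?_, fun d' hd => coord_add_vec_perp hd p ε⟩
  rw [coord_add_vec]
  exact lt_add_of_pos_right _ h2

theorem axisParallel_iff (h : d.Perp d') :
    AxisParallel p q ↔ d.coord p = d.coord q ∨ d'.coord p = d'.coord q := by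
  cases d <;> cases d' <;> simp_all [coord, Perp, AxisParallel, or_comm]

end Dir

/-! ### Shortest rectilinear paths -/

section Paths

variable {p q z : Plane}

/-- The rectilinear distance. -/
def rectDist (p q : Plane) : ℝ := |p.1 - q.1| + |p.2 - q.2|

theorem rectDist_self (p : Plane) : rectDist p p = 0 := by simp [rectDist]

theorem rectDist_triangle (p q z : Plane) : rectDist p z ≤ rectDist p q + rectDist q z := by
  have h1 := abs_sub_le p.1 q.1 z.1
  have h2 := abs_sub_le p.2 q.2 z.2
  simp only [rectDist]
  linarith

theorem rectDist_add_of_mem_segment (hz : z ∈ segment ℝ p q) :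
    rectDist p z + rectDist z q = rectDist p q := by
  obtain ⟨θ, h0, h1, h2, h3⟩ := mem_segment_iff.1 hz
  have e1 : p.1 - z.1 = θ * (p.1 - q.1) := by rw [h2]; ring
  have e2 : p.2 - z.2 = θ * (p.2 - q.2) := by rw [h3]; ring
  have e3 : z.1 - q.1 = (1 - θ) * (p.1 - q.1) := by rw [h2]; ring
  have e4 : z.2 - q.2 = (1 - θ) * (p.2 - q.2) := by rw [h3]; ring
  simp only [rectDist, e1, e2, e3, e4, abs_mul, abs_of_nonneg h0, abs_of_nonneg (sub_nonneg.2 h1)]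
  ring

theorem rectDist_le_pathLength : ∀ {l : List Plane} {p q : Plane}, l.head? = some p →
    l.getLast? = some q → rectDist p q ≤ pathLength l
  | [], _, _, h, _ => by simp at h
  | [a], p, q, h1, h2 => by
    simp at h1 h2
    rw [← h1, ← h2, rectDist_self]
    exact le_rfl
  | a :: b :: l, p, q, h1, h2 => by
    have h3 := rectDist_le_pathLength (l := b :: l) (p := b) (q := q) rfl (by simpa using h2)
    simp at h1
    subst h1
    have := rectDist_triangle a b q
    simp only [pathLength]
    simp only [rectDist] at *
    linarith

theorem rectDist_add_le_pathLength : ∀ {l : List Plane} {p q z : Plane}, l.head? = some p →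
    l.getLast? = some q → z ∈ pathTrace l → rectDist p z + rectDist z q ≤ pathLength l
  | [], _, _, _, h, _, _ => by simp at h
  | [a], p, q, z, h1, h2, h3 => by
    simp at h1 h2
    rw [pathTrace, mem_singleton_iff] at h3
    rw [h3, ← h1, ← h2, rectDist_self]
    simp [pathLength]
  | a :: b :: l, p, q, z, h1, h2, h3 => by
    have h2' : (b :: l).getLast? = some q := by simpa using h2
    simp at h1
    subst h1
    have e : pathLength (a :: b :: l) = rectDist a b + pathLength (b :: l) := by
      simp [pathLength, rectDist]
    rw [e]
    rcases h3 with h3 | h3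
    · have h4 := rectDist_add_of_mem_segment h3
      have h5 := rectDist_le_pathLength (l := b :: l) rfl h2'
      have h6 := rectDist_triangle z b q
      linarith
    · have h4 := rectDist_add_le_pathLength (l := b :: l) rfl h2' h3
      have h5 := rectDist_triangle a b z
      linarith

theorem isRectilinearPath_corner {c : Plane} (h1 : AxisParallel p c) (h2 : AxisParallel c q) :
    IsRectilinearPath [p, c, q] p q := by
  simp [IsRectilinearPath, h1, h2]

theorem IsShortestPath.length_eq {l : List Plane} (h : IsShortestPath l p q) :
    pathLength l = rectDist p q := by
  refine le_antisymm ?_ (rectDist_le_pathLength h.1.1 h.1.2.1)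
  refine (h.2 _ (isRectilinearPath_corner (c := (p.1, q.2)) (Or.inl rfl) (Or.inr rfl))).trans ?_
  simp [pathLength, rectDist, add_comm]

/-- A shortest rectilinear path stays in the box spanned by its endpoints. -/
theorem IsShortestPath.mem_box {l : List Plane} (h : IsShortestPath l p q) (hz : z ∈ pathTrace l) :
    (min p.1 q.1 ≤ z.1 ∧ z.1 ≤ max p.1 q.1) ∧ min p.2 q.2 ≤ z.2 ∧ z.2 ≤ max p.2 q.2 := by
  have h1 := rectDist_add_le_pathLength h.1.1 h.1.2.1 hz
  rw [h.length_eq] at h1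
  simp only [rectDist] at h1
  have h2 := abs_sub_le p.1 z.1 q.1
  have h3 := abs_sub_le p.2 z.2 q.2
  have key : ∀ x y w : ℝ, |x - w| + |w - y| ≤ |x - y| → min x y ≤ w ∧ w ≤ max x y := by
    intro x y w hw
    rcases le_total x y with hxy | hxy
    · rw [min_eq_left hxy, max_eq_right hxy]
      rw [abs_sub_comm x y, abs_of_nonneg (sub_nonneg.2 hxy)] at hw
      have := le_abs_self (x - w)
      have := neg_abs_le (w - y)
      have := neg_abs_le (x - w)
      have := le_abs_self (w - y)
      constructor <;> linarith
    · rw [min_eq_right hxy, max_eq_left hxy]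
      rw [abs_of_nonneg (sub_nonneg.2 hxy)] at hw
      have := le_abs_self (x - w)
      have := neg_abs_le (w - y)
      have := neg_abs_le (x - w)
      have := le_abs_self (w - y)
      constructor <;> linarith
  exact ⟨key _ _ _ (by linarith), key _ _ _ (by linarith)⟩

theorem head_mem_pathTrace : ∀ {l : List Plane}, l.head? = some p → p ∈ pathTrace l
  | [], h => by simp at h
  | [a], h => by simp at h; simp [pathTrace, h]
  | a :: b :: l, h => by
    simp at h
    subst h
    exact Or.inl (left_mem_segment ℝ _ _)

theorem last_mem_pathTrace : ∀ {l : List Plane}, l.getLast? = some q → q ∈ pathTrace l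
  | [], h => by simp at h
  | [a], h => by simp at h; simp [pathTrace, h]
  | a :: b :: l, h => Or.inr (last_mem_pathTrace (l := b :: l) (by simpa using h))

theorem isPreconnected_pathTrace : ∀ l : List Plane, IsPreconnected (pathTrace l)
  | [] => isPreconnected_empty
  | [_] => isPreconnected_singleton
  | a :: b :: l => (convex_segment a b).isPreconnected.union b (right_mem_segment ℝ a b)
      (head_mem_pathTrace rfl) (isPreconnected_pathTrace (b :: l))

end Paths

/-! ### Rectilinearly convex obstacles -/

namespace Obstacle

variable {Ω : Obstacle} {d d' : Dir} {p q z : Plane}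

theorem exists_between (hd : d.Perp d') (hp : p ∈ Ω.region) (hq : q ∈ Ω.region) {x : ℝ}
    (h1 : d.coord p ≤ x) (h2 : x ≤ d.coord q) : ∃ z ∈ Ω.region, d.coord z = x ∧
      min (d'.coord p) (d'.coord q) ≤ d'.coord z ∧ d'.coord z ≤ max (d'.coord p) (d'.coord q) := by
  obtain ⟨l, hl, hlω⟩ := Ω.convex p hp q hq
  obtain ⟨z, hz, hzx⟩ := (isPreconnected_pathTrace l).intermediate_value
    (head_mem_pathTrace hl.1.1) (last_mem_pathTrace hl.1.2.1) d.continuous_coord.continuousOn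
    ⟨h1, h2⟩
  refine ⟨z, hlω hz, hzx, ?_⟩
  obtain ⟨h3, h4⟩ := hl.mem_box hz
  cases d' <;> simp only [Dir.coord, min_neg_neg, max_neg_neg, neg_le_neg_iff] <;>
    first
    | exact h3
    | exact h4
    | exact h3.symm
    | exact h4.symm

/-- A point all of whose closed quadrants meet the region belongs to the region. -/
theorem mem_of_quadrants (hd : d.Perp d') {nw ne sw se : Plane}
    (h1 : nw ∈ Ω.region) (h1x : d.coord nw ≤ d.coord z) (h1y : d'.coord z ≤ d'.coord nw)
    (h2 : ne ∈ Ω.region) (h2x : d.coord z ≤ d.coord ne) (h2y : d'.coord z ≤ d'.coord ne)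
    (h3 : sw ∈ Ω.region) (h3x : d.coord sw ≤ d.coord z) (h3y : d'.coord sw ≤ d'.coord z)
    (h4 : se ∈ Ω.region) (h4x : d.coord z ≤ d.coord se) (h4y : d'.coord se ≤ d'.coord z) :
    z ∈ Ω.region := by
  obtain ⟨y, hy, hyx, hy1, -⟩ := exists_between hd h1 h2 h1x h2x
  obtain ⟨y', hy', hyx', -, hy2⟩ := exists_between hd h3 h4 h3x h4x
  obtain ⟨x, hx, hxz, hx1, hx2⟩ := exists_between hd.symm hy' hy (hy2.trans (max_le h3y h4y))
    ((le_min h1y h2y).trans hy1)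
  rw [hyx, hyx', min_self] at hx1
  rw [hyx, hyx', max_self] at hx2
  rwa [hd.ext (le_antisymm hx2 hx1) hxz] at hx

variable (Ω) in
/-- The coordinates of the vertices in all directions. -/
def vertexCoords : Set ℝ := {c | ∃ (d : Dir) (i : ZMod Ω.n), d.coord (Ω.vertex i) = c}

theorem finite_zmod (Ω : Obstacle) : Finite (ZMod Ω.n) := by
  have : NeZero Ω.n := ⟨by have := Ω.three_le; omega⟩
  exact Finite.of_fintype _

theorem finite_vertexCoords (Ω : Obstacle) : Ω.vertexCoords.Finite := by
  have := Ω.finite_zmod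
  have : Ω.vertexCoords = ⋃ i, {Dir.left.coord (Ω.vertex i), Dir.right.coord (Ω.vertex i),
      Dir.down.coord (Ω.vertex i), Dir.up.coord (Ω.vertex i)} := by
    ext c
    simp only [vertexCoords, mem_ofPred_eq, mem_iUnion, mem_insert_iff, mem_singleton_iff]
    constructor
    · rintro ⟨d, i, rfl⟩
      exact ⟨i, by cases d <;> simp⟩
    · rintro ⟨i, rfl | rfl | rfl | rfl⟩ <;> exact ⟨_, i, rfl⟩
  rw [this]
  exact finite_iUnion fun i => toFinite _

theorem coord_mem_vertexCoords (Ω : Obstacle) (d : Dir) (i : ZMod Ω.n) :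
    d.coord (Ω.vertex i) ∈ Ω.vertexCoords := ⟨d, i, rfl⟩

theorem isClosed (Ω : Obstacle) : IsClosed Ω.region := Ω.isCompact.isClosed

theorem mem_frontier_iff : z ∈ frontier Ω.region ↔ ∃ i, z ∈ Ω.edge i := by
  rw [Ω.frontier_eq, mem_iUnion]
  rfl

theorem nonempty (Ω : Obstacle) : Ω.region.Nonempty :=
  ⟨Ω.vertex 0, Ω.isClosed.frontier_subset (mem_frontier_iff.2 ⟨0, left_mem_segment ℝ _ _⟩)⟩

theorem add_one_ne (Ω : Obstacle) (i : ZMod Ω.n) : i + 1 ≠ i := by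
  have h := Ω.three_le
  have : Fact (1 < Ω.n) := ⟨by omega⟩
  simp

theorem add_two_ne (Ω : Obstacle) (i : ZMod Ω.n) : i + 1 + 1 ≠ i := by
  have h := Ω.three_le
  intro h2
  have h3 : ((2 : ℕ) : ZMod Ω.n) = 0 := by
    have : i + (1 + 1) = i + 0 := by rw [← add_assoc, h2, add_zero]
    have := add_left_cancel this
    push_cast
    rw [← this]
    norm_num
  rw [ZMod.natCast_eq_zero_iff] at h3
  have := Nat.le_of_dvd (by norm_num) h3
  omega

theorem vertex_ne (Ω : Obstacle) (i : ZMod Ω.n) : Ω.vertex i ≠ Ω.vertex (i + 1) := by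
  intro h
  refine Ω.general_position i (i + 1) (i + 1 + 1) (Ω.add_one_ne i).symm (Ω.add_one_ne _).symm
    (Ω.add_two_ne i).symm ?_
  rw [h, insert_eq_of_mem (mem_insert _ _)]
  exact collinear_pair ℝ _ _

theorem collinear_of_coord (hd : d.Perp d') {a b c : Plane} (h1 : d.coord a = d.coord b)
    (h2 : d.coord b = d.coord c) : Collinear ℝ ({a, b, c} : Set Plane) := by
  rw [collinear_iff_of_mem (p₀ := a) (by simp)]
  refine ⟨d'.vec, ?_⟩
  have key : ∀ g, d.coord g = d.coord a → ∃ r : ℝ, g = r • d'.vec +ᵥ a := fun g hg => by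
    refine ⟨d'.coord g - d'.coord a, ?_⟩
    rw [vadd_eq_add, add_comm]
    refine hd.ext ?_ ?_
    · rw [Dir.coord_add_vec_perp hd.symm, hg]
    · rw [Dir.coord_add_vec]
      ring
  rintro g (rfl | rfl | rfl)
  · exact key _ rfl
  · exact key _ h1.symm
  · exact key _ (h1.trans h2).symm

/-- A region point that can be moved off the region in direction `δ` lies on the boundary. -/
theorem mem_frontier_of_forall (hz : z ∈ Ω.region) (δ : Dir)
    (h : ∀ g ∈ Ω.region, (∀ d', δ.Perp d' → d'.coord g = d'.coord z) → δ.coord g ≤ δ.coord z) :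
    z ∈ frontier Ω.region := by
  refine ⟨subset_closure hz, fun hi => ?_⟩
  obtain ⟨q, hq, h1, h2⟩ := δ.exists_move isOpen_interior hi
  exact not_lt.2 (h q (interior_subset hq) h2) h1

theorem edge_cases (hd : d.Perp d') (i : ZMod Ω.n) :
    (∀ g ∈ Ω.edge i, d.coord g = d.coord (Ω.vertex i)) ∨
      ∀ g ∈ Ω.edge i, d'.coord g = d'.coord (Ω.vertex i) := by
  refine ((Dir.axisParallel_iff hd).1 (Ω.rectilinear i)).imp (fun h g hg => ?_) fun h g hg => ?_
  · have := d.coord_of_mem_segment hg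
    rw [← h, min_self, max_self] at this
    exact le_antisymm this.2 this.1
  · have := d'.coord_of_mem_segment hg
    rw [← h, min_self, max_self] at this
    exact le_antisymm this.2 this.1

/-- The height of the highest point to one side of a vertical line that is attained on this line is
a vertex coordinate. -/
theorem coord_mem_of_forall (hd : d.Perp d') (hz : z ∈ Ω.region)
    (h : ∀ g ∈ Ω.region, d.coord g ≤ d.coord z → d'.coord g ≤ d'.coord z) :
    d'.coord z ∈ Ω.vertexCoords := by
  obtain ⟨i, hi⟩ := mem_frontier_iff.1 (mem_frontier_of_forall hz d' fun g hg h2 =>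
    h g hg (h2 d hd.symm).le)
  rcases edge_cases hd i with h1 | h1
  · have hv : ∀ j, (Ω.vertex j ∈ Ω.edge i) → d'.coord (Ω.vertex j) ≤ d'.coord z := fun j hj =>
      h _ (Ω.isClosed.frontier_subset (mem_frontier_iff.2 ⟨i, hj⟩))
        ((h1 _ hj).trans (h1 z hi).symm).le
    have e1 := hv i (left_mem_segment ℝ _ _)
    have e2 := hv (i + 1) (right_mem_segment ℝ _ _)
    have e3 := (d'.coord_of_mem_segment hi).2
    rcases le_max_iff.1 e3 with h2 | h2
    · exact ⟨d', i, le_antisymm e1 h2⟩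
    · exact ⟨d', i + 1, le_antisymm e2 h2⟩
  · rw [h1 z hi]
    exact Ω.coord_mem_vertexCoords d' i

/-- Every extreme point lies on an extreme edge. -/
theorem exists_extreme_edge (d : Dir) (hz : z ∈ Ω.region)
    (h : ∀ g ∈ Ω.region, d.coord g ≤ d.coord z) :
    ∃ i, z ∈ Ω.edge i ∧ ∀ g ∈ Ω.edge i, d.coord g = d.coord z := by
  obtain ⟨d', hd⟩ := d.exists_perp
  obtain ⟨i, hi⟩ := mem_frontier_iff.1 (mem_frontier_of_forall hz d fun g hg _ => h g hg)
  have hvω : ∀ j, Ω.vertex j ∈ Ω.region := fun j => Ω.isClosed.frontier_subset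
    (mem_frontier_iff.2 ⟨j, left_mem_segment ℝ _ _⟩)
  rcases edge_cases hd i with h1 | h1
  · exact ⟨i, hi, fun g hg => (h1 g hg).trans (h1 z hi).symm⟩
  -- If the edge points in direction `d`, it ends in the point, and the next edge is extreme.
  have hv : z = Ω.vertex i ∨ z = Ω.vertex (i + 1) := by
    have e := (d.coord_of_mem_segment hi).2
    rcases le_max_iff.1 e with h2 | h2
    · exact Or.inl (hd.ext (le_antisymm h2 (h _ (hvω _))) (h1 z hi))
    · exact Or.inr (hd.ext (le_antisymm h2 (h _ (hvω _)))
        ((h1 z hi).trans (h1 _ (right_mem_segment ℝ _ _)).symm))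
  have e1 : d'.coord (Ω.vertex (i + 1)) = d'.coord (Ω.vertex i) := h1 _ (right_mem_segment ℝ _ _)
  rcases hv with rfl | rfl
  · have hi1 : i - 1 + 1 = i := by ring
    have hmem : Ω.vertex i ∈ Ω.edge (i - 1) := by
      have := right_mem_segment ℝ (Ω.vertex (i - 1)) (Ω.vertex (i - 1 + 1))
      rw [hi1] at this
      rw [edge, hi1]
      exact this
    rcases edge_cases hd (i - 1) with h2 | h2
    · exact ⟨i - 1, hmem, fun g hg => (h2 g hg).trans (h2 _ hmem).symm⟩
    · have a1 := Ω.add_one_ne (i - 1)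
      have a2 := Ω.add_two_ne (i - 1)
      rw [hi1] at a1 a2
      exact absurd (collinear_of_coord hd.symm (h2 _ hmem).symm e1.symm)
        (Ω.general_position _ _ _ a1.symm (Ω.add_one_ne i).symm a2.symm)
  · have hmem : Ω.vertex (i + 1) ∈ Ω.edge (i + 1) := left_mem_segment ℝ _ _
    rcases edge_cases hd (i + 1) with h2 | h2
    · exact ⟨i + 1, hmem, h2⟩
    · exact absurd (collinear_of_coord hd.symm e1.symm (h2 _ (right_mem_segment ℝ _ _)).symm)
        (Ω.general_position _ _ _ (Ω.add_one_ne i).symm (Ω.add_one_ne _).symm (Ω.add_two_ne i).symm)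

/-- The extreme edges are not single points. -/
theorem exists_extreme_ne (hd : d.Perp d') (hz : z ∈ Ω.region)
    (h : ∀ g ∈ Ω.region, d.coord g ≤ d.coord z) :
    ∃ g ∈ Ω.region, d.coord g = d.coord z ∧ d'.coord g ≠ d'.coord z := by
  obtain ⟨i, hi, hall⟩ := exists_extreme_edge d hz h
  obtain ⟨g, hg, hgz⟩ : ∃ g ∈ Ω.edge i, g ≠ z :=
    IsLineSegment.exists_ne ⟨_, _, Ω.vertex_ne i, rfl⟩ z
  exact ⟨g, Ω.isClosed.frontier_subset (mem_frontier_iff.2 ⟨i, hg⟩), hall g hg,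
    fun h => hgz (hd.ext (hall g hg) h)⟩

/-- No point cuts the region into two parts in opposite quadrants: the rest of the boundary polygon
is connected and stays in one of the quadrants. -/
theorem quadrant_of_subset (hd : d.Perp d') (hz : z ∈ Ω.region)
    (h : ∀ g ∈ Ω.region, d.coord g ≤ d.coord z ∧ d'.coord g ≤ d'.coord z ∨
      d.coord z ≤ d.coord g ∧ d'.coord z ≤ d'.coord g) :
    (∀ g ∈ Ω.region, d.coord g ≤ d.coord z ∧ d'.coord g ≤ d'.coord z) ∨
      ∀ g ∈ Ω.region, d.coord z ≤ d.coord g ∧ d'.coord z ≤ d'.coord g := by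
  -- A quadrant that contains all vertices contains the whole region.
  have hall : ∀ δ δ' : Dir, (∀ i, δ.coord (Ω.vertex i) ≤ δ.coord z ∧
      δ'.coord (Ω.vertex i) ≤ δ'.coord z) → ∀ g ∈ Ω.region, δ.coord g ≤ δ.coord z ∧
        δ'.coord g ≤ δ'.coord z := by
    intro δ δ' hv g hg
    have key : ∀ δ : Dir, (∀ i, δ.coord (Ω.vertex i) ≤ δ.coord z) → δ.coord g ≤ δ.coord z := by
      intro δ hv
      obtain ⟨m, hm, hmax⟩ := Ω.isCompact.exists_isMaxOn Ω.nonempty δ.continuous_coord.continuousOn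
      obtain ⟨i, hi⟩ := mem_frontier_iff.1 (mem_frontier_of_forall hm δ fun g hg _ => hmax hg)
      exact (hmax hg).trans ((δ.coord_of_mem_segment hi).2.trans (max_le (hv _) (hv _)))
    exact ⟨key δ fun i => (hv i).1, key δ' fun i => (hv i).2⟩
  have hvω : ∀ i, ∀ g ∈ Ω.edge i, g ∈ Ω.region := fun i g hg => Ω.isClosed.frontier_subset
    (mem_frontier_iff.2 ⟨i, hg⟩)
  set A := {g | d.coord g ≤ d.coord z ∧ d'.coord g ≤ d'.coord z} with hA
  set B := {g | d.coord z ≤ d.coord g ∧ d'.coord z ≤ d'.coord g} with hB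
  have hAc : IsClosed A := IsClosed.and (isClosed_le d.continuous_coord continuous_const)
    (isClosed_le d'.continuous_coord continuous_const)
  have hBc : IsClosed B := IsClosed.and (isClosed_le continuous_const d.continuous_coord)
    (isClosed_le continuous_const d'.continuous_coord)
  have hAB : ∀ g, g ∈ A → g ∈ B → g = z := fun g h1 h2 =>
    hd.ext (le_antisymm h1.1 h2.1) (le_antisymm h1.2 h2.2)
  have hside : ∀ i, z ∉ Ω.edge i → Ω.edge i ⊆ A ∨ Ω.edge i ⊆ B := by
    intro i hi
    by_contra! hc
    obtain ⟨h1, h2⟩ := hc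
    obtain ⟨a, ha, haA⟩ := not_subset.1 h1
    obtain ⟨b, hb, hbB⟩ := not_subset.1 h2
    obtain ⟨g, hg, hgA, hgB⟩ := isPreconnected_closed_iff.1 (convex_segment _ _).isPreconnected A B
      hAc hBc (fun g hg => h g (hvω i g hg)) ⟨b, hb, (h b (hvω i b hb)).resolve_right hbB⟩
      ⟨a, ha, (h a (hvω i a ha)).resolve_left haA⟩
    exact hi (hAB g hgA hgB ▸ hg)
  obtain ⟨j, hj, hj1⟩ : ∃ j, z ∈ Ω.edge j ∧ z ≠ Ω.vertex (j + 1) := by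
    have hzf : z ∈ frontier Ω.region := by
      refine ⟨subset_closure hz, fun hi => ?_⟩
      obtain ⟨q, hq, h1, h2⟩ := d.exists_move isOpen_interior hi
      obtain ⟨q', hq', h3, h4⟩ := d'.opp.exists_move isOpen_interior hq
      have h5 := h2 d' hd
      have h6 := h4 d hd.symm.opp_left
      simp only [Dir.coord_opp] at h3
      rcases h q' (interior_subset hq') with h7 | h7
      · linarith [h7.1]
      · linarith [h7.2]
    obtain ⟨j, hj⟩ := mem_frontier_iff.1 hzf
    by_cases h1 : z = Ω.vertex (j + 1)
    · exact ⟨j + 1, h1 ▸ left_mem_segment ℝ _ _, h1 ▸ Ω.vertex_ne (j + 1)⟩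
    · exact ⟨j, hj, h1⟩
  have hnot : ∀ i, i ≠ j → i + 1 ≠ j → z ∉ Ω.edge i := by
    intro i h1 h2 hi
    by_cases h3 : j + 1 = i
    · have := Ω.adjacent_edges j
      rw [h3] at this
      have hz' : z ∈ ({Ω.vertex i} : Set Plane) := by
        rw [← this]
        refine ⟨?_, hi⟩
        rw [← h3]
        exact hj
      rw [← h3] at hz'
      exact hj1 hz'
    · exact disjoint_left.1 (Ω.nonadjacent_edges i j h1 h2 h3) hi hj
  -- Walking around the polygon from the vertex after `z` never crosses to the other quadrant.
  have hwalk : ∀ E : Set Plane, (∀ i, z ∉ Ω.edge i → Ω.vertex i ∈ E → Ω.edge i ⊆ E) → z ∈ E →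
      Ω.vertex (j + 1) ∈ E → ∀ i, Ω.vertex i ∈ E := by
    intro E hE hzE h0
    have hk : ∀ k : ℕ, Ω.vertex (j + 1 + k) ∈ E := by
      intro k
      induction k with
      | zero => simpa using h0
      | succ k ih =>
        have e : j + 1 + ((k + 1 : ℕ) : ZMod Ω.n) = j + 1 + k + 1 := by push_cast; ring
        rw [e]
        by_cases h1 : j + 1 + k = j
        · rwa [h1]
        by_cases h2 : j + 1 + k + 1 = j
        · rw [h2]
          by_cases h3 : z = Ω.vertex j
          · rwa [← h3]
          have hjk : Ω.vertex j ∈ Ω.edge (j + 1 + k) := by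
            have := right_mem_segment ℝ (Ω.vertex (j + 1 + k)) (Ω.vertex (j + 1 + k + 1))
            rw [edge, h2]
            rwa [h2] at this
          refine hE (j + 1 + k) (fun h4 => h3 ?_) ih hjk
          have := Ω.adjacent_edges (j + 1 + k)
          rw [h2] at this
          have hz' : z ∈ ({Ω.vertex j} : Set Plane) := by
            rw [← this]
            refine ⟨?_, hj⟩
            rw [edge, h2] at h4
            exact h4
          exact hz'
        · exact hE _ (hnot _ h1 h2) ih (right_mem_segment ℝ _ _)
    intro i
    have hn : NeZero Ω.n := ⟨by have := Ω.three_le; omega⟩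
    have := hk (i - (j + 1)).val
    rwa [ZMod.natCast_zmod_val, add_sub_cancel] at this
  have hzA : z ∈ A := ⟨le_rfl, le_rfl⟩
  have hzB : z ∈ B := ⟨le_rfl, le_rfl⟩
  rcases h _ (hvω (j + 1) _ (left_mem_segment ℝ _ _)) with h0 | h0
  · left
    refine hall d d' (hwalk A (fun i hi hv => (hside i hi).resolve_right fun h1 => hi ?_) hzA h0)
    exact hAB _ hv (h1 (left_mem_segment ℝ _ _)) ▸ left_mem_segment ℝ _ _
  · right
    intro g hg
    have := hall d.opp d'.opp (fun i => by
      have := hwalk B (fun i hi hv => (hside i hi).resolve_left fun h1 => hi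
        (hAB _ (h1 (left_mem_segment ℝ _ _)) hv ▸ left_mem_segment ℝ _ _)) hzB h0 i
      simpa [hB] using this) g hg
    simpa using this

/-- A point strictly between two points of a chord that contains no vertex is an interior
point. -/
theorem mem_interior_of_between (hd : d.Perp d') {a b : Plane} (hc : d.coord z ∉ Ω.vertexCoords)
    (ha : a ∈ Ω.region) (hb : b ∈ Ω.region) (ha1 : d.coord a = d.coord z)
    (hb1 : d.coord b = d.coord z) (ha2 : d'.coord a < d'.coord z) (hb2 : d'.coord z < d'.coord b) :
    z ∈ interior Ω.region := by
  -- Away from the vertices, the region continues beyond `g` in direction `δ` without going back in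
  -- direction `δ'`.
  have key : ∀ δ δ' : Dir, δ.Perp δ' → ∀ g ∈ Ω.region, δ.coord g ∉ Ω.vertexCoords →
      ∃ h ∈ Ω.region, δ'.coord g ≤ δ'.coord h ∧ δ.coord g < δ.coord h := by
    intro δ δ' hδ g hg hgF
    by_contra! hcon
    exact hgF (coord_mem_of_forall (d := δ'.opp) hδ.symm.opp_left hg fun h hh hle =>
      hcon h hh (by simpa using hle))
  have hopp : ∀ x, x ∈ Ω.vertexCoords → -x ∈ Ω.vertexCoords := by
    rintro _ ⟨δ, i, rfl⟩
    exact ⟨δ.opp, i, by simp⟩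
  have hc' : d.opp.coord z ∉ Ω.vertexCoords := fun h => hc (by simpa using hopp _ h)
  have e : ∀ g : Plane, d.coord g = d.coord z → d.opp.coord g = d.opp.coord z := fun g hg => by
    simp [hg]
  obtain ⟨ne, hne, hne2, hne1⟩ := key d d' hd b hb (hb1 ▸ hc)
  obtain ⟨nw, hnw, hnw2, hnw1⟩ := key d.opp d' hd.opp_left b hb (e b hb1 ▸ hc')
  obtain ⟨se, hse, hse2, hse1⟩ := key d d'.opp hd.opp_right a ha (ha1 ▸ hc)
  obtain ⟨sw, hsw, hsw2, hsw1⟩ := key d.opp d'.opp hd.opp_left.opp_right a ha (e a ha1 ▸ hc')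
  simp only [Dir.coord_opp, neg_lt_neg_iff, neg_le_neg_iff] at *
  have hopen : IsOpen {g | (max (d.coord nw) (d.coord sw) < d.coord g ∧
      d.coord g < min (d.coord ne) (d.coord se)) ∧ d'.coord a < d'.coord g ∧
        d'.coord g < d'.coord b} :=
    ((isOpen_lt continuous_const d.continuous_coord).and
      (isOpen_lt d.continuous_coord continuous_const)).and
      ((isOpen_lt continuous_const d'.continuous_coord).and
      (isOpen_lt d'.continuous_coord continuous_const))
  refine mem_interior.2 ⟨_, fun g hg => ?_, hopen, ⟨⟨max_lt ?_ ?_, lt_min ?_ ?_⟩, ha2,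
    hb2⟩⟩
  · obtain ⟨⟨h1, h2⟩, h3, h4⟩ := hg
    obtain ⟨h5, h6⟩ := max_lt_iff.1 h1
    obtain ⟨h7, h8⟩ := lt_min_iff.1 h2
    exact mem_of_quadrants hd hnw h5.le (h4.le.trans hnw2) hne h7.le (h4.le.trans hne2) hsw h6.le
      (hsw2.trans h3.le) hse h8.le (hse2.trans h3.le)
  all_goals linarith

end Obstacle

/-! ### Frontiers cut out by a convex window -/

theorem exists_reach (d : Dir) {A : Set Plane} (hA : IsCompact A) (hne : A.Nonempty) :
    ∃ g ∈ A, reach d A = d.coord g ∧ ∀ h ∈ A, d.coord h ≤ d.coord g := by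
  obtain ⟨g, hg, hmax⟩ := hA.exists_isMaxOn hne d.continuous_coord.continuousOn
  refine ⟨g, hg, IsGreatest.csSup_eq ⟨mem_image_of_mem _ hg, ?_⟩, fun h hh => hmax hh⟩
  rintro _ ⟨h, hh, rfl⟩
  exact hmax hh

theorem reach_eq (d : Dir) {A : Set Plane} {g : Plane} (hg : g ∈ A)
    (h : ∀ k ∈ A, d.coord k ≤ d.coord g) : reach d A = d.coord g := by
  refine IsGreatest.csSup_eq ⟨mem_image_of_mem _ hg, ?_⟩
  rintro _ ⟨k, hk, rfl⟩
  exact h k hk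

/-- A compact convex subset of a segment that contains two points is a segment. -/
theorem isLineSegment_of_subset {a b p q : Plane} {A : Set Plane} (hA : A ⊆ segment ℝ a b)
    (hc : IsCompact A) (hconv : Convex ℝ A) (hp : p ∈ A) (hq : q ∈ A) (hpq : p ≠ q) :
    IsLineSegment A := by
  set f : ℝ →ᵃ[ℝ] Plane := AffineMap.lineMap a b
  have hf : Continuous f := by
    have : Continuous fun t : ℝ => AffineMap.lineMap a b t := by fun_prop
    exact this
  set I := Icc (0 : ℝ) 1 ∩ f ⁻¹' A
  have hI : IsCompact I := isCompact_Icc.inter_right (hc.isClosed.preimage hf)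
  have himg : f '' I = A := by
    ext z
    constructor
    · rintro ⟨θ, hθ, rfl⟩
      exact hθ.2
    · intro hz
      have := hA hz
      rw [segment_eq_image_lineMap] at this
      obtain ⟨θ, hθ, rfl⟩ := this
      exact ⟨θ, ⟨hθ, hz⟩, rfl⟩
  have hIc : IsConnected I := by
    refine ⟨?_, ((convex_Icc (0 : ℝ) 1).inter (hconv.affine_preimage f)).isPreconnected⟩
    rw [← himg] at hp
    obtain ⟨θ, hθ, -⟩ := hp
    exact ⟨θ, hθ⟩
  rw [eq_Icc_of_connected_compact hIc hI, ← segment_eq_Icc, image_segment] at himg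
  · refine ⟨_, _, fun h => ?_, himg.symm⟩
    rw [← himg, h, segment_same, mem_singleton_iff] at hp hq
    exact hpq (hp.trans hq.symm)
  · exact csInf_le_csSup hIc.nonempty hI.bddBelow hI.bddAbove

theorem isLineSegment_inter {a b z : Plane} {Q : Set Plane} (hab : a ≠ b) (hQ : IsClosed Q)
    (hQc : Convex ℝ Q) (hz : z ∈ segment ℝ a b) (hzQ : z ∈ interior Q) :
    IsLineSegment (segment ℝ a b ∩ Q) := by
  obtain ⟨q, hq, hqz⟩ := IsLineSegment.exists_ne ⟨a, b, hab, rfl⟩ z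
  have h : Tendsto (fun ε : ℝ => AffineMap.lineMap z q ε) (𝓝[>] 0) (𝓝 z) := by
    have : Tendsto (fun ε : ℝ => (AffineMap.lineMap z q ε : Plane)) (𝓝 0)
        (𝓝 (AffineMap.lineMap z q (0 : ℝ))) := Continuous.tendsto (by fun_prop) 0
    rw [AffineMap.lineMap_apply_zero] at this
    exact this.mono_left nhdsWithin_le_nhds
  obtain ⟨ε, h1, h2⟩ := ((h.eventually (isOpen_interior.mem_nhds hzQ)).and
    (Ioo_mem_nhdsGT (zero_lt_one' ℝ))).exists
  refine isLineSegment_of_subset inter_subset_left ((isCompact_segment a b).inter_right hQ)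
    ((convex_segment a b).inter hQc) ⟨hz, interior_subset hzQ⟩
    (q := AffineMap.lineMap z q ε) ⟨(convex_segment a b).segment_subset hz hq ?_, interior_subset h1⟩
    fun h => hqz ?_
  · rw [segment_eq_image_lineMap]
    exact ⟨ε, ⟨h2.1.le, h2.2.le⟩, rfl⟩
  · rw [eq_comm, AffineMap.lineMap_eq_left_iff] at h
    exact (h.resolve_right h2.1.ne').symm

/-- A point of a compact set that is extreme in some direction lies on its boundary, and so does
a point that is extreme in its row or column. -/
theorem mem_frontier_of_forall {K : Set Plane} {z : Plane} (hz : z ∈ K) (δ : Dir)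
    (h : ∀ g ∈ K, (∀ d', δ.Perp d' → d'.coord g = d'.coord z) → δ.coord g ≤ δ.coord z) :
    z ∈ frontier K := by
  refine ⟨subset_closure hz, fun hi => ?_⟩
  obtain ⟨q, hq, h1, h2⟩ := δ.exists_move isOpen_interior hi
  exact not_lt.2 (h q (interior_subset hq) h2) h1

theorem inter_frontier_nonempty {A K : Set Plane} (hA : IsPreconnected A) (hK : IsClosed K)
    (h1 : (A ∩ K).Nonempty) (h2 : (A ∩ Kᶜ).Nonempty) : (A ∩ frontier K).Nonempty := by
  by_contra hc
  rw [not_nonempty_iff_eq_empty] at hc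
  have hint : ∀ z ∈ A, z ∈ K → z ∈ interior K := fun z hz hzK => by
    by_contra hi
    have : z ∈ A ∩ frontier K := ⟨hz, subset_closure hzK, hi⟩
    rw [hc] at this
    exact this
  obtain ⟨z, -, hz, hz'⟩ := hA (interior K) Kᶜ isOpen_interior hK.isOpen_compl
    (fun z hz => (em (z ∈ K)).imp (hint z hz) id) (h1.imp fun z hz => ⟨hz.1, hint z hz.1 hz.2⟩) h2
  exact hz' (interior_subset hz)

/-- The bounding box, as the set of points that the family reaches beyond in every direction. -/
theorem mem_boundingBox_iff {S : Set (Set Plane)}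
    (hS : ∀ δ : Dir, ∃ k ∈ ⋃₀ S, ∀ g ∈ ⋃₀ S, δ.coord g ≤ δ.coord k) {g : Plane} :
    g ∈ boundingBox S ↔ ∀ δ : Dir, ∃ k ∈ ⋃₀ S, δ.coord g ≤ δ.coord k := by
  constructor
  · intro hg δ
    obtain ⟨l, hl, hl'⟩ := hS .left
    obtain ⟨r, hr, hr'⟩ := hS .right
    obtain ⟨b, hb, hb'⟩ := hS .down
    obtain ⟨t, ht, ht'⟩ := hS .up
    simp only [Dir.coord, neg_le_neg_iff] at hl' hr' hb' ht'
    have := hg _ ⟨(l.1, b.2), (r.1, t.2), rfl, fun z hz => ⟨⟨hl' z hz, hb' z hz⟩, hr' z hz,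
      ht' z hz⟩⟩
    obtain ⟨⟨h1, h2⟩, h3, h4⟩ := this
    cases δ
    exacts [⟨l, hl, neg_le_neg h1⟩, ⟨r, hr, h3⟩, ⟨b, hb, neg_le_neg h2⟩, ⟨t, ht, h4⟩]
  · rintro h _ ⟨a, b, rfl, hab⟩
    obtain ⟨l, hl, hl'⟩ := h .left
    obtain ⟨r, hr, hr'⟩ := h .right
    obtain ⟨k, hk, hk'⟩ := h .down
    obtain ⟨t, ht, ht'⟩ := h .up
    simp only [Dir.coord, neg_le_neg_iff] at hl' hr' hk' ht'
    exact ⟨⟨(hab hl).1.1.trans hl', (hab hk).1.2.trans hk'⟩, hr'.trans (hab hr).2.1,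
      ht'.trans (hab ht).2.2⟩

theorem isClosed_boundingBox (S : Set (Set Plane)) : IsClosed (boundingBox S) := by
  refine isClosed_sInter ?_
  rintro _ ⟨a, b, rfl, -⟩
  exact isClosed_Icc

namespace Obstacle

variable {Ω : Obstacle} {d d' : Dir} {Q f s : Set Plane} {T : Set (Set Plane)}

/-- The convex set `Q` cuts the obstacle in the same points as the bounding box of this
intersection. -/
structure IsWindow (Ω : Obstacle) (Q : Set Plane) : Prop where
  isClosed : IsClosed Q
  convex : Convex ℝ Q
  nonempty : (Ω.region ∩ Q).Nonempty
  box : ∀ g ∈ Ω.region, (∀ δ : Dir, ∃ h ∈ Ω.region ∩ Q, δ.coord g ≤ δ.coord h) → g ∈ Q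

/-- The parts of the edges in a window, together with further segments. -/
def windowFamily (Ω : Obstacle) (Q : Set Plane) (T : Set (Set Plane)) : Set (Set Plane) :=
  {e | IsLineSegment e ∧ ∃ i, e = Ω.edge i ∩ Q} ∪ T

section Window

variable (hQ : Ω.IsWindow Q) (hT : ⋃₀ T = Ω.region ∩ frontier Q)
include hQ hT

theorem windowFamily_subset : ⋃₀ Ω.windowFamily Q T ⊆ Ω.region ∩ Q := by
  rintro z ⟨e, ⟨-, i, rfl⟩ | he, hz⟩
  · exact ⟨Ω.isClosed.frontier_subset (mem_frontier_iff.2 ⟨i, hz.1⟩), hz.2⟩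
  · have : z ∈ ⋃₀ T := ⟨e, he, hz⟩
    rw [hT] at this
    exact ⟨this.1, hQ.isClosed.frontier_subset this.2⟩

/-- The family covers the boundary of the part of the obstacle in the window. -/
theorem frontier_subset_windowFamily :
    frontier (Ω.region ∩ Q) ⊆ ⋃₀ Ω.windowFamily Q T := by
  intro z hz
  have hzK : z ∈ Ω.region ∩ Q := (Ω.isClosed.inter hQ.isClosed).frontier_subset hz
  by_cases hzQ : z ∈ frontier Q
  · have : z ∈ ⋃₀ T := by rw [hT]; exact ⟨hzK.1, hzQ⟩
    obtain ⟨e, he, hze⟩ := this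
    exact ⟨e, Or.inr he, hze⟩
  rcases frontier_inter_subset _ _ hz with h | h
  · obtain ⟨i, hi⟩ := mem_frontier_iff.1 h.1
    have hint : z ∈ interior Q := by
      by_contra hc
      exact hzQ ⟨subset_closure hzK.2, hc⟩
    exact ⟨_, Or.inl ⟨isLineSegment_inter (Ω.vertex_ne i) hQ.isClosed hQ.convex hi hint, i, rfl⟩, hi,
      hzK.2⟩
  · exact absurd h.2 hzQ

theorem exists_extreme_windowFamily (δ : Dir) : ∃ k ∈ ⋃₀ Ω.windowFamily Q T,
    ∀ g ∈ Ω.region ∩ Q, δ.coord g ≤ δ.coord k := by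
  obtain ⟨k, hk, -, hmax⟩ := exists_reach δ (Ω.isCompact.inter_right hQ.isClosed) hQ.nonempty
  exact ⟨k, frontier_subset_windowFamily hQ hT (RectSkeleton.mem_frontier_of_forall hk δ
    fun g hg _ => hmax g hg), hmax⟩

theorem mem_boundingBox_windowFamily {g : Plane} : g ∈ boundingBox (Ω.windowFamily Q T) ↔
    ∀ δ : Dir, ∃ k ∈ Ω.region ∩ Q, δ.coord g ≤ δ.coord k := by
  rw [mem_boundingBox_iff fun δ => ?_]
  · refine forall_congr' fun δ => ⟨fun ⟨k, hk, h⟩ => ⟨k, windowFamily_subset hQ hT hk, h⟩,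
      fun ⟨k, hk, h⟩ => ?_⟩
    obtain ⟨m, hm, hmax⟩ := exists_extreme_windowFamily hQ hT δ
    exact ⟨m, hm, h.trans (hmax k hk)⟩
  · obtain ⟨m, hm, hmax⟩ := exists_extreme_windowFamily hQ hT δ
    exact ⟨m, hm, fun g hg => hmax g (windowFamily_subset hQ hT hg)⟩

theorem region_inter_boundingBox :
    Ω.region ∩ boundingBox (Ω.windowFamily Q T) = Ω.region ∩ Q := by
  ext g
  refine ⟨fun ⟨h1, h2⟩ => ⟨h1, hQ.box g h1 ((mem_boundingBox_windowFamily hQ hT).1 h2)⟩,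
    fun h => ⟨h.1, (mem_boundingBox_windowFamily hQ hT).2 fun δ => ⟨g, h, le_rfl⟩⟩⟩

theorem frontier_boundingBox : frontier (boundingBox (Ω.windowFamily Q T)) ∩ interior Ω.region =
    frontier Q ∩ interior Ω.region := by
  have hK := region_inter_boundingBox hQ hT
  have hsub : ∀ {A B : Set Plane}, IsClosed A → IsClosed B → Ω.region ∩ A = Ω.region ∩ B →
      frontier A ∩ interior Ω.region ⊆ frontier B ∩ interior Ω.region := by
    intro A B hA hB hAB g ⟨hg, hgi⟩
    have hgB : g ∈ B := by
      have : g ∈ Ω.region ∩ A := ⟨interior_subset hgi, hA.frontier_subset hg⟩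
      rw [hAB] at this
      exact this.2
    refine ⟨⟨subset_closure hgB, fun hi => hg.2 ?_⟩, hgi⟩
    refine mem_interior.2 ⟨_, ?_, isOpen_interior.inter isOpen_interior, hgi, hi⟩
    intro z hz
    have : z ∈ Ω.region ∩ B := ⟨interior_subset hz.1, interior_subset hz.2⟩
    rw [← hAB] at this
    exact this.2
  exact subset_antisymm (hsub (isClosed_boundingBox _) hQ.isClosed hK)
    (hsub hQ.isClosed (isClosed_boundingBox _) hK.symm)

/-- The family of a window is a skeleton: a path that meets the interior of the part in the window,
but starts outside it, crosses the boundary of this part, which the family covers. -/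
theorem isSkeleton_windowFamily (hTf : T.Finite) (hTs : ∀ t ∈ T, IsLineSegment t) :
    IsSkeleton (Ω.region ∩ boundingBox (Ω.windowFamily Q T)) (Ω.windowFamily Q T) := by
  rw [region_inter_boundingBox hQ hT]
  refine ⟨?_, ?_, fun s hs => (subset_sUnion_of_mem hs).trans (windowFamily_subset hQ hT), ?_⟩
  · have := Ω.finite_zmod
    refine ((finite_range fun i => Ω.edge i ∩ Q).subset ?_).union hTf
    rintro _ ⟨-, i, rfl⟩
    exact ⟨i, rfl⟩
  · rintro s (⟨hs, -⟩ | hs)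
    · exact hs
    · exact hTs s hs
  · rintro p q hp - h π hπ
    have hmeet := h π hπ
    obtain ⟨c, -, rfl⟩ := hπ
    have hpπ : p ∈ pathTrace [p, c, q] := head_mem_pathTrace rfl
    obtain ⟨z, hz, hzf⟩ : (pathTrace [p, c, q] ∩ frontier (Ω.region ∩ Q)).Nonempty := by
      by_cases hpK : p ∈ Ω.region ∩ Q
      · exact ⟨p, hpπ, subset_closure hpK, hp⟩
      · exact inter_frontier_nonempty (isPreconnected_pathTrace _)
          (Ω.isClosed.inter hQ.isClosed) (hmeet.mono (inter_subset_inter_right _ interior_subset))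
          ⟨p, hpπ, hpK⟩
    obtain ⟨s, hs, hzs⟩ := frontier_subset_windowFamily hQ hT hzf
    exact ⟨s, hs, z, hz, hzs⟩

/-- A segment that reaches furthest beyond a frontier is a candidate. -/
theorem isNonAuxiliary_of_window (hd : d.Perp d') (hTf : T.Finite) (hTs : ∀ t ∈ T, IsLineSegment t)
    (hX : IsPreconnected (frontier Q ∩ interior Ω.region))
    (hne : (frontier Q ∩ interior Ω.region).Nonempty)
    (hcl : closure (frontier Q ∩ interior Ω.region) = Ω.region ∩ frontier Q)
    {a b : Plane} (hab : a ≠ b) (hda : d.coord b = d.coord a) (ha : a ∈ Ω.region ∩ frontier Q)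
    (hleg : Ω.region ∩ frontier Q = segment ℝ a b ∨ ∃ c : Plane, a ≠ c ∧
      (∀ d', d.Perp d' → d'.coord a = d'.coord c) ∧
        Ω.region ∩ frontier Q = segment ℝ a b ∪ segment ℝ a c)
    (hQa : ∀ g ∈ Q, d.coord g ≤ d.coord a)
    (hmin : ∃ m ∈ Ω.region ∩ Q, ∀ g ∈ Ω.region, d.coord m ≤ d.coord g)
    (hcol : ∀ m ∈ Ω.region ∩ Q, ∀ x, d.coord m ≤ x → x ≤ d.coord a →
      (∀ g ∈ Ω.region, d.coord m ≤ d.coord g) → ∃ g ∈ Ω.region ∩ Q, d.coord g = x)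
    {i : ZMod Ω.n} (hE : ∀ g ∈ Ω.edge i, ∀ h ∈ Ω.region, d.coord h ≤ d.coord g)
    (htow : ∃ z ∈ Ω.region ∩ frontier Q, ∃ g ∈ Ω.edge i, d'.coord z ≤ d'.coord g)
    (hs : Ω.IsVisibilityEdge s) (hsf : (s ∩ (Ω.region ∩ frontier Q)).Nonempty)
    (hend : ∀ p ∈ Ω.region ∩ frontier Q, ¬ IsEndpoint p s)
    {e : Plane} (he : e ∈ s) (hae : d.coord a < d.coord e)
    (hmax : ∀ t, Ω.IsVisibilityEdge t → (t ∩ (Ω.region ∩ frontier Q)).Nonempty →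
      (∀ g ∈ t, d.coord g ≤ d.coord e) ∧ ((∃ g ∈ t, d.coord g = d.coord e) →
        ∀ g ∈ t, d'.coord g ≤ d'.coord e ∨ ∃ k ∈ Ω.region ∩ Q, d'.coord g ≤ d'.coord k)) :
    Ω.IsNonAuxiliaryMaximalFrontierVisibilityEdge s := by
  set S := Ω.windowFamily Q T with hS
  have hsub : ⋃₀ S ⊆ Ω.region ∩ Q := windowFamily_subset hQ hT
  have haS : a ∈ ⋃₀ S := by
    rw [← hT] at ha
    obtain ⟨t, ht, hat⟩ := ha
    exact ⟨t, Or.inr ht, hat⟩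
  have hreach : reach d (⋃₀ S) = d.coord a := reach_eq d haS fun k hk => hQa k (hsub hk).2
  have hfr : Ω.IsFrontier S (Ω.region ∩ frontier Q) := by
    refine ⟨isSkeleton_windowFamily hQ hT hTf hTs, ?_⟩
    rw [hS, frontier_boundingBox hQ hT]
    obtain ⟨x, hx⟩ := hne
    exact ⟨x, hx, by rw [hX.connectedComponentIn hx, hcl]⟩
  -- The family covers exactly the part of the obstacle up to the frontier.
  obtain ⟨m, hm, hmmin⟩ := hmin
  have hproj : d.coord '' ⋃₀ S = Icc (d.coord m) (d.coord a) := by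
    ext x
    constructor
    · rintro ⟨g, hg, rfl⟩
      exact ⟨hmmin g (hsub hg).1, hQa g (hsub hg).2⟩
    · rintro ⟨h1, h2⟩
      obtain ⟨g, hg, hgx⟩ := hcol m hm x h1 h2 hmmin
      have hc : IsCompact (Ω.region ∩ Q ∩ {g | d.coord g = x}) :=
        (Ω.isCompact.inter_right hQ.isClosed).inter_right
          (isClosed_eq d.continuous_coord continuous_const)
      obtain ⟨k, hk, -, hkmax⟩ := exists_reach d' hc ⟨g, hg, hgx⟩
      refine ⟨k, frontier_subset_windowFamily hQ hT (RectSkeleton.mem_frontier_of_forall hk.1 d'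
        fun z hz hzk => hkmax z ⟨hz, ?_⟩), hk.2⟩
      exact (hzk d hd.symm).trans hk.2
  -- Hence the advancement of an edge that meets the frontier is its length beyond the frontier.
  have hadv : ∀ t, Ω.IsVisibilityEdge t → (t ∩ (Ω.region ∩ frontier Q)).Nonempty →
      advancement S d t = max (reach d t - d.coord a) 0 := by
    rintro t ht ⟨z, hzt, -, hzQ⟩
    have hza := hQa z (hQ.isClosed.frontier_subset hzQ)
    have hcomp : IsCompact (d.coord '' t) := ht.1.isCompact.image d.continuous_coord
    have hconn : IsConnected (d.coord '' t) :=
      ht.1.isPathConnected.isConnected.image _ d.continuous_coord.continuousOn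
    have hset : d.coord '' t \ d.coord '' ⋃₀ S = Ioc (d.coord a) (reach d t) := by
      rw [hproj]
      ext x
      constructor
      · rintro ⟨⟨g, hg, rfl⟩, h2⟩
        exact ⟨not_le.1 fun h => h2 ⟨hmmin g (ht.2.1 hg), h⟩,
          le_csSup hcomp.bddAbove (mem_image_of_mem _ hg)⟩
      · rintro ⟨h1, h2⟩
        refine ⟨?_, fun h => not_le.2 h1 h.2⟩
        rw [eq_Icc_of_connected_compact hconn hcomp]
        exact ⟨(csInf_le hcomp.bddBelow (mem_image_of_mem _ hzt)).trans (hza.trans h1.le), h2⟩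
    rw [advancement, hset, Real.volume_Ioc, ENNReal.toReal_ofReal']
  have hse : reach d s = d.coord e := reach_eq d he (hmax s hs hsf).1
  refine ⟨S, _, ⟨hfr, d, d', Ω.edge i, ⟨a, b, hab, hreach.symm, hda.trans hreach.symm, hleg⟩,
    ⟨⟨i, rfl⟩, fun g hg => (reach_eq d (Ω.isClosed.frontier_subset (mem_frontier_iff.2 ⟨i, hg⟩))
      (hE g hg)).symm⟩, hd, htow, ⟨hs, hsf⟩, fun t ⟨ht, htf⟩ => ?_⟩,
    fun ⟨p, hp, hps⟩ => hend p hp hps⟩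
  obtain ⟨h1, h2⟩ := hmax t ht htf
  obtain ⟨g, hg, hgr, -⟩ := exists_reach d ht.1.isCompact ht.1.nonempty
  rw [hadv t ht htf, hadv s hs hsf, hse, hgr]
  refine ⟨max_le_max (by linarith [h1 g hg]) le_rfl, fun heq => ?_⟩
  have hge : d.coord g = d.coord e := by
    rw [max_eq_left (sub_pos.2 hae).le] at heq
    rcases max_choice (d.coord g - d.coord a) 0 with h | h <;> rw [h] at heq <;> linarith
  obtain ⟨k, hk, hkr, -⟩ := exists_reach d' ht.1.isCompact ht.1.nonempty
  simp only [advancementToward]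
  obtain ⟨u, hu, humax⟩ := exists_extreme_windowFamily hQ hT d'
  rw [reach_eq d' hu fun k hk => humax k (hsub hk), hkr]
  obtain ⟨w, -, hwr, hwmax⟩ := exists_reach d' hs.1.isCompact hs.1.nonempty
  have hew := hwmax e he
  rw [hwr]
  rcases h2 ⟨g, hg, hge⟩ k hk with h3 | ⟨j, hj, h3⟩
  · exact max_le_max le_rfl (by linarith)
  · have := humax j hj
    exact max_le (le_max_left _ _) (le_max_of_le_left (by linarith))

end Window
end Obstacle

/-! ### Half-planes and quarter-planes as windows -/

theorem isPreconnected_closure_of_openSegment {a b : Plane} {X : Set Plane}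
    (h1 : openSegment ℝ a b ⊆ X) (h2 : X ⊆ segment ℝ a b) :
    IsPreconnected X ∧ closure X = segment ℝ a b := by
  have hcl : closure (openSegment ℝ a b) = segment ℝ a b := closure_openSegment a b
  exact ⟨(convex_openSegment a b).isPreconnected.subset_closure h1 (hcl ▸ h2),
    subset_antisymm (closure_minimal h2 (isCompact_segment a b).isClosed) (hcl ▸ closure_mono h1)⟩

/-- A compact convex set on a line is a segment. -/
theorem exists_eq_segment {d d' : Dir} (hd : d.Perp d') {A : Set Plane} {c : ℝ} (hA : IsCompact A)
    (hne : A.Nonempty) (hc : ∀ g ∈ A, d.coord g = c)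
    (hconv : ∀ a ∈ A, ∀ b ∈ A, ∀ z, d.coord z = c → d'.coord a ≤ d'.coord z →
      d'.coord z ≤ d'.coord b → z ∈ A) :
    ∃ a ∈ A, ∃ b ∈ A, A = segment ℝ a b ∧ ∀ g ∈ A, d'.coord a ≤ d'.coord g ∧
      d'.coord g ≤ d'.coord b := by
  obtain ⟨b, hb, -, hmax⟩ := exists_reach d' hA hne
  obtain ⟨a, ha, -, hmin⟩ := exists_reach d'.opp hA hne
  simp only [Dir.coord_opp, neg_le_neg_iff] at hmin
  refine ⟨a, ha, b, hb, subset_antisymm (fun z hz => ?_) fun z hz => ?_, fun g hg =>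
    ⟨hmin g hg, hmax g hg⟩⟩
  · have h1 := hmin z hz
    have h2 := hmax z hz
    rcases (hmin b hb).eq_or_lt with h3 | h3
    · have : z = a := hd.ext ((hc z hz).trans (hc a ha).symm) (by linarith)
      rw [this]
      exact left_mem_segment ℝ a b
    · have hpos := sub_pos.2 h3
      set θ := (d'.coord z - d'.coord a) / (d'.coord b - d'.coord a) with hθ
      have e : z = (a.1 + θ * (b.1 - a.1), a.2 + θ * (b.2 - a.2)) := by
        refine hd.ext ?_ ?_
        · rw [Dir.coord_lineMap, hc z hz, hc a ha, hc b hb]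
          ring
        · rw [Dir.coord_lineMap, hθ, div_mul_cancel₀ _ hpos.ne']
          ring
      rw [e]
      exact mem_segment_iff.2 ⟨θ, div_nonneg (by linarith) hpos.le,
        (div_le_one hpos).2 (by linarith), rfl, rfl⟩
  · have h1 := d.coord_of_mem_segment hz
    have h2 := d'.coord_of_mem_segment hz
    rw [hc a ha, hc b hb, min_self, max_self] at h1
    rw [min_eq_left (hmin b hb), max_eq_right (hmin b hb)] at h2
    exact hconv a ha b hb z (le_antisymm h1.2 h1.1) h2.1 h2.2

theorem not_isEndpoint {d : Dir} {s : Set Plane} {p g h : Plane} (hg : g ∈ s) (hh : h ∈ s)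
    (h1 : d.coord g < d.coord p) (h2 : d.coord p < d.coord h) : ¬ IsEndpoint p s := by
  rintro ⟨q, rfl⟩
  have h3 := (d.coord_of_mem_segment hg).1
  have h4 := (d.coord_of_mem_segment hh).2
  rcases le_total (d.coord p) (d.coord q) with h | h
  · rw [min_eq_left h] at h3
    linarith
  · rw [max_eq_left h] at h4
    linarith

theorem convex_halfPlane (d : Dir) (c : ℝ) : Convex ℝ {g : Plane | d.coord g ≤ c} := by
  rw [convex_iff_segment_subset]
  intro a ha b hb z hz
  exact (d.coord_of_mem_segment hz).2.trans (max_le ha hb)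

theorem isClosed_halfPlane (d : Dir) (c : ℝ) : IsClosed {g : Plane | d.coord g ≤ c} :=
  isClosed_le d.continuous_coord continuous_const

theorem frontier_halfPlane (d : Dir) (c : ℝ) :
    frontier {g : Plane | d.coord g ≤ c} = {g | d.coord g = c} := by
  refine subset_antisymm (frontier_le_subset_eq d.continuous_coord continuous_const) fun z hz => ?_
  refine ⟨subset_closure (le_of_eq hz), fun hi => ?_⟩
  obtain ⟨q, hq, h1, -⟩ := d.exists_move isOpen_interior hi
  have hq' : d.coord q ≤ c := interior_subset (s := {g : Plane | d.coord g ≤ c}) hq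
  exact not_lt.2 hq' (lt_of_eq_of_lt (Eq.symm hz) h1)

theorem Dir.Perp.eq_or_opp {d d' δ : Dir} (h : d.Perp d') (h' : d.Perp δ) :
    δ = d' ∨ δ = d'.opp := by
  cases d <;> cases d' <;> cases δ <;> simp_all [Dir.Perp, Dir.opp]

theorem frontier_quarterPlane (d d' : Dir) (c₁ c₂ : ℝ) :
    frontier {g : Plane | d.coord g ≤ c₁ ∧ d'.coord g ≤ c₂} =
      {g | (d.coord g ≤ c₁ ∧ d'.coord g ≤ c₂) ∧ (d.coord g = c₁ ∨ d'.coord g = c₂)} := by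
  have hcl : IsClosed {g : Plane | d.coord g ≤ c₁ ∧ d'.coord g ≤ c₂} :=
    (isClosed_halfPlane d c₁).and (isClosed_halfPlane d' c₂)
  refine subset_antisymm (fun z hz => ?_) fun z hz => ⟨subset_closure hz.1, fun hi => ?_⟩
  · have hzQ := hcl.frontier_subset hz
    refine ⟨hzQ, ?_⟩
    by_contra! hc
    refine hz.2 (mem_interior.2 ⟨{g | d.coord g < c₁ ∧ d'.coord g < c₂}, fun g hg =>
      ⟨le_of_lt hg.1, le_of_lt hg.2⟩, (isOpen_lt d.continuous_coord continuous_const).and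
      (isOpen_lt d'.continuous_coord continuous_const), hzQ.1.lt_of_ne hc.1, hzQ.2.lt_of_ne hc.2⟩)
  · rcases hz.2 with h | h
    · obtain ⟨q, hq, h1, -⟩ := d.exists_move isOpen_interior hi
      linarith [(interior_subset hq).1]
    · obtain ⟨q, hq, h1, -⟩ := d'.exists_move isOpen_interior hi
      linarith [(interior_subset hq).2]

namespace Obstacle

variable {Ω : Obstacle} {d d' : Dir} {s : Set Plane} {z : Plane}

theorem openSegment_subset_interior (hd : d.Perp d') {a b : Plane} (ha : a ∈ Ω.region)
    (hb : b ∈ Ω.region) (hab : d.coord a = d.coord b) (hF : d.coord a ∉ Ω.vertexCoords)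
    (hlt : d'.coord a < d'.coord b) : openSegment ℝ a b ⊆ interior Ω.region := by
  intro z hz
  have hzs := openSegment_subset_segment ℝ a b hz
  have h1 := d.coord_of_mem_segment hzs
  have h2 := d'.coord_of_mem_segment hzs
  rw [← hab, min_self, max_self] at h1
  rw [min_eq_left hlt.le, max_eq_right hlt.le] at h2
  have hza : d.coord z = d.coord a := le_antisymm h1.2 h1.1
  refine mem_interior_of_between hd (hza ▸ hF) ha hb hza.symm (hab.symm.trans hza.symm)
    (h2.1.lt_of_ne fun h => ?_) (h2.2.lt_of_ne fun h => ?_)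
  · rw [hd.ext hza h.symm, left_mem_openSegment_iff] at hz
    rw [hz] at hlt
    exact lt_irrefl _ hlt
  · rw [hd.ext (hza.trans hab) h, right_mem_openSegment_iff] at hz
    rw [hz] at hlt
    exact lt_irrefl _ hlt

/-- A segment that reaches furthest beyond a vertical chord is a candidate. -/
theorem isNonAuxiliary_halfPlane (hd : d.Perp d') {c : ℝ} (hc : c ∉ Ω.vertexCoords)
    (htwo : ∃ z ∈ Ω.region, ∃ z' ∈ Ω.region, d.coord z = c ∧ d.coord z' = c ∧ z ≠ z')
    (hs : Ω.IsVisibilityEdge s) (h1 : ∃ g ∈ s, d.coord g < c) (h2 : ∃ g ∈ s, c < d.coord g)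
    (htow : ∃ z ∈ Ω.region, d.coord z = c ∧
      ∃ g ∈ Ω.region, (∀ h ∈ Ω.region, d.coord h ≤ d.coord g) ∧ d'.coord z ≤ d'.coord g)
    {e : Plane} (he : e ∈ s)
    (hmax : ∀ t, Ω.IsVisibilityEdge t → (∃ z ∈ t, d.coord z = c) →
      (∀ g ∈ t, d.coord g ≤ d.coord e) ∧ ((∃ g ∈ t, d.coord g = d.coord e) →
        ∀ g ∈ t, c ≤ d.coord g → d'.coord g ≤ d'.coord e ∨
          ∃ h ∈ Ω.region, d.coord h ≤ c ∧ d'.coord g ≤ d'.coord h)) :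
    Ω.IsNonAuxiliaryMaximalFrontierVisibilityEdge s := by
  set A := {g | g ∈ Ω.region ∧ d.coord g = c} with hA
  obtain ⟨u, hu, v, hv, huc, hvc, huv⟩ := htwo
  obtain ⟨a, ha, b, hb, hseg, hab⟩ := exists_eq_segment hd (A := A) (c := c)
    (Ω.isCompact.inter_right (isClosed_eq d.continuous_coord continuous_const)) ⟨u, hu, huc⟩
    (fun g hg => hg.2) fun p hp q hq z hz h1 h2 => ⟨mem_of_quadrants hd hq.1 (hq.2.trans hz.symm).le
      h2 hq.1 (hz.trans hq.2.symm).le h2 hp.1 (hp.2.trans hz.symm).le h1 hp.1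
      (hz.trans hp.2.symm).le h1, hz⟩
  have hlt : d'.coord a < d'.coord b := by
    obtain ⟨e1, e2⟩ := hab u ⟨hu, huc⟩
    obtain ⟨e3, e4⟩ := hab v ⟨hv, hvc⟩
    refine (e1.trans e2).lt_of_ne fun h => huv (hd.ext (huc.trans hvc.symm) ?_)
    linarith
  have hopen := openSegment_subset_interior hd ha.1 hb.1 (ha.2.trans hb.2.symm)
    (by rw [ha.2]; exact hc) hlt
  have hAf : Ω.region ∩ frontier {g | d.coord g ≤ c} = A := by rw [frontier_halfPlane]; rfl
  have hopenX : openSegment ℝ a b ⊆ frontier {g | d.coord g ≤ c} ∩ interior Ω.region := by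
    intro z hz
    have hzA : z ∈ A := by
      rw [hseg]
      exact openSegment_subset_segment ℝ a b hz
    rw [frontier_halfPlane]
    exact ⟨hzA.2, hopen hz⟩
  obtain ⟨hX1, hX2⟩ := isPreconnected_closure_of_openSegment hopenX (fun z hz => by
    rw [← hseg, ← hAf]
    exact ⟨interior_subset hz.2, hz.1⟩)
  have hQ : Ω.IsWindow {g | d.coord g ≤ c} := ⟨isClosed_halfPlane d c, convex_halfPlane d c,
    ⟨u, hu, huc.le⟩, fun g _ h => by
      obtain ⟨k, hk, hgk⟩ := h d
      exact hgk.trans hk.2⟩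
  obtain ⟨w, hw, hwc, g, hg, hgmax, hwg⟩ := htow
  obtain ⟨i, hgi, hi⟩ := exists_extreme_edge d hg hgmax
  obtain ⟨m, hm, -, hmin⟩ := exists_reach d.opp Ω.isCompact Ω.nonempty
  simp only [Dir.coord_opp, neg_le_neg_iff] at hmin
  have hne : a ≠ b := fun h => hlt.ne (by rw [h])
  obtain ⟨g₁, hg₁, hg₁c⟩ := h1
  obtain ⟨g₂, hg₂, hg₂c⟩ := h2
  have hce : c < d.coord e := by
    obtain ⟨z, hz, hzc⟩ := hs.1.convex.isPreconnected.intermediate_value hg₁ hg₂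
      d.continuous_coord.continuousOn ⟨hg₁c.le, hg₂c.le⟩
    exact hg₂c.trans_le ((hmax s hs ⟨z, hz, hzc⟩).1 g₂ hg₂)
  refine isNonAuxiliary_of_window (T := {A}) hQ (by rw [hAf, sUnion_singleton]) hd
    (finite_singleton A) ?_ hX1 ?_ ?_ hne (hb.2.trans ha.2.symm) (hAf.symm ▸ ha) ?_ (fun g hg => ?_)
    ⟨m, ⟨hm, (hmin u hu).trans huc.le⟩, hmin⟩ ?_ (i := i) ?_ ?_ hs ?_ ?_ he (ha.2.trans_lt hce) ?_
  · rintro t rfl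
    exact ⟨a, b, hne, hseg⟩
  · rw [← closure_nonempty_iff, hX2]
    exact ⟨a, left_mem_segment ℝ a b⟩
  · rw [hX2, hAf, hseg]
  · exact Or.inl (hAf.trans hseg)
  · exact (show d.coord g ≤ c from hg).trans ha.2.ge
  · intro m hm x h1 h2 _
    obtain ⟨z, hz, hzx, -⟩ := exists_between hd hm.1 ha.1 h1 h2
    exact ⟨z, ⟨hz, hzx.le.trans (h2.trans ha.2.le)⟩, hzx⟩
  · intro k hk h hh
    exact (hgmax h hh).trans (hi k hk).ge
  · exact ⟨w, hAf.symm ▸ ⟨hw, hwc⟩, g, hgi, hwg⟩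
  · obtain ⟨z, hz, hzc⟩ := hs.1.convex.isPreconnected.intermediate_value hg₁ hg₂
      d.continuous_coord.continuousOn ⟨hg₁c.le, hg₂c.le⟩
    exact ⟨z, hz, hAf.symm ▸ ⟨hs.2.1 hz, hzc⟩⟩
  · rw [hAf]
    exact fun p hp => not_isEndpoint hg₁ hg₂ (hg₁c.trans_le hp.2.ge) (hp.2.trans_lt hg₂c)
  · rintro t ht ⟨z, hzt, hz⟩
    rw [hAf] at hz
    obtain ⟨h3, h4⟩ := hmax t ht ⟨z, hzt, hz.2⟩
    refine ⟨h3, fun h5 g hg => ?_⟩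
    rcases le_total c (d.coord g) with h6 | h6
    · exact (h4 h5 g hg h6).imp_right fun ⟨h, hh, hhc, hgh⟩ => ⟨h, ⟨hh, hhc⟩, hgh⟩
    · exact Or.inr ⟨g, ⟨ht.2.1 hg, h6⟩, le_rfl⟩

/-- The part of a chord to one side of an interior point. -/
theorem exists_arm (hd : d.Perp d') {κ : Plane} (hκ : κ ∈ interior Ω.region)
    (hF : d.coord κ ∉ Ω.vertexCoords) : ∃ a, d.coord a = d.coord κ ∧ d'.coord a < d'.coord κ ∧
      {g | g ∈ Ω.region ∧ d.coord g = d.coord κ ∧ d'.coord g ≤ d'.coord κ} = segment ℝ κ a ∧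
        openSegment ℝ κ a ⊆ interior Ω.region := by
  have hκω := interior_subset hκ
  obtain ⟨a, ha, b, hb, hseg, hab⟩ := exists_eq_segment hd
    (A := {g | g ∈ Ω.region ∧ d.coord g = d.coord κ ∧ d'.coord g ≤ d'.coord κ}) (c := d.coord κ)
    (Ω.isCompact.inter_right ((isClosed_eq d.continuous_coord continuous_const).and
      (isClosed_le d'.continuous_coord continuous_const))) ⟨κ, hκω, rfl, le_rfl⟩
    (fun g hg => hg.2.1) fun p hp q hq z hz h1 h2 => ⟨mem_of_quadrants hd hq.1
      (hq.2.1.trans hz.symm).le h2 hq.1 (hz.trans hq.2.1.symm).le h2 hp.1 (hp.2.1.trans hz.symm).le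
      h1 hp.1 (hz.trans hp.2.1.symm).le h1, hz, h2.trans hq.2.2⟩
  have hbκ : b = κ := hd.ext hb.2.1 (le_antisymm hb.2.2 (hab κ ⟨hκω, rfl, le_rfl⟩).2)
  subst hbκ
  obtain ⟨q, hq, h1, h2⟩ := d'.opp.exists_move isOpen_interior hκ
  simp only [Dir.coord_opp, neg_lt_neg_iff] at h1
  have hlt : d'.coord a < d'.coord b :=
    (hab q ⟨interior_subset hq, h2 d hd.symm.opp_left, h1.le⟩).1.trans_lt h1
  refine ⟨a, ha.2.1, hlt, hseg.trans (segment_symm ℝ a b), ?_⟩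
  rw [openSegment_symm]
  exact openSegment_subset_interior hd ha.1 hb.1 ha.2.1 (ha.2.1 ▸ hF) hlt

/-- A segment that reaches furthest beyond an L-shaped frontier is a candidate. -/
theorem isNonAuxiliary_quarterPlane (hd : d.Perp d') {κ : Plane} (hκ : κ ∈ interior Ω.region)
    (hF₁ : d.coord κ ∉ Ω.vertexCoords) (hF₂ : d'.coord κ ∉ Ω.vertexCoords)
    (hl : ∃ m ∈ Ω.region, (∀ h ∈ Ω.region, d.coord m ≤ d.coord h) ∧ d'.coord m ≤ d'.coord κ)
    (hr : ∃ g ∈ Ω.region, (∀ h ∈ Ω.region, d.coord h ≤ d.coord g) ∧ d'.coord κ ≤ d'.coord g)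
    (hs : Ω.IsVisibilityEdge s) {p e : Plane} (hp : p ∈ s) (hp1 : d.coord p < d.coord κ)
    (hp2 : d'.coord p < d'.coord κ) (he : e ∈ s) (he1 : d.coord κ < d.coord e)
    (he2 : d'.coord p ≤ d'.coord e)
    (hmax : ∀ t, Ω.IsVisibilityEdge t → (∃ z ∈ t, d.coord z ≤ d.coord κ ∧ d'.coord z ≤ d'.coord κ ∧
      (d.coord z = d.coord κ ∨ d'.coord z = d'.coord κ)) → (∀ g ∈ t, d.coord g ≤ d.coord e) ∧
        ((∃ g ∈ t, d.coord g = d.coord e) → ∀ g ∈ t, d'.coord g ≤ d'.coord e ∨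
          d'.coord g ≤ d'.coord κ)) :
    Ω.IsNonAuxiliaryMaximalFrontierVisibilityEdge s := by
  have hκω := interior_subset hκ
  obtain ⟨a₁, ha₁, hlt₁, hA₁, ho₁⟩ := exists_arm hd hκ hF₁
  obtain ⟨a₂, ha₂, hlt₂, hA₂, ho₂⟩ := exists_arm hd.symm hκ hF₂
  have hne₁ : κ ≠ a₁ := fun h => hlt₁.ne (by rw [← h])
  have hne₂ : κ ≠ a₂ := fun h => hlt₂.ne (by rw [← h])
  set Q := {g | d.coord g ≤ d.coord κ ∧ d'.coord g ≤ d'.coord κ} with hQdef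
  have hfr := frontier_quarterPlane d d' (d.coord κ) (d'.coord κ)
  have hAf : Ω.region ∩ frontier Q = segment ℝ κ a₁ ∪ segment ℝ κ a₂ := by
    rw [← hA₁, ← hA₂, hfr]
    ext g
    constructor
    · rintro ⟨h1, ⟨h2, h3⟩, h4 | h4⟩
      · exact Or.inl ⟨h1, h4, h3⟩
      · exact Or.inr ⟨h1, h4, h2⟩
    · rintro (⟨h1, h2, h3⟩ | ⟨h1, h2, h3⟩)
      · exact ⟨h1, ⟨h2.le, h3⟩, Or.inl h2⟩
      · exact ⟨h1, ⟨h3, h2.le⟩, Or.inr h2⟩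
  have hκf : κ ∈ frontier Q := by
    rw [hfr]
    exact ⟨⟨le_rfl, le_rfl⟩, Or.inl rfl⟩
  -- Both arms without some of their endpoints, and the corner.
  have harm : ∀ a, openSegment ℝ κ a ⊆ interior Ω.region →
      segment ℝ κ a ⊆ Ω.region ∩ frontier Q →
      IsPreconnected (segment ℝ κ a ∩ interior Ω.region) ∧
        closure (segment ℝ κ a ∩ interior Ω.region) = segment ℝ κ a := fun a ha _ =>
    isPreconnected_closure_of_openSegment (fun z hz => ⟨openSegment_subset_segment ℝ κ a hz, ha hz⟩)
      inter_subset_left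
  obtain ⟨hp₁, hc₁⟩ := harm a₁ ho₁ (hAf ▸ subset_union_left)
  obtain ⟨hp₂, hc₂⟩ := harm a₂ ho₂ (hAf ▸ subset_union_right)
  have hX : frontier Q ∩ interior Ω.region =
      segment ℝ κ a₁ ∩ interior Ω.region ∪ segment ℝ κ a₂ ∩ interior Ω.region := by
    rw [← union_inter_distrib_right, ← hAf]
    ext z
    exact ⟨fun h => ⟨⟨interior_subset h.2, h.1⟩, h.2⟩, fun h => ⟨h.1.2, h.2⟩⟩
  have hQ : Ω.IsWindow Q := ⟨(isClosed_halfPlane d _).and (isClosed_halfPlane d' _),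
    (convex_halfPlane d _).inter (convex_halfPlane d' _), ⟨κ, hκω, le_rfl, le_rfl⟩, fun g _ h => by
      obtain ⟨k, hk, hgk⟩ := h d
      obtain ⟨k', hk', hgk'⟩ := h d'
      exact ⟨hgk.trans hk.2.1, hgk'.trans hk'.2.2⟩⟩
  obtain ⟨g, hg, hgmax, hκg⟩ := hr
  obtain ⟨i, hgi, hi⟩ := exists_extreme_edge d hg hgmax
  obtain ⟨m, hm, hmin, hmκ⟩ := hl
  refine isNonAuxiliary_of_window (T := {segment ℝ κ a₁, segment ℝ κ a₂}) (a := κ) (b := a₁) hQ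
    (by rw [hAf, sUnion_pair]) hd (toFinite _) ?_ ?_ ⟨κ, hκf, hκ⟩ ?_ hne₁ ha₁ ⟨hκω, hκf⟩ ?_
    (fun g hg => hg.1) ⟨m, ⟨hm, hmin κ hκω, hmκ⟩, hmin⟩ ?_ (i := i)
    (fun k hk h hh => (hgmax h hh).trans (hi k hk).ge) ⟨κ, ⟨hκω, hκf⟩, g, hgi, hκg⟩ hs ?_ ?_ he he1
    ?_
  · rintro t (rfl | rfl)
    exacts [⟨_, _, hne₁, rfl⟩, ⟨_, _, hne₂, rfl⟩]
  · rw [hX]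
    exact hp₁.union κ ⟨left_mem_segment ℝ κ a₁, hκ⟩ ⟨left_mem_segment ℝ κ a₂, hκ⟩ hp₂
  · rw [hX, closure_union, hc₁, hc₂, hAf]
  · refine Or.inr ⟨a₂, hne₂, fun δ hδ => ?_, hAf⟩
    rcases hd.eq_or_opp hδ with rfl | rfl
    · exact ha₂.symm
    · simp [ha₂]
  · intro m' hm' x h1 h2 _
    obtain ⟨z, hz, hzx, -, hz2⟩ := exists_between hd hm'.1 hκω h1 h2
    exact ⟨z, ⟨hz, hzx.le.trans h2, hz2.trans (max_le hm'.2.2 le_rfl)⟩, hzx⟩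
  · obtain ⟨z, hz, hzf⟩ := inter_frontier_nonempty hs.1.convex.isPreconnected hQ.isClosed
      ⟨p, hp, hp1.le, hp2.le⟩ ⟨e, he, fun h => not_le.2 he1 h.1⟩
    exact ⟨z, hz, hs.2.1 hz, hzf⟩
  · rintro q ⟨-, hq⟩
    rw [hfr] at hq
    obtain ⟨⟨hq1, hq2⟩, hq3⟩ := hq
    rcases hq1.eq_or_lt with h | h
    · exact not_isEndpoint hp he (hp1.trans_le h.ge) (h.trans_lt he1)
    -- An endpoint on the other arm, to the left of the corner and above `p`, would make the segment
    -- descend from it, whereas `e` is further right than `p` and not lower.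
    have hq4 := hq3.resolve_left h.ne
    rintro ⟨q', rfl⟩
    obtain ⟨θ, hθ0, hθ1, hp3, hp4⟩ := mem_segment_iff.1 hp
    obtain ⟨μ, hμ0, hμ1, he3, he4⟩ := mem_segment_iff.1 he
    have ep : p = (q.1 + θ * (q'.1 - q.1), q.2 + θ * (q'.2 - q.2)) := Prod.ext hp3 hp4
    have ee : e = (q.1 + μ * (q'.1 - q.1), q.2 + μ * (q'.2 - q.2)) := Prod.ext he3 he4
    have e1 := d.coord_lineMap q q' θ
    rw [← ep] at e1
    have e2 := d'.coord_lineMap q q' θ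
    rw [← ep] at e2
    have e3 := d.coord_lineMap q q' μ
    rw [← ee] at e3
    have e4 := d'.coord_lineMap q q' μ
    rw [← ee] at e4
    have h5 : d'.coord q' - d'.coord q < 0 := by nlinarith
    have h6 : 0 < d.coord q' - d.coord q := by nlinarith
    have h7 : μ ≤ θ := by
      by_contra! hc
      nlinarith
    nlinarith
  · rintro t ht ⟨z, hzt, -, hz⟩
    rw [hfr] at hz
    obtain ⟨h3, h4⟩ := hmax t ht ⟨z, hzt, hz.1.1, hz.1.2, hz.2⟩
    exact ⟨h3, fun h5 g hg => (h4 h5 g hg).imp_right fun h => ⟨κ, ⟨hκω, le_rfl, le_rfl⟩, h⟩⟩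

/-- A visibility edge that touches an extreme edge and is not contained in it is a candidate: it
reaches furthest beyond a chord close to this extreme edge. -/
theorem isNonAuxiliary_of_extreme (hs : Ω.IsVisibilityEdge s) {g : Plane} (hg : g ∈ s)
    (hmax : ∀ h ∈ Ω.region, d.coord h ≤ d.coord g) {g' : Plane} (hg' : g' ∈ s)
    (hlt : d.coord g' < d.coord g) : Ω.IsNonAuxiliaryMaximalFrontierVisibilityEdge s := by
  obtain ⟨d₀, hd₀⟩ := d.exists_perp
  have hgω := hs.2.1 hg
  -- The chord is chosen beyond points that are extreme in the perpendicular directions, so that the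
  -- second condition on a maximal edge holds for every competitor.
  have hex : ∀ δ, d.Perp δ → ∃ u ∈ Ω.region, (∀ h ∈ Ω.region, δ.coord h ≤ δ.coord u) ∧
      d.coord u < d.coord g := by
    intro δ hδ
    obtain ⟨u, hu, -, humax⟩ := exists_reach δ Ω.isCompact Ω.nonempty
    obtain ⟨v, hv, hvu, hne⟩ := exists_extreme_ne hδ.symm hu humax
    by_cases h : d.coord u < d.coord g
    · exact ⟨u, hu, humax, h⟩
    · have := le_antisymm (hmax u hu) (not_lt.1 h)
      exact ⟨v, hv, fun k hk => (humax k hk).trans hvu.ge, (hmax v hv).lt_of_ne (this ▸ hne)⟩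
  obtain ⟨u₀, hu₀, hmax₀, hlt₀⟩ := hex d₀ hd₀
  obtain ⟨u₁, hu₁, hmax₁, hlt₁⟩ := hex d₀.opp hd₀.opp_right
  obtain ⟨w, hw1, hw2⟩ := mem_closure_iff.1 (Ω.closure_interior.symm ▸ hgω)
    {z | max (max (d.coord u₀) (d.coord u₁)) (d.coord g') < d.coord z}
    (isOpen_lt continuous_const d.continuous_coord) (max_lt (max_lt hlt₀ hlt₁) hlt)
  have hopen : IsOpen {t : ℝ | w + t • d.vec ∈ interior Ω.region} :=
    isOpen_interior.preimage (by fun_prop)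
  obtain ⟨ε, hε, hball⟩ := Metric.isOpen_iff.1 hopen 0 (by simpa using hw2)
  obtain ⟨c, hwc, hcε, hcF⟩ := exists_between_notMem Ω.finite_vertexCoords
    (show d.coord w < d.coord w + ε by linarith)
  have hw' : w + (c - d.coord w) • d.vec ∈ interior Ω.region := by
    refine hball ?_
    rw [Metric.mem_ball, Real.dist_eq, sub_zero, abs_of_pos (sub_pos.2 hwc)]
    linarith
  set w' := w + (c - d.coord w) • d.vec
  have hw'c : d.coord w' = c := by rw [Dir.coord_add_vec]; ring
  obtain ⟨v, hv, hv1, hv2⟩ := d₀.exists_move isOpen_interior hw'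
  obtain ⟨x, hx, hx1, -⟩ := d.exists_move isOpen_interior hw'
  have hcg : c < d.coord g := hw'c ▸ hx1.trans_le (hmax x (interior_subset hx))
  have hw3 : max (max (d.coord u₀) (d.coord u₁)) (d.coord g') < d.coord w := hw1
  obtain ⟨h1, h2⟩ := max_lt_iff.1 hw3
  obtain ⟨h3, h4⟩ := max_lt_iff.1 h1
  obtain ⟨z, hz, hzc⟩ := hs.1.convex.isPreconnected.intermediate_value hg' hg
    d.continuous_coord.continuousOn ⟨(h2.trans hwc).le, hcg.le⟩
  have key : ∀ δ, d.Perp δ → δ.coord z ≤ δ.coord g →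
      (∃ u ∈ Ω.region, (∀ h ∈ Ω.region, δ.coord h ≤ δ.coord u) ∧ d.coord u ≤ c) →
      Ω.IsNonAuxiliaryMaximalFrontierVisibilityEdge s := by
    rintro δ hδ hzg ⟨u, hu, humax, huc⟩
    exact isNonAuxiliary_halfPlane hδ hcF ⟨w', interior_subset hw', v, interior_subset hv, hw'c,
      (hv2 d hd₀.symm).trans hw'c, fun h => hv1.ne (by rw [← h])⟩ hs ⟨g', hg', h2.trans hwc⟩
      ⟨g, hg, hcg⟩ ⟨z, hs.2.1 hz, hzc, g, hgω, hmax, hzg⟩ hg fun t ht _ =>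
        ⟨fun k hk => hmax k (ht.2.1 hk), fun _ k hk _ => Or.inr ⟨u, hu, huc,
          humax k (ht.2.1 hk)⟩⟩
  rcases le_total (d₀.coord z) (d₀.coord g) with h | h
  · exact key d₀ hd₀ h ⟨u₀, hu₀, hmax₀, (h3.trans hwc).le⟩
  · exact key d₀.opp hd₀.opp_right (by simpa using h) ⟨u₁, hu₁, hmax₁, (h4.trans hwc).le⟩

end Obstacle

/-! ### Obstacles as regions in a chart -/

namespace Dir

variable {d d' : Dir}

/-- The coordinates in two perpendicular directions, as a linear automorphism of the plane. -/
noncomputable def chart (hd : d.Perp d') : Plane ≃ₗ[ℝ] Plane where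
  toFun z := (d.coord z, d'.coord z)
  invFun z := z.1 • d.vec + z.2 • d'.vec
  map_add' p q := by cases d <;> cases d' <;> simp [coord, add_comm, Prod.ext_iff]
  map_smul' c p := by cases d <;> cases d' <;> simp [coord, Prod.ext_iff]
  left_inv z := by cases d <;> cases d' <;> simp_all [coord, vec, Perp]
  right_inv z := by cases d <;> cases d' <;> simp_all [coord, vec, Perp]

@[simp] theorem coord_chart_symm (hd : d.Perp d') (z : Plane) :
    d.coord ((chart hd).symm z) = z.1 :=
  congrArg Prod.fst ((chart hd).apply_symm_apply z)

@[simp] theorem coord_chart_symm' (hd : d.Perp d') (z : Plane) :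
    d'.coord ((chart hd).symm z) = z.2 :=
  congrArg Prod.snd ((chart hd).apply_symm_apply z)

end Dir

/-- The image of a set of points under a linear chart. -/
def inChart (e : Plane ≃ₗ[ℝ] Plane) (A : Set Plane) : Set Plane := e.symm ⁻¹' A

section Chart

variable {e : Plane ≃ₗ[ℝ] Plane} {A B s ω : Set Plane}

theorem inChart_eq_image : inChart e A = e '' A := (e.toEquiv.image_eq_preimage_symm A).symm

theorem inChart_symm_inChart : inChart e.symm (inChart e A) = A := by
  ext z
  simp [inChart]

theorem inChart_inChart_symm : inChart e (inChart e.symm A) = A := by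
  ext z
  simp [inChart]

theorem inChart_mono (h : A ⊆ B) : inChart e A ⊆ inChart e B := preimage_mono h

theorem inChart_sUnion (S : Set (Set Plane)) : inChart e (⋃₀ S) = ⋃₀ (inChart e '' S) := by
  ext z
  simp [inChart]

theorem inChart_injective : Function.Injective (inChart e) := fun A B h => by
  rw [← inChart_symm_inChart (e := e) (A := A), h, inChart_symm_inChart]

theorem IsLineSegment.inChart (h : IsLineSegment s) : IsLineSegment (inChart e s) := by
  obtain ⟨p, q, hpq, rfl⟩ := h
  refine ⟨e p, e q, e.injective.ne hpq, ?_⟩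
  rw [inChart_eq_image]
  exact image_segment ℝ e.toLinearMap.toAffineMap p q

theorem MaxSeg.inChart (h : MaxSeg ω s) : MaxSeg (inChart e ω) (inChart e s) := by
  refine ⟨h.1.inChart, inChart_mono h.2.1, fun t ht hω hs => ?_⟩
  have h1 := inChart_mono (e := e.symm) hω
  have h2 := inChart_mono (e := e.symm) hs
  rw [inChart_symm_inChart] at h1 h2
  rw [← h.2.2 _ (ht.inChart (e := e.symm)) h1 h2, inChart_inChart_symm]

theorem MaxSeg.exists_inChart (h : MaxSeg (RectSkeleton.inChart e ω) s) :
    ∃ s', MaxSeg ω s' ∧ RectSkeleton.inChart e s' = s := by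
  have := h.inChart (e := e.symm)
  rw [inChart_symm_inChart] at this
  exact ⟨_, this, inChart_inChart_symm⟩

theorem inChart_interior : inChart e (interior A) = interior (inChart e A) :=
  e.symm.toContinuousLinearEquiv.toHomeomorph.preimage_interior A

theorem inChart_closure : inChart e (closure A) = closure (inChart e A) :=
  e.symm.toContinuousLinearEquiv.toHomeomorph.preimage_closure A

theorem continuous_chart : Continuous e := e.toContinuousLinearEquiv.continuous

theorem forall_inChart {P : Plane → Prop} :
    (∀ z ∈ inChart e A, P z) ↔ ∀ z ∈ A, P (e z) :=
  ⟨fun h z hz => h (e z) (by simpa [inChart] using hz),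
    fun h z hz => by simpa using h (e.symm z) hz⟩

theorem exists_inChart {P : Plane → Prop} :
    (∃ z ∈ inChart e A, P z) ↔ ∃ z ∈ A, P (e z) :=
  ⟨fun ⟨z, hz, h⟩ => ⟨e.symm z, hz, by simpa using h⟩,
    fun ⟨z, hz, h⟩ => ⟨e z, by simpa [inChart] using hz, h⟩⟩

end Chart

namespace Obstacle

variable {Ω : Obstacle} {d d' : Dir}

/-- The visibility edges that are non-auxiliary maximal frontier visibility edges. -/
def frontierEdges (Ω : Obstacle) : Set (Set Plane) :=
  {s | Ω.IsVisibilityEdge s ∧ Ω.IsNonAuxiliaryMaximalFrontierVisibilityEdge s}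

theorem neg_mem_vertexCoords {c : ℝ} : -c ∈ Ω.vertexCoords ↔ c ∈ Ω.vertexCoords := by
  have : ∀ c, c ∈ Ω.vertexCoords → -c ∈ Ω.vertexCoords := by
    rintro _ ⟨d, i, rfl⟩
    exact ⟨d.opp, i, d.coord_opp _⟩
  exact ⟨fun h => by simpa using this _ h, this c⟩

/-- In the chart of two perpendicular directions an obstacle is a `RectRegion`. Its distinguished
segments are the images of the non-auxiliary maximal frontier visibility edges, and its exceptional
coordinates those of the vertices. -/
theorem rectRegion (Ω : Obstacle) (hd : d.Perp d') :
    RectRegion (inChart (Dir.chart hd) Ω.region) (inChart (Dir.chart hd) '' Ω.frontierEdges)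
      Ω.vertexCoords := by
  set e := Dir.chart hd with he
  have hs := hd.symm
  have hin : ∀ g ∈ Ω.region, e g ∈ inChart e Ω.region := fun g hg => by
    simpa [inChart] using hg
  have he1 : ∀ z, (e z).1 = d.coord z := fun _ => rfl
  have he2 : ∀ z, (e z).2 = d'.coord z := fun _ => rfl
  have hmem : ∀ s, MaxSeg Ω.region s → Ω.IsNonAuxiliaryMaximalFrontierVisibilityEdge s →
      inChart e s ∈ inChart e '' Ω.frontierEdges := fun s h1 h2 => ⟨s, ⟨h1, h2⟩, rfl⟩
  have hex : ∀ {δ : Dir} {s : Set Plane}, MaxSeg Ω.region s →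
      (∃ g ∈ s, ∀ h ∈ Ω.region, δ.coord h ≤ δ.coord g) →
      (∃ g ∈ s, ∃ h ∈ Ω.region, δ.coord g < δ.coord h) →
      inChart e s ∈ inChart e '' Ω.frontierEdges := by
    rintro δ s hs ⟨g, hg, hmax⟩ ⟨g', hg', h, hh, hlt⟩
    exact hmem s hs (isNonAuxiliary_of_extreme hs hg hmax hg' (hlt.trans_le (hmax h hh)))
  constructor
  case isCompact =>
    rw [inChart_eq_image]
    exact Ω.isCompact.image continuous_chart
  case fat => rw [← inChart_interior, ← inChart_closure, Ω.closure_interior]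
  case nonempty =>
    rw [inChart_eq_image]
    exact Ω.nonempty.image _
  case hconn =>
    simp only [forall_inChart, he1, he2]
    intro p hp q hq x h1 h2
    obtain ⟨z, hz, h3, h4, h5⟩ := exists_between hd hp hq h1 h2
    refine ⟨d'.coord z, ?_, h4, h5⟩
    have : (x, d'.coord z) = e z := by rw [← h3]; rfl
    rw [this]
    exact hin z hz
  case vconn =>
    simp only [forall_inChart, he1, he2]
    intro p hp q hq x h1 h2
    obtain ⟨z, hz, h3, h4, h5⟩ := exists_between hs hp hq h1 h2
    refine ⟨d.coord z, ?_, h4, h5⟩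
    have : (d.coord z, x) = e z := by rw [← h3]; rfl
    rw [this]
    exact hin z hz
  case noPinch =>
    simp only [forall_inChart, he1, he2]
    exact fun z hz h => quadrant_of_subset hd hz h
  case finite => exact Ω.finite_vertexCoords
  case top_of_left =>
    simp only [forall_inChart, he1, he2]
    exact fun z hz h => coord_mem_of_forall hd hz h
  case right_of_lower =>
    simp only [forall_inChart, he1, he2]
    exact fun z hz h => coord_mem_of_forall hs hz h
  case bottom_of_right =>
    simp only [forall_inChart, he1, he2]
    intro z hz h
    have := coord_mem_of_forall hd.opp_left.opp_right hz fun g hg => by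
      simpa only [Dir.coord_opp, neg_le_neg_iff] using h g hg
    rwa [Dir.coord_opp, neg_mem_vertexCoords] at this
  case left_of_upper =>
    simp only [forall_inChart, he1, he2]
    intro z hz h
    have := coord_mem_of_forall hs.opp_left.opp_right hz fun g hg => by
      simpa only [Dir.coord_opp, neg_le_neg_iff] using h g hg
    rwa [Dir.coord_opp, neg_mem_vertexCoords] at this
  case maxSeg =>
    rintro _ ⟨s, hs, rfl⟩
    exact MaxSeg.inChart hs.1
  case ext_left =>
    simp only [forall_inChart, he1, he2]
    intro z hz h
    obtain ⟨g, hg, h1, h2⟩ := exists_extreme_ne hd.opp_left hz fun g hg => by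
      simpa only [Dir.coord_opp, neg_le_neg_iff] using h g hg
    refine ⟨d'.coord g, h2, ?_⟩
    have : (d.coord z, d'.coord g) = e g := by
      rw [Dir.coord_opp, Dir.coord_opp, neg_inj] at h1
      rw [← h1]; rfl
    rw [this]
    exact hin g hg
  case ext_right =>
    simp only [forall_inChart, he1, he2]
    intro z hz h
    obtain ⟨g, hg, h1, h2⟩ := exists_extreme_ne hd hz h
    refine ⟨d'.coord g, h2, ?_⟩
    have : (d.coord z, d'.coord g) = e g := by rw [← h1]; rfl
    rw [this]
    exact hin g hg
  case ext_down =>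
    simp only [forall_inChart, he1, he2]
    intro z hz h
    obtain ⟨g, hg, h1, h2⟩ := exists_extreme_ne hs.opp_left hz fun g hg => by
      simpa only [Dir.coord_opp, neg_le_neg_iff] using h g hg
    refine ⟨d.coord g, h2, ?_⟩
    have : (d.coord g, d'.coord z) = e g := by
      rw [Dir.coord_opp, Dir.coord_opp, neg_inj] at h1
      rw [← h1]; rfl
    rw [this]
    exact hin g hg
  case ext_up =>
    simp only [forall_inChart, he1, he2]
    intro z hz h
    obtain ⟨g, hg, h1, h2⟩ := exists_extreme_ne hs hz h
    refine ⟨d.coord g, h2, ?_⟩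
    have : (d.coord g, d'.coord z) = e g := by rw [← h1]; rfl
    rw [this]
    exact hin g hg
  case mem_left =>
    rintro s hs h1 h2
    obtain ⟨s, hv, rfl⟩ := hs.exists_inChart
    simp only [forall_inChart, exists_inChart, he1] at h1 h2
    exact hex (δ := d.opp) hv (by simpa only [Dir.coord_opp, neg_le_neg_iff] using h1)
      (by simpa only [Dir.coord_opp, neg_lt_neg_iff] using h2)
  case mem_right =>
    rintro s hs h1 h2
    obtain ⟨s, hv, rfl⟩ := hs.exists_inChart
    simp only [forall_inChart, exists_inChart, he1] at h1 h2
    exact hex (δ := d) hv h1 h2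
  case mem_down =>
    rintro s hs h1 h2
    obtain ⟨s, hv, rfl⟩ := hs.exists_inChart
    simp only [forall_inChart, exists_inChart, he2] at h1 h2
    exact hex (δ := d'.opp) hv (by simpa only [Dir.coord_opp, neg_le_neg_iff] using h1)
      (by simpa only [Dir.coord_opp, neg_lt_neg_iff] using h2)
  case mem_up =>
    rintro s hs h1 h2
    obtain ⟨s, hv, rfl⟩ := hs.exists_inChart
    simp only [forall_inChart, exists_inChart, he2] at h1 h2
    exact hex (δ := d') hv h1 h2
  case mem_rightward =>
    intro c hc h1 s hs h2 h3 h4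
    obtain ⟨s, hv, rfl⟩ := hs.exists_inChart
    simp only [forall_inChart, exists_inChart, he1, he2] at h1 h2 h3 h4 ⊢
    intro x hx hmax
    refine hmem s hv (isNonAuxiliary_halfPlane hd hc ?_ hv h2 h3
      (h4.imp fun z hz => ⟨hv.2.1 hz.1, hz.2⟩) hx fun t ht ht' => ?_)
    · obtain ⟨z, hz, z', hz', e1, e2, e3⟩ := h1
      exact ⟨z, hz, z', hz', e1, e2, fun h => e3 (by rw [h])⟩
    · have := hmax (inChart e t) (MaxSeg.inChart ht)
      simp only [forall_inChart, exists_inChart, he1, he2] at this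
      exact this ht'
  case mem_upward =>
    intro c hc h1 s hs' h2 h3 h4
    obtain ⟨s, hv, rfl⟩ := hs'.exists_inChart
    simp only [forall_inChart, exists_inChart, he1, he2] at h1 h2 h3 h4 ⊢
    intro x hx hmax
    refine hmem s hv (isNonAuxiliary_halfPlane hs hc ?_ hv h2 h3
      (h4.imp fun z hz => ⟨hv.2.1 hz.1, hz.2⟩) hx fun t ht ht' => ?_)
    · obtain ⟨z, hz, z', hz', e1, e2, e3⟩ := h1
      exact ⟨z, hz, z', hz', e1, e2, fun h => e3 (by rw [h])⟩
    · have := hmax (inChart e t) (MaxSeg.inChart ht)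
      simp only [forall_inChart, exists_inChart, he1, he2] at this
      exact this ht'
  case mem_cornerRight =>
    intro c₁ hc₁ c₂ hc₂ hκ h1 h2 s hs
    obtain ⟨s, hv, rfl⟩ := hs.exists_inChart
    simp only [forall_inChart, exists_inChart, he1, he2] at h1 h2 ⊢
    intro p hp hp1 hp2 x hx hx1 hx2 hmax
    rw [← inChart_interior] at hκ
    have e1 := Dir.coord_chart_symm hd (c₁, c₂)
    have e2 := Dir.coord_chart_symm' hd (c₁, c₂)
    refine hmem s hv (isNonAuxiliary_quarterPlane hd (κ := e.symm (c₁, c₂)) hκ (by rwa [e1])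
      (by rwa [e2]) ?_ ?_ hv hp ?_ ?_ hx ?_ hx2 fun t ht ht' => ?_) <;> (try rw [e1]) <;>
      (try rw [e2])
    all_goals first | assumption | skip
    rw [e1, e2] at ht'
    have := hmax (inChart e t) (MaxSeg.inChart ht)
    simp only [forall_inChart, exists_inChart, he1, he2] at this
    exact this ht'
  case mem_cornerUp =>
    intro c₁ hc₁ c₂ hc₂ hκ h1 h2 s hs'
    obtain ⟨s, hv, rfl⟩ := hs'.exists_inChart
    simp only [forall_inChart, exists_inChart, he1, he2] at h1 h2 ⊢
    intro p hp hp1 hp2 x hx hx1 hx2 hmax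
    rw [← inChart_interior] at hκ
    have e1 := Dir.coord_chart_symm hd (c₂, c₁)
    have e2 := Dir.coord_chart_symm' hd (c₂, c₁)
    refine hmem s hv (isNonAuxiliary_quarterPlane hs (κ := e.symm (c₂, c₁)) hκ (by rwa [e2])
      (by rwa [e1]) ?_ ?_ hv hp ?_ ?_ hx ?_ hx2 fun t ht ht' => ?_) <;> (try rw [e2]) <;>
      (try rw [e1])
    all_goals first | assumption | skip
    rw [e1, e2] at ht'
    have := hmax (inChart e t) (MaxSeg.inChart ht)
    simp only [forall_inChart, exists_inChart, he1, he2] at this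
    exact this ht'

end Obstacle

/-! ### Elbows and one-corner paths -/

section Elbow

variable {d d' : Dir} {p q z w : Plane}

/-- The points of the rectilinear path that leads from `p` in direction `d` and then in
direction `d'` to `q`, for a point `q` that lies beyond `p` in both directions. -/
def elbow (d d' : Dir) (p q : Plane) : Set Plane :=
  {z | d'.coord z = d'.coord p ∧ d.coord p ≤ d.coord z ∧ d.coord z ≤ d.coord q ∨
    d.coord z = d.coord q ∧ d'.coord p ≤ d'.coord z ∧ d'.coord z ≤ d'.coord q}

theorem isClosed_elbow (d d' : Dir) (p q : Plane) : IsClosed (elbow d d' p q) := by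
  have h1 := d.continuous_coord
  have h2 := d'.continuous_coord
  exact ((isClosed_eq h2 continuous_const).inter ((isClosed_le continuous_const h1).inter
    (isClosed_le h1 continuous_const))).union ((isClosed_eq h1 continuous_const).inter
      ((isClosed_le continuous_const h2).inter (isClosed_le h2 continuous_const)))

theorem elbow_opp (d d' : Dir) (p q : Plane) : elbow d'.opp d.opp q p = elbow d d' p q := by
  ext z
  simp only [elbow, mem_ofPred_eq, Dir.coord_opp, neg_inj, neg_le_neg_iff]
  constructor <;> rintro (⟨h1, h2, h3⟩ | ⟨h1, h2, h3⟩)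
  exacts [Or.inr ⟨h1, h3, h2⟩, Or.inl ⟨h1, h3, h2⟩, Or.inr ⟨h1, h3, h2⟩, Or.inl ⟨h1, h3, h2⟩]

theorem Dir.Perp.dist_le (hd : d.Perp d') {ε : ℝ} (h1 : |d.coord z - d.coord w| ≤ ε)
    (h2 : |d'.coord z - d'.coord w| ≤ ε) : dist z w ≤ ε := by
  rw [Prod.dist_eq, Real.dist_eq, Real.dist_eq]
  refine max_le ?_ ?_ <;> cases d <;> cases d' <;> simp_all [Dir.coord, Dir.Perp, neg_add_eq_sub,
    abs_sub_comm]

/-- Around an interior point there is a square in the set. -/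
theorem Dir.Perp.exists_square (hd : d.Perp d') {A : Set Plane} (hw : w ∈ interior A) :
    ∃ δ > 0, ∀ a b, |a| ≤ δ → |b| ≤ δ →
      ∃ g ∈ A, d.coord g = d.coord w + a ∧ d'.coord g = d'.coord w + b := by
  obtain ⟨δ, hδ, hball⟩ := Metric.isOpen_iff.1 isOpen_interior w hw
  refine ⟨δ / 2, by positivity, fun a b ha hb => ?_⟩
  obtain ⟨g, h1, h2⟩ := hd.exists_coord (d.coord w + a) (d'.coord w + b)
  refine ⟨g, interior_subset (hball ?_), h1, h2⟩
  have := hd.dist_le (z := g) (w := w) (ε := δ / 2) (by rwa [h1, add_sub_cancel_left])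
    (by rwa [h2, add_sub_cancel_left])
  exact Metric.mem_ball.2 (by linarith)

/-- A compact set that misses an elbow keeps a positive distance from it. -/
theorem exists_margin (hd : d.Perp d') {K : Set Plane} (hK : IsCompact K)
    (h : ¬(elbow d d' p q ∩ K).Nonempty) : ∃ ε > 0, ∀ z ∈ K, ∀ y ∈ elbow d d' p q,
      |d.coord y - d.coord z| ≤ ε → |d'.coord y - d'.coord z| ≤ ε → False := by
  obtain ⟨ε, hε, hsub⟩ := hK.exists_cthickening_subset_open (isClosed_elbow d d' p q).isOpen_compl
    fun z hz hz' => h ⟨z, hz', hz⟩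
  exact ⟨ε, hε, fun z hz y hy h1 h2 =>
    hsub (Metric.mem_cthickening_of_dist_le y z ε K hz (hd.dist_le h1 h2)) hy⟩

theorem isShortestPath_of_length {l : List Plane} (h : IsRectilinearPath l p q)
    (hl : pathLength l = rectDist p q) : IsShortestPath l p q :=
  ⟨h, fun _ h' => hl.trans_le (rectDist_le_pathLength h'.1 h'.2.1)⟩

theorem Dir.Perp.rectDist_eq (hd : d.Perp d') (p q : Plane) :
    rectDist p q = |d.coord p - d.coord q| + |d'.coord p - d'.coord q| := by
  have h : ∀ x y : ℝ, |-x - -y| = |x - y| := fun x y => by rw [neg_sub_neg, abs_sub_comm]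
  cases d <;> cases d' <;> simp_all only [Dir.coord, Dir.Perp, rectDist] <;>
    first | rfl | exact add_comm _ _ | simp_all

theorem IsShortestPath.coord_mem_box {l : List Plane} (h : IsShortestPath l p q)
    (hz : z ∈ pathTrace l) (d : Dir) (hpq : d.coord p ≤ d.coord q) :
    d.coord p ≤ d.coord z ∧ d.coord z ≤ d.coord q := by
  obtain ⟨⟨h1, h2⟩, h3, h4⟩ := h.mem_box hz
  cases d <;> simp only [Dir.coord, neg_le_neg_iff] at hpq ⊢
  · rw [min_eq_right hpq] at h1
    rw [max_eq_left hpq] at h2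
    exact ⟨h2, h1⟩
  · rw [min_eq_left hpq] at h1
    rw [max_eq_right hpq] at h2
    exact ⟨h1, h2⟩
  · rw [min_eq_right hpq] at h3
    rw [max_eq_left hpq] at h4
    exact ⟨h4, h3⟩
  · rw [min_eq_left hpq] at h3
    rw [max_eq_right hpq] at h4
    exact ⟨h3, h4⟩

/-- A path from `p` to `q` crosses every line perpendicular to `d` between them. -/
theorem IsShortestPath.exists_coord_eq {l : List Plane} (h : IsShortestPath l p q) {x : ℝ}
    (h1 : d.coord p ≤ x) (h2 : x ≤ d.coord q) : ∃ z ∈ pathTrace l, d.coord z = x :=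
  (isPreconnected_pathTrace l).intermediate_value (head_mem_pathTrace h.1.1)
    (last_mem_pathTrace h.1.2.1) d.continuous_coord.continuousOn ⟨h1, h2⟩

theorem IsShortestPath.mem_pathTrace_of_coord_eq {l : List Plane} (h : IsShortestPath l p q)
    (hd : d.Perp d') (hpq : d.coord p = d.coord q) (hz : d.coord z = d.coord p)
    (h1 : d'.coord p ≤ d'.coord z) (h2 : d'.coord z ≤ d'.coord q) : z ∈ pathTrace l := by
  obtain ⟨y, hy, hyz⟩ := h.exists_coord_eq h1 h2
  have h3 := h.coord_mem_box hy d hpq.le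
  have : y = z := hd.ext (by linarith [h3.1, h3.2]) hyz
  rwa [← this]

/-- An elbow is the trace of a one-corner path. -/
theorem pathTrace_mem_oneCornerPaths (hd : d.Perp d') (h1 : d.coord p ≤ d.coord q)
    (h2 : d'.coord p ≤ d'.coord q) :
    ∃ π ∈ oneCornerPaths p q, π ⊆ elbow d d' p q := by
  obtain ⟨c, hc1, hc2⟩ := hd.exists_coord (d.coord q) (d'.coord p)
  have hpath := isRectilinearPath_corner (p := p) (c := c) (q := q)
    ((Dir.axisParallel_iff hd).2 (Or.inr hc2.symm)) ((Dir.axisParallel_iff hd).2 (Or.inl hc1))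
  have hs : IsShortestPath [p, c, q] p q := by
    refine isShortestPath_of_length hpath ?_
    have : pathLength [p, c, q] = rectDist p c + rectDist c q := by simp [pathLength, rectDist]
    rw [this, hd.rectDist_eq, hd.rectDist_eq c, hd.rectDist_eq p q, hc1, hc2]
    simp
  refine ⟨_, ⟨c, hs, rfl⟩, fun z hz => ?_⟩
  have h3 := hs.coord_mem_box hz d h1
  have h4 := hs.coord_mem_box hz d' h2
  rcases hz with hz | hz | hz
  · have := d'.coord_of_mem_segment hz
    rw [hc2, min_self, max_self] at this
    exact Or.inl ⟨le_antisymm this.2 this.1, h3⟩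
  · have := d.coord_of_mem_segment hz
    rw [hc1, min_self, max_self] at this
    exact Or.inr ⟨le_antisymm this.2 this.1, h4⟩
  · obtain rfl : z = q := hz
    exact Or.inr ⟨rfl, h2, le_rfl⟩

theorem Dir.exists_le (δ : Dir) (p q : Plane) : ∃ d : Dir, d.coord p ≤ d.coord q ∧
    (∀ d', δ.Perp d' → d.Perp d') ∧ ∀ x y, δ.coord x = δ.coord y → d.coord x = d.coord y := by
  rcases le_total (δ.coord p) (δ.coord q) with h | h
  · exact ⟨δ, h, fun _ h => h, fun _ _ h => h⟩
  · exact ⟨δ.opp, by simpa using h, fun _ h => h.opp_left, fun _ _ h => by simpa using h⟩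

/-- Every one-corner path contains an elbow. -/
theorem exists_elbow_subset {π : Set Plane} (h : π ∈ oneCornerPaths p q) :
    ∃ d d' : Dir, d.Perp d' ∧ d.coord p ≤ d.coord q ∧ d'.coord p ≤ d'.coord q ∧
      elbow d d' p q ⊆ π := by
  obtain ⟨c, hs, rfl⟩ := h
  have hseg : ∀ {d d' : Dir}, d.Perp d' → ∀ {a b z : Plane}, d.coord z = d.coord a →
      d.coord z = d.coord b → d'.coord a ≤ d'.coord z → d'.coord z ≤ d'.coord b →
      z ∈ segment ℝ a b := by
    intro d d' hd a b z h1 h2 h3 h4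
    obtain ⟨y, hy, hyz⟩ := (convex_segment a b).isPreconnected.intermediate_value
      (left_mem_segment ℝ a b) (right_mem_segment ℝ a b) d'.continuous_coord.continuousOn ⟨h3, h4⟩
    have h5 := d.coord_of_mem_segment hy
    rw [← h1, ← h2, min_self, max_self] at h5
    have : y = z := hd.ext (le_antisymm h5.2 h5.1) hyz
    rwa [← this]
  have key : ∀ δ δ' : Dir, δ.Perp δ' →
      (δ.coord c = δ.coord q ∧ δ'.coord c = δ'.coord p ∨ δ.coord p = δ.coord q) →
      ∃ d d' : Dir, d.Perp d' ∧ d.coord p ≤ d.coord q ∧ d'.coord p ≤ d'.coord q ∧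
        elbow d d' p q ⊆ pathTrace [p, c, q] := by
    intro δ δ' hδ hc
    obtain ⟨d, h1, hdp, hde⟩ := δ.exists_le p q
    obtain ⟨d', h2, hdp', hde'⟩ := δ'.exists_le p q
    have hd : d.Perp d' := (hdp' d (hdp δ' hδ).symm).symm
    refine ⟨d, d', hd, h1, h2, ?_⟩
    rcases hc with ⟨e1, e2⟩ | e
    · replace e1 := hde _ _ e1
      replace e2 := hde' _ _ e2
      rintro z (⟨h3, h4, h5⟩ | ⟨h3, h4, h5⟩)
      · exact Or.inl (hseg hd.symm h3 (h3.trans e2.symm) h4 (e1 ▸ h5))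
      · exact Or.inr (Or.inl (hseg hd (h3.trans e1.symm) h3 (e2 ▸ h4) h5))
    · replace e := hde _ _ e
      rintro z (⟨h3, h4, h5⟩ | ⟨h3, h4, h5⟩)
      · exact hs.mem_pathTrace_of_coord_eq hd e (le_antisymm (h5.trans e.ge) h4) h3.ge
          (h3.trans_le h2)
      · exact hs.mem_pathTrace_of_coord_eq hd e (h3.trans e.symm) h4 h5
  have hru : Dir.right.Perp Dir.up := Or.inr rfl
  have hax : AxisParallel p c ∧ AxisParallel c q := by
    simpa [IsRectilinearPath] using hs.1
  rcases hax with ⟨h1 | h1, h2 | h2⟩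
  · exact key .right .up hru (Or.inr (h1.trans h2))
  · exact key .up .right hru.symm (Or.inl ⟨h2, h1.symm⟩)
  · exact key .right .up hru (Or.inl ⟨h2, h1.symm⟩)
  · exact key .up .right hru.symm (Or.inr (h1.trans h2))

end Elbow

namespace Obstacle

variable {Ω : Obstacle} {d d' : Dir} {p q w v : Plane} {K : Set Plane}

/-! ### Connected sets that touch all sides block every path -/

/-- No point of the obstacle lies strictly beyond `p` in both directions. -/
def Free (Ω : Obstacle) (d d' : Dir) (p : Plane) : Prop :=
  ∀ g ∈ Ω.region, d.coord p < d.coord g → ¬ d'.coord p < d'.coord g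

/-- The set reaches as far in all four directions as the obstacle. -/
def Touches (Ω : Obstacle) (K : Set Plane) : Prop :=
  ∀ d : Dir, ∃ g ∈ K, ∀ h ∈ Ω.region, d.coord h ≤ d.coord g

/-- A point with points of the obstacle in all four open quadrants is interior. -/
theorem exists_free (hd : d.Perp d') (hp : p ∉ interior Ω.region) :
    (Ω.Free d d' p ∨ Ω.Free d d'.opp p) ∨ Ω.Free d.opp d' p ∨ Ω.Free d.opp d'.opp p := by
  simp only [Free]
  by_contra! hc
  obtain ⟨⟨⟨a, ha, ha1, ha2⟩, b, hb, hb1, hb2⟩, ⟨x, hx, hx1, hx2⟩, y, hy, hy1, hy2⟩ := hc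
  simp only [Dir.coord_opp, neg_lt_neg_iff] at hb2 hx1 hy1 hy2
  have h1 := d.continuous_coord
  have h2 := d'.continuous_coord
  refine hp (mem_interior.2 ⟨{g | (d.coord x < d.coord g ∧ d'.coord g < d'.coord x) ∧
    (d.coord g < d.coord a ∧ d'.coord g < d'.coord a) ∧
    (d.coord y < d.coord g ∧ d'.coord y < d'.coord g) ∧
    (d.coord g < d.coord b ∧ d'.coord b < d'.coord g)}, fun g hg => ?_, ?_,
    ⟨hx1, hx2⟩, ⟨ha1, ha2⟩, ⟨hy1, hy2⟩, hb1, hb2⟩)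
  · obtain ⟨⟨k1, k2⟩, ⟨k3, k4⟩, ⟨k5, k6⟩, k7, k8⟩ := hg
    exact mem_of_quadrants hd hx k1.le k2.le ha k3.le k4.le hy k5.le k6.le hb k7.le k8.le
  · exact ((isOpen_lt continuous_const h1).and (isOpen_lt h2 continuous_const)).and
      (((isOpen_lt h1 continuous_const).and (isOpen_lt h2 continuous_const)).and
        (((isOpen_lt continuous_const h1).and (isOpen_lt continuous_const h2)).and
          ((isOpen_lt h1 continuous_const).and (isOpen_lt continuous_const h2))))

/-- An elbow that contains an interior point does not lie in an empty quadrant of its start. -/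
theorem not_free_of_elbow (hd : d.Perp d') (hpq : d.coord p ≤ d.coord q)
    (hw : w ∈ elbow d d' p q) (hwi : w ∈ interior Ω.region) : ¬Ω.Free d d' p := by
  intro h
  obtain ⟨δ, hδ, hsq⟩ := hd.exists_square hwi
  obtain ⟨g, hg, h1, h2⟩ := hsq δ δ (abs_of_pos hδ).le (abs_of_pos hδ).le
  rcases hw with ⟨h3, h4, h5⟩ | ⟨h3, h4, h5⟩ <;> exact h g hg (by linarith) (by linarith)

/-- If both ends of an elbow have an empty quadrant to the right of and below them, the whole elbow
misses the interior. -/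
theorem not_free_of_elbow' (hd : d.Perp d') (hw : w ∈ elbow d d' p q)
    (hwi : w ∈ interior Ω.region) : ¬(Ω.Free d d'.opp p ∧ Ω.Free d d'.opp q) := by
  rintro ⟨h, h'⟩
  obtain ⟨δ, hδ, hsq⟩ := hd.exists_square hwi
  obtain ⟨g, hg, h1, h2⟩ := hsq δ (-δ) (abs_of_pos hδ).le (by rw [abs_neg, abs_of_pos hδ])
  rcases hw with ⟨h3, h4, h5⟩ | ⟨h3, h4, h5⟩
  · exact h g hg (by linarith) (by simp only [Dir.coord_opp]; linarith)
  · exact h' g hg (by linarith) (by simp only [Dir.coord_opp]; linarith)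

/-- The elbow extends through empty quadrants at its ends to a curve that bounds a quadrant.  The
set `K` cannot lie on one side of it, as otherwise the other elbow would miss the interior. -/
theorem elbow_inter_of_corner (hd : d.Perp d') (hpq : d.coord p ≤ d.coord q)
    (hpq' : d'.coord p ≤ d'.coord q) (hc : IsCompact K) (hK : IsPreconnected K)
    (hKω : K ⊆ Ω.region) (ht : Ω.Touches K) (hw : w ∈ elbow d d' p q)
    (hwi : w ∈ interior Ω.region)
    (hp : Ω.Free d.opp d' p ∨ Ω.Free d.opp d'.opp p)
    (hq : Ω.Free d.opp d' q ∨ Ω.Free d d' q) (hv : v ∈ elbow d' d p q)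
    (hvi : v ∈ interior Ω.region) : (elbow d d' p q ∩ K).Nonempty := by
  by_contra hne
  obtain ⟨ε₀, hε₀, hmar⟩ := exists_margin hd hc hne
  obtain ⟨δ₁, hδ₁, hsq₁⟩ := hd.exists_square hwi
  obtain ⟨δ₂, hδ₂, hsq₂⟩ := hd.exists_square hvi
  obtain ⟨ε, hε, hle, hlt₁, hlt₂⟩ : ∃ ε > 0, ε ≤ ε₀ ∧ ε < δ₁ ∧ ε < δ₂ :=
    ⟨min ε₀ (min (δ₁ / 2) (δ₂ / 2)), by positivity, min_le_left _ _,
      (min_le_right _ _).trans_lt ((min_le_left _ _).trans_lt (by linarith)),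
      (min_le_right _ _).trans_lt ((min_le_right _ _).trans_lt (by linarith))⟩
  -- The first leg is shifted by `ε` into the empty quadrant at `p`, so that its prolongation beyond
  -- `p` misses the region, and likewise the second leg at `q`.
  obtain ⟨b, hb1, hb2, hb3⟩ : ∃ b, |b - d'.coord p| ≤ ε ∧
      (∀ g ∈ Ω.region, d'.coord g = b → d.coord p ≤ d.coord g) ∧
      (d.coord v = d.coord p → d'.coord p ≤ d'.coord v →
        ∀ g ∈ Ω.region, d'.coord g < b → d.coord v - δ₂ < d.coord g) := by
    rcases hp with hp | hp
    · refine ⟨d'.coord p + ε, by simp [abs_of_pos hε], fun g hg h => ?_, fun h1 h2 => ?_⟩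
      · by_contra! hlt
        exact hp g hg (by simpa using hlt) (by linarith)
      · obtain ⟨g, hg, h3, h4⟩ := hsq₂ (-δ₂) δ₂ (by rw [abs_neg, abs_of_pos hδ₂])
          (abs_of_pos hδ₂).le
        exact (hp g hg (by simp only [Dir.coord_opp]; linarith) (by linarith)).elim
    · refine ⟨d'.coord p - ε, by simp [abs_of_pos hε], fun g hg h => ?_, fun h1 h2 g hg h => ?_⟩
      · by_contra! hlt
        exact hp g hg (by simpa using hlt) (by simp only [Dir.coord_opp]; linarith)
      · by_contra! hlt
        exact hp g hg (by simp only [Dir.coord_opp]; linarith)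
          (by simp only [Dir.coord_opp]; linarith)
  obtain ⟨a, ha1, ha2, ha3⟩ : ∃ a, |a - d.coord q| ≤ ε ∧
      (∀ g ∈ Ω.region, d.coord g = a → d'.coord g ≤ d'.coord q) ∧
      (d'.coord v = d'.coord q → d.coord v ≤ d.coord q →
        ∀ g ∈ Ω.region, a < d.coord g → d'.coord g < d'.coord v + δ₂) := by
    rcases hq with hq | hq
    · refine ⟨d.coord q - ε, by simp [abs_of_pos hε], fun g hg h => ?_, fun h1 h2 => ?_⟩
      · by_contra! hlt
        exact hq g hg (by simp only [Dir.coord_opp]; linarith) hlt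
      · obtain ⟨g, hg, h3, h4⟩ := hsq₂ (-δ₂) δ₂ (by rw [abs_neg, abs_of_pos hδ₂])
          (abs_of_pos hδ₂).le
        exact (hq g hg (by simp only [Dir.coord_opp]; linarith) (by linarith)).elim
    · refine ⟨d.coord q + ε, by simp [abs_of_pos hε], fun g hg h => ?_, fun h1 h2 g hg h => ?_⟩
      · by_contra! hlt
        exact hq g hg (by linarith) hlt
      · by_contra! hlt
        exact hq g hg (by linarith) (by linarith)
  obtain ⟨ha4, ha5⟩ := abs_le.1 ha1
  obtain ⟨hb4, hb5⟩ := abs_le.1 hb1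
  obtain ⟨hwp, hwq⟩ : d'.coord p ≤ d'.coord w ∧ d.coord w ≤ d.coord q := by
    rcases hw with h | h
    exacts [⟨h.1.ge, h.2.2⟩, ⟨h.2.1, h.1.le⟩]
  have hmar' : ∀ z ∈ K, ∀ x y : ℝ, (y = d'.coord p ∧ d.coord p ≤ x ∧ x ≤ d.coord q ∨
      x = d.coord q ∧ d'.coord p ≤ y ∧ y ≤ d'.coord q) → |x - d.coord z| ≤ ε →
      |y - d'.coord z| ≤ ε → False := by
    intro z hz x y h h1 h2
    obtain ⟨g, rfl, rfl⟩ := hd.exists_coord x y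
    exact hmar z hz g h (h1.trans hle) (h2.trans hle)
  -- The function vanishes on the curve and is negative inside the quadrant.
  have hzero : ∀ z ∈ K, max (d.coord z - a) (b - d'.coord z) ≠ 0 := by
    intro z hz h0
    have h1 : d.coord z ≤ a := by linarith [le_max_left (d.coord z - a) (b - d'.coord z)]
    have h2 : b ≤ d'.coord z := by linarith [le_max_right (d.coord z - a) (b - d'.coord z)]
    rcases max_choice (d.coord z - a) (b - d'.coord z) with h | h
    · have h3 : d.coord z = a := by linarith
      have h4 := ha2 z (hKω hz) h3
      refine hmar' z hz (d.coord q) (max (d'.coord z) (d'.coord p))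
        (Or.inr ⟨rfl, le_max_right _ _, max_le h4 hpq'⟩) (by rwa [h3, abs_sub_comm]) ?_
      rw [abs_le]
      constructor
      · linarith [le_max_left (d'.coord z) (d'.coord p)]
      · rcases max_choice (d'.coord z) (d'.coord p) with h | h <;> rw [h] <;> linarith
    · have h3 : d'.coord z = b := by linarith
      have h4 := hb2 z (hKω hz) h3
      refine hmar' z hz (min (d.coord z) (d.coord q)) (d'.coord p)
        (Or.inl ⟨rfl, le_min h4 hpq, min_le_right _ _⟩) ?_ (by rwa [h3, abs_sub_comm])
      rw [abs_le]
      constructor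
      · rcases min_choice (d.coord z) (d.coord q) with h | h <;> rw [h] <;> linarith
      · linarith [min_le_left (d.coord z) (d.coord q)]
  have hcont : ContinuousOn (fun z => max (d.coord z - a) (b - d'.coord z)) K :=
    ((d.continuous_coord.sub continuous_const).max
      (continuous_const.sub d'.continuous_coord)).continuousOn
  obtain ⟨r, hr, hr'⟩ := ht d
  by_cases hneg : ∀ z ∈ K, max (d.coord z - a) (b - d'.coord z) < 0
  · obtain ⟨m, hm, hm'⟩ := ht d'.opp
    obtain ⟨g, hg, h1, h2⟩ := hsq₁ δ₁ (-δ₁) (abs_of_pos hδ₁).le (by rw [abs_neg, abs_of_pos hδ₁])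
    have h3 := hr' g hg
    have h4 := hm' g hg
    simp only [Dir.coord_opp, neg_le_neg_iff] at h4
    have h5 := (max_lt_iff.1 (hneg r hr)).1
    have h6 := (max_lt_iff.1 (hneg m hm)).2
    rcases hw with h | h
    · linarith [h.1]
    · linarith [h.1]
  · push Not at hneg
    obtain ⟨z₁, hz₁, hz₁'⟩ := hneg
    have hpos : ∀ z ∈ K, a < d.coord z ∨ d'.coord z < b := by
      intro z hz
      by_contra! hcon
      obtain ⟨y, hy, hy0⟩ := hK.intermediate_value hz hz₁ hcont
        ⟨max_le (sub_nonpos.2 hcon.1) (sub_nonpos.2 hcon.2), hz₁'⟩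
      exact hzero y hy hy0
    obtain ⟨l, hl, hl'⟩ := ht d.opp
    obtain ⟨t, htK, ht'⟩ := ht d'
    simp only [Dir.coord_opp, neg_le_neg_iff] at hl'
    obtain ⟨g, hg, h1, h2⟩ := hsq₁ (-δ₁) δ₁ (by rw [abs_neg, abs_of_pos hδ₁]) (abs_of_pos hδ₁).le
    obtain ⟨k, hk, h3, h4⟩ := hsq₂ (-δ₂) δ₂ (by rw [abs_neg, abs_of_pos hδ₂]) (abs_of_pos hδ₂).le
    have hlb : d'.coord l < b := (hpos l hl).resolve_left (by linarith [hl' g hg])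
    have hta : a < d.coord t := (hpos t htK).resolve_right (by linarith [ht' g hg])
    rcases hv with ⟨h5, h6, h7⟩ | ⟨h5, h6, h7⟩
    · linarith [hb3 h5 h6 l (hKω hl) hlb, hl' k hk]
    · linarith [ha3 h5 h7 t (hKω htK) hta, ht' k hk]

/-- The second leg of the elbow extends through empty quadrants to a full line. -/
theorem elbow_inter_of_line (hd : d.Perp d') (hpq : d.coord p ≤ d.coord q)
    (hc : IsCompact K) (hK : IsPreconnected K)
    (hKω : K ⊆ Ω.region) (ht : Ω.Touches K) (hw : w ∈ elbow d d' p q)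
    (hwi : w ∈ interior Ω.region)
    (hp : Ω.Free d d'.opp p)
    (hq : Ω.Free d d' q ∨ Ω.Free d.opp d' q ∧ d.coord p < d.coord q) :
    (elbow d d' p q ∩ K).Nonempty := by
  by_contra hne
  obtain ⟨ε₀, hε₀, hmar⟩ := exists_margin hd hc hne
  obtain ⟨δ, hδ, hsq⟩ := hd.exists_square hwi
  obtain ⟨g, hg, h1, h2⟩ := hsq δ (-δ) (abs_of_pos hδ).le (by rw [abs_neg, abs_of_pos hδ])
  obtain ⟨k, hk, h3, -⟩ := hsq (-δ) δ (by rw [abs_neg, abs_of_pos hδ]) (abs_of_pos hδ).le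
  have hwq : d.coord w = d.coord q := by
    rcases hw with h | h
    · exact (hp g hg (by linarith) (by simp only [Dir.coord_opp]; linarith)).elim
    · exact h.1
  -- The line is shifted into the empty quadrant at `q`.
  obtain ⟨a, ha1, ha2, ha3, ha4⟩ : ∃ a, |a - d.coord q| ≤ ε₀ ∧ |a - d.coord q| ≤ δ ∧
      d.coord p < a ∧ ∀ g ∈ Ω.region, d.coord g = a → d'.coord g ≤ d'.coord q := by
    rcases hq with hq | ⟨hq, hlt⟩
    · have hε : 0 < min ε₀ δ := by positivity
      refine ⟨d.coord q + min ε₀ δ, ?_, ?_, by linarith, fun g hg h => ?_⟩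
      · simp [abs_of_pos hε]
      · simp [abs_of_pos hε]
      · by_contra! hcon
        exact hq g hg (by linarith) hcon
    · have hs : 0 < (d.coord q - d.coord p) / 2 := by linarith
      have hε : 0 < min (min ε₀ δ) ((d.coord q - d.coord p) / 2) := by positivity
      refine ⟨d.coord q - min (min ε₀ δ) ((d.coord q - d.coord p) / 2), ?_, ?_, ?_,
        fun g hg h => ?_⟩
      · simp [abs_of_pos hε]
      · simp [abs_of_pos hε]
      · linarith [min_le_right (min ε₀ δ) ((d.coord q - d.coord p) / 2)]
      · by_contra! hcon
        exact hq g hg (by simp only [Dir.coord_opp]; linarith) hcon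
  obtain ⟨ha5, ha6⟩ := abs_le.1 ha2
  obtain ⟨l, hl, hl'⟩ := ht d.opp
  obtain ⟨r, hr, hr'⟩ := ht d
  have h4 := hl' k hk
  simp only [Dir.coord_opp, neg_le_neg_iff] at h4
  obtain ⟨z, hz, hza⟩ := hK.intermediate_value hl hr d.continuous_coord.continuousOn
    (show a ∈ Icc _ _ from ⟨by linarith, by linarith [hr' g hg]⟩)
  obtain ⟨y, hy1, hy2⟩ := hd.exists_coord (d.coord q) (d'.coord z)
  refine hmar z hz y (Or.inr ⟨hy1, ?_, hy2 ▸ ha4 z (hKω hz) hza⟩) ?_ ?_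
  · by_contra! hcon
    exact hp z (hKω hz) (by linarith) (by simp only [Dir.coord_opp]; linarith)
  · rwa [hy1, hza, abs_sub_comm]
  · rw [hy2, sub_self, abs_zero]
    exact hε₀.le

end Obstacle

section Elbow

variable {d d' : Dir} {p q : Plane}

@[simp] theorem Dir.opp_opp (d : Dir) : d.opp.opp = d := by cases d <;> rfl

theorem elbow_opp_left (h : d.coord p = d.coord q) :
    elbow d.opp d' p q = elbow d d' p q := by
  ext z
  simp only [elbow, mem_ofPred_eq, Dir.coord_opp, neg_inj, neg_le_neg_iff, h]
  tauto

theorem elbow_opp_right (h : d'.coord p = d'.coord q) :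
    elbow d d'.opp p q = elbow d d' p q := by
  ext z
  simp only [elbow, mem_ofPred_eq, Dir.coord_opp, neg_inj, neg_le_neg_iff, h]
  tauto

end Elbow

namespace Obstacle

variable {Ω : Obstacle} {d d' : Dir} {p q : Plane} {K : Set Plane} {S : Set (Set Plane)}

theorem Free.symm (h : Ω.Free d d' p) : Ω.Free d' d p := fun g hg h1 h2 => h g hg h2 h1

/-- A connected set that touches all four sides meets every elbow between points outside the
interior, unless one of the two elbows between these points misses the interior. -/
theorem elbow_inter_nonempty (hd : d.Perp d') (hpq : d.coord p ≤ d.coord q)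
    (hpq' : d'.coord p ≤ d'.coord q) (hc : IsCompact K) (hK : IsPreconnected K)
    (hKω : K ⊆ Ω.region) (ht : Ω.Touches K) (hp : p ∉ interior Ω.region)
    (hq : q ∉ interior Ω.region) (h : (elbow d d' p q ∩ interior Ω.region).Nonempty)
    (h' : (elbow d' d p q ∩ interior Ω.region).Nonempty) : (elbow d d' p q ∩ K).Nonempty := by
  obtain ⟨w, hw, hwi⟩ := h
  obtain ⟨v, hv, hvi⟩ := h'
  have hd' : d'.opp.Perp d.opp := hd.symm.opp_left.opp_right
  have e1 : d'.opp.coord q ≤ d'.opp.coord p := by simpa using hpq'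
  have e2 : d.opp.coord q ≤ d.opp.coord p := by simpa using hpq
  have hw' := hw
  rw [← elbow_opp] at hw'
  have hq1 : ¬Ω.Free d.opp d'.opp q := fun hf => not_free_of_elbow hd' e1 hw' hwi hf.symm
  rcases exists_free hd hp with (hp | hp) | hp
  · exact (not_free_of_elbow hd hpq hw hwi hp).elim
  · rcases exists_free hd hq with (hq | hq) | hq | hq
    · exact elbow_inter_of_line hd hpq hc hK hKω ht hw hwi hp (Or.inl hq)
    · exact (not_free_of_elbow' hd hw hwi ⟨hp, hq⟩).elim
    -- If the elbow is a segment, the opposite of the direction `d` serves as well.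
    · rcases hpq.lt_or_eq with hlt | he
      · exact elbow_inter_of_line hd hpq hc hK hKω ht hw hwi hp (Or.inr ⟨hq, hlt⟩)
      · have := elbow_inter_of_corner hd.opp_left (by simpa using he.ge) hpq' hc hK hKω ht
          (by rwa [elbow_opp_left he]) hwi (by rw [Dir.opp_opp]; exact Or.inr hp) (Or.inr hq)
          (by rwa [elbow_opp_right he]) hvi
        rwa [elbow_opp_left he] at this
    · exact (hq1 hq).elim
  · rcases exists_free hd hq with (hq | hq) | hq | hq
    · exact elbow_inter_of_corner hd hpq hpq' hc hK hKω ht hw hwi hp (Or.inr hq) hv hvi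
    · have hline := elbow_inter_of_line (p := q) (q := p) hd' e1 hc hK hKω ht hw' hwi
        (by rw [Dir.opp_opp]; exact hq.symm)
      rw [Dir.opp_opp, elbow_opp] at hline
      rcases hp with hp | hp
      · rcases hpq'.lt_or_eq with hlt | he
        · exact hline (Or.inr ⟨hp.symm, by simpa using hlt⟩)
        · have := elbow_inter_of_corner hd.opp_right hpq (by simpa using he.ge) hc hK hKω ht
            (by rwa [elbow_opp_right he]) hwi (by rw [Dir.opp_opp]; exact Or.inr hp) (Or.inr hq)
            (by rwa [elbow_opp_left he]) hvi
          rwa [elbow_opp_right he] at this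
      · exact hline (Or.inl hp.symm)
    · exact elbow_inter_of_corner hd hpq hpq' hc hK hKω ht hw hwi hp (Or.inl hq) hv hvi
    · exact (hq1 hq).elim

theorem isCompact_sUnion (hf : S.Finite) (hS : ∀ s ∈ S, IsLineSegment s) : IsCompact (⋃₀ S) :=
  hf.isCompact_sUnion fun s hs => (hS s hs).isCompact

/-- A connected family that touches all four sides is a skeleton: it meets the elbow that each one-
corner path contains. -/
theorem isConnectedSkeleton_of_touches (hf : S.Finite) (hS : ∀ s ∈ S, IsLineSegment s)
    (hSω : ∀ s ∈ S, s ⊆ Ω.region) (hc : IsPathConnected (⋃₀ S)) (ht : Ω.Touches (⋃₀ S)) :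
    IsConnectedSkeleton Ω.region S := by
  refine ⟨⟨hf, hS, hSω, fun p q hp hq hall π hπ => ?_⟩, hc⟩
  obtain ⟨d, d', hd, h1, h2, hsub⟩ := exists_elbow_subset hπ
  have hmeet : ∀ {d d' : Dir}, d.Perp d' → d.coord p ≤ d.coord q → d'.coord p ≤ d'.coord q →
      (elbow d d' p q ∩ interior Ω.region).Nonempty := by
    intro d d' hd h1 h2
    obtain ⟨ρ, hρ, hρe⟩ := pathTrace_mem_oneCornerPaths hd h1 h2
    exact (hall ρ hρ).mono (inter_subset_inter_left _ hρe)
  obtain ⟨z, hz, s, hs, hzs⟩ := elbow_inter_nonempty hd h1 h2 (isCompact_sUnion hf hS)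
    hc.isConnected.isPreconnected (sUnion_subset hSω) ht hp hq (hmeet hd h1 h2)
    (hmeet hd.symm h2 h1)
  exact ⟨s, hs, z, hsub hz, hzs⟩

/-- A connected skeleton touches all four sides: otherwise a line that separates it from a side
passes through the interior. -/
theorem touches_of_isConnectedSkeleton (h : IsConnectedSkeleton Ω.region S) :
    Ω.Touches (⋃₀ S) := by
  intro d
  obtain ⟨d', hd⟩ := d.exists_perp
  have hK := isCompact_sUnion h.1.finite h.1.isLineSegment
  obtain ⟨g, hg, hmax⟩ := hK.exists_isMaxOn h.2.nonempty d.continuous_coord.continuousOn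
  refine ⟨g, hg, fun x hx => ?_⟩
  by_contra! hlt
  obtain ⟨w, hw1, hw2⟩ := mem_closure_iff.1 (Ω.closure_interior.symm ▸ hx)
    {z | d.coord g < d.coord z} (isOpen_lt continuous_const d.continuous_coord) hlt
  obtain ⟨a, -, -, hamax⟩ := exists_reach d' Ω.isCompact Ω.nonempty
  obtain ⟨b, -, -, hbmax⟩ := exists_reach d'.opp Ω.isCompact Ω.nonempty
  simp only [Dir.coord_opp, neg_le_neg_iff] at hbmax
  obtain ⟨p, hp1, hp2⟩ := hd.exists_coord (d.coord w) (d'.coord b - 1)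
  obtain ⟨q, hq1, hq2⟩ := hd.exists_coord (d.coord w) (d'.coord a + 1)
  have hpω : p ∉ interior Ω.region := fun hp => by linarith [hbmax p (interior_subset hp)]
  have hqω : q ∉ interior Ω.region := fun hq => by linarith [hamax q (interior_subset hq)]
  have hw := interior_subset hw2
  have hpq : d.coord p = d.coord q := hp1.trans hq1.symm
  have hpq' : d'.coord p ≤ d'.coord q := by linarith [hamax w hw, hbmax w hw]
  obtain ⟨π, hπ, -⟩ := pathTrace_mem_oneCornerPaths hd hpq.le hpq'
  obtain ⟨s, hs, z, hz, hzs⟩ := h.1.blocks p q hpω hqω (fun ρ hρ => by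
    obtain ⟨c, hc, rfl⟩ := hρ
    exact ⟨w, hc.mem_pathTrace_of_coord_eq hd hpq hp1.symm (by linarith [hbmax w hw])
      (by linarith [hamax w hw]), hw2⟩) π hπ
  obtain ⟨c, hc, rfl⟩ := hπ
  have h1 := (hc.coord_mem_box hz d hpq.le).1
  have h2 : d.coord z ≤ d.coord g := hmax ⟨s, hs, hzs⟩
  have h3 : d.coord g < d.coord w := hw1
  linarith

/-- The boundary polygon is traversed from vertex to vertex. -/
theorem isPathConnected_frontier (Ω : Obstacle) : IsPathConnected (frontier Ω.region) := by
  have hsub : ∀ i, Ω.edge i ⊆ frontier Ω.region := fun i z hz => mem_frontier_iff.2 ⟨i, hz⟩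
  have hj : ∀ i, ∀ a ∈ Ω.edge i, ∀ b ∈ Ω.edge i, JoinedIn (frontier Ω.region) a b :=
    fun i a ha b hb => (((convex_segment _ _).isPathConnected ⟨a, ha⟩).joinedIn a ha b hb).mono
      (hsub i)
  have hv : ∀ m : ℕ, JoinedIn (frontier Ω.region) (Ω.vertex 0) (Ω.vertex m) := by
    intro m
    induction m with
    | zero =>
      rw [Nat.cast_zero]
      exact hj 0 _ (left_mem_segment ℝ _ _) _ (left_mem_segment ℝ _ _)
    | succ k ih =>
      rw [Nat.cast_succ]
      exact ih.trans (hj k _ (left_mem_segment ℝ _ _) _ (right_mem_segment ℝ _ _))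
  refine ⟨Ω.vertex 0, hsub 0 (left_mem_segment ℝ _ _), fun {z} hz => ?_⟩
  obtain ⟨i, hi⟩ := mem_frontier_iff.1 hz
  have : NeZero Ω.n := ⟨by have := Ω.three_le; omega⟩
  have h1 := hv i.val
  rw [ZMod.natCast_zmod_val] at h1
  exact h1.trans (hj i _ (left_mem_segment ℝ _ _) _ hi)

/-- The boundary edges form a connected skeleton. -/
theorem exists_isConnectedSkeleton (Ω : Obstacle) : ∃ S, IsConnectedSkeleton Ω.region S := by
  have := Ω.finite_zmod
  have hU : ⋃₀ range Ω.edge = frontier Ω.region := by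
    rw [sUnion_range, Ω.frontier_eq]
    rfl
  refine ⟨range Ω.edge, isConnectedSkeleton_of_touches (finite_range _) ?_ ?_ ?_ ?_⟩
  · rintro _ ⟨i, rfl⟩
    exact ⟨_, _, Ω.vertex_ne i, rfl⟩
  · rintro _ ⟨i, rfl⟩ z hz
    exact Ω.isClosed.frontier_subset (mem_frontier_iff.2 ⟨i, hz⟩)
  · rw [hU]
    exact Ω.isPathConnected_frontier
  · rw [hU]
    intro d
    obtain ⟨g, hg, -, hmax⟩ := exists_reach d Ω.isCompact Ω.nonempty
    obtain ⟨i, hi, -⟩ := exists_extreme_edge d hg hmax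
    exact ⟨g, mem_frontier_iff.2 ⟨i, hi⟩, hmax⟩

/-! ### Replacing a skeleton by candidate edges -/

theorem spans_inChart (hd : d.Perp d') (hK : K ⊆ Ω.region) (ht : Ω.Touches K) :
    Spans (inChart (Dir.chart hd) Ω.region) (inChart (Dir.chart hd) K) := by
  have key : ∀ δ : Dir, ∃ g ∈ inChart (Dir.chart hd) K,
      g ∈ inChart (Dir.chart hd) Ω.region ∧ ∀ h ∈ inChart (Dir.chart hd) Ω.region,
        δ.coord ((Dir.chart hd).symm h) ≤ δ.coord ((Dir.chart hd).symm g) := by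
    intro δ
    obtain ⟨g, hg, hmax⟩ := ht δ
    refine ⟨Dir.chart hd g, by simpa [inChart] using hg, by simpa [inChart] using hK hg,
      fun h hh => ?_⟩
    rw [LinearEquiv.symm_apply_apply]
    exact hmax _ hh
  refine ⟨?_, ?_, ?_, ?_⟩
  · simpa [Leftmost] using key d.opp
  · simpa [Rightmost] using key d
  · simpa [Lowest] using key d'.opp
  · simpa [Highest] using key d'

theorem touches_of_spans (hd : d.Perp d') {A : Set Plane}
    (h : Spans (inChart (Dir.chart hd) Ω.region) A) :
    Ω.Touches (inChart (Dir.chart hd).symm A) := by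
  have key : ∀ δ : Dir, (∃ g ∈ A, ∀ h ∈ inChart (Dir.chart hd) Ω.region,
      δ.coord ((Dir.chart hd).symm h) ≤ δ.coord ((Dir.chart hd).symm g)) →
      ∃ g ∈ inChart (Dir.chart hd).symm A, ∀ h ∈ Ω.region, δ.coord h ≤ δ.coord g := by
    rintro δ ⟨g, hg, hmax⟩
    refine ⟨(Dir.chart hd).symm g, by simpa [inChart] using hg, fun h hh => ?_⟩
    have := hmax (Dir.chart hd h) (by simpa [inChart] using hh)
    rwa [LinearEquiv.symm_apply_apply] at this
  intro δ
  apply key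
  rcases hd.eq_or δ with rfl | rfl | rfl | rfl
  · obtain ⟨g, hg, h1⟩ := h.right
    exact ⟨g, hg, by simpa using h1.2⟩
  · obtain ⟨g, hg, h1⟩ := h.left
    exact ⟨g, hg, by simpa using h1.2⟩
  · obtain ⟨g, hg, h1⟩ := h.up
    exact ⟨g, hg, by simpa using h1.2⟩
  · obtain ⟨g, hg, h1⟩ := h.down
    exact ⟨g, hg, by simpa using h1.2⟩

/-- The replacement in the chart of directions for which the left side does not lie above the right
side. -/
theorem exists_subset_frontierEdges_of_le (hd : d.Perp d') (h : IsConnectedSkeleton Ω.region S)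
    {l r : Plane} (hl : l ∈ Ω.region) (hlmax : ∀ g ∈ Ω.region, d.coord l ≤ d.coord g)
    (hr : r ∈ Ω.region) (hrmax : ∀ g ∈ Ω.region, d.coord g ≤ d.coord r)
    (hlr : d'.coord l ≤ d'.coord r) :
    ∃ T ⊆ Ω.frontierEdges, T.ncard ≤ S.ncard ∧ IsConnectedSkeleton Ω.region T := by
  set e := Dir.chart hd with he
  obtain ⟨A, ⟨hA, T, hTG, hTf, hTc, rfl⟩, hspan⟩ := exists_built_of_spans (Ω.rectRegion hd)
    (l₀ := e l) (r₀ := e r) ⟨by simpa [inChart, he] using hl, forall_inChart.2 hlmax⟩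
    ⟨by simpa [inChart, he] using hr, forall_inChart.2 hrmax⟩ hlr (h.1.finite.image (inChart e))
    (by
      rintro _ ⟨z, hz, rfl⟩
      exact ⟨(h.1.isLineSegment z hz).inChart, inChart_mono (h.1.inside z hz)⟩)
    (by
      rw [← inChart_sUnion, inChart_eq_image]
      exact h.2.isConnected.isPreconnected.image _ continuous_chart.continuousOn)
    (by
      rw [← inChart_sUnion]
      exact spans_inChart hd (sUnion_subset h.1.inside) (touches_of_isConnectedSkeleton h))
  have hsub : inChart e.symm '' T ⊆ Ω.frontierEdges := by
    rintro _ ⟨t, ht, rfl⟩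
    obtain ⟨s, hs, rfl⟩ := hTG ht
    rwa [inChart_symm_inChart]
  rw [ncard_image_of_injective _ inChart_injective] at hTc
  refine ⟨inChart e.symm '' T, hsub, (ncard_image_le hTf).trans hTc,
    isConnectedSkeleton_of_touches (hTf.image _) (fun s hs => (hsub hs).1.1)
      (fun s hs => (hsub hs).1.2.1) ?_ ?_⟩
  · rw [← inChart_sUnion, inChart_eq_image]
    exact hA.image continuous_chart
  · rw [← inChart_sUnion]
    exact touches_of_spans hd hspan

/-- Every connected skeleton can be replaced by one that consists of candidate edges, without
increasing the number of segments. -/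
theorem exists_subset_frontierEdges (h : IsConnectedSkeleton Ω.region S) :
    ∃ T ⊆ Ω.frontierEdges, T.ncard ≤ S.ncard ∧ IsConnectedSkeleton Ω.region T := by
  obtain ⟨l, hl, -, hl'⟩ := exists_reach .left Ω.isCompact Ω.nonempty
  obtain ⟨r, hr, -, hr'⟩ := exists_reach .right Ω.isCompact Ω.nonempty
  have hru : Dir.right.Perp Dir.up := Or.inr rfl
  have hlu : Dir.left.Perp Dir.up := Or.inr rfl
  rcases le_total (Dir.up.coord l) (Dir.up.coord r) with hle | hle
  · exact exists_subset_frontierEdges_of_le hru h hl (fun g hg => neg_le_neg_iff.1 (hl' g hg)) hr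
      hr' hle
  · exact exists_subset_frontierEdges_of_le hlu h hr (fun g hg => neg_le_neg (hr' g hg)) hl
      hl' hle

theorem frontierEdges_subset_candidateSet (Ω : Obstacle) : Ω.frontierEdges ⊆ Ω.candidateSet :=
  fun _ hs => Or.inr (Or.inr (Or.inr hs.2))

end Obstacle

end RectSkeleton

theorem mainTheorem8 (Ω : RectSkeleton.Obstacle) :
    ∃ S : Set (Set RectSkeleton.Plane),
      RectSkeleton.IsMinimumConnectedSkeleton Ω.region S ∧ S ⊆ Ω.candidateSet := by
  classical
  -- The boundary edges form a connected skeleton, so the smallest number of segments exists.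
  have hex : ∃ n, ∃ S, RectSkeleton.IsConnectedSkeleton Ω.region S ∧ S.ncard = n := by
    obtain ⟨S, hS⟩ := Ω.exists_isConnectedSkeleton
    exact ⟨_, S, hS, rfl⟩
  obtain ⟨S, hS, hSn⟩ := Nat.find_spec hex
  obtain ⟨T, hT, hTS, hTc⟩ := RectSkeleton.Obstacle.exists_subset_frontierEdges hS
  exact ⟨T, ⟨hTc, fun U hU => (hTS.trans hSn.le).trans (Nat.find_min' hex ⟨U, hU, rfl⟩)⟩,
    hT.trans Ω.frontierEdges_subset_candidateSet⟩
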